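/- Let $d\ge 1$ and let $\Omega\subset\mathbb{R}^d$ be a bounded domain with Lipschitz boundary $\partial\Omega=\Gamma_D\cup\Gamma_N$, where $\Gamma_D\cap\Gamma_N=\emptyset$, $\Gamma_N$ is closed and $\Gamma_D$ has positive $(d-1)$-dimensional measure. Let $H_0^1(\Omega\cup\Gamma_N)=\{u\in H^1(\Omega): u=0 \text{ on } \Gamma_D\}$, with dual space $H^{-1}(\Omega\cup\Gamma_N)$. Let $T,\tau,\lambda>0$, and let $\kappa\in C^1([0,\infty))$ be locally Lipschitz continuous on $[0,\infty)$ and such that, for some constants $\kappa_0,\kappa_1,n_*,n^*>0$: (i) $\kappa(z)>0$ for all $z>0$; (ii) either $\kappa(z)\ge\kappa_0$ for all $z\ge0$, or $\kappa(z)=z$ for all $0\le z\le n_*$; (iii) $\kappa(z)\ge\kappa_1 z$ for all $z\ge n^*$. Let $n_D,V_D\in L^2(0,T;H^1(\Omega))$ and $\theta_D\in L^q(0,T;W^{1,q}(\Omega))$ for some $2<q<\infty$, let $n_D,\theta_D\in L^\infty(0,T;L^\infty(\Omega))$ with $\inf_{\Omega\times(0,T)}n_D>0$ and $\inf_{\Omega\times(0,T)}\theta_D>0$,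 and let $n_I,\theta_L,C\in L^\infty(\Omega)$ with $\inf_\Omega n_I>0$, $\inf_\Omega\theta_L>0$ and $C\ge0$ in $\Omega$. Consider the problem $$\partial_t n-\operatorname{div}(\nabla(n\theta)+n\nabla V)=0,\quad \operatorname{div}(\kappa(n)\nabla\theta)=\frac n\tau(\theta-\theta_L),\quad -\lambda^2\Delta V=n-C\quad\text{in }\Omega\times(0,T),$$ $$n=n_D,\ \theta=\theta_D,\ V=V_D\ \text{ on }\Gamma_D,\qquad \nabla n\cdot\nu=\nabla\theta\cdot\nu=\nabla V\cdot\nu=0\ \text{ on }\Gamma_N,\qquad n(0)=n_I .$$ A bounded weak solution is a triple $(n,\theta,V)\in L^2(0,T;H^1(\Omega))^3$ with $n,\theta\in L^\infty(0,T;L^\infty(\Omega))$, $n\ge0$ and $\partial_t n\in L^2(0,T;H^{-1}(\Omega\cup\Gamma_N))$ that satisfies the Dirichlet conditions in the sense that $n-n_D$, $\theta-\theta_D$, $V-V_D$ take values in $H_0^1(\Omega\cup\Gamma_N)$, the initial condition in the sense of $C^0([0,T];H^{-1}(\Omega\cup\Gamma_N))$, and, for almost every $t\in(0,T)$ and all $\phi\in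 H_0^1(\Omega\cup\Gamma_N)$, $$\langle\partial_t n,\phi\rangle+\int_\Omega(\theta\nabla n+n\nabla\theta+n\nabla V)\cdot\nabla\phi\,dx=0,$$ $$-\int_\Omega\kappa(n)\nabla\theta\cdot\nabla\phi\,dx=\int_\Omega\frac n\tau(\theta-\theta_L)\phi\,dx,\qquad \lambda^2\int_\Omega\nabla V\cdot\nabla\phi\,dx=\int_\Omega(n-C)\phi\,dx .$$ Let $1\le p\le\infty$ with $p>2$ if $d=2$ and $p\ge d$ if $d\ge3$. Then there is at most one bounded weak solution $(n,\theta,V)$ with $n\in L^\infty(0,T;W^{1,p}(\Omega))$ and $\theta\in L^\infty(0,T;W^{1,\infty}(\Omega))$: any two such solutions coincide almost everywhere. -/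

import Mathlib

open MeasureTheory Set Filter Topology
open scoped ENNReal NNReal ContDiff

noncomputable section

namespace EnergyTransport

/-- Euclidean space `ℝ^d`. -/
abbrev E (d : ℕ) : Type := EuclideanSpace ℝ (Fin d)

/-- Partial derivative of a (smooth) scalar function. -/
def pderiv {d : ℕ} (i : Fin d) (φ : E d → ℝ) (x : E d) : ℝ :=
  fderiv ℝ φ x (EuclideanSpace.single i (1 : ℝ))

/-- `φ ∈ C_c^∞(U)`. -/
structure IsTestFun {X : Type*} [NormedAddCommGroup X] [NormedSpace ℝ X]
    (U : Set X) (φ : X → ℝ) : Prop where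
  smooth : ContDiff ℝ ∞ φ
  compact : HasCompactSupport φ
  supp : tsupport φ ⊆ U

/-! ### The Sobolev space `H¹(Ω)` -/

/-- `g` is the weak gradient of `u` in `Ω`. -/
def HasWeakGrad {d : ℕ} (Ω : Set (E d)) (u : E d → ℝ) (g : E d → E d) : Prop :=
  ∀ φ : E d → ℝ, IsTestFun Ω φ → ∀ i : Fin d,
    ∫ x in Ω, u x * pderiv i φ x = - ∫ x in Ω, g x i * φ x

/-- The Hilbert space `L²(Ω) × L²(Ω; ℝ^d)` with norm `(‖u‖² + ‖g‖²)^{1/2}`. -/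
abbrev L2Pair {d : ℕ} (Ω : Set (E d)) : Type :=
  WithLp 2 (Lp ℝ 2 (volume.restrict Ω) × Lp (E d) 2 (volume.restrict Ω))

lemma IsTestFun.memLp {d : ℕ} {Ω : Set (E d)} {φ : E d → ℝ} (h : IsTestFun Ω φ) :
    MemLp φ 2 (volume.restrict Ω) :=
  (h.smooth.continuous.memLp_of_hasCompactSupport h.compact).restrict Ω

lemma IsTestFun.memLp_pderiv {d : ℕ} {Ω : Set (E d)} {φ : E d → ℝ} (h : IsTestFun Ω φ)
    (i : Fin d) : MemLp (pderiv i φ) 2 (volume.restrict Ω) := by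
  have hc : Continuous (pderiv i φ) :=
    (h.smooth.continuous_fderiv (by simp)).clm_apply continuous_const
  have hs : HasCompactSupport (pderiv i φ) := h.compact.fderiv_apply ℝ _
  exact (hc.memLp_of_hasCompactSupport hs).restrict Ω

lemma memLp_coord {d : ℕ} {μ : Measure (E d)} {g : E d → E d} (hg : MemLp g 2 μ) (i : Fin d) :
    MemLp (fun x => g x i) 2 μ :=
  (EuclideanSpace.proj (𝕜 := ℝ) i : E d →L[ℝ] ℝ).comp_memLp' hg

/-- `H¹(Ω)`: the pairs `(u, ∇u)` with `u ∈ L²(Ω)` whose weak gradient `∇u` is in `L²(Ω)`,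
with the norm `(‖u‖² + ‖∇u‖²)^{1/2}`. -/
def H1 {d : ℕ} (Ω : Set (E d)) : Submodule ℝ (L2Pair Ω) where
  carrier := {w | HasWeakGrad Ω w.fst w.snd}
  zero_mem' := by
    intro φ _ i
    have h1 : ∫ x in Ω, ((0 : L2Pair Ω).fst : E d → ℝ) x * pderiv i φ x = 0 := by
      refine integral_eq_zero_of_ae ?_
      filter_upwards [Lp.coeFn_zero ℝ 2 (volume.restrict Ω)] with x hx
      rw [WithLp.zero_fst, hx, Pi.zero_apply, zero_mul]
    have h2 : ∫ x in Ω, ((0 : L2Pair Ω).snd : E d → E d) x i * φ x = 0 := by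
      refine integral_eq_zero_of_ae ?_
      filter_upwards [Lp.coeFn_zero (E d) 2 (volume.restrict Ω)] with x hx
      rw [WithLp.zero_snd, hx, Pi.zero_apply, PiLp.zero_apply, zero_mul]; rfl
    rw [h1, h2, neg_zero]
  add_mem' := by
    intro a b ha hb φ hφ i
    have h1 : ∫ x in Ω, ((a + b).fst : E d → ℝ) x * pderiv i φ x
        = (∫ x in Ω, (a.fst : E d → ℝ) x * pderiv i φ x)
          + ∫ x in Ω, (b.fst : E d → ℝ) x * pderiv i φ x := by
      refine Eq.trans ?_ (integral_add ((Lp.memLp a.fst).integrable_mul (hφ.memLp_pderiv i))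
        ((Lp.memLp b.fst).integrable_mul (hφ.memLp_pderiv i)))
      refine integral_congr_ae ?_
      filter_upwards [Lp.coeFn_add a.fst b.fst] with x hx
      rw [WithLp.add_fst, hx, Pi.add_apply, add_mul]
    have h2 : ∫ x in Ω, ((a + b).snd : E d → E d) x i * φ x
        = (∫ x in Ω, (a.snd : E d → E d) x i * φ x)
          + ∫ x in Ω, (b.snd : E d → E d) x i * φ x := by
      refine Eq.trans ?_ (integral_add ((memLp_coord (Lp.memLp a.snd) i).integrable_mul hφ.memLp)
        ((memLp_coord (Lp.memLp b.snd) i).integrable_mul hφ.memLp))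
      refine integral_congr_ae ?_
      filter_upwards [Lp.coeFn_add a.snd b.snd] with x hx
      rw [WithLp.add_snd, hx, Pi.add_apply, PiLp.add_apply, add_mul]
    rw [h1, h2, ha φ hφ i, hb φ hφ i, neg_add]
  smul_mem' := by
    intro c a ha φ hφ i
    have h1 : ∫ x in Ω, ((c • a).fst : E d → ℝ) x * pderiv i φ x
        = c * ∫ x in Ω, (a.fst : E d → ℝ) x * pderiv i φ x := by
      rw [← integral_const_mul]
      refine integral_congr_ae ?_
      filter_upwards [Lp.coeFn_smul c a.fst] with x hx
      rw [WithLp.smul_fst, hx, Pi.smul_apply, smul_eq_mul, mul_assoc]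
    have h2 : ∫ x in Ω, ((c • a).snd : E d → E d) x i * φ x
        = c * ∫ x in Ω, (a.snd : E d → E d) x i * φ x := by
      rw [← integral_const_mul]
      refine integral_congr_ae ?_
      filter_upwards [Lp.coeFn_smul c a.snd] with x hx
      rw [WithLp.smul_snd, hx, Pi.smul_apply, PiLp.smul_apply, smul_eq_mul, mul_assoc]
    rw [h1, h2, ha φ hφ i, mul_neg]

/-- The function underlying an element of `H¹(Ω)`. -/
def fn {d : ℕ} {Ω : Set (E d)} (u : H1 Ω) : E d → ℝ := (u : L2Pair Ω).fst

/-- The weak gradient of an element of `H¹(Ω)`. -/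
def grad {d : ℕ} {Ω : Set (E d)} (u : H1 Ω) : E d → E d := (u : L2Pair Ω).snd

/-! ### Lipschitz domains and boundary values -/

/-- `∂Ω ∈ C^{0,1}`: near each boundary point, `Ω` is the set of points above the graph of a
Lipschitz function `γ` over the hyperplane orthogonal to some unit vector `e`. -/
def HasLipschitzBoundary {d : ℕ} (Ω : Set (E d)) : Prop :=
  ∀ x₀ ∈ frontier Ω, ∃ (e : E d) (γ : E d → ℝ) (L : ℝ≥0) (r : ℝ),
    ‖e‖ = 1 ∧ LipschitzWith L γ ∧ 0 < r ∧
    ∀ y ∈ Metric.ball x₀ r, (y ∈ Ω ↔ γ (y - inner ℝ e y • e) < inner ℝ e y)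

/-- `u ∈ H¹(Ω)` has zero trace on `Γ ⊆ ∂Ω`: `u` is the limit in `H¹(Ω)` of functions that are
smooth up to the boundary and whose boundary values tend to `0` in `L²(Γ)` with respect to the
`(d-1)`-dimensional surface measure. -/
def ZeroTraceOn {d : ℕ} (Ω Γ : Set (E d)) (u : H1 Ω) : Prop :=
  ∃ φ : ℕ → E d → ℝ, (∀ k, ContDiff ℝ ∞ (φ k) ∧ HasCompactSupport (φ k)) ∧
    Tendsto (fun k => eLpNorm (fun x => φ k x - fn u x) 2 (volume.restrict Ω)) atTop (𝓝 0) ∧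
    Tendsto (fun k => eLpNorm (fun x => gradient (φ k) x - grad u x) 2 (volume.restrict Ω))
      atTop (𝓝 0) ∧
    Tendsto (fun k => eLpNorm (φ k) 2
      ((Measure.hausdorffMeasure ((d : ℝ) - 1) : Measure (E d)).restrict Γ)) atTop (𝓝 0)

lemma fn_add {d : ℕ} {Ω : Set (E d)} (u v : H1 Ω) :
    fn (u + v) =ᵐ[volume.restrict Ω] fn u + fn v :=
  Lp.coeFn_add (u : L2Pair Ω).fst (v : L2Pair Ω).fst

lemma grad_add {d : ℕ} {Ω : Set (E d)} (u v : H1 Ω) :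
    grad (u + v) =ᵐ[volume.restrict Ω] grad u + grad v :=
  Lp.coeFn_add (u : L2Pair Ω).snd (v : L2Pair Ω).snd

lemma fn_smul {d : ℕ} {Ω : Set (E d)} (c : ℝ) (u : H1 Ω) :
    fn (c • u) =ᵐ[volume.restrict Ω] c • fn u :=
  Lp.coeFn_smul c (u : L2Pair Ω).fst

lemma grad_smul {d : ℕ} {Ω : Set (E d)} (c : ℝ) (u : H1 Ω) :
    grad (c • u) =ᵐ[volume.restrict Ω] c • grad u :=
  Lp.coeFn_smul c (u : L2Pair Ω).snd

lemma memLp_fn {d : ℕ} {Ω : Set (E d)} (u : H1 Ω) : MemLp (fn u) 2 (volume.restrict Ω) :=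
  Lp.memLp (u : L2Pair Ω).fst

lemma memLp_grad {d : ℕ} {Ω : Set (E d)} (u : H1 Ω) : MemLp (grad u) 2 (volume.restrict Ω) :=
  Lp.memLp (u : L2Pair Ω).snd

lemma continuous_gradient {d : ℕ} {φ : E d → ℝ} (h : ContDiff ℝ ∞ φ) :
    Continuous (gradient φ) :=
  (InnerProductSpace.toDual ℝ (E d)).symm.continuous.comp (h.continuous_fderiv (by simp))

lemma gradient_add' {d : ℕ} {φ ψ : E d → ℝ} (h : ContDiff ℝ ∞ φ) (h' : ContDiff ℝ ∞ ψ) (x : E d) :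
    gradient (φ + ψ) x = gradient φ x + gradient ψ x := by
  have h1 : DifferentiableAt ℝ φ x := h.differentiable (by simp) x
  have h2 : DifferentiableAt ℝ ψ x := h'.differentiable (by simp) x
  simp only [gradient, fderiv_add h1 h2, map_add]

lemma gradient_smul' {d : ℕ} {φ : E d → ℝ} (c : ℝ) (h : ContDiff ℝ ∞ φ) (x : E d) :
    gradient (c • φ) x = c • gradient φ x := by
  have h1 : DifferentiableAt ℝ φ x := h.differentiable (by simp) x
  simp only [gradient, fderiv_const_smul h1 c, map_smulₛₗ]
  rfl

/-- If the `eLpNorm`s of two sequences tend to zero, so do those of their sum. -/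
lemma tendsto_eLpNorm_add {X F : Type*} [MeasurableSpace X] [NormedAddCommGroup F]
    {μ : Measure X} {f g h : ℕ → X → F} (hfm : ∀ k, AEStronglyMeasurable (f k) μ)
    (hgm : ∀ k, AEStronglyMeasurable (g k) μ) (hh : ∀ k, h k =ᵐ[μ] f k + g k)
    (hf : Tendsto (fun k => eLpNorm (f k) 2 μ) atTop (𝓝 0))
    (hg : Tendsto (fun k => eLpNorm (g k) 2 μ) atTop (𝓝 0)) :
    Tendsto (fun k => eLpNorm (h k) 2 μ) atTop (𝓝 0) := by
  have hs := hf.add hg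
  rw [add_zero] at hs
  refine tendsto_of_tendsto_of_tendsto_of_le_of_le tendsto_const_nhds hs (fun _ => zero_le) ?_
  intro k
  simp only
  rw [eLpNorm_congr_ae (hh k)]
  exact eLpNorm_add_le (hfm k) (hgm k) (by norm_num)

lemma tendsto_eLpNorm_smul {X F : Type*} [MeasurableSpace X] [NormedAddCommGroup F]
    [NormedSpace ℝ F] {μ : Measure X} {f h : ℕ → X → F} (c : ℝ) (hh : ∀ k, h k =ᵐ[μ] c • f k)
    (hf : Tendsto (fun k => eLpNorm (f k) 2 μ) atTop (𝓝 0)) :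
    Tendsto (fun k => eLpNorm (h k) 2 μ) atTop (𝓝 0) := by
  have hs := ENNReal.Tendsto.const_mul (a := ‖c‖ₑ) hf (Or.inr (by simp))
  rw [mul_zero] at hs
  refine hs.congr fun k => ?_
  rw [eLpNorm_congr_ae (hh k), eLpNorm_const_smul]

lemma ZeroTraceOn.zero {d : ℕ} (Ω Γ : Set (E d)) : ZeroTraceOn Ω Γ (0 : H1 Ω) := by
  refine ⟨fun _ _ => 0, fun _ => ⟨contDiff_const, HasCompactSupport.zero⟩, ?_, ?_, ?_⟩
  · refine tendsto_const_nhds.congr fun k => ?_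
    rw [eLpNorm_congr_ae (g := fun _ => (0 : ℝ)), eLpNorm_zero']
    filter_upwards [Lp.coeFn_zero ℝ 2 (volume.restrict Ω)] with x hx
    have : fn (0 : H1 Ω) x = 0 := hx
    rw [this, sub_zero]
  · refine tendsto_const_nhds.congr fun k => ?_
    rw [eLpNorm_congr_ae (g := fun _ => (0 : E d)), eLpNorm_zero']
    filter_upwards [Lp.coeFn_zero (E d) 2 (volume.restrict Ω)] with x hx
    have : grad (0 : H1 Ω) x = 0 := hx
    rw [this, sub_zero]
    simp [gradient]
  · simp only [eLpNorm_zero']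
    exact tendsto_const_nhds

lemma ZeroTraceOn.add {d : ℕ} {Ω Γ : Set (E d)} {u v : H1 Ω} (hu : ZeroTraceOn Ω Γ u)
    (hv : ZeroTraceOn Ω Γ v) : ZeroTraceOn Ω Γ (u + v) := by
  obtain ⟨φ, hφ, h1, h2, h3⟩ := hu
  obtain ⟨ψ, hψ, k1, k2, k3⟩ := hv
  refine ⟨fun k => φ k + ψ k, fun k => ⟨(hφ k).1.add (hψ k).1, (hφ k).2.add (hψ k).2⟩, ?_, ?_, ?_⟩
  · refine tendsto_eLpNorm_add
      (fun k => (hφ k).1.continuous.aestronglyMeasurable.sub (memLp_fn u).1)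
      (fun k => (hψ k).1.continuous.aestronglyMeasurable.sub (memLp_fn v).1) (fun k => ?_) h1 k1
    filter_upwards [fn_add u v] with x hx
    simp only [hx, Pi.add_apply, Pi.sub_apply]
    ring
  · refine tendsto_eLpNorm_add
      (fun k => (continuous_gradient (hφ k).1).aestronglyMeasurable.sub (memLp_grad u).1)
      (fun k => (continuous_gradient (hψ k).1).aestronglyMeasurable.sub (memLp_grad v).1)
      (fun k => ?_) h2 k2
    filter_upwards [grad_add u v] with x hx
    simp only [hx, gradient_add' (hφ k).1 (hψ k).1, Pi.add_apply, Pi.sub_apply]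
    abel
  · exact tendsto_eLpNorm_add (fun k => (hφ k).1.continuous.aestronglyMeasurable)
      (fun k => (hψ k).1.continuous.aestronglyMeasurable) (fun k => EventuallyEq.rfl) h3 k3

lemma ZeroTraceOn.smul {d : ℕ} {Ω Γ : Set (E d)} {u : H1 Ω} (c : ℝ) (hu : ZeroTraceOn Ω Γ u) :
    ZeroTraceOn Ω Γ (c • u) := by
  obtain ⟨φ, hφ, h1, h2, h3⟩ := hu
  refine ⟨fun k => c • φ k, fun k => ⟨contDiff_const.smul (hφ k).1, (hφ k).2.smul_left⟩, ?_, ?_, ?_⟩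
  · refine tendsto_eLpNorm_smul c (fun k => ?_) h1
    filter_upwards [fn_smul c u] with x hx
    simp only [hx, Pi.smul_apply, smul_sub]
  · refine tendsto_eLpNorm_smul c (fun k => ?_) h2
    filter_upwards [grad_smul c u] with x hx
    simp only [hx, gradient_smul' c (hφ k).1, Pi.smul_apply, smul_sub]
  · exact tendsto_eLpNorm_smul c (fun k => EventuallyEq.rfl) h3

/-- `H₀¹(Ω ∪ Γ_N) = {u ∈ H¹(Ω) : u = 0 on Γ_D}`, with the norm of `H¹(Ω)`. -/
def H10 {d : ℕ} (Ω ΓD : Set (E d)) : Submodule ℝ (H1 Ω) where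
  carrier := {u | ZeroTraceOn Ω ΓD u}
  zero_mem' := ZeroTraceOn.zero Ω ΓD
  add_mem' := fun hu hv => hu.add hv
  smul_mem' := fun c _ hu => hu.smul c

/-- `H⁻¹(Ω ∪ Γ_N)`, the topological dual of `H₀¹(Ω ∪ Γ_N)`. -/
abbrev HMinus1 {d : ℕ} (Ω ΓD : Set (E d)) : Type := StrongDual ℝ (H10 Ω ΓD)

/-- The bounded domain `Ω ⊂ ℝ^d` with its Lipschitz boundary, split into a Dirichlet part `Γ_D`
of positive surface measure and a closed Neumann part `Γ_N`. -/
structure IsAdmissibleDomain {d : ℕ} (Ω ΓD ΓN : Set (E d)) : Prop where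
  isOpen : IsOpen Ω
  connected : IsConnected Ω
  bounded : Bornology.IsBounded Ω
  lipschitz : HasLipschitzBoundary Ω
  union : ΓD ∪ ΓN = frontier Ω
  disjoint : Disjoint ΓD ΓN
  closed : IsClosed ΓN
  pos : 0 < (Measure.hausdorffMeasure ((d : ℝ) - 1) : Measure (E d)) ΓD

/-! ### Data -/

/-- Lebesgue measure on the time interval `(0,T)`. -/
abbrev timeMeasure (T : ℝ) : Measure ℝ := volume.restrict (Ioo 0 T)

/-- The conditions on the thermal conductivity `κ`, of which only the restriction to `[0,∞)`
matters. -/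
structure IsConductivity (κ : ℝ → ℝ) : Prop where
  contDiffOn : ContDiffOn ℝ 1 κ (Ici 0)
  pos : ∀ z > 0, 0 < κ z
  lower : (∃ κ₀ > 0, ∀ z ≥ 0, κ₀ ≤ κ z) ∨ (∃ n₁ > 0, ∀ z, 0 ≤ z → z ≤ n₁ → κ z = z)
  growth : ∃ κ₁ > 0, ∃ n₂ > 0, ∀ z ≥ n₂, κ₁ * z ≤ κ z

/-- `u ∈ L^∞(0,T; L^∞(Ω))`. -/
def IsBoundedFun {d : ℕ} {Ω : Set (E d)} (T : ℝ) (u : ℝ → H1 Ω) : Prop :=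
  ∃ K : ℝ, ∀ᵐ t ∂timeMeasure T, ∀ᵐ x ∂volume.restrict Ω, |fn (u t) x| ≤ K

/-- The conditions on the boundary data. The fields `memLp_θ` and `sobolev_θ` together
say `θ_D ∈ L^q(0,T; W^{1,q}(Ω))`, where `2 < q < ∞` (the former gives the measurability and, `Ω`
being bounded, follows from the latter otherwise). -/
structure IsBoundaryData {d : ℕ} {Ω : Set (E d)} (T q : ℝ) (nD θD VD : ℝ → H1 Ω) : Prop where
  memLp_n : MemLp nD 2 (timeMeasure T)
  memLp_V : MemLp VD 2 (timeMeasure T)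
  memLp_θ : MemLp θD 2 (timeMeasure T)
  bdd_n : IsBoundedFun T nD
  bdd_θ : IsBoundedFun T θD
  inf_n : ∃ c > 0, ∀ᵐ t ∂timeMeasure T, ∀ᵐ x ∂volume.restrict Ω, c ≤ fn (nD t) x
  inf_θ : ∃ c > 0, ∀ᵐ t ∂timeMeasure T, ∀ᵐ x ∂volume.restrict Ω, c ≤ fn (θD t) x
  sobolev_θ : ∫⁻ t in Ioo 0 T,
    ((eLpNorm (fn (θD t)) (ENNReal.ofReal q) (volume.restrict Ω)) ^ q
      + (eLpNorm (grad (θD t)) (ENNReal.ofReal q) (volume.restrict Ω)) ^ q) < ⊤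

/-- The conditions on the initial datum, the lattice temperature and the doping profile. -/
structure IsInitialData {d : ℕ} (Ω : Set (E d)) (nI θL C : E d → ℝ) : Prop where
  bdd_nI : MemLp nI ⊤ (volume.restrict Ω)
  bdd_θL : MemLp θL ⊤ (volume.restrict Ω)
  bdd_C : MemLp C ⊤ (volume.restrict Ω)
  inf_nI : ∃ c > 0, ∀ᵐ x ∂volume.restrict Ω, c ≤ nI x
  inf_θL : ∃ c > 0, ∀ᵐ x ∂volume.restrict Ω, c ≤ θL x
  nonneg_C : ∀ᵐ x ∂volume.restrict Ω, 0 ≤ C x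

/-! ### Weak solutions -/

/-- `w = ∂ₜu` in the sense of `H⁻¹(Ω ∪ Γ_N)`-valued distributions on `(0,T)`, where `L²(Ω)` is
embedded into `H⁻¹(Ω ∪ Γ_N)` through the scalar product of `L²(Ω)`. -/
def IsTimeDeriv {d : ℕ} {Ω ΓD : Set (E d)} (T : ℝ) (u : ℝ → H1 Ω) (w : ℝ → HMinus1 Ω ΓD) : Prop :=
  ∀ ψ : ℝ → ℝ, IsTestFun (Ioo 0 T) ψ → ∀ φ : H10 Ω ΓD,
    ∫ t in Ioo 0 T, deriv ψ t * ∫ x in Ω, fn (u t) x * fn (φ : H1 Ω) x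
      = - ∫ t in Ioo 0 T, ψ t * w t φ

/-- `u(0) = u₀`: the representative of `u` in `C⁰([0,T]; H⁻¹(Ω ∪ Γ_N))` equals `u₀` at `t = 0`. -/
def HasInitialValue {d : ℕ} {Ω : Set (E d)} (ΓD : Set (E d)) (T : ℝ) (u : ℝ → H1 Ω)
    (u₀ : E d → ℝ) : Prop :=
  ∃ U : ℝ → HMinus1 Ω ΓD, ContinuousOn U (Icc 0 T) ∧
    (∀ᵐ t ∂timeMeasure T, ∀ φ : H10 Ω ΓD, U t φ = ∫ x in Ω, fn (u t) x * fn (φ : H1 Ω) x) ∧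
    ∀ φ : H10 Ω ΓD, U 0 φ = ∫ x in Ω, u₀ x * fn (φ : H1 Ω) x

/-- `(n,θ,V)` is a bounded weak solution of
`∂ₜn - div(∇(nθ) + n∇V) = 0`, `div(κ(n)∇θ) = n(θ - θ_L)/τ`, `-λ²ΔV = n - C` in `Ω × (0,T)`
with `n(0) = n_I`, `n = n_D`, `θ = θ_D`, `V = V_D` on `Γ_D` and homogeneous Neumann conditions
on the rest of the boundary. The equations hold in `H⁻¹(Ω ∪ Γ_N)` for almost every `t`;
`∇(nθ) = θ∇n + n∇θ`, and `n ≥ 0` since `κ` lives on `[0,∞)`. -/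
structure IsBoundedWeakSolution {d : ℕ} (Ω ΓD : Set (E d)) (T τ lam : ℝ) (κ : ℝ → ℝ)
    (nD θD VD : ℝ → H1 Ω) (nI θL C : E d → ℝ) (n θ V : ℝ → H1 Ω) : Prop where
  memLp_n : MemLp n 2 (timeMeasure T)
  memLp_θ : MemLp θ 2 (timeMeasure T)
  memLp_V : MemLp V 2 (timeMeasure T)
  bdd_n : IsBoundedFun T n
  bdd_θ : IsBoundedFun T θ
  nonneg_n : ∀ᵐ t ∂timeMeasure T, ∀ᵐ x ∂volume.restrict Ω, 0 ≤ fn (n t) x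
  bc_n : ∀ᵐ t ∂timeMeasure T, n t - nD t ∈ H10 Ω ΓD
  bc_θ : ∀ᵐ t ∂timeMeasure T, θ t - θD t ∈ H10 Ω ΓD
  bc_V : ∀ᵐ t ∂timeMeasure T, V t - VD t ∈ H10 Ω ΓD
  initial : HasInitialValue ΓD T n nI
  density : ∃ w : ℝ → HMinus1 Ω ΓD, MemLp w 2 (timeMeasure T) ∧ IsTimeDeriv T n w ∧
    ∀ᵐ t ∂timeMeasure T, ∀ φ : H10 Ω ΓD,
      w t φ + ∫ x in Ω, (inner ℝ (fn (θ t) x • grad (n t) x + fn (n t) x • grad (θ t) x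
        + fn (n t) x • grad (V t) x) (grad (φ : H1 Ω) x) : ℝ) = 0
  temperature : ∀ᵐ t ∂timeMeasure T, ∀ φ : H10 Ω ΓD,
    - ∫ x in Ω, κ (fn (n t) x) * (inner ℝ (grad (θ t) x) (grad (φ : H1 Ω) x) : ℝ)
      = ∫ x in Ω, fn (n t) x / τ * (fn (θ t) x - θL x) * fn (φ : H1 Ω) x
  poisson : ∀ᵐ t ∂timeMeasure T, ∀ φ : H10 Ω ΓD,
    lam ^ 2 * ∫ x in Ω, (inner ℝ (grad (V t) x) (grad (φ : H1 Ω) x) : ℝ)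
      = ∫ x in Ω, (fn (n t) x - C x) * fn (φ : H1 Ω) x

/-- `u ∈ L^∞(0,T; W^{1,p}(Ω))`, for `u : (0,T) → H¹(Ω)`. -/
def MemLinftyW1 {d : ℕ} {Ω : Set (E d)} (T : ℝ) (p : ℝ≥0∞) (u : ℝ → H1 Ω) : Prop :=
  ∃ K : ℝ≥0, ∀ᵐ t ∂timeMeasure T,
    eLpNorm (fn (u t)) p (volume.restrict Ω) ≤ K ∧ eLpNorm (grad (u t)) p (volume.restrict Ω) ≤ K

/-- The class in which uniqueness holds: bounded weak solutions with
`n ∈ L^∞(0,T; W^{1,p}(Ω))` and `θ ∈ L^∞(0,T; W^{1,∞}(Ω))`. -/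
structure IsRegularSolution {d : ℕ} (Ω ΓD : Set (E d)) (T τ lam : ℝ) (κ : ℝ → ℝ)
    (nD θD VD : ℝ → H1 Ω) (nI θL C : E d → ℝ) (p : ℝ≥0∞) (n θ V : ℝ → H1 Ω) : Prop where
  sol : IsBoundedWeakSolution Ω ΓD T τ lam κ nD θD VD nI θL C n θ V
  reg_n : MemLinftyW1 T p n
  reg_θ : MemLinftyW1 T ⊤ θ

end EnergyTransport

end

noncomputable section

namespace EnergyTransport

/-! The difference `n = n₁ - n₂` vanishes on `Γ_D`, so it may be used as a test function, and
uniqueness is a Gronwall estimate for `‖n(t)‖²` in `L²(Ω)`. The Poisson equation gives `‖∇(V₁ - V₂)‖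
≤ A‖n‖`. The temperature equation is monotone in the temperature and uniformly elliptic; since `κ`
is locally Lipschitz and `∇θ₁` is bounded, `‖∇(θ₁ - θ₂)‖ ≤ A‖n‖` as well
(`exists_elliptic_stability`). In the difference of the density equations the term `θ₁|∇n|² ≥
c|∇n|²` absorbs every other occurrence of `∇n`.

Two terms need more than Young's inequality (`exists_density_stability`). The field `∇V₁` need not
be bounded, but `n∇V₁·∇n = ∇V₁·∇(n²/2)`, and the Poisson equation tested with `n²/2` turns its
integral into `∫(n₁ - C)n²/(2λ²)`, which is bounded below by a multiple of `-‖n‖²`. The product `(θ₁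
- θ₂)∇n₂` is in `L²` by Hölder and the Sobolev embedding of `H₀¹(Ω ∪ Γ_N)`
(`exists_eLpNorm_smul_le`); this is where `p > 2` or `p ≥ d` enters. For `d = 1` the embedding is
into `L^∞` and `∇n₂ ∈ L²` is enough, at the price of a Gronwall coefficient that is only integrable
in time (`ae_eq_zero_of_le_integral`).

The constant `c` is supplied by `exists_lower_bound`. Testing the temperature equation with a cutoff
`β(θ)` shows that `θ` is bounded below wherever `n ≠ 0`, and everywhere if `κ ≥ κ₀`. If instead
`κ(z) = z` near zero, the density equation is tested with `β(e^{μt}n)`: on the set where this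
function varies, `n∇θ = κ(n)∇θ`, so the heat flux can be eliminated by the temperature equation and
the drift by the Poisson equation, and `e^{μt}n` stays above a positive constant for suitable `μ`.

Here `n` itself does not vanish on `Γ_D`, and no time derivative of `n_D` is available. The chain
rule is therefore replaced by an inequality for convex functionals whose subgradients along the
solution take values in `H₀¹(Ω ∪ Γ_N)` (`ae_sub_le_integral_of_convex`): convexity bounds the
backward increments, and backward averages of the time derivative converge in `L²`.

The facts about Lipschitz domains all rest on interior cones: smooth functions are dense by
mollification with kernels supported in a cone, Poincaré's inequality propagates from a piece of
`Γ_D` through the connected set `Ω`, and the Sobolev inequality follows from the Loomis-Whitney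
inequality along a basis of cone directions. -/

lemma sq_lintegral_le_mul {X : Type*} [MeasurableSpace X] (ν : Measure X)
    {g : X → ℝ≥0∞} (hg : AEMeasurable g ν) :
    (∫⁻ y, g y ∂ν) ^ 2 ≤ ν univ * ∫⁻ y, g y ^ 2 ∂ν := by
  have h := ENNReal.lintegral_mul_le_Lp_mul_Lq ν (p := 2) (q := 2)
    (by constructor <;> norm_num) hg (aemeasurable_const (b := (1 : ℝ≥0∞)))
  simp only [Pi.mul_apply, mul_one, ENNReal.one_rpow, lintegral_one] at h
  calc (∫⁻ y, g y ∂ν) ^ 2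
      ≤ ((∫⁻ y, g y ^ (2 : ℝ) ∂ν) ^ (1 / 2 : ℝ) * ν univ ^ (1 / 2 : ℝ)) ^ 2 := by gcongr
    _ = ν univ * ∫⁻ y, g y ^ 2 ∂ν := by
        rw [mul_pow, mul_comm, ← ENNReal.rpow_natCast, ← ENNReal.rpow_mul, ← ENNReal.rpow_natCast,
          ← ENNReal.rpow_mul]
        simp

lemma sq_lintegral_le {X : Type*} [MeasurableSpace X] (ν : Measure X) [IsProbabilityMeasure ν]
    {g : X → ℝ≥0∞} (hg : AEMeasurable g ν) : (∫⁻ y, g y ∂ν) ^ 2 ≤ ∫⁻ y, g y ^ 2 ∂ν := by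
  simpa using sq_lintegral_le_mul ν hg

lemma eLpNorm_two_sq {X F : Type*} [MeasurableSpace X] [NormedAddCommGroup F] (μ : Measure X)
    (f : X → F) : eLpNorm f 2 μ ^ 2 = ∫⁻ x, ‖f x‖ₑ ^ 2 ∂μ := by
  have := eLpNorm_nnreal_pow_eq_lintegral (f := f) (μ := μ) (p := 2) (by norm_num)
  simpa using this

/-! ### Averages of translates and superpositions in `L²` -/

section Average

variable {G F : Type*} [NormedAddCommGroup G] [NormedSpace ℝ G] [FiniteDimensional ℝ G]
  [MeasurableSpace G] [BorelSpace G]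
  [NormedAddCommGroup F] (μ : Measure G) [μ.IsAddHaarMeasure]

/-- Translation is continuous in `L²`. -/
lemma tendsto_eLpNorm_translate {f : G → F} (hf : MemLp f 2 μ) :
    Tendsto (fun y => eLpNorm (fun x => f (x + y) - f x) 2 μ) (𝓝 0) (𝓝 0) := by
  have : Fact ((2 : ℝ≥0∞) ≠ ⊤) := ⟨by simp⟩
  have h1 : Continuous fun y : G => (DomAddAct.mk y +ᵥ hf.toLp f : Lp F 2 μ) := by
    have : Continuous fun y : G => (DomAddAct.mk y : Gᵈᵃᵃ) := DomAddAct.continuous_mk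
    exact this.vadd continuous_const
  have h2 := (h1.tendsto 0).edist (tendsto_const_nhds (x := (DomAddAct.mk (0 : G) +ᵥ hf.toLp f)))
  simp only [edist_self] at h2
  refine h2.congr fun y => ?_
  rw [DomAddAct.mk_vadd_toLp, DomAddAct.mk_vadd_toLp, Lp.edist_toLp_toLp]
  refine eLpNorm_congr_ae (ae_of_all _ fun x => ?_)
  simp [add_comm]

/-- Averages of translates, with respect to probability measures concentrating at `0`,
converge in `L²`. -/
theorem tendsto_eLpNorm_average [NormedSpace ℝ F] [CompleteSpace F] {f : G → F} (hfm : StronglyMeasurable f) (hf : MemLp f 2 μ)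
    (ν : ℕ → Measure G) [∀ k, IsProbabilityMeasure (ν k)]
    (hν : ∀ ε > 0, ∀ᶠ k in atTop, ∀ᵐ y ∂ν k, ‖y‖ < ε) :
    Tendsto (fun k => eLpNorm (fun x => (∫ y, f (x + y) ∂ν k) - f x) 2 μ) atTop (𝓝 0) := by
  have hj : StronglyMeasurable fun z : G × G => f (z.1 + z.2) :=
    hfm.comp_measurable (measurable_fst.add measurable_snd)
  have hd : StronglyMeasurable fun z : G × G => f (z.1 + z.2) - f z.1 :=
    hj.sub (hfm.comp_measurable measurable_fst)
  -- Jensen's inequality for the probability measure `ν k`, followed by Tonelli, reduces the average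
  -- to single translates.
  have key : ∀ k, (eLpNorm (fun x => (∫ y, f (x + y) ∂ν k) - f x) 2 μ) ^ 2
      ≤ ∫⁻ y, (eLpNorm (fun x => f (x + y) - f x) 2 μ) ^ 2 ∂ν k := by
    intro k
    -- Without integrability on the fibre the Bochner integral would be zero by convention and `f x`
    -- could not be moved inside it. By Tonelli almost every fibre is square integrable.
    have hint : ∀ᵐ x ∂μ, Integrable (fun y => f (x + y)) (ν k) := by
      have h1 : ∫⁻ x, ∫⁻ y, ‖f (x + y)‖ₑ ^ 2 ∂ν k ∂μ < ⊤ := by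
        rw [lintegral_lintegral_swap (hj.enorm.pow_const 2).aemeasurable]
        have : ∀ y, ∫⁻ x, ‖f (x + y)‖ₑ ^ 2 ∂μ = eLpNorm f 2 μ ^ 2 := fun y => by
          rw [lintegral_add_right_eq_self (μ := μ) (fun x => ‖f x‖ₑ ^ 2) y, eLpNorm_two_sq]
        simp only [this, lintegral_const, measure_univ, mul_one]
        exact ENNReal.pow_lt_top hf.2
      have h2 := ae_lt_top (μ := μ) (f := fun x => ∫⁻ y, ‖f (x + y)‖ₑ ^ 2 ∂ν k)
        (Measurable.lintegral_prod_right (f := fun x y => ‖f (x + y)‖ₑ ^ 2)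
          (hj.enorm.pow_const 2)) h1.ne
      filter_upwards [h2] with x hx
      have hm : MemLp (fun y => f (x + y)) 2 (ν k) := by
        refine ⟨(hfm.comp_measurable (measurable_const_add x)).aestronglyMeasurable, ?_⟩
        by_contra h
        rw [not_lt, top_le_iff] at h
        rw [← eLpNorm_two_sq, h] at hx
        simp at hx
      exact hm.integrable (by norm_num)
    rw [eLpNorm_two_sq]
    simp only [eLpNorm_two_sq]
    rw [lintegral_lintegral_swap]
    swap
    · exact ((hd.comp_measurable measurable_swap).enorm.pow_const 2).aemeasurable
    refine lintegral_mono_ae ?_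
    filter_upwards [hint] with x hx
    have e : (∫ y, f (x + y) ∂ν k) - f x = ∫ y, (f (x + y) - f x) ∂ν k := by
      rw [integral_sub hx (integrable_const _)]; simp
    rw [e]
    calc _ ≤ (∫⁻ y, ‖f (x + y) - f x‖ₑ ∂ν k) ^ 2 := by
          gcongr; exact enorm_integral_le_lintegral_enorm _
      _ ≤ _ := sq_lintegral_le _ (hd.comp_measurable measurable_prodMk_left).enorm.aemeasurable
  rw [ENNReal.tendsto_nhds_zero]
  intro ε hε
  have h1 := (ENNReal.tendsto_nhds_zero.1 (tendsto_eLpNorm_translate μ hf)) ε hε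
  obtain ⟨δ, hδ, h2⟩ := Metric.eventually_nhds_iff.1 h1
  filter_upwards [hν δ hδ] with k hk
  rw [← ENNReal.pow_le_pow_left_iff (n := 2) (by norm_num)]
  calc _ ≤ _ := key k
    _ ≤ ∫⁻ y, ε ^ 2 ∂ν k := by
        refine lintegral_mono_ae ?_
        filter_upwards [hk] with y hy
        gcongr
        exact h2 (by simpa using hy)
    _ = ε ^ 2 := by simp

end Average

/-- Continuity of `(u, g) ↦ h(u) g` in `L²` for bounded continuous `h`. -/
theorem tendsto_eLpNorm_comp_smul {X F : Type*} [MeasurableSpace X] {μ : Measure X}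
    [NormedAddCommGroup F] [NormedSpace ℝ F] {h : ℝ → ℝ} (hh : Continuous h) {L : ℝ}
    (hL : ∀ s, |h s| ≤ L) {u : ℕ → X → ℝ} {v : X → ℝ} {g : ℕ → X → F} {k : X → F}
    (hu : ∀ j, MemLp (u j) 2 μ) (hv : MemLp v 2 μ) (hg : ∀ j, MemLp (g j) 2 μ) (hk : MemLp k 2 μ)
    (huv : Tendsto (fun j => eLpNorm (fun x => u j x - v x) 2 μ) atTop (𝓝 0))
    (hgk : Tendsto (fun j => eLpNorm (fun x => g j x - k x) 2 μ) atTop (𝓝 0)) :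
    Tendsto (fun j => eLpNorm (fun x => h (u j x) • g j x - h (v x) • k x) 2 μ) atTop (𝓝 0) := by
  -- Since `h` is only continuous, `h(u_j)` need not converge in `L²`-norm at a rate given by `u_j -
  -- v`. Along a subsequence `u_j → v` almost everywhere; then `h(u_j)(g_j - k)` is small because
  -- `h` is bounded, and `(h(u_j) - h(v))k` tends to zero by dominated convergence.
  refine tendsto_of_subseq_tendsto fun ns hns => ?_
  have hm : TendstoInMeasure μ (fun j => u (ns j)) atTop v :=
    tendstoInMeasure_of_tendsto_eLpNorm (p := 2) (by norm_num) (fun j => (hu _).1) hv.1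
      (huv.comp hns)
  obtain ⟨ms, hms, hae⟩ := hm.exists_seq_tendsto_ae
  refine ⟨ms, ?_⟩
  have hL0 : 0 ≤ L := (abs_nonneg _).trans (hL 0)
  set js := fun i => ns (ms i)
  have hjs : Tendsto js atTop atTop := hns.comp hms.tendsto_atTop
  have t1 : Tendsto (fun i => eLpNorm (fun x => h (u (js i) x) • (g (js i) x - k x)) 2 μ)
      atTop (𝓝 0) := by
    have h0 := ENNReal.Tendsto.const_mul (a := ENNReal.ofReal L) (hgk.comp hjs) (Or.inr (by simp))
    rw [mul_zero] at h0
    refine tendsto_of_tendsto_of_tendsto_of_le_of_le tendsto_const_nhds h0 (fun _ => zero_le) ?_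
    intro i
    refine eLpNorm_le_mul_eLpNorm_of_ae_le_mul (ae_of_all _ fun x => ?_) 2
    rw [norm_smul]
    gcongr
    exact hL _
  have t2 : Tendsto (fun i => eLpNorm (fun x => (h (u (js i) x) - h (v x)) • k x) 2 μ)
      atTop (𝓝 0) := by
    have hsq : Tendsto (fun i => ∫⁻ x, ‖(h (u (js i) x) - h (v x)) • k x‖ₑ ^ 2 ∂μ) atTop (𝓝 0) := by
      have e0 : (0 : ℝ≥0∞) = ∫⁻ x, 0 ∂μ := by simp
      rw [e0]
      refine tendsto_lintegral_of_dominated_convergence'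
        (fun x => (ENNReal.ofReal (2 * L) * ‖k x‖ₑ) ^ 2) (fun i => ?_) (fun i => ?_) ?_ ?_
      · exact ((((hh.comp_aestronglyMeasurable (hu _).1).sub
          (hh.comp_aestronglyMeasurable hv.1)).smul hk.1).enorm).pow_const 2
      · refine ae_of_all _ fun x => ?_
        refine pow_le_pow_left' ?_ 2
        rw [enorm_smul]
        gcongr
        rw [← ofReal_norm]
        refine ENNReal.ofReal_le_ofReal ((norm_sub_le _ _).trans ?_)
        have := hL (u (js i) x); have := hL (v x)
        simp only [Real.norm_eq_abs]; linarith
      · simp only [mul_pow]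
        rw [lintegral_const_mul' _ _ (ENNReal.pow_ne_top ENNReal.ofReal_ne_top), ← eLpNorm_two_sq]
        exact ENNReal.mul_ne_top (ENNReal.pow_ne_top ENNReal.ofReal_ne_top) (ENNReal.pow_ne_top hk.2.ne)
      · filter_upwards [hae] with x hx
        have h1 : Tendsto (fun i => (h (u (js i) x) - h (v x)) • k x) atTop (𝓝 0) := by
          have := ((hh.tendsto (v x)).comp hx).sub_const (h (v x))
          have := this.smul_const (k x)
          simpa using this
        have h2 := (ENNReal.continuous_pow 2).tendsto _ |>.comp h1.enorm
        simpa [Function.comp_def] using h2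
    have := (ENNReal.continuous_rpow_const (y := 1 / 2)).tendsto 0 |>.comp hsq
    simp only [Function.comp_def, ← eLpNorm_two_sq] at this
    rw [ENNReal.zero_rpow_of_pos (by norm_num)] at this
    refine this.congr fun i => ?_
    rw [← ENNReal.rpow_natCast, ← ENNReal.rpow_mul]; simp
  refine tendsto_eLpNorm_add (fun i => ?_) (fun i => ?_) (fun i => ?_) t1 t2
  · exact (hh.comp_aestronglyMeasurable (hu _).1).smul ((hg _).1.sub hk.1)
  · exact ((hh.comp_aestronglyMeasurable (hu _).1).sub
          (hh.comp_aestronglyMeasurable hv.1)).smul hk.1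
  · refine ae_of_all _ fun x => ?_
    simp only [Pi.add_apply, smul_sub, sub_smul, js]
    abel

/-! ### Interior cones of Lipschitz domains -/

lemma exists_cone_of_graph {d : ℕ} {Ω : Set (E d)} {x₀ e : E d} {γ : E d → ℝ} {L : ℝ≥0} {r : ℝ}
    (he : ‖e‖ = 1) (hγ : LipschitzWith L γ) (hr : 0 < r)
    (hG : ∀ y ∈ Metric.ball x₀ r, (y ∈ Ω ↔ γ (y - inner ℝ e y • e) < inner ℝ e y)) :
    ∃ (c ρ : ℝ), 0 < c ∧ c ≤ 1 ∧ 0 < ρ ∧ ∀ x ∈ closure Ω,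
      x ∈ Metric.ball x₀ ρ → ∀ s, 0 < s → s < ρ → ∀ v ∈ Metric.ball e c, x + s • v ∈ Ω := by
  -- Chosen so that `2cL = 1 - 2c`. Along `s(e + w)` with `‖w‖ < c` the component orthogonal to `e`
  -- moves by at most `2cs`, so the graph rises by at most `s(1 - 2c)`, while the height grows by at
  -- least `s(1 - c)`.
  set c : ℝ := 1 / (2 * L + 2) with hc
  have hL0 : (0 : ℝ) ≤ L := L.2
  have hc0 : 0 < c := by positivity
  have hcL : c * (2 * L + 2) = 1 := by rw [hc]; field_simp
  have hc1 : c ≤ 1 := by nlinarith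
  have hball : ∀ x ∈ Metric.ball x₀ (r / 3), ∀ s, 0 < s → s < r / 3 → ∀ v ∈ Metric.ball e c,
      x + s • v ∈ Metric.ball x₀ r := by
    intro x hx s hs hsr v hv
    have hv2 : ‖v‖ < 2 := by
      have : ‖v‖ ≤ ‖v - e‖ + ‖e‖ := by simpa using norm_add_le (v - e) e
      rw [Metric.mem_ball, dist_eq_norm] at hv
      linarith
    rw [Metric.mem_ball] at hx ⊢
    calc dist (x + s • v) x₀ ≤ dist (x + s • v) x + dist x x₀ := dist_triangle _ _ _
      _ < 2 * (r / 3) + r / 3 := by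
          refine add_lt_add ?_ hx
          rw [dist_self_add_left, norm_smul, Real.norm_of_nonneg hs.le]
          nlinarith [norm_nonneg v]
      _ = r := by ring
  refine ⟨c, r / 3, hc0, hc1, by positivity, ?_⟩
  intro x hxc hx s hs hsr v hv
  -- Vertices on the boundary are admitted: on the closure the graph inequality survives with `≤`,
  -- and the strict gain along the cone restores `<`.
  have hle : γ (x - inner ℝ e x • e) ≤ inner ℝ e x := by
    have hγc := hγ.continuous
    have hmem : x ∈ closure (Metric.ball x₀ r ∩ Ω) :=
      Metric.isOpen_ball.inter_closure ⟨Metric.ball_subset_ball (by linarith) hx, hxc⟩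
    refine le_on_closure (f := fun y => γ (y - inner ℝ e y • e)) (g := fun y => inner ℝ e y)
      (fun y hy => ((hG y hy.1).1 hy.2).le) ?_ ?_ hmem
    · exact Continuous.continuousOn (by fun_prop)
    · exact Continuous.continuousOn (by fun_prop)
  rw [hG _ (hball x hx s hs hsr v hv)]
  obtain ⟨w, rfl⟩ : ∃ w, v = e + w := ⟨v - e, by abel⟩
  have hw : ‖w‖ < c := by simpa [Metric.mem_ball, dist_eq_norm] using hv
  have hee : inner ℝ e e = (1 : ℝ) := by rw [real_inner_self_eq_norm_sq, he]; norm_num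
  have hew : |(inner ℝ e w : ℝ)| ≤ ‖w‖ := by
    have := abs_real_inner_le_norm e w
    rwa [he, one_mul] at this
  have h1 : (inner ℝ e (x + s • (e + w)) : ℝ) = inner ℝ e x + s * (1 + inner ℝ e w) := by
    rw [inner_add_right, inner_smul_right, inner_add_right, hee]
  have h2 : dist (γ (x + s • (e + w) - (inner ℝ e (x + s • (e + w)) : ℝ) • e))
      (γ (x - (inner ℝ e x : ℝ) • e)) ≤ L * (s * (2 * c)) := by
    refine (hγ.dist_le_mul _ _).trans ?_
    gcongr
    have e1 : x + s • (e + w) - (inner ℝ e (x + s • (e + w)) : ℝ) • e - (x - (inner ℝ e x : ℝ) • e)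
        = s • (w - (inner ℝ e w : ℝ) • e) := by
      rw [h1]; module
    rw [dist_eq_norm, e1, norm_smul, Real.norm_of_nonneg hs.le]
    gcongr
    refine (norm_sub_le _ _).trans ?_
    rw [norm_smul, he, Real.norm_eq_abs]
    linarith
  rw [h1]
  rw [Real.dist_eq] at h2
  have h3 := (abs_le.1 h2).2
  have h4 := (abs_le.1 hew).1
  have h5 : L * (s * (2 * c)) = s * (1 - 2 * c) := by linear_combination s * hcL
  have h6 : s * (1 - 2 * c) < s * (1 + inner ℝ e w) := by gcongr; linarith
  rw [h1] at h3
  linarith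

/-- Near every point of the closure, a Lipschitz domain contains truncated cones with vertices in
its closure and a common direction. -/
theorem HasLipschitzBoundary.exists_cone {d : ℕ} {Ω : Set (E d)} (hL : HasLipschitzBoundary Ω)
    (hO : IsOpen Ω) {x₀ : E d} (hx₀ : x₀ ∈ closure Ω) :
    ∃ (e : E d) (c ρ : ℝ), 0 < c ∧ c ≤ 1 ∧ 0 < ρ ∧ ‖e‖ ≤ 1 ∧ ∀ x ∈ closure Ω,
      x ∈ Metric.ball x₀ ρ → ∀ s, 0 < s → s < ρ → ∀ v ∈ Metric.ball e c, x + s • v ∈ Ω := by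
  by_cases hx : x₀ ∈ Ω
  · obtain ⟨r, hr, hb⟩ := Metric.isOpen_iff.1 hO x₀ hx
    -- At an interior point every direction is allowed: with axis `0` and opening `1` the cone is a
    -- full ball. This is why the axis is only required to satisfy `‖e‖ ≤ 1`.
    refine ⟨0, 1, r / 2, one_pos, le_rfl, by positivity, by simp, ?_⟩
    intro x _ hx s hs hsr v hv
    refine hb ?_
    rw [mem_ball_zero_iff] at hv
    rw [Metric.mem_ball] at hx ⊢
    calc dist (x + s • v) x₀ ≤ dist (x + s • v) x + dist x x₀ := dist_triangle _ _ _
      _ < r / 2 + r / 2 := by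
          refine add_lt_add ?_ hx
          rw [dist_self_add_left, norm_smul, Real.norm_of_nonneg hs.le]
          nlinarith [norm_nonneg v]
      _ = r := by ring
  · have hf : x₀ ∈ frontier Ω := by rw [hO.frontier_eq]; exact ⟨hx₀, hx⟩
    obtain ⟨e, γ, L, r, he, hγ, hr, hG⟩ := hL x₀ hf
    obtain ⟨c, ρ, h1, h2, h3, h4⟩ := exists_cone_of_graph he hγ hr hG
    exact ⟨e, c, ρ, h1, h2, h3, he.le, h4⟩

/-! ### Sobolev functions and the density of smooth functions -/

lemma gradient_apply {d : ℕ} (φ : E d → ℝ) (x : E d) (i : Fin d) :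
    gradient φ x i = pderiv i φ x := by
  have h : inner ℝ (gradient φ x) (EuclideanSpace.single i (1 : ℝ)) = pderiv i φ x := by
    rw [gradient, InnerProductSpace.toDual_symm_apply, pderiv]
  rw [← h, EuclideanSpace.inner_single_right]
  simp

/-- `u` and its weak gradient `g` are square integrable (with strongly measurable
representatives). -/
structure IsSobolev {d : ℕ} (Ω : Set (E d)) (u : E d → ℝ) (g : E d → E d) : Prop where
  sm_fn : StronglyMeasurable u
  sm_grad : StronglyMeasurable g
  memLp_fn : MemLp u 2 (volume.restrict Ω)
  memLp_grad : MemLp g 2 (volume.restrict Ω)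
  weak : HasWeakGrad Ω u g

lemma isSobolev_H1 {d : ℕ} {Ω : Set (E d)} (u : H1 Ω) : IsSobolev Ω (fn u) (grad u) :=
  ⟨Lp.stronglyMeasurable _, Lp.stronglyMeasurable _, memLp_fn u, memLp_grad u, u.2⟩

lemma HasWeakGrad.congr {d : ℕ} {Ω : Set (E d)} {u v : E d → ℝ} {g h : E d → E d}
    (H : HasWeakGrad Ω u g) (huv : u =ᵐ[volume.restrict Ω] v) (hgh : g =ᵐ[volume.restrict Ω] h) :
    HasWeakGrad Ω v h := by
  intro φ hφ i
  have h1 : ∫ x in Ω, v x * pderiv i φ x = ∫ x in Ω, u x * pderiv i φ x :=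
    integral_congr_ae (huv.mono fun x hx => by simp only [hx])
  have h2 : ∫ x in Ω, h x i * φ x = ∫ x in Ω, g x i * φ x :=
    integral_congr_ae (hgh.mono fun x hx => by simp only [hx])
  rw [h1, h2]
  exact H φ hφ i

/-- An element of `H¹(Ω)` from a function and its weak gradient. -/
def H1.mk {d : ℕ} {Ω : Set (E d)} (u : E d → ℝ) (g : E d → E d)
    (hu : MemLp u 2 (volume.restrict Ω)) (hg : MemLp g 2 (volume.restrict Ω))
    (H : HasWeakGrad Ω u g) : H1 Ω :=
  ⟨WithLp.toLp 2 (hu.toLp u, hg.toLp g), H.congr hu.coeFn_toLp.symm hg.coeFn_toLp.symm⟩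

lemma H1.fn_mk {d : ℕ} {Ω : Set (E d)} {u : E d → ℝ} {g : E d → E d}
    (hu : MemLp u 2 (volume.restrict Ω)) (hg : MemLp g 2 (volume.restrict Ω))
    (H : HasWeakGrad Ω u g) : fn (H1.mk u g hu hg H) =ᵐ[volume.restrict Ω] u := hu.coeFn_toLp

lemma H1.grad_mk {d : ℕ} {Ω : Set (E d)} {u : E d → ℝ} {g : E d → E d}
    (hu : MemLp u 2 (volume.restrict Ω)) (hg : MemLp g 2 (volume.restrict Ω))
    (H : HasWeakGrad Ω u g) : grad (H1.mk u g hu hg H) =ᵐ[volume.restrict Ω] g := hg.coeFn_toLp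

lemma H1.ext_ae {d : ℕ} {Ω : Set (E d)} {u v : H1 Ω} (h1 : fn u =ᵐ[volume.restrict Ω] fn v)
    (h2 : grad u =ᵐ[volume.restrict Ω] grad v) : u = v := by
  refine Subtype.ext ?_
  refine (WithLp.equiv 2 _).injective (Prod.ext ?_ ?_)
  · exact Lp.ext h1
  · exact Lp.ext h2

lemma norm_H1_sq {d : ℕ} {Ω : Set (E d)} (u : H1 Ω) :
    ‖u‖ ^ 2 = ‖(u : L2Pair Ω).fst‖ ^ 2 + ‖(u : L2Pair Ω).snd‖ ^ 2 :=
  WithLp.prod_norm_sq_eq_of_L2 _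

/-- The product of a Sobolev function with a smooth function. -/
lemma IsSobolev.smooth_mul {d : ℕ} {Ω : Set (E d)} {u : E d → ℝ} {g : E d → E d}
    (h : IsSobolev Ω u g) {χ : E d → ℝ} (hχ : ContDiff ℝ ∞ χ) {K : ℝ} (hK : ∀ x, |χ x| ≤ K)
    (hK' : ∀ x, ‖gradient χ x‖ ≤ K) :
    IsSobolev Ω (fun x => χ x * u x) (fun x => χ x • g x + u x • gradient χ x) := by
  have hcg := continuous_gradient hχ
  refine ⟨hχ.continuous.stronglyMeasurable.mul h.sm_fn, (hχ.continuous.stronglyMeasurable.smul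
    h.sm_grad).add (h.sm_fn.smul hcg.stronglyMeasurable), ?_, ?_, ?_⟩
  · exact h.memLp_fn.of_le_mul (c := K) (hχ.continuous.aestronglyMeasurable.mul h.memLp_fn.1)
      (ae_of_all _ fun x => by rw [norm_mul]; gcongr; exact hK x)
  · refine MemLp.add ?_ ?_
    · exact h.memLp_grad.of_le_mul (c := K) (hχ.continuous.aestronglyMeasurable.smul h.memLp_grad.1)
        (ae_of_all _ fun x => by rw [norm_smul]; gcongr; exact hK x)
    · exact h.memLp_fn.of_le_mul (c := K) (h.memLp_fn.1.smul hcg.aestronglyMeasurable)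
        (ae_of_all _ fun x => by rw [norm_smul, mul_comm]; gcongr; exact hK' x)
  · intro φ hφ i
    have hφχ : IsTestFun Ω (fun x => χ x * φ x) :=
      ⟨hχ.mul hφ.smooth, hφ.compact.mul_left, (tsupport_mul_subset_right).trans hφ.supp⟩
    have hχi : ∀ x, pderiv i χ x = gradient χ x i := fun x => (gradient_apply χ x i).symm
    have hp : ∀ x, pderiv i (fun x => χ x * φ x) x = χ x * pderiv i φ x + φ x * gradient χ x i := by
      intro x
      rw [← hχi, pderiv, fderiv_fun_mul (hχ.differentiable (by simp) x)
        (hφ.smooth.differentiable (by simp) x)]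
      simp [pderiv]
    have key := h.weak _ hφχ i
    simp only [hp] at key
    have hb : Continuous fun x => gradient χ x i := by fun_prop
    have hcφ := hφ.smooth.continuous
    have m1 : MemLp (fun x => χ x * pderiv i φ x) 2 (volume.restrict Ω) :=
      (hφ.memLp_pderiv i).of_le_mul (c := K) (hχ.continuous.aestronglyMeasurable.mul
        (hφ.memLp_pderiv i).1) (ae_of_all _ fun x => by rw [norm_mul]; gcongr; exact hK x)
    have m2 : MemLp (fun x => φ x * gradient χ x i) 2 (volume.restrict Ω) :=
      ((hcφ.mul hb).memLp_of_hasCompactSupport hφ.compact.mul_right).restrict Ω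
    have m3 : MemLp (fun x => χ x * φ x) 2 (volume.restrict Ω) := hφχ.memLp
    have i1 := h.memLp_fn.integrable_mul m1
    have i2 := h.memLp_fn.integrable_mul m2
    have i3 := (memLp_coord h.memLp_grad i).integrable_mul m3
    have e1 : ∫ x in Ω, u x * (χ x * pderiv i φ x + φ x * gradient χ x i)
        = (∫ x in Ω, u x * (χ x * pderiv i φ x)) + ∫ x in Ω, u x * (φ x * gradient χ x i) := by
      refine Eq.trans ?_ (integral_add i1 i2)
      exact integral_congr_ae (ae_of_all _ fun x => by ring)
    have e2 : ∫ x in Ω, (χ x • g x + u x • gradient χ x) i * φ x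
        = (∫ x in Ω, g x i * (χ x * φ x)) + ∫ x in Ω, u x * (φ x * gradient χ x i) := by
      refine Eq.trans ?_ (integral_add i3 i2)
      refine integral_congr_ae (ae_of_all _ fun x => ?_)
      simp only [PiLp.add_apply, PiLp.smul_apply, smul_eq_mul]; ring
    have e3 : ∫ x in Ω, χ x * u x * pderiv i φ x = ∫ x in Ω, u x * (χ x * pderiv i φ x) :=
      integral_congr_ae (ae_of_all _ fun x => by ring)
    rw [e1] at key
    rw [e2, e3]
    linarith

/-- `(u, g)` is the limit in `H¹(Ω)` of smooth functions on the whole space, which can be chosen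
nonnegative if `pos` holds. -/
def IsSmoothLimit {d : ℕ} (Ω : Set (E d)) (u : E d → ℝ) (g : E d → E d) (pos : Prop) : Prop :=
  ∃ φ : ℕ → E d → ℝ, (∀ k, ContDiff ℝ ∞ (φ k) ∧ HasCompactSupport (φ k)) ∧
    Tendsto (fun k => eLpNorm (fun x => φ k x - u x) 2 (volume.restrict Ω)) atTop (𝓝 0) ∧
    Tendsto (fun k => eLpNorm (fun x => gradient (φ k) x - g x) 2 (volume.restrict Ω))
      atTop (𝓝 0) ∧
    (pos → ∀ k x, 0 ≤ φ k x)

lemma IsSmoothLimit.add {d : ℕ} {Ω : Set (E d)} {u v : E d → ℝ} {g h : E d → E d} {pos : Prop}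
    (hu : IsSobolev Ω u g) (hv : IsSobolev Ω v h)
    (Hu : IsSmoothLimit Ω u g pos) (Hv : IsSmoothLimit Ω v h pos) :
    IsSmoothLimit Ω (fun x => u x + v x) (fun x => g x + h x) pos := by
  obtain ⟨φ, hφ, h1, h2, h3⟩ := Hu
  obtain ⟨ψ, hψ, k1, k2, k3⟩ := Hv
  refine ⟨fun k => φ k + ψ k, fun k => ⟨(hφ k).1.add (hψ k).1, (hφ k).2.add (hψ k).2⟩, ?_, ?_, ?_⟩
  · refine tendsto_eLpNorm_add
      (fun k => (hφ k).1.continuous.aestronglyMeasurable.sub hu.memLp_fn.1)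
      (fun k => (hψ k).1.continuous.aestronglyMeasurable.sub hv.memLp_fn.1) (fun k => ?_) h1 k1
    refine ae_of_all _ fun x => ?_
    simp only [Pi.add_apply, Pi.sub_apply]
    ring
  · refine tendsto_eLpNorm_add
      (fun k => (continuous_gradient (hφ k).1).aestronglyMeasurable.sub hu.memLp_grad.1)
      (fun k => (continuous_gradient (hψ k).1).aestronglyMeasurable.sub hv.memLp_grad.1)
      (fun k => ?_) h2 k2
    refine ae_of_all _ fun x => ?_
    simp only [gradient_add' (hφ k).1 (hψ k).1, Pi.add_apply, Pi.sub_apply]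
    abel
  · exact fun hp k x => add_nonneg (h3 hp k x) (k3 hp k x)

lemma IsSmoothLimit.congr {d : ℕ} {Ω : Set (E d)} {u v : E d → ℝ} {g h : E d → E d} {pos : Prop}
    (H : IsSmoothLimit Ω u g pos) (huv : u =ᵐ[volume.restrict Ω] v)
    (hgh : g =ᵐ[volume.restrict Ω] h) : IsSmoothLimit Ω v h pos := by
  obtain ⟨φ, hφ, h1, h2, h3⟩ := H
  refine ⟨φ, hφ, h1.congr fun k => eLpNorm_congr_ae ?_, h2.congr fun k => eLpNorm_congr_ae ?_, h3⟩
  · filter_upwards [huv] with x hx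
    rw [hx]
  · filter_upwards [hgh] with x hx
    rw [hx]

section Mollify

variable {d : ℕ} {f η : E d → ℝ}

/-- The kernel is evaluated at `t - x`, so that the mollification at `x` averages `f` over `x + supp
η`. If `supp η` lies in an interior cone, these points stay in `Ω` even for `x` near the boundary.
-/
lemma mollify_eq_convolution : (fun x => ∫ t, f t * η (t - x))
    = MeasureTheory.convolution f (fun y => η (-y)) (ContinuousLinearMap.mul ℝ ℝ) volume := by
  ext x
  simp only [MeasureTheory.convolution, ContinuousLinearMap.mul_apply', neg_sub]

lemma contDiff_mollify (hf : LocallyIntegrable f volume) (hη : ContDiff ℝ ∞ η)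
    (hc : HasCompactSupport η) : ContDiff ℝ ∞ fun x => ∫ t, f t * η (t - x) := by
  rw [mollify_eq_convolution]
  exact (hc.comp_homeomorph (Homeomorph.neg (E d))).contDiff_convolution_right _ hf
    (hη.comp contDiff_neg)

lemma hasCompactSupport_mollify (hf : HasCompactSupport f) (hc : HasCompactSupport η) :
    HasCompactSupport fun x => ∫ t, f t * η (t - x) := by
  rw [mollify_eq_convolution]
  exact HasCompactSupport.convolution _ hf (hc.comp_homeomorph (Homeomorph.neg (E d)))

/-- The derivative in `x` falls on the kernel and equals minus its derivative in `t`. The result has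
exactly the form to which the definition of the weak gradient applies, with test function `t ↦ η(t -
x)`. -/
lemma gradient_mollify (hf : LocallyIntegrable f volume) (hη : ContDiff ℝ ∞ η)
    (hc : HasCompactSupport η) (x : E d) (i : Fin d) :
    gradient (fun x => ∫ t, f t * η (t - x)) x i
      = - ∫ t, f t * pderiv i (fun t => η (t - x)) t := by
  have hrs : ContDiff ℝ ∞ (fun y => η (-y)) := hη.comp contDiff_neg
  have hrc : HasCompactSupport (fun y => η (-y)) :=
    hc.comp_homeomorph (Homeomorph.neg (E d))
  have hd := hrc.hasFDerivAt_convolution_right (ContinuousLinearMap.mul ℝ ℝ) hf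
    (hrs.of_le (by simp)) x
  rw [gradient_apply, pderiv, mollify_eq_convolution, hd.fderiv,
    convolution_precompR_apply _ hf (hrc.fderiv ℝ) (hrs.continuous_fderiv (by simp)),
    MeasureTheory.convolution, ← integral_neg]
  refine integral_congr_ae (ae_of_all _ fun t => ?_)
  have e1 : fderiv ℝ (fun y => η (-y)) (x - t) = - fderiv ℝ η (t - x) := by
    have := ((hη.differentiable (by simp) (-(x - t))).hasFDerivAt).comp (x - t)
      ((hasFDerivAt_id (𝕜 := ℝ) (x - t)).fun_neg)
    rw [neg_sub] at this
    refine this.fderiv.trans ?_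
    ext v
    simp
  have e2 : fderiv ℝ (fun t => η (t - x)) t = fderiv ℝ η (t - x) := by
    rw [fderiv_comp_sub]
  simp only [pderiv, e1, e2, ContinuousLinearMap.mul_apply', neg_apply,
    mul_neg]

end Mollify

/-- Mollification with a kernel supported in a cone of directions pointing into `Ω`. -/
theorem isSmoothLimit_of_support {d : ℕ} {Ω : Set (E d)} (hO : IsOpen Ω) {f : E d → ℝ}
    {g : E d → E d} (hf : IsSobolev Ω f g) {pos : Prop} (hpos : pos → ∀ x, 0 ≤ f x)
    {x₀ e : E d} {c ρ : ℝ} (hc : 0 < c) (hc1 : c ≤ 1) (hρ : 0 < ρ) (he : ‖e‖ ≤ 1)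
    (hcone : ∀ x ∈ closure Ω, x ∈ Metric.ball x₀ ρ → ∀ s, 0 < s → s < ρ →
      ∀ v ∈ Metric.ball e c, x + s • v ∈ Ω)
    (hsupp : ∀ x, ρ / 2 < dist x x₀ → f x = 0 ∧ g x = 0) : IsSmoothLimit Ω f g pos := by
  have hOm := hO.measurableSet
  set f₀ : E d → ℝ := Ω.indicator f with hf₀
  set g₀ : E d → E d := Ω.indicator g with hg₀
  have hf₀m : StronglyMeasurable f₀ := hf.sm_fn.indicator hOm
  have hg₀m : StronglyMeasurable g₀ := hf.sm_grad.indicator hOm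
  have hf₀L : MemLp f₀ 2 volume := (memLp_indicator_iff_restrict hOm).2 hf.memLp_fn
  have hg₀L : MemLp g₀ 2 volume := (memLp_indicator_iff_restrict hOm).2 hf.memLp_grad
  -- The kernels are bumps around `s e` of radius `sc/2`, so their supports lie in `s` times the
  -- ball around `e` of radius `c`, and have norm at most `2s ≤ ρ/4`. The factor `1/8` ensures that
  -- points at distance at least `ρ` from `x₀` only see values of `f` at distance greater than
  -- `ρ/2`, where `f` vanishes.
  set s : ℕ → ℝ := fun k => ρ / 8 / (k + 1) with hs
  have hs0 : ∀ k, 0 < s k := fun k => by positivity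
  have hs1 : ∀ k, s k ≤ ρ / 8 := fun k => by
    refine div_le_self (by positivity) ?_
    linarith [(Nat.cast_nonneg k : (0 : ℝ) ≤ k)]
  have hslim : Tendsto s atTop (𝓝 0) := by
    refine ((tendsto_const_div_atTop_nhds_zero_nat (ρ / 8)).comp (tendsto_add_atTop_nat 1)).congr
      fun k => ?_
    simp [hs]
  let b : ∀ k, ContDiffBump (s k • e) := fun k =>
    { rIn := s k * c / 4, rOut := s k * c / 2, rIn_pos := by have := hs0 k; positivity,
      rIn_lt_rOut := by have := mul_pos (hs0 k) hc; linarith }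
  set η : ℕ → E d → ℝ := fun k => (b k).normed volume with hη
  have hη0 : ∀ k x, 0 ≤ η k x := fun k x => (b k).nonneg_normed x
  have hηs : ∀ k, ContDiff ℝ ∞ (η k) := fun k => (b k).contDiff_normed
  have hηc : ∀ k, HasCompactSupport (η k) := fun k => (b k).hasCompactSupport_normed
  have hηt : ∀ k, tsupport (η k) = Metric.closedBall (s k • e) (s k * c / 2) :=
    fun k => (b k).tsupport_normed_eq
  have hηv : ∀ k, ∀ y ∈ tsupport (η k), ∃ v ∈ Metric.ball e c, y = s k • v := by
    intro k y hy
    rw [hηt, Metric.mem_closedBall, dist_eq_norm] at hy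
    refine ⟨(s k)⁻¹ • y, ?_, by rw [smul_smul, mul_inv_cancel₀ (hs0 k).ne', one_smul]⟩
    rw [Metric.mem_ball, dist_eq_norm]
    have : (s k)⁻¹ • y - e = (s k)⁻¹ • (y - s k • e) := by
      rw [smul_sub, smul_smul, inv_mul_cancel₀ (hs0 k).ne', one_smul]
    rw [this, norm_smul, norm_inv, Real.norm_of_nonneg (hs0 k).le, inv_mul_lt_iff₀ (hs0 k)]
    nlinarith [hs0 k]
  have hηn : ∀ k, ∀ y ∈ tsupport (η k), ‖y‖ ≤ 2 * s k := by
    intro k y hy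
    obtain ⟨v, hv, rfl⟩ := hηv k y hy
    rw [Metric.mem_ball, dist_eq_norm] at hv
    have : ‖v‖ ≤ ‖v - e‖ + ‖e‖ := by simpa using norm_add_le (v - e) e
    rw [norm_smul, Real.norm_of_nonneg (hs0 k).le]
    nlinarith [hs0 k]
  set ν : ℕ → Measure (E d) := fun k => volume.withDensity fun y => ENNReal.ofReal (η k y) with hν
  have hprob : ∀ k, IsProbabilityMeasure (ν k) := by
    intro k
    refine ⟨?_⟩
    rw [hν, withDensity_apply _ MeasurableSet.univ, Measure.restrict_univ,
      ← ofReal_integral_eq_lintegral_ofReal (b k).integrable_normed (ae_of_all _ (hη0 k)),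
      (b k).integral_normed, ENNReal.ofReal_one]
  have hconc : ∀ ε > 0, ∀ᶠ k in atTop, ∀ᵐ y ∂ν k, ‖y‖ < ε := by
    intro ε hε
    filter_upwards [hslim.eventually (gt_mem_nhds (by positivity : 0 < ε / 2))] with k hk
    rw [hν, ae_withDensity_iff (by
      exact ENNReal.measurable_ofReal.comp (hηs k).continuous.measurable)]
    refine ae_of_all _ fun y hy => ?_
    have : y ∈ tsupport (η k) := subset_tsupport _ fun h => hy (by rw [h]; simp)
    linarith [hηn k y this]
  have hνint : ∀ {F : Type} [NormedAddCommGroup F] [NormedSpace ℝ F] (k : ℕ) (h : E d → F),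
      ∫ y, h y ∂ν k = ∫ y, η k y • h y := by
    intro F _ _ k h
    change ∫ y, h y ∂(volume.withDensity fun y => ENNReal.ofReal (η k y)) = _
    rw [integral_withDensity_eq_integral_toReal_smul (f := fun y => ENNReal.ofReal (η k y))
      (ENNReal.measurable_ofReal.comp (hηs k).continuous.measurable)
      (ae_of_all _ fun _ => ENNReal.ofReal_lt_top)]
    simp only [ENNReal.toReal_ofReal (hη0 k _)]
  set φ : ℕ → E d → ℝ := fun k x => ∫ t, f₀ t * η k (t - x) with hφ
  have hf₀loc : LocallyIntegrable f₀ volume := hf₀L.locallyIntegrable (by norm_num)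
  have hφν : ∀ k x, φ k x = ∫ y, f₀ (x + y) ∂ν k := by
    intro k x
    rw [hνint, ← integral_sub_right_eq_self _ x]
    refine integral_congr_ae (ae_of_all _ fun t => ?_)
    simp only [smul_eq_mul, add_sub_cancel]
    exact mul_comm _ _
  have hφs : ∀ k, ContDiff ℝ ∞ (φ k) := fun k => contDiff_mollify hf₀loc (hηs k) (hηc k)
  have hf₀c : HasCompactSupport f₀ := by
    refine HasCompactSupport.intro (isCompact_closedBall x₀ (ρ / 2)) fun x hx => ?_
    rw [Metric.mem_closedBall, not_le] at hx
    by_cases h : x ∈ Ω <;> simp [hf₀, h, (hsupp x hx).1]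
  have hφc : ∀ k, HasCompactSupport (φ k) := fun k => hasCompactSupport_mollify hf₀c (hηc k)
  -- The extension of `f` by zero need not be weakly differentiable across `∂Ω`, so the identity is
  -- claimed for `x ∈ Ω` only. Near `x₀` the shifted kernel is a test function on `Ω` by the cone
  -- property; far from `x₀` both sides vanish.
  have hgrad : ∀ k, ∀ x ∈ Ω, gradient (φ k) x = ∫ y, g₀ (x + y) ∂ν k := by
    intro k x hx
    have hψs : ContDiff ℝ ∞ fun t => η k (t - x) := (hηs k).comp (contDiff_id.sub contDiff_const)
    have hψc : HasCompactSupport fun t => η k (t - x) :=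
      (hηc k).comp_homeomorph (Homeomorph.subRight x)
    have hψt : ∀ t, t ∈ tsupport (fun t => η k (t - x)) → t - x ∈ tsupport (η k) := by
      intro t ht
      exact tsupport_comp_subset_preimage (η k) (f := fun t => t - x) (by fun_prop) ht
    ext i
    have hint : Integrable (fun y => η k y • g₀ (x + y)) volume := by
      have m1 : MemLp (η k) 2 volume := (hηs k).continuous.memLp_of_hasCompactSupport (hηc k)
      have m2 : MemLp (fun y => g₀ (x + y)) 2 volume :=
        hg₀L.comp_measurePreserving (measurePreserving_add_left volume x)
      exact memLp_one_iff_integrable.1 (m2.smul m1)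
    have r1 : (∫ y, g₀ (x + y) ∂ν k) i = ∫ t, g₀ t i * η k (t - x) := by
      rw [hνint]
      have := (EuclideanSpace.proj (𝕜 := ℝ) i : E d →L[ℝ] ℝ).integral_comp_comm hint
      refine this.symm.trans ?_
      rw [ ← integral_sub_right_eq_self _ x]
      refine integral_congr_ae (ae_of_all _ fun t => ?_)
      simp only [PiLp.proj_apply, PiLp.smul_apply, add_sub_cancel, smul_eq_mul]
      exact mul_comm _ _
    have r2 := gradient_mollify hf₀loc (hηs k) (hηc k) x i
    rw [r1, r2]
    by_cases hxb : x ∈ Metric.ball x₀ ρ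
    · have hψ : IsTestFun Ω fun t => η k (t - x) := by
        refine ⟨hψs, hψc, fun t ht => ?_⟩
        obtain ⟨v, hv, h⟩ := hηv k _ (hψt t ht)
        rw [sub_eq_iff_eq_add'] at h
        rw [h]
        exact hcone x (subset_closure hx) hxb _ (hs0 k) (by linarith [hs1 k]) v hv
      have := hf.weak _ hψ i
      have e1 : ∫ t, f₀ t * pderiv i (fun t => η k (t - x)) t
          = ∫ t in Ω, f t * pderiv i (fun t => η k (t - x)) t := by
        rw [← integral_indicator hOm]
        refine integral_congr_ae (ae_of_all _ fun t => ?_)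
        by_cases ht : t ∈ Ω <;> simp [hf₀, ht]
      have e2 : ∫ t, g₀ t i * η k (t - x) = ∫ t in Ω, g t i * η k (t - x) := by
        rw [← integral_indicator hOm]
        refine integral_congr_ae (ae_of_all _ fun t => ?_)
        by_cases ht : t ∈ Ω <;> simp [hg₀, ht]
      rw [e1, e2, this, neg_neg]
    · have hfar : ∀ t, t ∈ tsupport (fun t => η k (t - x)) → f₀ t = 0 ∧ g₀ t = 0 := by
        intro t ht
        have h1 := hηn k _ (hψt t ht)
        rw [Metric.mem_ball, not_lt] at hxb
        have h2 := dist_triangle x t x₀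
        rw [dist_comm x t, dist_eq_norm t x] at h2
        have h3 := hsupp t (by linarith [hs1 k])
        simp [hf₀, hg₀, h3.1, h3.2]
      have e1 : ∫ t, f₀ t * pderiv i (fun t => η k (t - x)) t = 0 := by
        refine integral_eq_zero_of_ae (ae_of_all _ fun t => ?_)
        by_cases ht : t ∈ tsupport (fun t => η k (t - x))
        · simp [(hfar t ht).1]
        · have : fderiv ℝ (fun t => η k (t - x)) t = 0 := by
            by_contra h
            exact ht (support_fderiv_subset ℝ h)
          simp [pderiv, this]
      have e2 : ∫ t, g₀ t i * η k (t - x) = 0 := by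
        refine integral_eq_zero_of_ae (ae_of_all _ fun t => ?_)
        by_cases ht : t ∈ tsupport (fun t => η k (t - x))
        · simp [(hfar t ht).2]
        · simp [image_eq_zero_of_notMem_tsupport ht]
      rw [e1, e2, neg_zero]
  refine ⟨φ, fun k => ⟨hφs k, hφc k⟩, ?_, ?_, ?_⟩
  · have := tendsto_eLpNorm_average volume hf₀m hf₀L ν hconc
    refine tendsto_of_tendsto_of_tendsto_of_le_of_le tendsto_const_nhds this (fun _ => zero_le) ?_
    intro k
    refine le_trans (le_of_eq (eLpNorm_congr_ae ?_)) (eLpNorm_mono_measure _ Measure.restrict_le_self)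
    filter_upwards [ae_restrict_mem hOm] with x hx
    simp only [hφν, hf₀, indicator_of_mem hx]
  · have := tendsto_eLpNorm_average volume hg₀m hg₀L ν hconc
    refine tendsto_of_tendsto_of_tendsto_of_le_of_le tendsto_const_nhds this (fun _ => zero_le) ?_
    intro k
    refine le_trans (le_of_eq (eLpNorm_congr_ae ?_)) (eLpNorm_mono_measure _ Measure.restrict_le_self)
    filter_upwards [ae_restrict_mem hOm] with x hx
    simp only [hgrad k x hx, hg₀, indicator_of_mem hx]
  · intro hp k x
    rw [hφν]
    exact integral_nonneg fun y => indicator_nonneg (fun z _ => hpos hp z) _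

lemma exists_bound_smooth {d : ℕ} {χ : E d → ℝ} (hχ : ContDiff ℝ ∞ χ) (hc : HasCompactSupport χ) :
    ∃ K, (∀ x, |χ x| ≤ K) ∧ ∀ x, ‖gradient χ x‖ ≤ K := by
  obtain ⟨K₁, h1⟩ := hc.exists_bound_of_continuous hχ.continuous
  have hc' : HasCompactSupport (gradient χ) := by
    have := (hc.fderiv ℝ).comp_left (g := (InnerProductSpace.toDual ℝ (E d)).symm) (map_zero _)
    exact this
  obtain ⟨K₂, h2⟩ := hc'.exists_bound_of_continuous (continuous_gradient hχ)
  exact ⟨max K₁ K₂, fun x => (h1 x).trans (le_max_left _ _), fun x => (h2 x).trans (le_max_right _ _)⟩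

lemma gradient_one_sub {d : ℕ} (χ : E d → ℝ) (x : E d) :
    gradient (fun x => 1 - χ x) x = - gradient χ x := by
  simp only [gradient, fderiv_const_sub, map_neg]

lemma gradient_eq_zero_of_eventuallyEq {d : ℕ} {χ : E d → ℝ} {x : E d} {a : ℝ}
    (h : χ =ᶠ[𝓝 x] fun _ => a) : gradient χ x = 0 := by
  rw [gradient, h.fderiv_eq]; simp

/-- Functions smooth up to the boundary are dense in `H¹` of a bounded Lipschitz domain, and
nonnegative functions can be approximated by nonnegative ones. -/
theorem IsSobolev.isSmoothLimit {d : ℕ} {Ω : Set (E d)} (hO : IsOpen Ω)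
    (hB : Bornology.IsBounded Ω) (hL : HasLipschitzBoundary Ω) {pos : Prop} {u : E d → ℝ}
    {g : E d → E d} (hu : IsSobolev Ω u g) (hpos : pos → ∀ x, 0 ≤ u x) :
    IsSmoothLimit Ω u g pos := by
  choose! e c ρ hc hc1 hρ he hcone using
    fun (x₀ : E d) (hx₀ : x₀ ∈ closure Ω) => hL.exists_cone hO hx₀
  -- In place of a partition of unity, bumps are peeled off one at a time: `u = bu + (1 - b)u`,
  -- where `bu` is supported near one centre and is treated by mollification, and `(1 - b)u`
  -- vanishes on the ball of that centre, so that one ball fewer is needed. Both factors are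
  -- nonnegative, which preserves the sign.
  have step : ∀ t : Finset (E d), (∀ j ∈ t, j ∈ closure Ω) → ∀ (u : E d → ℝ) (g : E d → E d),
      IsSobolev Ω u g → (pos → ∀ x, 0 ≤ u x) →
      (∀ x ∈ Ω, (∀ j ∈ t, x ∉ Metric.ball j (ρ j / 4)) → u x = 0 ∧ g x = 0) →
      IsSmoothLimit Ω u g pos := by
    intro t
    induction t using Finset.induction_on with
    | empty =>
      intro _ u g hu _ h0
      have H : IsSmoothLimit Ω (fun _ => 0) (fun _ => 0) pos :=
        ⟨fun _ _ => 0, fun _ => ⟨contDiff_const, HasCompactSupport.zero⟩, by simp,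
          by simp [gradient], fun _ _ _ => le_rfl⟩
      refine H.congr ?_ ?_
      · filter_upwards [ae_restrict_mem hO.measurableSet] with x hx using (h0 x hx (by simp)).1.symm
      · filter_upwards [ae_restrict_mem hO.measurableSet] with x hx using (h0 x hx (by simp)).2.symm
    | insert j t _ ih =>
      intro ht u g hu hpos h0
      have hj : j ∈ closure Ω := ht j (Finset.mem_insert_self _ _)
      have hρj := hρ j hj
      let b : ContDiffBump j := ⟨ρ j / 4, ρ j / 2, by positivity, by linarith⟩
      have hbs : ContDiff ℝ ∞ b := b.contDiff
      obtain ⟨K, hK, hK'⟩ := exists_bound_smooth hbs b.hasCompactSupport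
      have hS1 := hu.smooth_mul hbs hK hK'
      have hS2 := hu.smooth_mul (χ := fun x => 1 - b x) (contDiff_const.sub hbs) (K := 1 + K)
        (fun x => (abs_sub _ _).trans (by rw [abs_one]; linarith [hK x]))
        (fun x => by rw [gradient_one_sub, norm_neg]; linarith [hK' x])
      have A1 := isSmoothLimit_of_support hO hS1 (pos := pos)
        (fun hp x => mul_nonneg b.nonneg (hpos hp x)) (hc j hj) (hc1 j hj) hρj (he j hj)
        (hcone j hj) (fun x hx => by
          have h1 : x ∉ tsupport b := by
            rw [b.tsupport_eq, Metric.mem_closedBall, not_le]; exact hx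
          have h2 : b =ᶠ[𝓝 x] fun _ => (0 : ℝ) := notMem_tsupport_iff_eventuallyEq.1 h1
          simp [h2.eq_of_nhds, gradient_eq_zero_of_eventuallyEq h2])
      have A2 := ih (fun i hi => ht i (Finset.mem_insert_of_mem hi)) _ _ hS2
        (fun hp x => mul_nonneg (sub_nonneg.2 b.le_one) (hpos hp x)) (by
          intro x hx hxt
          by_cases hxj : x ∈ Metric.ball j (ρ j / 4)
          · have h2 : b =ᶠ[𝓝 x] fun _ => (1 : ℝ) := b.eventuallyEq_one_of_mem_ball hxj
            simp [gradient_one_sub, h2.eq_of_nhds, gradient_eq_zero_of_eventuallyEq h2]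
          · have := h0 x hx (by
              intro i hi
              rcases Finset.mem_insert.1 hi with rfl | hi
              · exact hxj
              · exact hxt i hi)
            simp [this.1, this.2])
      refine (A1.add hS1 hS2 A2).congr (ae_of_all _ fun x => ?_) (ae_of_all _ fun x => ?_)
      · ring
      · simp only [gradient_one_sub]; module
  obtain ⟨t, ht, hcov⟩ := hB.isCompact_closure.elim_nhds_subcover (fun x => Metric.ball x (ρ x / 4))
    (fun x hx => Metric.ball_mem_nhds _ (by have := hρ x hx; positivity))
  refine step t ht u g hu hpos fun x hx hxt => ?_
  obtain ⟨j, hj, hxj⟩ := mem_iUnion₂.1 (hcov (subset_closure hx))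
  exact absurd hxj (hxt j hj)

/-! ### Limits of weak gradients, the chain rule and zero boundary values -/

lemma tendsto_integral_mul_of_L2 {X : Type*} [MeasurableSpace X] {μ : Measure X} {u : ℕ → X → ℝ}
    {v ψ : X → ℝ} (hu : ∀ k, MemLp (u k) 2 μ) (hv : MemLp v 2 μ) (hψ : MemLp ψ 2 μ)
    (h : Tendsto (fun k => eLpNorm (fun x => u k x - v x) 2 μ) atTop (𝓝 0)) :
    Tendsto (fun k => ∫ x, u k x * ψ x ∂μ) atTop (𝓝 (∫ x, v x * ψ x ∂μ)) := by
  refine tendsto_integral_of_L1' _ (hv.integrable_mul hψ).1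
    (Eventually.of_forall fun k => (hu k).integrable_mul hψ) ?_
  have h2 := ENNReal.Tendsto.mul_const (b := eLpNorm ψ 2 μ) h (Or.inr hψ.2.ne)
  rw [zero_mul] at h2
  refine tendsto_of_tendsto_of_tendsto_of_le_of_le tendsto_const_nhds h2 (fun _ => zero_le) ?_
  intro k
  have := eLpNorm_smul_le_mul_eLpNorm (p := 2) (q := 2) (r := 1) (μ := μ)
    hψ.1 ((hu k).sub hv).1
  refine le_trans (le_of_eq (eLpNorm_congr_ae (ae_of_all _ fun x => ?_))) this
  simp only [Pi.sub_apply, Pi.smul_apply', Pi.mul_apply, smul_eq_mul]; ring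

/-- For a fixed test function both sides of the defining identity are continuous under `L²`
convergence, so the weak gradient is a closed operator. The chain rule and the vanishing of
gradients on level sets are obtained in this way from approximations. -/
lemma HasWeakGrad.of_tendsto {d : ℕ} {Ω : Set (E d)} {u : ℕ → E d → ℝ} {v : E d → ℝ}
    {g : ℕ → E d → E d} {h : E d → E d} (H : ∀ k, HasWeakGrad Ω (u k) (g k))
    (hu : ∀ k, MemLp (u k) 2 (volume.restrict Ω)) (hv : MemLp v 2 (volume.restrict Ω))
    (hg : ∀ k, MemLp (g k) 2 (volume.restrict Ω)) (hh : MemLp h 2 (volume.restrict Ω))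
    (h1 : Tendsto (fun k => eLpNorm (fun x => u k x - v x) 2 (volume.restrict Ω)) atTop (𝓝 0))
    (h2 : Tendsto (fun k => eLpNorm (fun x => g k x - h x) 2 (volume.restrict Ω)) atTop (𝓝 0)) :
    HasWeakGrad Ω v h := by
  intro φ hφ i
  have t1 := tendsto_integral_mul_of_L2 hu hv (hφ.memLp_pderiv i) h1
  have h2i : Tendsto (fun k => eLpNorm (fun x => g k x i - h x i) 2 (volume.restrict Ω))
      atTop (𝓝 0) := by
    refine tendsto_of_tendsto_of_tendsto_of_le_of_le tendsto_const_nhds h2 (fun _ => zero_le) ?_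
    intro k
    refine eLpNorm_mono fun x => ?_
    exact PiLp.norm_apply_le (g k x - h x) i
  have t2 := (tendsto_integral_mul_of_L2 (fun k => memLp_coord (hg k) i) (memLp_coord hh i)
    hφ.memLp h2i).neg
  refine tendsto_nhds_unique t1 (t2.congr fun k => ?_)
  rw [H k φ hφ i]

/-- The test function vanishes outside `Ω`, hence the integrals may be taken over the whole space,
where integration by parts has no boundary term. -/
lemma hasWeakGrad_of_contDiff {d : ℕ} {Ω : Set (E d)} {F : E d → ℝ}
    (hF : ContDiff ℝ 1 F) : HasWeakGrad Ω F (gradient F) := by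
  intro φ hφ i
  have hφd := hφ.smooth.differentiable (by simp)
  have hFd := hF.differentiable (by simp)
  have hcp : Continuous (pderiv i φ) :=
    (hφ.smooth.continuous_fderiv (by simp)).clm_apply continuous_const
  have hcF : Continuous (pderiv i F) := (hF.continuous_fderiv (by simp)).clm_apply continuous_const
  have hs : HasCompactSupport (pderiv i φ) := hφ.compact.fderiv_apply ℝ _
  have key := integral_mul_fderiv_eq_neg_fderiv_mul_of_integrable (μ := volume) (f := F) (g := φ)
    (v := EuclideanSpace.single i (1 : ℝ))
    ((hcF.mul hφ.smooth.continuous).integrable_of_hasCompactSupport hφ.compact.mul_left)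
    ((hF.continuous.mul hcp).integrable_of_hasCompactSupport hs.mul_left)
    ((hF.continuous.mul hφ.smooth.continuous).integrable_of_hasCompactSupport hφ.compact.mul_left)
    (fun x _ => hFd x) (fun x _ => hφd x)
  have e1 : ∫ x in Ω, F x * pderiv i φ x = ∫ x, F x * pderiv i φ x := by
    refine setIntegral_eq_integral_of_forall_compl_eq_zero fun x hx => ?_
    have : fderiv ℝ φ x = 0 := by
      by_contra h
      exact hx (hφ.supp (support_fderiv_subset ℝ h))
    simp [pderiv, this]
  have e2 : ∫ x in Ω, gradient F x i * φ x = ∫ x, pderiv i F x * φ x := by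
    simp only [gradient_apply]
    refine setIntegral_eq_integral_of_forall_compl_eq_zero fun x hx => ?_
    rw [image_eq_zero_of_notMem_tsupport fun h => hx (hφ.supp h), mul_zero]
  rw [e1, e2]
  exact key

lemma HasWeakGrad.ae_eq_zero {d : ℕ} {Ω : Set (E d)} (hO : IsOpen Ω) {g : E d → E d}
    (hg : MemLp g 2 (volume.restrict Ω)) (h : HasWeakGrad Ω (fun _ => 0) g) :
    g =ᵐ[volume.restrict Ω] 0 := by
  have key : ∀ i, ∀ᵐ x ∂volume, x ∈ Ω → g x i = 0 := by
    intro i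
    refine hO.ae_eq_zero_of_integral_contDiff_smul_eq_zero ?_ ?_
    · rw [locallyIntegrableOn_iff hO.isLocallyClosed]
      intro k hk hkc
      have : MemLp (fun x => g x i) 2 (volume.restrict k) :=
        (memLp_coord hg i).mono_measure (Measure.restrict_mono hk le_rfl)
      have hf : IsFiniteMeasure (volume.restrict k) := ⟨by simpa using hkc.measure_lt_top⟩
      exact this.integrable (by norm_num)
    · intro ψ hψ hc hs
      have := h ψ ⟨hψ, hc, hs⟩ i
      simp only [zero_mul, integral_zero] at this
      rw [← setIntegral_eq_integral_of_forall_compl_eq_zero (s := Ω) fun x hx => by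
        rw [image_eq_zero_of_notMem_tsupport fun h => hx (hs h), zero_smul]]
      simp only [smul_eq_mul, mul_comm (ψ _)]
      linarith
  have : ∀ᵐ x ∂volume, ∀ i, x ∈ Ω → g x i = 0 := ae_all_iff.2 key
  refine (ae_restrict_iff' hO.measurableSet).2 ?_
  filter_upwards [this] with x hx hxO
  ext i
  exact hx i hxO

/-- A weak gradient of zero is zero by the fundamental lemma of the calculus of variations. Hence
equality of functions in `L²(Ω)` already gives equality in `H¹(Ω)`, which is needed for the
densities at the end. -/
lemma H1.ext_fn {d : ℕ} {Ω : Set (E d)} (hO : IsOpen Ω) {u v : H1 Ω}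
    (h : fn u =ᵐ[volume.restrict Ω] fn v) : u = v := by
  have h0 : fn (u + (-1 : ℝ) • v) =ᵐ[volume.restrict Ω] fun _ => 0 := by
    filter_upwards [fn_add u ((-1 : ℝ) • v), fn_smul (-1) v, h] with x h1 h2 h3
    rw [h1, Pi.add_apply, h2, Pi.smul_apply, h3]; simp
  have h1 := ((u + (-1 : ℝ) • v).2.congr h0 (EventuallyEq.refl _ _)).ae_eq_zero hO
    (memLp_grad (u + (-1 : ℝ) • v))
  refine H1.ext_ae h ?_
  filter_upwards [h1, grad_add u ((-1 : ℝ) • v), grad_smul (-1) v] with x h1 h2 h3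
  have h1' : grad (u + (-1 : ℝ) • v) x = 0 := h1
  rw [h2, Pi.add_apply, h3, Pi.smul_apply, neg_one_smul, ← sub_eq_add_neg, sub_eq_zero] at h1'
  exact h1'

lemma tendsto_H1_iff {d : ℕ} {Ω : Set (E d)} {u : ℕ → H1 Ω} {v : H1 Ω} :
    Tendsto u atTop (𝓝 v) ↔
      Tendsto (fun k => eLpNorm (fun x => fn (u k) x - fn v x) 2 (volume.restrict Ω)) atTop (𝓝 0) ∧
      Tendsto (fun k => eLpNorm (fun x => grad (u k) x - grad v x) 2 (volume.restrict Ω))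
        atTop (𝓝 0) := by
  have h1 : Tendsto u atTop (𝓝 v) ↔
      Tendsto (fun k => WithLp.ofLp (u k : L2Pair Ω)) atTop (𝓝 (WithLp.ofLp (v : L2Pair Ω))) := by
    rw [tendsto_subtype_rng]
    refine ⟨fun h => ((WithLp.prod_continuous_ofLp 2 _ _).tendsto _).comp h, fun h => ?_⟩
    exact ((WithLp.prod_continuous_toLp 2 _ _).tendsto _).comp h
  rw [h1, Prod.tendsto_iff, Lp.tendsto_Lp_iff_tendsto_eLpNorm', Lp.tendsto_Lp_iff_tendsto_eLpNorm']
  rfl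

lemma IsAdmissibleDomain.isFiniteMeasure {d : ℕ} {Ω ΓD ΓN : Set (E d)}
    (hΩ : IsAdmissibleDomain Ω ΓD ΓN) : IsFiniteMeasure (volume.restrict Ω) :=
  ⟨by simpa using hΩ.bounded.measure_lt_top⟩

/-- Smooth functions with bounded derivative. -/
structure IsSmoothLip (f : ℝ → ℝ) (L : ℝ) : Prop where
  smooth : ContDiff ℝ ∞ f
  bound : ∀ s, |deriv f s| ≤ L

lemma IsSmoothLip.nonneg {f : ℝ → ℝ} {L : ℝ} (hf : IsSmoothLip f L) : 0 ≤ L :=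
  (abs_nonneg _).trans (hf.bound 0)

lemma IsSmoothLip.abs_sub_le {f : ℝ → ℝ} {L : ℝ} (hf : IsSmoothLip f L) (a b : ℝ) :
    |f a - f b| ≤ L * |a - b| :=
  Convex.norm_image_sub_le_of_norm_deriv_le (s := univ)
    (fun x _ => hf.smooth.differentiable (by simp) x) (fun x _ => hf.bound x) convex_univ
    (mem_univ b) (mem_univ a)

lemma IsSmoothLip.continuous_deriv {f : ℝ → ℝ} {L : ℝ} (hf : IsSmoothLip f L) :
    Continuous (deriv f) := hf.smooth.continuous_deriv (by simp)

lemma IsSmoothLip.gradient_comp {d : ℕ} {f : ℝ → ℝ} {L : ℝ} (hf : IsSmoothLip f L) {φ : E d → ℝ}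
    (hφ : ContDiff ℝ ∞ φ) (x : E d) :
    gradient (fun x => f (φ x)) x = deriv f (φ x) • gradient φ x := by
  have h := ((hf.smooth.differentiable (by simp) (φ x)).hasDerivAt.comp_hasFDerivAt x
    (hφ.differentiable (by simp) x).hasFDerivAt)
  have h2 : fderiv ℝ (fun x => f (φ x)) x = deriv f (φ x) • fderiv ℝ φ x := h.fderiv
  simp only [gradient, h2, map_smulₛₗ]
  rfl

lemma IsSmoothLip.memLp_comp {X : Type*} [MeasurableSpace X] {μ : Measure X} [IsFiniteMeasure μ]
    {f : ℝ → ℝ} {L : ℝ} (hf : IsSmoothLip f L) {u : X → ℝ} (hu : MemLp u 2 μ) :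
    MemLp (fun x => f (u x)) 2 μ := by
  have h1 : MemLp (fun x => |f 0| + L * ‖u x‖) 2 μ :=
    MemLp.add (memLp_const |f 0|) (MemLp.const_mul hu.norm L)
  refine h1.mono (hf.smooth.continuous.comp_aestronglyMeasurable hu.1) (ae_of_all _ fun x => ?_)
  have := hf.abs_sub_le (u x) 0
  rw [sub_zero, ← Real.norm_eq_abs (u x)] at this
  have h2 := abs_sub_abs_le_abs_sub (f (u x)) (f 0)
  rw [Real.norm_eq_abs, Real.norm_eq_abs]
  refine le_trans ?_ (le_abs_self _)
  linarith

lemma IsSmoothLip.memLp_deriv_smul {X F : Type*} [MeasurableSpace X] {μ : Measure X}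
    [NormedAddCommGroup F] [NormedSpace ℝ F]
    {f : ℝ → ℝ} {L : ℝ} (hf : IsSmoothLip f L) {u : X → ℝ} {g : X → F} (hu : MemLp u 2 μ)
    (hg : MemLp g 2 μ) : MemLp (fun x => deriv f (u x) • g x) 2 μ :=
  hg.of_le_mul (c := L) ((hf.continuous_deriv.comp_aestronglyMeasurable hu.1).smul hg.1)
    (ae_of_all _ fun x => by rw [norm_smul]; gcongr; exact hf.bound _)

lemma IsSmoothLip.tendsto_comp {X : Type*} [MeasurableSpace X] {μ : Measure X}
    {f : ℝ → ℝ} {L : ℝ} (hf : IsSmoothLip f L) {u : ℕ → X → ℝ} {v : X → ℝ}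
    (h : Tendsto (fun k => eLpNorm (fun x => u k x - v x) 2 μ) atTop (𝓝 0)) :
    Tendsto (fun k => eLpNorm (fun x => f (u k x) - f (v x)) 2 μ) atTop (𝓝 0) := by
  have h0 := ENNReal.Tendsto.const_mul (a := ENNReal.ofReal L) h (Or.inr (by simp))
  rw [mul_zero] at h0
  refine tendsto_of_tendsto_of_tendsto_of_le_of_le tendsto_const_nhds h0 (fun _ => zero_le) ?_
  intro i
  exact eLpNorm_le_mul_eLpNorm_of_ae_le_mul (ae_of_all _ fun x => hf.abs_sub_le _ _) 2

section

variable {d : ℕ} {Ω ΓD ΓN : Set (E d)}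

lemma memLp_smooth {φ : E d → ℝ} (hφ : ContDiff ℝ ∞ φ) (hB : Bornology.IsBounded Ω) :
    MemLp φ 2 (volume.restrict Ω) ∧ MemLp (gradient φ) 2 (volume.restrict Ω) := by
  have hc := hB.isCompact_closure
  have hfin : IsFiniteMeasure (volume.restrict (closure Ω)) := ⟨by simpa using hc.measure_lt_top⟩
  have key : ∀ {F : Type} [NormedAddCommGroup F] {g : E d → F}
      (_ : SecondCountableTopologyEither (E d) F), Continuous g → MemLp g 2 (volume.restrict Ω) := by
    intro F _ g _ hg
    obtain ⟨C, hC⟩ := hc.exists_bound_of_continuousOn hg.continuousOn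
    have : MemLp g 2 (volume.restrict (closure Ω)) :=
      MemLp.of_bound hg.aestronglyMeasurable C
        ((ae_restrict_mem isClosed_closure.measurableSet).mono fun x hx => hC x hx)
    exact this.mono_measure (Measure.restrict_mono subset_closure le_rfl)
  exact ⟨key inferInstance hφ.continuous, key inferInstance (continuous_gradient hφ)⟩

/-- The chain rule in `H¹(Ω)`. -/
theorem IsSmoothLip.hasWeakGrad_comp (hΩ : IsAdmissibleDomain Ω ΓD ΓN) {f : ℝ → ℝ} {L : ℝ}
    (hf : IsSmoothLip f L) (u : H1 Ω) :
    HasWeakGrad Ω (fun x => f (fn u x)) (fun x => deriv f (fn u x) • grad u x) := by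
  have := hΩ.isFiniteMeasure
  obtain ⟨φ, hφ, h1, h2, -⟩ := (isSobolev_H1 u).isSmoothLimit hΩ.isOpen hΩ.bounded hΩ.lipschitz
    (pos := False) False.elim
  have hm := fun k => memLp_smooth (hφ k).1 hΩ.bounded
  refine HasWeakGrad.of_tendsto (u := fun k x => f (φ k x))
    (g := fun k x => deriv f (φ k x) • gradient (φ k) x) (fun k => ?_)
    (fun k => hf.memLp_comp (hm k).1) (hf.memLp_comp (memLp_fn u))
    (fun k => hf.memLp_deriv_smul (hm k).1 (hm k).2)
    (hf.memLp_deriv_smul (memLp_fn u) (memLp_grad u)) (hf.tendsto_comp h1) ?_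
  · have := hasWeakGrad_of_contDiff (Ω := Ω) (F := fun x => f (φ k x))
      ((hf.smooth.comp (hφ k).1).of_le (by simp))
    refine this.congr EventuallyEq.rfl (ae_of_all _ fun x => ?_)
    exact hf.gradient_comp (hφ k).1 x
  · exact tendsto_eLpNorm_comp_smul hf.continuous_deriv hf.bound (fun k => (hm k).1) (memLp_fn u)
      (fun k => (hm k).2) (memLp_grad u) h1 h2

/-- The superposition operator `u ↦ f ∘ u` on `H¹(Ω)`. -/
theorem IsSmoothLip.exists_comp (hΩ : IsAdmissibleDomain Ω ΓD ΓN) {f : ℝ → ℝ} {L : ℝ}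
    (hf : IsSmoothLip f L) : ∃ F : H1 Ω → H1 Ω, Continuous F ∧ ∀ u,
      fn (F u) =ᵐ[volume.restrict Ω] (fun x => f (fn u x)) ∧
      grad (F u) =ᵐ[volume.restrict Ω] fun x => deriv f (fn u x) • grad u x := by
  have := hΩ.isFiniteMeasure
  set F : H1 Ω → H1 Ω := fun u => H1.mk _ _ (hf.memLp_comp (memLp_fn u))
    (hf.memLp_deriv_smul (memLp_fn u) (memLp_grad u)) (hf.hasWeakGrad_comp hΩ u)
  have hF : ∀ u, fn (F u) =ᵐ[volume.restrict Ω] (fun x => f (fn u x)) ∧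
      grad (F u) =ᵐ[volume.restrict Ω] fun x => deriv f (fn u x) • grad u x :=
    fun u => ⟨H1.fn_mk _ _ _, H1.grad_mk _ _ _⟩
  refine ⟨F, ?_, hF⟩
  rw [continuous_iff_seqContinuous]
  intro u v huv
  obtain ⟨h1, h2⟩ := tendsto_H1_iff.1 huv
  refine tendsto_H1_iff.2 ⟨(hf.tendsto_comp h1).congr fun k => eLpNorm_congr_ae ?_,
    (tendsto_eLpNorm_comp_smul hf.continuous_deriv hf.bound (fun k => memLp_fn (u k)) (memLp_fn v)
      (fun k => memLp_grad (u k)) (memLp_grad v) h1 h2).congr fun k => eLpNorm_congr_ae ?_⟩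
  · filter_upwards [(hF (u k)).1, (hF v).1] with x hx hy
    simp only [Function.comp_apply, hx, hy]
  · filter_upwards [(hF (u k)).2, (hF v).2] with x hx hy
    simp only [Function.comp_apply, hx, hy]

/-- In the definition of vanishing boundary values, the smooth functions need not have compact
support. -/
lemma zeroTraceOn_of_smooth (hB : Bornology.IsBounded Ω) {Γ : Set (E d)} (hΓ : Γ ⊆ closure Ω)
    {u : H1 Ω} {φ : ℕ → E d → ℝ} (hφ : ∀ k, ContDiff ℝ ∞ (φ k))
    (h1 : Tendsto (fun k => eLpNorm (fun x => φ k x - fn u x) 2 (volume.restrict Ω)) atTop (𝓝 0))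
    (h2 : Tendsto (fun k => eLpNorm (fun x => gradient (φ k) x - grad u x) 2 (volume.restrict Ω))
      atTop (𝓝 0))
    (h3 : Tendsto (fun k => eLpNorm (φ k) 2
      ((Measure.hausdorffMeasure ((d : ℝ) - 1) : Measure (E d)).restrict Γ)) atTop (𝓝 0))
    (hOm : MeasurableSet Ω) (hΓm : MeasurableSet Γ) :
    ZeroTraceOn Ω Γ u := by
  obtain ⟨R, hR, hRb⟩ : ∃ R > 0, closure Ω ⊆ Metric.ball (0 : E d) R := by
    obtain ⟨R, hR⟩ := hB.closure.subset_ball (0 : E d)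
    exact ⟨max R 1, by positivity, hR.trans (Metric.ball_subset_ball (le_max_left _ _))⟩
  let b : ContDiffBump (0 : E d) := ⟨R, R + 1, hR, by linarith⟩
  have hb : ∀ k, ∀ x ∈ closure Ω, (fun x => b x * φ k x) =ᶠ[𝓝 x] φ k := by
    intro k x hx
    filter_upwards [b.eventuallyEq_one_of_mem_ball (hRb hx)] with y hy
    rw [hy, Pi.one_apply, one_mul]
  refine ⟨fun k x => b x * φ k x, fun k => ⟨b.contDiff.mul (hφ k), b.hasCompactSupport.mul_right⟩,
    ?_, ?_, ?_⟩
  · refine h1.congr fun k => eLpNorm_congr_ae ?_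
    filter_upwards [ae_restrict_mem hOm] with x hx
    rw [(hb k x (subset_closure hx)).eq_of_nhds]
  · refine h2.congr fun k => eLpNorm_congr_ae ?_
    filter_upwards [ae_restrict_mem hOm] with x hx
    have : gradient (fun x => b x * φ k x) x = gradient (φ k) x := by
      rw [gradient, gradient, (hb k x (subset_closure hx)).fderiv_eq]
    rw [this]
  · refine h3.congr fun k => eLpNorm_congr_ae ?_
    filter_upwards [ae_restrict_mem hΓm] with x hx
    rw [(hb k x (hΓ hx)).eq_of_nhds]

lemma IsAdmissibleDomain.measurableSet_dirichlet (hΩ : IsAdmissibleDomain Ω ΓD ΓN) :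
    MeasurableSet ΓD := by
  have : ΓD = frontier Ω \ ΓN := by
    rw [← hΩ.union, union_sdiff_right, hΩ.disjoint.sdiff_eq_left]
  rw [this]
  exact isClosed_frontier.measurableSet.diff hΩ.closed.measurableSet

lemma IsAdmissibleDomain.dirichlet_subset (hΩ : IsAdmissibleDomain Ω ΓD ΓN) : ΓD ⊆ closure Ω :=
  subset_union_left.trans (hΩ.union.subset.trans frontier_subset_closure)

/-- If `u = u_D` on `Γ_D`, `u_D ≥ m` and `f = 0` on `[m, ∞)`, then `f(u) = 0` on `Γ_D`. -/
theorem IsSmoothLip.comp_mem_H10 (hΩ : IsAdmissibleDomain Ω ΓD ΓN) {f : ℝ → ℝ} {L : ℝ}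
    (hf : IsSmoothLip f L) {u uD v : H1 Ω} {m : ℝ} (hu : u - uD ∈ H10 Ω ΓD)
    (hm : ∀ᵐ x ∂volume.restrict Ω, m ≤ fn uD x) (hf0 : ∀ s, m ≤ s → f s = 0)
    (hv : fn v =ᵐ[volume.restrict Ω] fun x => f (fn u x))
    (hv' : grad v =ᵐ[volume.restrict Ω] fun x => deriv f (fn u x) • grad u x) :
    v ∈ H10 Ω ΓD := by
  have hfin := hΩ.isFiniteMeasure
  obtain ⟨φ, hφ, p1, p2, p3⟩ := hu
  have hS := isSobolev_H1 uD
  -- The positive part is taken at every point because nonnegative approximation asks for a function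
  -- that is nonnegative everywhere; it changes `u_D - m` only on a null set.
  have hS' : IsSobolev Ω (fun x => max (fn uD x - m) 0) (grad uD) := by
    have hm' : (fun x => fn uD x - m) =ᵐ[volume.restrict Ω] fun x => max (fn uD x - m) 0 := by
      filter_upwards [hm] with x hx
      rw [max_eq_left (by linarith)]
    refine ⟨(hS.sm_fn.sub stronglyMeasurable_const).sup stronglyMeasurable_const, hS.sm_grad,
      (memLp_congr_ae hm').1 (hS.memLp_fn.sub (memLp_const m)), hS.memLp_grad, ?_⟩
    have hf1 : IsSmoothLip (fun s => s - m) 1 := by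
      refine ⟨contDiff_id.sub contDiff_const, fun s => ?_⟩
      simp
    refine (hf1.hasWeakGrad_comp hΩ uD).congr hm' (ae_of_all _ fun x => ?_)
    simp
  obtain ⟨w, hw, w1, w2, w3⟩ := hS'.isSmoothLimit hΩ.isOpen hΩ.bounded hΩ.lipschitz (pos := True)
    (fun _ x => le_max_right _ _)
  -- Here `φ k` approximates `u - u_D` with small values on `Γ_D`, and `w k ≥ 0` approximates `u_D -
  -- m`. Since `f(w k + m) = 0`, on `Γ_D` one has `|f(z k)| ≤ L|φ k|`, which tends to zero; no trace
  -- of `u_D` is needed.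
  set z : ℕ → E d → ℝ := fun k x => φ k x + w k x + m with hz
  have hzs : ∀ k, ContDiff ℝ ∞ (z k) := fun k => ((hφ k).1.add (hw k).1).add contDiff_const
  have hzg : ∀ k x, gradient (z k) x = gradient (φ k) x + gradient (w k) x := by
    intro k x
    rw [← gradient_add' (hφ k).1 (hw k).1, gradient, gradient]
    congr 1
    exact fderiv_add_const m
  have hsub : fn (u - uD) =ᵐ[volume.restrict Ω] fn u - fn uD :=
    Lp.coeFn_sub (u : L2Pair Ω).fst (uD : L2Pair Ω).fst
  have hsub' : grad (u - uD) =ᵐ[volume.restrict Ω] grad u - grad uD :=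
    Lp.coeFn_sub (u : L2Pair Ω).snd (uD : L2Pair Ω).snd
  have z1 : Tendsto (fun k => eLpNorm (fun x => z k x - fn u x) 2 (volume.restrict Ω))
      atTop (𝓝 0) := by
    refine tendsto_eLpNorm_add
      (fun k => (hφ k).1.continuous.aestronglyMeasurable.sub (memLp_fn (u - uD)).1)
      (fun k => (hw k).1.continuous.aestronglyMeasurable.sub hS'.memLp_fn.1) (fun k => ?_) p1 w1
    filter_upwards [hsub, hm] with x hx hx'
    simp only [hx, Pi.add_apply, Pi.sub_apply, hz, max_eq_left (sub_nonneg.2 hx')]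
    ring
  have z2 : Tendsto (fun k => eLpNorm (fun x => gradient (z k) x - grad u x) 2 (volume.restrict Ω))
      atTop (𝓝 0) := by
    refine tendsto_eLpNorm_add
      (fun k => (continuous_gradient (hφ k).1).aestronglyMeasurable.sub (memLp_grad (u - uD)).1)
      (fun k => (continuous_gradient (hw k).1).aestronglyMeasurable.sub hS'.memLp_grad.1)
      (fun k => ?_) p2 w2
    filter_upwards [hsub'] with x hx
    simp only [hx, hzg, Pi.add_apply, Pi.sub_apply]
    abel
  have hzm := fun k => memLp_smooth (hzs k) hΩ.bounded
  refine zeroTraceOn_of_smooth hΩ.bounded hΩ.dirichlet_subset (φ := fun k x => f (z k x))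
    (fun k => hf.smooth.comp (hzs k)) ?_ ?_ ?_ hΩ.isOpen.measurableSet hΩ.measurableSet_dirichlet
  · refine (hf.tendsto_comp z1).congr fun k => eLpNorm_congr_ae ?_
    filter_upwards [hv] with x hx
    rw [hx]
  · refine (tendsto_eLpNorm_comp_smul hf.continuous_deriv hf.bound (fun k => (hzm k).1)
      (memLp_fn u) (fun k => (hzm k).2) (memLp_grad u) z1 z2).congr fun k => eLpNorm_congr_ae ?_
    filter_upwards [hv'] with x hx
    rw [hx, hf.gradient_comp (hzs k)]
  · have h0 := ENNReal.Tendsto.const_mul (a := ENNReal.ofReal L) p3 (Or.inr (by simp))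
    rw [mul_zero] at h0
    refine tendsto_of_tendsto_of_tendsto_of_le_of_le tendsto_const_nhds h0 (fun _ => zero_le) ?_
    intro k
    refine eLpNorm_le_mul_eLpNorm_of_ae_le_mul (ae_of_all _ fun x => ?_) 2
    have h1 := hf.abs_sub_le (z k x) (w k x + m)
    rw [hf0 (w k x + m) (by linarith [w3 trivial k x]), sub_zero] at h1
    refine h1.trans_eq ?_
    simp only [hz, Real.norm_eq_abs]
    congr 2
    ring

/-- On `Γ_D` the approximations satisfy `|f(φ)| ≤ L|φ|` because `f(0) = 0`. -/
theorem IsSmoothLip.comp_mem_H10_of_zero (hΩ : IsAdmissibleDomain Ω ΓD ΓN) {f : ℝ → ℝ} {L : ℝ}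
    (hf : IsSmoothLip f L) {u v : H1 Ω} (hu : u ∈ H10 Ω ΓD) (hf0 : f 0 = 0)
    (hv : fn v =ᵐ[volume.restrict Ω] fun x => f (fn u x))
    (hv' : grad v =ᵐ[volume.restrict Ω] fun x => deriv f (fn u x) • grad u x) :
    v ∈ H10 Ω ΓD := by
  have hfin := hΩ.isFiniteMeasure
  obtain ⟨φ, hφ, p1, p2, p3⟩ := hu
  have hm := fun k => memLp_smooth (hφ k).1 hΩ.bounded
  refine zeroTraceOn_of_smooth hΩ.bounded hΩ.dirichlet_subset (φ := fun k x => f (φ k x))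
    (fun k => hf.smooth.comp (hφ k).1) ?_ ?_ ?_ hΩ.isOpen.measurableSet hΩ.measurableSet_dirichlet
  · refine (hf.tendsto_comp p1).congr fun k => eLpNorm_congr_ae ?_
    filter_upwards [hv] with x hx
    rw [hx]
  · refine (tendsto_eLpNorm_comp_smul hf.continuous_deriv hf.bound (fun k => (hm k).1)
      (memLp_fn u) (fun k => (hm k).2) (memLp_grad u) p1 p2).congr fun k => eLpNorm_congr_ae ?_
    filter_upwards [hv'] with x hx
    rw [hx, hf.gradient_comp (hφ k).1]
  · have h0 := ENNReal.Tendsto.const_mul (a := ENNReal.ofReal L) p3 (Or.inr (by simp))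
    rw [mul_zero] at h0
    refine tendsto_of_tendsto_of_tendsto_of_le_of_le tendsto_const_nhds h0 (fun _ => zero_le) ?_
    intro k
    refine eLpNorm_le_mul_eLpNorm_of_ae_le_mul (ae_of_all _ fun x => ?_) 2
    have h1 := hf.abs_sub_le (φ k x) 0
    rwa [hf0, sub_zero, sub_zero] at h1

/-- The gradient of a nonnegative Sobolev function vanishes almost everywhere on its zero set. -/
theorem grad_eq_zero_of_fn_eq_zero (hΩ : IsAdmissibleDomain Ω ΓD ΓN) (u : H1 Ω) :
    ∀ᵐ x ∂volume.restrict Ω, fn u x = 0 → grad u x = 0 := by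
  have hfin := hΩ.isFiniteMeasure
  have hOm := hΩ.isOpen.measurableSet
  set ε : ℕ → ℝ := fun k => 1 / ((k : ℝ) + 1) with hε
  have hε0 : ∀ k, 0 < ε k := fun k => Nat.one_div_pos_of_nat
  have hεl : Tendsto ε atTop (𝓝 0) := tendsto_one_div_add_atTop_nhds_zero_nat
  -- These functions tend to zero uniformly, while their derivatives `1/(1 + (s/ε)²)` are bounded by
  -- one and tend to the indicator of `{0}`. The chain rule passes to the limit and makes the
  -- gradient of `u`, restricted to `{u = 0}`, a weak gradient of the zero function.
  set f : ℕ → ℝ → ℝ := fun k s => ε k * Real.arctan (s / ε k) with hf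
  have hfd : ∀ k s, deriv (f k) s = 1 / (1 + (s / ε k) ^ 2) := by
    intro k s
    have := (((hasDerivAt_id s).div_const (ε k)).arctan).const_mul (ε k)
    rw [hf]
    refine this.deriv.trans ?_
    have := (hε0 k).ne'
    simp only [id]
    field_simp
  have hfL : ∀ k, IsSmoothLip (f k) 1 := by
    intro k
    refine ⟨contDiff_const.mul (Real.contDiff_arctan.comp (contDiff_id.div_const _)), fun s => ?_⟩
    rw [hfd, abs_of_nonneg (by positivity)]
    exact div_le_one_of_le₀ (by nlinarith [sq_nonneg (s / ε k)]) (by positivity)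
  set g : E d → E d := {x | fn u x = 0}.indicator (grad u) with hg
  have hms : MeasurableSet {x | fn u x = 0} :=
    (isSobolev_H1 u).sm_fn.measurable (measurableSet_singleton 0)
  have hgL : MemLp g 2 (volume.restrict Ω) := (memLp_grad u).indicator hms
  have key : HasWeakGrad Ω (fun _ => 0) g := by
    refine HasWeakGrad.of_tendsto (fun k => (hfL k).hasWeakGrad_comp hΩ u)
      (fun k => (hfL k).memLp_comp (memLp_fn u)) (MemLp.zero' (p := 2))
      (fun k => (hfL k).memLp_deriv_smul (memLp_fn u) (memLp_grad u)) hgL ?_ ?_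
    · have hC : Tendsto (fun k => ENNReal.ofReal (ε k * 2) *
          eLpNorm (fun _ : E d => (1 : ℝ)) 2 (volume.restrict Ω)) atTop (𝓝 0) := by
        have h1 := ENNReal.tendsto_ofReal (hεl.mul_const 2)
        rw [zero_mul, ENNReal.ofReal_zero] at h1
        have := ENNReal.Tendsto.mul_const (b := eLpNorm (fun _ : E d => (1 : ℝ)) 2 (volume.restrict Ω))
          h1 (Or.inr (memLp_const (1 : ℝ)).2.ne)
        rwa [zero_mul] at this
      refine tendsto_of_tendsto_of_tendsto_of_le_of_le tendsto_const_nhds hC (fun _ => zero_le) ?_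
      intro k
      refine eLpNorm_le_mul_eLpNorm_of_ae_le_mul (ae_of_all _ fun x => ?_) 2
      rw [sub_zero, hf, norm_mul, Real.norm_of_nonneg (hε0 k).le, norm_one, mul_one]
      refine mul_le_mul_of_nonneg_left ?_ (hε0 k).le
      rw [Real.norm_eq_abs, abs_le]
      have := Real.neg_pi_div_two_lt_arctan (fn u x / ε k)
      have := Real.arctan_lt_pi_div_two (fn u x / ε k)
      have := Real.pi_le_four
      constructor <;> linarith
    · have hsq : Tendsto (fun k => ∫⁻ x in Ω, ‖deriv (f k) (fn u x) • grad u x - g x‖ₑ ^ 2)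
          atTop (𝓝 0) := by
        have e0 : (0 : ℝ≥0∞) = ∫⁻ x in Ω, 0 := by simp
        rw [e0]
        refine tendsto_lintegral_of_dominated_convergence' (fun x => ‖grad u x‖ₑ ^ 2)
          (fun k => ?_) (fun k => ae_of_all _ fun x => ?_) ?_ ?_
        · exact ((((hfL k).memLp_deriv_smul (memLp_fn u) (memLp_grad u)).sub hgL).1.enorm).pow_const 2
        · refine pow_le_pow_left' ?_ 2
          by_cases hx : fn u x = 0
          · simp [hg, hx, hfd]
          · have e : deriv (f k) (fn u x) • grad u x - g x = deriv (f k) (fn u x) • grad u x := by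
              simp [hg, hx]
            rw [e, enorm_smul]
            refine mul_le_of_le_one_left zero_le ?_
            rw [← ofReal_norm, ENNReal.ofReal_le_one]
            exact (hfL k).bound _
        · rw [← eLpNorm_two_sq]
          exact ENNReal.pow_ne_top (memLp_grad u).2.ne
        · refine ae_of_all _ fun x => ?_
          by_cases hx : fn u x = 0
          · simp [hg, hx, hfd]
          · have e : ∀ k, deriv (f k) (fn u x) • grad u x - g x
                = (ε k ^ 2 / (ε k ^ 2 + fn u x ^ 2)) • grad u x := by
              intro k
              have : (ε k) ≠ 0 := (hε0 k).ne'
              have h2 : ε k ^ 2 + fn u x ^ 2 ≠ 0 := by positivity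
              rw [hfd]
              simp only [hg, indicator, mem_ofPred_eq, hx, if_false, sub_zero]
              congr 1
              field_simp
            simp only [e]
            have h1 : Tendsto (fun k => (ε k ^ 2 / (ε k ^ 2 + fn u x ^ 2)) • grad u x) atTop
                (𝓝 (((0 : ℝ) ^ 2 / ((0 : ℝ) ^ 2 + fn u x ^ 2)) • grad u x)) :=
              ((hεl.pow 2).div ((hεl.pow 2).add_const _) (by positivity)).smul_const _
            have h2 := (ENNReal.continuous_pow 2).tendsto _ |>.comp h1.enorm
            simpa [Function.comp_def] using h2
      have := (ENNReal.continuous_rpow_const (y := 1 / 2)).tendsto 0 |>.comp hsq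
      simp only [Function.comp_def, ← eLpNorm_two_sq] at this
      rw [ENNReal.zero_rpow_of_pos (by norm_num)] at this
      refine this.congr fun i => ?_
      rw [← ENNReal.rpow_natCast, ← ENNReal.rpow_mul]; simp
  filter_upwards [key.ae_eq_zero hΩ.isOpen hgL] with x hx h0
  simpa [hg, h0] using hx

end

/-! ### Poincaré's inequality -/

lemma norm_gradient {d : ℕ} (u : E d → ℝ) (x : E d) : ‖gradient u x‖ = ‖fderiv ℝ u x‖ :=
  (InnerProductSpace.toDual ℝ (E d)).symm.norm_map _

lemma continuous_gradient_of_contDiff_one {d : ℕ} {u : E d → ℝ} (hu : ContDiff ℝ 1 u) :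
    Continuous (gradient u) :=
  (InnerProductSpace.toDual ℝ (E d)).symm.continuous.comp (hu.continuous_fderiv (by simp))

/-- The increment along a segment is controlled by the gradient. -/
lemma enorm_sub_le_lintegral {d : ℕ} {u : E d → ℝ} (hu : ContDiff ℝ 1 u) (x v : E d) {s h : ℝ}
    (hs : 0 ≤ s) (hsh : s ≤ h) :
    ‖u (x + s • v) - u x‖ₑ ≤ ‖v‖ₑ * ∫⁻ r in Ioo 0 h, ‖gradient u (x + r • v)‖ₑ := by
  have hd : ∀ r : ℝ, HasDerivAt (fun r : ℝ => u (x + r • v)) (fderiv ℝ u (x + r • v) v) r := by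
    intro r
    have h1 : HasDerivAt (fun r : ℝ => x + r • v) v r := by
      simpa using ((hasDerivAt_id r).smul_const v).const_add x
    exact (hu.differentiable (by simp) _).hasFDerivAt.comp_hasDerivAt r h1
  have hc : Continuous fun r : ℝ => fderiv ℝ u (x + r • v) v :=
    ((hu.continuous_fderiv (by simp)).comp (by fun_prop)).clm_apply continuous_const
  have e := intervalIntegral.integral_eq_sub_of_hasDerivAt (a := 0) (b := s) (fun r _ => hd r)
    (hc.intervalIntegrable _ _)
  rw [zero_smul, add_zero] at e
  rw [← e, intervalIntegral.integral_of_le hs]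
  refine (enorm_integral_le_lintegral_enorm _).trans ?_
  rw [setLIntegral_congr (Ioo_ae_eq_Ioc (μ := volume)).symm,
    ← lintegral_const_mul' _ _ enorm_ne_top]
  refine (lintegral_mono fun r => ?_).trans (lintegral_mono_set (Ioo_subset_Ioo_right hsh))
  have h1 := (fderiv ℝ u (x + r • v)).le_opNorm v
  rw [← norm_gradient] at h1
  rw [← ofReal_norm, ← ofReal_norm, ← ofReal_norm, ← ENNReal.ofReal_mul (norm_nonneg _), mul_comm]
  exact ENNReal.ofReal_le_ofReal h1

lemma sq_enorm_sub_le_lintegral {d : ℕ} {u : E d → ℝ} (hu : ContDiff ℝ 1 u) (x v : E d) {s h : ℝ}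
    (hs : 0 ≤ s) (hsh : s ≤ h) : ‖u (x + s • v) - u x‖ₑ ^ 2
      ≤ ENNReal.ofReal h * ‖v‖ₑ ^ 2 * ∫⁻ r in Ioo 0 h, ‖gradient u (x + r • v)‖ₑ ^ 2 := by
  have hc : Continuous fun r : ℝ => gradient u (x + r • v) :=
    (continuous_gradient_of_contDiff_one hu).comp (by fun_prop)
  calc _ ≤ (‖v‖ₑ * ∫⁻ r in Ioo 0 h, ‖gradient u (x + r • v)‖ₑ) ^ 2 := by
        gcongr; exact enorm_sub_le_lintegral hu x v hs hsh
    _ ≤ ‖v‖ₑ ^ 2 * ((volume.restrict (Ioo 0 h)) univ *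
        ∫⁻ r in Ioo 0 h, ‖gradient u (x + r • v)‖ₑ ^ 2) := by
        rw [mul_pow]
        gcongr
        exact sq_lintegral_le_mul _ hc.enorm.measurable.aemeasurable
    _ = _ := by
        rw [Measure.restrict_apply_univ, Real.volume_Ioo, sub_zero]; ring

lemma sq_enorm_le {a b : ℝ} : ‖a‖ₑ ^ 2 ≤ 2 * ‖a - b‖ₑ ^ 2 + 2 * ‖b‖ₑ ^ 2 := by
  simp only [← ofReal_norm, ← ENNReal.ofReal_pow (norm_nonneg _)]
  rw [show (2 : ℝ≥0∞) = ENNReal.ofReal 2 by simp, ← ENNReal.ofReal_mul (by norm_num),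
    ← ENNReal.ofReal_mul (by norm_num), ← ENNReal.ofReal_add (by positivity) (by positivity)]
  refine ENNReal.ofReal_le_ofReal ?_
  simp only [Real.norm_eq_abs, sq_abs]
  nlinarith [sq_nonneg (a - 2 * b)]

/-- Change of variables under a homothety. -/
lemma lintegral_homothety {d : ℕ} {F : E d → ℝ≥0∞} (hF : Measurable F) {r : ℝ} (hr : 1 / 2 ≤ r)
    (y : E d) : ∫⁻ x, F (r • x + y) ≤ 2 ^ d * ∫⁻ x, F x := by
  have hr0 : 0 < r := by linarith
  have h1 : ∫⁻ x, F (r • x + y) = ∫⁻ x, F (x + y) ∂(Measure.map (r • ·) volume) := by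
    rw [lintegral_map (f := fun x => F (x + y)) (hF.comp (measurable_add_const y))
      (measurable_const_smul r)]
  rw [h1, Measure.map_addHaar_smul _ hr0.ne', lintegral_smul_measure,
    lintegral_add_right_eq_self F y, smul_eq_mul]
  gcongr
  rw [finrank_euclideanSpace, Fintype.card_fin, abs_of_pos (by positivity)]
  have : (r ^ d)⁻¹ ≤ 2 ^ d := by
    rw [← inv_pow]
    gcongr
    rw [inv_le_comm₀ hr0 (by norm_num)]
    linarith
  calc ENNReal.ofReal (r ^ d)⁻¹ ≤ ENNReal.ofReal (2 ^ d) := ENNReal.ofReal_le_ofReal this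
    _ = 2 ^ d := by rw [ENNReal.ofReal_pow (by norm_num)]; simp

/-- A Poincaré inequality on bounded convex sets. -/
lemma lintegral_lintegral_sub_le {d : ℕ} {A : Set (E d)} (hA : Convex ℝ A) (hAm : MeasurableSet A)
    (hB : Bornology.IsBounded A) : ∃ C : ℝ≥0, ∀ u : E d → ℝ, ContDiff ℝ 1 u →
      ∫⁻ x in A, ∫⁻ y in A, ‖u y - u x‖ₑ ^ 2 ≤ C * ∫⁻ x in A, ‖gradient u x‖ₑ ^ 2 := by
  have hvol : volume A ≠ ⊤ := hB.measure_lt_top.ne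
  set D : ℝ≥0∞ := ENNReal.ofReal (Metric.diam A) with hD
  refine ⟨(D ^ 2 * (2 ^ d * volume A)).toNNReal, fun u hu => ?_⟩
  rw [ENNReal.coe_toNNReal (by simp [hD, ENNReal.mul_eq_top, hvol])]
  have hcg := continuous_gradient_of_contDiff_one hu
  set F : E d → ℝ≥0∞ := A.indicator fun x => ‖gradient u x‖ₑ ^ 2 with hF
  have hFm : Measurable F := (hcg.enorm.measurable.pow_const 2).indicator hAm
  have hFi : ∫⁻ x in A, ‖gradient u x‖ₑ ^ 2 = ∫⁻ x, F x := (lintegral_indicator hAm _).symm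
  have hmeas : ∀ t : ℝ, Measurable fun z : E d × E d => F (z.1 + t • (z.2 - z.1)) :=
    fun t => hFm.comp (by fun_prop)
  have h1 : ∀ x ∈ A, ∀ y ∈ A, ‖u y - u x‖ₑ ^ 2 ≤ D ^ 2 * ∫⁻ t in Ioo (0 : ℝ) 1, F (x + t • (y - x)) := by
    intro x hx y hy
    have := sq_enorm_sub_le_lintegral hu x (y - x) (s := 1) (h := 1) zero_le_one le_rfl
    rw [one_smul, add_sub_cancel, ENNReal.ofReal_one, one_mul] at this
    refine this.trans (mul_le_mul' (pow_le_pow_left' ?_ 2) ?_)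
    · rw [← ofReal_norm, hD, ← dist_eq_norm]
      exact ENNReal.ofReal_le_ofReal (Metric.dist_le_diam_of_mem hB hy hx)
    · refine setLIntegral_mono' measurableSet_Ioo fun t ht => ?_
      have : x + t • (y - x) ∈ A := by
        have := hA hx hy (a := 1 - t) (b := t) (by linarith [ht.2]) ht.1.le (by ring)
        convert this using 1
        module
      rw [hF, indicator_of_mem this]
  -- The point `x + t(y - x)` depends on `x` with factor `1 - t` and on `y` with factor `t`. The
  -- variable whose factor is at least `1/2` is integrated first, so the Jacobian costs at most
  -- `2^d` and no singularity in `t` appears.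
  have h2 : ∀ t ∈ Ioo (0 : ℝ) 1, ∫⁻ x in A, ∫⁻ y in A, F (x + t • (y - x))
      ≤ 2 ^ d * volume A * ∫⁻ x, F x := by
    intro t ht
    rcases le_total t (1 / 2) with h | h
    · rw [lintegral_lintegral_swap (hmeas t).aemeasurable]
      calc _ ≤ ∫⁻ y in A, 2 ^ d * ∫⁻ x, F x := by
            refine lintegral_mono fun y => (setLIntegral_le_lintegral _ _).trans ?_
            have := lintegral_homothety hFm (r := 1 - t) (by linarith) (t • y)
            refine le_trans (le_of_eq (lintegral_congr fun x => ?_)) this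
            congr 1
            module
        _ = _ := by rw [lintegral_const, Measure.restrict_apply_univ]; ring
    · calc _ ≤ ∫⁻ x in A, 2 ^ d * ∫⁻ x, F x := by
            refine lintegral_mono fun x => (setLIntegral_le_lintegral _ _).trans ?_
            have := lintegral_homothety hFm (r := t) h ((1 - t) • x)
            refine le_trans (le_of_eq (lintegral_congr fun y => ?_)) this
            congr 1
            module
        _ = _ := by rw [lintegral_const, Measure.restrict_apply_univ]; ring
  have hm3 : Measurable fun z : (E d × E d) × ℝ => F (z.1.1 + z.2 • (z.1.2 - z.1.1)) :=
    hFm.comp (by fun_prop)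
  calc ∫⁻ x in A, ∫⁻ y in A, ‖u y - u x‖ₑ ^ 2
      ≤ ∫⁻ x in A, ∫⁻ y in A, D ^ 2 * ∫⁻ t in Ioo (0 : ℝ) 1, F (x + t • (y - x)) :=
        setLIntegral_mono' hAm fun x hx => setLIntegral_mono' hAm fun y hy => h1 x hx y hy
    _ = D ^ 2 * ∫⁻ z : E d × E d, (∫⁻ t in Ioo (0 : ℝ) 1, F (z.1 + t • (z.2 - z.1)))
          ∂((volume.restrict A).prod (volume.restrict A)) := by
        rw [← lintegral_const_mul' _ _ (by simp [hD]), lintegral_prod]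
        exact ((hm3.lintegral_prod_right' (ν := volume.restrict (Ioo (0 : ℝ) 1))).const_mul _).aemeasurable
    _ = D ^ 2 * ∫⁻ t in Ioo (0 : ℝ) 1, (∫⁻ z : E d × E d, F (z.1 + t • (z.2 - z.1))
          ∂((volume.restrict A).prod (volume.restrict A))) := by
        rw [lintegral_lintegral_swap hm3.aemeasurable]
    _ ≤ D ^ 2 * ∫⁻ t in Ioo (0 : ℝ) 1, 2 ^ d * volume A * ∫⁻ x, F x := by
        gcongr 1
        refine setLIntegral_mono' measurableSet_Ioo fun t ht => ?_
        rw [lintegral_prod _ (hmeas t).aemeasurable]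
        exact h2 t ht
    _ = _ := by
        rw [hFi, lintegral_const, Measure.restrict_apply_univ, Real.volume_Ioo]
        simp; ring

section Poincare

variable {d : ℕ}

/-- `∫ u² dπ` is controlled by the `L²` norms of `u` on `Γ` and of `∇u` on `Ω`. -/
def IsControlled (Ω Γ : Set (E d)) (π : Measure (E d)) : Prop :=
  ∃ C : ℝ≥0, ∀ u : E d → ℝ, ContDiff ℝ 1 u → ∫⁻ x, ‖u x‖ₑ ^ 2 ∂π
    ≤ C * ((∫⁻ x in Γ, ‖u x‖ₑ ^ 2 ∂(Measure.hausdorffMeasure ((d : ℝ) - 1) : Measure (E d)))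
      + ∫⁻ x in Ω, ‖gradient u x‖ₑ ^ 2)

variable {Ω Γ : Set (E d)} {π ρ : Measure (E d)}

lemma IsControlled.mono (h : IsControlled Ω Γ π) (hρ : ρ ≤ π) : IsControlled Ω Γ ρ := by
  obtain ⟨C, hC⟩ := h
  exact ⟨C, fun u hu => (lintegral_mono' hρ le_rfl).trans (hC u hu)⟩

lemma IsControlled.add (h : IsControlled Ω Γ π) (h' : IsControlled Ω Γ ρ) :
    IsControlled Ω Γ (π + ρ) := by
  obtain ⟨C, hC⟩ := h
  obtain ⟨C', hC'⟩ := h'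
  refine ⟨C + C', fun u hu => ?_⟩
  rw [lintegral_add_measure, ENNReal.coe_add, add_mul]
  exact add_le_add (hC u hu) (hC' u hu)

lemma isControlled_zero : IsControlled Ω Γ (0 : Measure (E d)) := ⟨0, fun u _ => by simp⟩

/-- Control spreads over convex subsets of `Ω`. -/
lemma IsControlled.of_convex (h : IsControlled Ω Γ π) {A : Set (E d)} (hA : Convex ℝ A)
    (hAm : MeasurableSet A) (hB : Bornology.IsBounded A) (hAΩ : A ⊆ Ω)
    (hπA : π ≤ volume.restrict A) (hπ : π univ ≠ 0) : IsControlled Ω Γ (volume.restrict A) := by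
  obtain ⟨C, hC⟩ := h
  obtain ⟨C', hC'⟩ := lintegral_lintegral_sub_le hA hAm hB
  have hvol : volume A ≠ ⊤ := hB.measure_lt_top.ne
  have hπt : π univ ≠ ⊤ := ((hπA univ).trans_lt (by simpa using hB.measure_lt_top)).ne
  have hfinπ : IsFiniteMeasure π := ⟨hπt.lt_top⟩
  refine ⟨((2 * C' + 2 * volume A * C) / π univ).toNNReal, fun u hu => ?_⟩
  rw [ENNReal.coe_toNNReal (ENNReal.div_ne_top (by simp [ENNReal.mul_eq_top, hvol]) hπ)]
  set Q := (∫⁻ x in Γ, ‖u x‖ₑ ^ 2 ∂(Measure.hausdorffMeasure ((d : ℝ) - 1) : Measure (E d)))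
      + ∫⁻ x in Ω, ‖gradient u x‖ₑ ^ 2
  have hcu := hu.continuous
  have hm2 : Measurable fun z : E d × E d => ‖u z.2 - u z.1‖ₑ ^ 2 :=
    (Continuous.enorm (by fun_prop)).measurable.pow_const 2
  have hm2' : Measurable fun x => ∫⁻ y in A, ‖u y - u x‖ₑ ^ 2 := hm2.lintegral_prod_right'
  -- The inequality `|u(y)|² ≤ 2|u(y) - u(x)|² + 2|u(x)|²` is integrated over `y ∈ A` and over `x`
  -- with respect to `π`. The first term is bounded by the convex Poincaré inequality because `π` is
  -- at most the volume on `A`, the second by the assumed control.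
  have key : π univ * ∫⁻ y in A, ‖u y‖ₑ ^ 2 ≤ (2 * C' + 2 * volume A * C) * Q := by
    calc π univ * ∫⁻ y in A, ‖u y‖ₑ ^ 2 = ∫⁻ _, (∫⁻ y in A, ‖u y‖ₑ ^ 2) ∂π := by
          rw [lintegral_const, mul_comm]
      _ ≤ ∫⁻ x, (2 * (∫⁻ y in A, ‖u y - u x‖ₑ ^ 2) + 2 * volume A * ‖u x‖ₑ ^ 2) ∂π := by
          refine lintegral_mono fun x => ?_
          calc ∫⁻ y in A, ‖u y‖ₑ ^ 2
              ≤ ∫⁻ y in A, (2 * ‖u y - u x‖ₑ ^ 2 + 2 * ‖u x‖ₑ ^ 2) :=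
                lintegral_mono fun y => sq_enorm_le
            _ = _ := by
                rw [lintegral_add_right _ measurable_const, lintegral_const_mul' _ _ (by simp),
                  lintegral_const, Measure.restrict_apply_univ]
                ring
      _ = 2 * (∫⁻ x, (∫⁻ y in A, ‖u y - u x‖ₑ ^ 2) ∂π) + 2 * volume A * ∫⁻ x, ‖u x‖ₑ ^ 2 ∂π := by
          rw [lintegral_add_left (hm2'.const_mul _), lintegral_const_mul' _ _ (by simp),
            lintegral_const_mul' _ _ (ENNReal.mul_ne_top (by simp) hvol)]
      _ ≤ 2 * (C' * Q) + 2 * volume A * (C * Q) := by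
          gcongr
          · refine (lintegral_mono' hπA le_rfl).trans ((hC' u hu).trans ?_)
            gcongr
            exact (lintegral_mono_set hAΩ).trans le_add_self
          · exact hC u hu
      _ = _ := by ring
  rw [ENNReal.div_eq_inv_mul, mul_assoc, ← ENNReal.div_eq_inv_mul,
    ENNReal.le_div_iff_mul_le (Or.inl hπ) (Or.inl hπt), mul_comm]
  exact key

/-- Control spreads along segments in `Ω`. -/
lemma IsControlled.of_shift {A B : Set (E d)} (h : IsControlled Ω Γ (volume.restrict B))
    (v : E d) (hAm : MeasurableSet A) (hΩ : MeasurableSet Ω)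
    (hseg : ∀ x ∈ A, ∀ t ∈ Ioo (0 : ℝ) 1, x + t • v ∈ Ω) (hAB : ∀ x ∈ A, x + v ∈ B)
    (hB : MeasurableSet B) : IsControlled Ω Γ (volume.restrict A) := by
  obtain ⟨C, hC⟩ := h
  refine ⟨2 * (‖v‖₊ ^ 2) + 2 * C, fun u hu => ?_⟩
  set Q := (∫⁻ x in Γ, ‖u x‖ₑ ^ 2 ∂(Measure.hausdorffMeasure ((d : ℝ) - 1) : Measure (E d)))
      + ∫⁻ x in Ω, ‖gradient u x‖ₑ ^ 2
  have hcg := continuous_gradient_of_contDiff_one hu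
  have hcu := hu.continuous
  have hm : Measurable fun z : E d × ℝ => ‖gradient u (z.1 + z.2 • v)‖ₑ ^ 2 :=
    (Continuous.enorm (by fun_prop)).measurable.pow_const 2
  have htr : ∀ {S T : Set (E d)} (w : E d) {F : E d → ℝ≥0∞}, MeasurableSet S → MeasurableSet T →
      (∀ x ∈ S, x + w ∈ T) → ∫⁻ x in S, F (x + w) ≤ ∫⁻ x in T, F x := by
    intro S T w F hS hT hST
    rw [← lintegral_indicator hS, ← lintegral_indicator hT,
      ← lintegral_add_right_eq_self (T.indicator F) w]
    refine lintegral_mono fun x => ?_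
    by_cases hx : x ∈ S
    · rw [indicator_of_mem hx, indicator_of_mem (hST x hx)]
    · rw [indicator_of_notMem hx]; exact zero_le
  have h1 : ∀ x, ‖u (x + v) - u x‖ₑ ^ 2
      ≤ ‖v‖ₑ ^ 2 * ∫⁻ r in Ioo (0 : ℝ) 1, ‖gradient u (x + r • v)‖ₑ ^ 2 := by
    intro x
    have := sq_enorm_sub_le_lintegral hu x v (s := 1) (h := 1) zero_le_one le_rfl
    rwa [one_smul, ENNReal.ofReal_one, one_mul] at this
  calc ∫⁻ x in A, ‖u x‖ₑ ^ 2
      ≤ ∫⁻ x in A, (2 * (‖v‖ₑ ^ 2 * ∫⁻ r in Ioo (0 : ℝ) 1, ‖gradient u (x + r • v)‖ₑ ^ 2)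
        + 2 * ‖u (x + v)‖ₑ ^ 2) := by
        refine lintegral_mono fun x => (sq_enorm_le (b := u (x + v))).trans ?_
        gcongr
        rw [enorm_sub_rev]
        exact h1 x
    _ = 2 * (‖v‖ₑ ^ 2 * ∫⁻ x in A, ∫⁻ r in Ioo (0 : ℝ) 1, ‖gradient u (x + r • v)‖ₑ ^ 2)
        + 2 * ∫⁻ x in A, ‖u (x + v)‖ₑ ^ 2 := by
        rw [lintegral_add_left, lintegral_const_mul' _ _ (by simp),
          lintegral_const_mul' _ _ (by simp), lintegral_const_mul' _ _ (by simp)]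
        exact ((hm.lintegral_prod_right').const_mul _).const_mul _
    _ ≤ 2 * (‖v‖ₑ ^ 2 * Q) + 2 * (C * Q) := by
        gcongr
        · rw [lintegral_lintegral_swap hm.aemeasurable]
          calc _ ≤ ∫⁻ r in Ioo (0 : ℝ) 1, Q := by
                refine setLIntegral_mono' measurableSet_Ioo fun r hr => ?_
                refine (htr (r • v) (F := fun x => ‖gradient u x‖ₑ ^ 2) hAm hΩ
                  fun x hx => hseg x hx r hr).trans le_add_self
            _ = Q := by simp
        · exact (htr v (F := fun x => ‖u x‖ₑ ^ 2) hAm hB hAB).trans (hC u hu)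
    _ = _ := by
        rw [enorm_eq_nnnorm]; push_cast; ring

end Poincare

/-- Orthogonal coordinates with first axis `e`. -/
lemma exists_coordinates {m : ℕ} {e : E (m + 1)} (he : ‖e‖ = 1) :
    ∃ (l : (Fin m → ℝ) →L[ℝ] E (m + 1)) (Q : E (m + 1) →L[ℝ] (Fin m → ℝ)),
      (∀ y, (inner ℝ e y : ℝ) • e + l (Q y) = y) ∧
      MeasurePreserving (fun p : ℝ × (Fin m → ℝ) => p.1 • e + l p.2) := by
  have horth : Orthonormal ℝ (({0} : Set (Fin (m + 1))).domRestrict fun _ => e) :=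
    ⟨fun _ => he, fun i j hij => absurd (Subsingleton.elim i j) hij⟩
  obtain ⟨b, hb⟩ := horth.exists_orthonormalBasis_extension_of_card_eq (by simp)
  have hb0 : b 0 = e := hb 0 rfl
  refine ⟨∑ i, (ContinuousLinearMap.proj (R := ℝ) (φ := fun _ : Fin m => ℝ) i).smulRight (b i.succ),
    ContinuousLinearMap.pi fun i => innerSL ℝ (b i.succ), fun y => ?_, ?_⟩
  · have := b.sum_repr' y
    rw [Fin.sum_univ_succ, hb0] at this
    simpa [sum_apply] using this
  · have h1 := (volume_preserving_piFinSuccAbove (fun _ : Fin (m + 1) => ℝ) 0).symm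
    have h2 := (b.measurePreserving_repr_symm.comp (PiLp.volume_preserving_toLp (Fin (m + 1)))).comp h1
    refine Eq.subst (motive := fun f => MeasurePreserving f volume volume) ?_ h2
    refine funext fun p => ?_
    simp only [Function.comp_apply]
    rw [← b.sum_repr_symm, Fin.sum_univ_succ, hb0]
    simp [sum_apply, MeasurableEquiv.piFinSuccAbove]

/-- The start of the proof of Poincaré's inequality: control of `u` on a small ball by the values
of `u` on the Dirichlet boundary. -/
lemma exists_isControlled_ball {m : ℕ} {Ω ΓD ΓN : Set (E (m + 1))}
    (hΩ : IsAdmissibleDomain Ω ΓD ΓN) : ∃ x r, 0 < r ∧ Metric.ball x r ⊆ Ω ∧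
      IsControlled Ω ΓD (volume.restrict (Metric.ball x r)) := by
  have hdim : ((m + 1 : ℕ) : ℝ) - 1 = m := by push_cast; ring
  have hpos := hΩ.pos
  rw [hdim] at hpos
  unfold IsControlled
  rw [hdim]
  -- `Γ_D` is the boundary minus a closed set, hence a countable union of compact sets, one of which
  -- has positive surface measure. This avoids regularity or finiteness of the Hausdorff measure.
  obtain ⟨K₀, hK₀D, hK₀c, hK₀⟩ : ∃ K ⊆ ΓD, IsCompact K ∧
      (Measure.hausdorffMeasure (m : ℝ) : Measure (E (m + 1))) K ≠ 0 := by
    obtain ⟨F, hF, hFs, hFU, -⟩ := hΩ.closed.isOpen_compl.exists_iUnion_isClosed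
    have hD : ΓD = frontier Ω ∩ ΓNᶜ := by
      rw [← hΩ.union, ← sdiff_eq, union_sdiff_right, hΩ.disjoint.sdiff_eq_left]
    by_contra! hcon
    refine hpos.ne' ?_
    rw [hD, ← hFU, inter_iUnion]
    refine measure_iUnion_null fun n => ?_
    refine hcon _ ?_ ?_
    · rw [hD]; exact inter_subset_inter_right _ (hFs n)
    · exact (hΩ.bounded.isCompact_closure.of_isClosed_subset isClosed_frontier
        frontier_subset_closure).inter_right (hF n)
  obtain ⟨x₀, hx₀, hnear⟩ := exists_mem_forall_mem_nhdsWithin_pos_measure hK₀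
  have hDf : ΓD ⊆ frontier Ω := hΩ.union ▸ subset_union_left
  -- Every neighbourhood of `x₀` in `K₀` has positive surface measure, so the piece of `K₀`
  -- considered may be made as small as the graph and the cone require.
  obtain ⟨e, γ, L, r, he, hγ, hr, hG⟩ := hΩ.lipschitz x₀ (hDf (hK₀D hx₀))
  obtain ⟨c, ρ, hc, hc1, hρ, hcone⟩ := exists_cone_of_graph he hγ hr hG
  set h := ρ / 2 with hh
  have hh0 : 0 < h := by positivity
  -- The three bounds serve the ball `A` below, the graph representation and the cone, in this
  -- order.
  set ρ' := min (h * c / 2) (min (r / 2) (ρ / 2)) with hρ'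
  have hρ'0 : 0 < ρ' := by positivity
  set K := K₀ ∩ Metric.closedBall x₀ ρ' with hK
  have hKc : IsCompact K := hK₀c.inter_right Metric.isClosed_closedBall
  have hKD : K ⊆ ΓD := inter_subset_left.trans hK₀D
  have hKpos : 0 < (Measure.hausdorffMeasure (m : ℝ) : Measure (E (m + 1))) K :=
    hnear _ (inter_mem self_mem_nhdsWithin
      (mem_nhdsWithin_of_mem_nhds (Metric.closedBall_mem_nhds x₀ hρ'0)))
  have hKd : ∀ y ∈ K, dist y x₀ ≤ ρ' := fun y hy => hy.2
  have hKr : ∀ y ∈ K, y ∈ Metric.ball x₀ r := fun y hy =>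
    (hKd y hy).trans_lt (by
      have : ρ' ≤ r / 2 := (min_le_right _ _).trans (min_le_left _ _)
      linarith)
  have hKρ : ∀ y ∈ K, y ∈ Metric.ball x₀ ρ := fun y hy =>
    (hKd y hy).trans_lt (by
      have : ρ' ≤ ρ / 2 := (min_le_right _ _).trans (min_le_right _ _)
      linarith)
  have hKγ : ∀ y ∈ K, γ (y - (inner ℝ e y : ℝ) • e) = inner ℝ e y := by
    intro y hy
    have hyf := hDf (hKD hy)
    rw [hΩ.isOpen.frontier_eq] at hyf
    have hyr := hKr y hy
    refine le_antisymm ?_ ?_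
    · have hγc := hγ.continuous
      refine le_on_closure (s := Metric.ball x₀ r ∩ Ω) (f := fun y => γ (y - (inner ℝ e y : ℝ) • e))
        (g := fun y => (inner ℝ e y : ℝ)) (fun y hy => ((hG y hy.1).1 hy.2).le) ?_ ?_
        (Metric.isOpen_ball.inter_closure ⟨hyr, hyf.1⟩)
      · exact Continuous.continuousOn (by fun_prop)
      · exact Continuous.continuousOn (by fun_prop)
    · exact not_lt.1 fun hlt => hyf.2 ((hG y hyr).2 hlt)
  obtain ⟨l, Q, hlQ, hmp⟩ := exists_coordinates he
  set G : (Fin m → ℝ) → E (m + 1) := fun ξ => γ (l ξ) • e + l ξ with hGdef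
  have hGK : ∀ y ∈ K, G (Q y) = y := by
    intro y hy
    have h1 : l (Q y) = y - (inner ℝ e y : ℝ) • e := by rw [eq_sub_iff_add_eq', hlQ]
    simp only [hGdef]
    rw [h1, hKγ y hy]
    abel
  have hγl : LipschitzWith (L * ‖l‖₊) fun ξ => γ (l ξ) := hγ.comp l.lipschitz
  have hGl : LipschitzWith (1 * (L * ‖l‖₊) + ‖l‖₊) G := by
    refine LipschitzWith.add ?_ l.lipschitz
    have h1 : LipschitzWith 1 fun t : ℝ => t • e := by
      refine LipschitzWith.of_dist_le_mul fun s t => ?_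
      rw [dist_eq_norm, ← sub_smul, norm_smul, he, mul_one, NNReal.coe_one, one_mul, dist_eq_norm]
    exact h1.comp hγl
  have hm0 : (0 : ℝ) ≤ m := Nat.cast_nonneg m
  have hvol : (Measure.hausdorffMeasure (m : ℝ) : Measure (Fin m → ℝ)) = volume := by
    have := hausdorffMeasure_pi_real (ι := Fin m)
    rwa [Fintype.card_fin] at this
  have hQKc : IsCompact (Q '' K) := hKc.image Q.continuous
  have hQKm : MeasurableSet (Q '' K) := hQKc.measurableSet
  -- `K` is the image of its projection under the Lipschitz graph map `G`, so a null projection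
  -- would make `K` null for the surface measure.
  have hQKpos : volume (Q '' K) ≠ 0 := by
    intro h0
    have h1 := hGl.hausdorffMeasure_image_le hm0 (Q '' K)
    rw [hvol, h0, mul_zero, image_image] at h1
    have h2 : (fun y => G (Q y)) '' K = K := by
      rw [image_congr hGK, image_id']
    rw [h2] at h1
    exact hKpos.ne' (le_zero_iff.1 h1)
  have hQKfin : volume (Q '' K) ≠ ⊤ := hQKc.measure_lt_top.ne
  have hGm : Measurable G := hGl.continuous.measurable
  -- Conversely the projection `Q` is Lipschitz, so Lebesgue measure on the parameter set, carried
  -- to the graph, is at most a multiple of the surface measure on `K`. Integrals over parameters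
  -- are thus controlled by integrals over `Γ_D`.
  have hmap : (volume.restrict (Q '' K)).map G ≤ ((‖Q‖₊ : ℝ≥0∞) ^ (m : ℝ)) •
      (Measure.hausdorffMeasure (m : ℝ) : Measure (E (m + 1))).restrict K := by
    refine Measure.le_iff.2 fun Z hZ => ?_
    rw [Measure.map_apply hGm hZ, Measure.restrict_apply (hGm hZ), Measure.smul_apply,
      Measure.restrict_apply hZ, smul_eq_mul, ← hvol]
    refine le_trans (measure_mono ?_) (Q.lipschitz.hausdorffMeasure_image_le hm0 (Z ∩ K))
    rintro ξ ⟨hξ, y, hy, rfl⟩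
    refine ⟨y, ⟨?_, hy⟩, rfl⟩
    rw [mem_preimage, hGK y hy] at hξ
    exact hξ
  set Ψ : (Fin m → ℝ) × ℝ → E (m + 1) := fun p => G p.1 + p.2 • e with hΨ
  -- In the orthogonal coordinates `Ψ` is a shear by `γ`, which preserves volume although `γ` is
  -- only Lipschitz.
  have hΨmp : MeasurePreserving Ψ (volume.prod volume) volume := by
    have h1 : MeasurePreserving (fun p : (Fin m → ℝ) × ℝ => (p.1, γ (l p.1) + p.2))
        (volume.prod volume) (volume.prod volume) := by
      refine (MeasurePreserving.id (volume : Measure (Fin m → ℝ))).skew_product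
        (g := fun ξ t => γ (l ξ) + t) ?_ ?_
      · exact ((hγl.continuous.measurable).comp measurable_fst).add measurable_snd
      · exact ae_of_all _ fun ξ => map_add_left_eq_self _ _
    have h2 := (hmp.comp (Measure.measurePreserving_swap (μ := volume) (ν := volume))).comp h1
    refine Eq.subst (motive := fun f => MeasurePreserving f (volume.prod volume) volume) ?_ h2
    refine funext fun p => ?_
    simp only [hΨ, hGdef, Function.comp_apply, Prod.fst_swap, Prod.snd_swap]
    module
  have hΨm : Measurable Ψ := hΨmp.measurable
  -- For heights between `a` and `h` the points `y + s e`, `y ∈ K`, are within `hc/2 + hc/2` of `x₀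
  -- + h e`, hence in the ball `A`.
  set a := h - h * c / 2 with ha
  have ha0 : 0 < a := by nlinarith
  have hah : a < h := by have := mul_pos hh0 hc; linarith
  set A := Metric.ball (x₀ + h • e) (h * c) with hA
  have hAΩ : A ⊆ Ω := by
    intro z hz
    have h1 := hcone x₀ (frontier_subset_closure (hDf (hK₀D hx₀))) (Metric.mem_ball_self hρ) h hh0
      (by linarith) (h⁻¹ • (z - x₀)) (by
        rw [hA, Metric.mem_ball, dist_eq_norm] at hz
        rw [Metric.mem_ball, dist_eq_norm]
        have : h⁻¹ • (z - x₀) - e = h⁻¹ • (z - (x₀ + h • e)) := by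
          rw [← sub_sub, smul_sub h⁻¹ (z - x₀), smul_smul, inv_mul_cancel₀ hh0.ne', one_smul]
        rw [this, norm_smul, norm_inv, Real.norm_of_nonneg hh0.le, inv_mul_lt_iff₀ hh0]
        exact hz)
    rwa [smul_smul, mul_inv_cancel₀ hh0.ne', one_smul, add_sub_cancel] at h1
  have hΨA : ∀ p ∈ (Q '' K) ×ˢ Ioo a h, Ψ p ∈ A := by
    rintro ⟨-, s⟩ ⟨⟨y, hy, rfl⟩, hs⟩
    simp only [hΨ, hGK y hy, hA, Metric.mem_ball]
    calc dist (y + s • e) (x₀ + h • e) ≤ dist y x₀ + dist (s • e) (h • e) := dist_add_add_le _ _ _ _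
      _ < h * c / 2 + h * c / 2 := by
          refine add_lt_add_of_le_of_lt ((hKd y hy).trans (min_le_left _ _)) ?_
          rw [dist_eq_norm, ← sub_smul, norm_smul, he, mul_one, Real.norm_eq_abs, abs_lt]
          simp only [mem_Ioo, ha] at hs
          constructor <;> linarith [hs.1, hs.2, mul_pos hh0 hc]
      _ = h * c := by ring
  have hΨΩ : ∀ p ∈ (Q '' K) ×ˢ Ioo 0 h, Ψ p ∈ Ω := by
    rintro ⟨-, s⟩ ⟨⟨y, hy, rfl⟩, hs⟩
    simp only [hΨ, hGK y hy]
    exact hcone y (frontier_subset_closure (hDf (hKD hy))) (hKρ y hy) s hs.1 (by linarith [hs.2]) e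
      (Metric.mem_ball_self hc)
  -- Measurability of `B` is not assumed; a measurable hull of `Z ∩ B` takes its place.
  have hpush : ∀ {S : Set ((Fin m → ℝ) × ℝ)} {B : Set (E (m + 1))}, MeasurableSet S →
      (∀ p ∈ S, Ψ p ∈ B) → ((volume.prod volume).restrict S).map Ψ ≤ volume.restrict B := by
    intro S B hS hSB
    refine Measure.le_iff.2 fun Z hZ => ?_
    rw [Measure.map_apply hΨm hZ, Measure.restrict_apply (hΨm hZ), Measure.restrict_apply hZ]
    calc _ ≤ (volume.prod volume) (Ψ ⁻¹' (Z ∩ toMeasurable volume (Z ∩ B))) := by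
          refine measure_mono fun p hp => ⟨hp.1, subset_toMeasurable _ _ ⟨hp.1, hSB p hp.2⟩⟩
      _ = volume (Z ∩ toMeasurable volume (Z ∩ B)) :=
          hΨmp.measure_preimage (hZ.inter (measurableSet_toMeasurable _ _)).nullMeasurableSet
      _ ≤ volume (toMeasurable volume (Z ∩ B)) := measure_mono inter_subset_right
      _ = volume (Z ∩ B) := measure_toMeasurable _
  -- `π` is part of the volume of the ball `A`, foliated by segments that start on `K`. Integration
  -- along these segments bounds `∫u² dπ` by the boundary values and the gradient; since `π ≠ 0`,
  -- the control then spreads over the convex set `A`.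
  set π : Measure (E (m + 1)) := ((volume.prod volume).restrict ((Q '' K) ×ˢ Ioo a h)).map Ψ with hπ
  have hπA : π ≤ volume.restrict A := hpush (hQKm.prod measurableSet_Ioo) hΨA
  have hπ0 : π univ ≠ 0 := by
    rw [hπ, Measure.map_apply hΨm MeasurableSet.univ, preimage_univ, Measure.restrict_apply_univ,
      Measure.prod_prod, Real.volume_Ioo]
    refine mul_ne_zero hQKpos ?_
    rw [Ne, ENNReal.ofReal_eq_zero, not_le]
    linarith
  have hπC : ∃ C : ℝ≥0, ∀ u : E (m + 1) → ℝ, ContDiff ℝ 1 u → ∫⁻ x, ‖u x‖ₑ ^ 2 ∂π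
    ≤ C * ((∫⁻ x in ΓD, ‖u x‖ₑ ^ 2 ∂(Measure.hausdorffMeasure (m : ℝ) : Measure (E (m + 1))))
      + ∫⁻ x in Ω, ‖gradient u x‖ₑ ^ 2) := by
    set V := ENNReal.ofReal (h - a) with hV
    set W := ENNReal.ofReal h with hW
    refine ⟨(2 * (V * W) + 2 * V * ((‖Q‖₊ : ℝ≥0∞) ^ (m : ℝ))).toNNReal, fun u hu => ?_⟩
    rw [ENNReal.coe_toNNReal (by
      refine ENNReal.add_ne_top.2 ⟨by simp [hV, hW, ENNReal.mul_eq_top], ?_⟩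
      refine ENNReal.mul_ne_top (by simp [hV, ENNReal.mul_eq_top]) ?_
      exact ENNReal.rpow_ne_top_of_nonneg hm0 ENNReal.coe_ne_top)]
    have hcu := hu.continuous
    have hcg := continuous_gradient_of_contDiff_one hu
    have hcG := hGl.continuous
    set R := ∫⁻ x in ΓD, ‖u x‖ₑ ^ 2 ∂(Measure.hausdorffMeasure (m : ℝ) : Measure (E (m + 1)))
    set D := ∫⁻ x in Ω, ‖gradient u x‖ₑ ^ 2
    have hm1 : Measurable fun p : (Fin m → ℝ) × ℝ => ‖u (G p.1 + p.2 • e)‖ₑ ^ 2 :=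
      (Continuous.enorm (by fun_prop)).measurable.pow_const 2
    have hm2 : Measurable fun p : (Fin m → ℝ) × ℝ => ‖gradient u (G p.1 + p.2 • e)‖ₑ ^ 2 :=
      (Continuous.enorm (by fun_prop)).measurable.pow_const 2
    have hee : ‖e‖ₑ = 1 := by rw [← ofReal_norm, he, ENNReal.ofReal_one]
    have hR : ∫⁻ ξ in Q '' K, ‖u (G ξ)‖ₑ ^ 2 ≤ (‖Q‖₊ : ℝ≥0∞) ^ (m : ℝ) * R := by
      rw [← lintegral_map (f := fun x => ‖u x‖ₑ ^ 2) (hcu.enorm.measurable.pow_const 2) hGm]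
      refine (lintegral_mono' hmap le_rfl).trans ?_
      rw [lintegral_smul_measure, smul_eq_mul]
      gcongr
      exact lintegral_mono_set hKD
    have hD : ∫⁻ ξ in Q '' K, ∫⁻ s in Ioo 0 h, ‖gradient u (G ξ + s • e)‖ₑ ^ 2 ≤ D := by
      rw [← lintegral_prod (fun p : (Fin m → ℝ) × ℝ => ‖gradient u (G p.1 + p.2 • e)‖ₑ ^ 2)
        hm2.aemeasurable, Measure.prod_restrict]
      have := lintegral_mono' (hpush (hQKm.prod measurableSet_Ioo) hΨΩ)
        (le_refl fun x => ‖gradient u x‖ₑ ^ 2)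
      rwa [lintegral_map (hcg.enorm.measurable.pow_const 2) hΨm] at this
    rw [hπ, lintegral_map (hcu.enorm.measurable.pow_const 2) hΨm, ← Measure.prod_restrict,
      lintegral_prod _ hm1.aemeasurable]
    calc ∫⁻ ξ in Q '' K, ∫⁻ s in Ioo a h, ‖u (G ξ + s • e)‖ₑ ^ 2
        ≤ ∫⁻ ξ in Q '' K, (2 * (V * W) * (∫⁻ s in Ioo 0 h, ‖gradient u (G ξ + s • e)‖ₑ ^ 2)
            + 2 * V * ‖u (G ξ)‖ₑ ^ 2) := by
          refine lintegral_mono fun ξ => ?_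
          calc ∫⁻ s in Ioo a h, ‖u (G ξ + s • e)‖ₑ ^ 2
              ≤ ∫⁻ s in Ioo a h, (2 * (W * ∫⁻ s in Ioo 0 h, ‖gradient u (G ξ + s • e)‖ₑ ^ 2)
                + 2 * ‖u (G ξ)‖ₑ ^ 2) := by
                refine setLIntegral_mono' measurableSet_Ioo fun s hs => ?_
                refine (sq_enorm_le (b := u (G ξ))).trans ?_
                gcongr
                have := sq_enorm_sub_le_lintegral hu (G ξ) e (ha0.trans hs.1).le hs.2.le
                rwa [hee, one_pow, mul_one] at this
            _ = _ := by
                rw [lintegral_const, Measure.restrict_apply_univ, Real.volume_Ioo]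
                ring
      _ = 2 * (V * W) * (∫⁻ ξ in Q '' K, ∫⁻ s in Ioo 0 h, ‖gradient u (G ξ + s • e)‖ₑ ^ 2)
            + 2 * V * ∫⁻ ξ in Q '' K, ‖u (G ξ)‖ₑ ^ 2 := by
          rw [lintegral_add_left (hm2.lintegral_prod_right'.const_mul _),
            lintegral_const_mul' _ _ (by simp [hV, hW, ENNReal.mul_eq_top]),
            lintegral_const_mul' _ _ (by simp [hV, ENNReal.mul_eq_top])]
      _ ≤ 2 * (V * W) * D + 2 * V * ((‖Q‖₊ : ℝ≥0∞) ^ (m : ℝ) * R) := by gcongr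
      _ ≤ 2 * (V * W) * (R + D) + 2 * V * ((‖Q‖₊ : ℝ≥0∞) ^ (m : ℝ) * (R + D)) := by
          gcongr
          · exact le_add_self
          · exact le_self_add
      _ = _ := by ring
  have hfinal : IsControlled Ω ΓD (volume.restrict A) := by
    refine IsControlled.of_convex (π := π) ?_ (convex_ball _ _) measurableSet_ball
      Metric.isBounded_ball hAΩ hπA hπ0
    unfold IsControlled
    rw [hdim]
    exact hπC
  refine ⟨x₀ + h • e, h * c, by positivity, hAΩ, ?_⟩
  unfold IsControlled at hfinal
  rwa [hdim] at hfinal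

/-- Starting from one controlled ball, control passes to every ball in `Ω` that meets a controlled
one, hence to all of `Ω` by connectedness. Near the boundary points are shifted along the axis of an
interior cone into a controlled ball, and compactness of the closure makes the constant uniform. -/
lemma isControlled_restrict {d : ℕ} (hd : 1 ≤ d) {Ω ΓD ΓN : Set (E d)}
    (hΩ : IsAdmissibleDomain Ω ΓD ΓN) : IsControlled Ω ΓD (volume.restrict Ω) := by
  obtain ⟨x₁, r₁, hr₁, hb₁, hC₁⟩ : ∃ x r, 0 < r ∧ Metric.ball x r ⊆ Ω ∧
      IsControlled Ω ΓD (volume.restrict (Metric.ball x r)) := by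
    obtain ⟨m, rfl⟩ : ∃ m, d = m + 1 := ⟨d - 1, by omega⟩
    exact exists_isControlled_ball hΩ
  have hOm := hΩ.isOpen.measurableSet
  have spread : ∀ {x y : E d} {r s : ℝ}, IsControlled Ω ΓD (volume.restrict (Metric.ball x r)) →
      Metric.ball y s ⊆ Ω → (Metric.ball x r ∩ Metric.ball y s).Nonempty →
      IsControlled Ω ΓD (volume.restrict (Metric.ball y s)) := by
    intro x y r s hx hy hne
    refine (hx.mono (Measure.restrict_mono (inter_subset_left (t := Metric.ball y s)) le_rfl)).of_convex
      (convex_ball _ _) measurableSet_ball Metric.isBounded_ball hy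
      (Measure.restrict_mono inter_subset_right le_rfl) ?_
    rw [Measure.restrict_apply_univ]
    exact ((Metric.isOpen_ball.inter Metric.isOpen_ball).measure_pos _ hne).ne'
  set U : Set (E d) := {x | ∃ r > 0, Metric.ball x r ⊆ Ω ∧
    IsControlled Ω ΓD (volume.restrict (Metric.ball x r))} with hU
  have hUo : IsOpen U := by
    rw [Metric.isOpen_iff]
    rintro x ⟨r, hr, hx, hC⟩
    refine ⟨r, hr, fun y hy => ?_⟩
    have hsub : Metric.ball y (r - dist y x) ⊆ Metric.ball x r :=
      Metric.ball_subset_ball' (by linarith)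
    exact ⟨r - dist y x, sub_pos.2 hy, hsub.trans hx, hC.mono (Measure.restrict_mono hsub le_rfl)⟩
  -- `U` is open, meets `Ω` and is relatively closed in `Ω`: a ball around a limit point contains
  -- the centre of a controlled ball and is then controlled itself.
  have hUΩ : Ω ⊆ U := by
    refine hΩ.connected.isPreconnected.subset_of_closure_inter_subset hUo
      ⟨x₁, hb₁ (Metric.mem_ball_self hr₁), r₁, hr₁, hb₁, hC₁⟩ ?_
    rintro x ⟨hxU, hxΩ⟩
    obtain ⟨r, hr, hb⟩ := Metric.isOpen_iff.1 hΩ.isOpen x hxΩ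
    obtain ⟨y, ⟨s, hs, hyΩ, hyC⟩, hxy⟩ := Metric.mem_closure_iff.1 hxU r hr
    exact ⟨r, hr, hb, spread hyC hb ⟨y, Metric.mem_ball_self hs, by rwa [Metric.mem_ball']⟩⟩
  have hloc : ∀ x₀ ∈ closure Ω, ∃ V ∈ 𝓝 x₀, IsControlled Ω ΓD (volume.restrict (Ω ∩ V)) := by
    intro x₀ hx₀
    obtain ⟨e, c, ρ, hc, hc1, hρ, he, hcone⟩ := hΩ.lipschitz.exists_cone hΩ.isOpen hx₀
    set s := ρ / 2 with hs
    have hs0 : 0 < s := by positivity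
    have hBΩ : Metric.ball (x₀ + s • e) (s * c) ⊆ Ω := by
      intro z hz
      have h1 := hcone x₀ hx₀ (Metric.mem_ball_self hρ) s hs0 (by linarith) (s⁻¹ • (z - x₀)) (by
          rw [Metric.mem_ball, dist_eq_norm] at hz
          rw [Metric.mem_ball, dist_eq_norm]
          have : s⁻¹ • (z - x₀) - e = s⁻¹ • (z - (x₀ + s • e)) := by
            rw [← sub_sub, smul_sub s⁻¹ (z - x₀), smul_smul, inv_mul_cancel₀ hs0.ne', one_smul]
          rw [this, norm_smul, norm_inv, Real.norm_of_nonneg hs0.le, inv_mul_lt_iff₀ hs0]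
          exact hz)
      rwa [smul_smul, mul_inv_cancel₀ hs0.ne', one_smul, add_sub_cancel] at h1
    have hsc : 0 < s * c := by positivity
    obtain ⟨r, hr, -, hC⟩ := hUΩ (hBΩ (Metric.mem_ball_self hsc))
    have hB := spread hC hBΩ ⟨_, Metric.mem_ball_self hr, Metric.mem_ball_self hsc⟩
    refine ⟨Metric.ball x₀ (min ρ (s * c)), Metric.ball_mem_nhds _ (lt_min hρ hsc), ?_⟩
    -- The translation by `s e` moves the neighbourhood of `x₀` into the controlled ball around `x₀
    -- + s e`, and the segments in between lie in `Ω` by the cone property.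
    refine hB.of_shift (s • e) (hOm.inter measurableSet_ball) hOm ?_ ?_ measurableSet_ball
    · rintro x ⟨hx, hxb⟩ t ht
      rw [smul_smul]
      refine hcone x (subset_closure hx) (Metric.ball_subset_ball (min_le_left _ _) hxb) _
        (mul_pos ht.1 hs0) ?_ e (Metric.mem_ball_self hc)
      nlinarith [ht.2]
    · rintro x ⟨-, hxb⟩
      rw [Metric.mem_ball, dist_add_right]
      exact Metric.ball_subset_ball (min_le_right _ _) hxb
  choose! V hV hVC using hloc
  obtain ⟨t, ht, hcov⟩ := hΩ.bounded.isCompact_closure.elim_nhds_subcover V hV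
  have hfin : ∀ t : Finset (E d), (∀ x ∈ t, x ∈ closure Ω) →
      IsControlled Ω ΓD (volume.restrict (⋃ x ∈ t, Ω ∩ V x)) := by
    intro t
    induction t using Finset.induction_on with
    | empty => intro _; simpa using isControlled_zero
    | insert a t _ ih =>
      intro h
      rw [Finset.set_biUnion_insert]
      exact ((hVC a (h a (Finset.mem_insert_self _ _))).add
        (ih fun x hx => h x (Finset.mem_insert_of_mem hx))).mono (Measure.restrict_union_le _ _)
  refine (hfin t ht).mono (Measure.restrict_mono (fun x hx => ?_) le_rfl)
  obtain ⟨y, hy, hxy⟩ := mem_iUnion₂.1 (hcov (subset_closure hx))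
  exact mem_iUnion₂.2 ⟨y, hy, hx, hxy⟩

lemma tendsto_eLpNorm_of_tendsto_sub {X F : Type*} [MeasurableSpace X] [NormedAddCommGroup F]
    {μ : Measure X} {p : ℝ≥0∞} (hp : 1 ≤ p) {f : ℕ → X → F} {g : X → F}
    (hf : ∀ k, AEStronglyMeasurable (f k) μ) (hg : AEStronglyMeasurable g μ)
    (h : Tendsto (fun k => eLpNorm (fun x => f k x - g x) p μ) atTop (𝓝 0)) :
    Tendsto (fun k => eLpNorm (f k) p μ) atTop (𝓝 (eLpNorm g p μ)) := by
  have h1 : ∀ k, eLpNorm g p μ ≤ eLpNorm (f k) p μ + eLpNorm (fun x => f k x - g x) p μ := by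
    intro k
    have := eLpNorm_sub_le (p := p) (hf k) ((hf k).sub hg) hp
    rwa [sub_sub_cancel] at this
  have h2 : ∀ k, eLpNorm (f k) p μ ≤ eLpNorm (fun x => f k x - g x) p μ + eLpNorm g p μ := by
    intro k
    have := eLpNorm_add_le (p := p) ((hf k).sub hg) hg hp
    rwa [sub_add_cancel] at this
  refine tendsto_of_tendsto_of_tendsto_of_le_of_le (g := fun k => eLpNorm g p μ
    - eLpNorm (fun x => f k x - g x) p μ) (h := fun k => eLpNorm (fun x => f k x - g x) p μ
    + eLpNorm g p μ) ?_ ?_ (fun k => tsub_le_iff_right.2 (h1 k)) h2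
  · have := ENNReal.Tendsto.sub (tendsto_const_nhds (x := eLpNorm g p μ)) h (Or.inr (by simp))
    rwa [tsub_zero] at this
  · have := h.add (tendsto_const_nhds (x := eLpNorm g p μ))
    rwa [zero_add] at this

/-- Poincaré's inequality in `H₀¹(Ω ∪ Γ_N)`. -/
theorem exists_poincare {d : ℕ} (hd : 1 ≤ d) {Ω ΓD ΓN : Set (E d)}
    (hΩ : IsAdmissibleDomain Ω ΓD ΓN) : ∃ C : ℝ≥0, ∀ u ∈ H10 Ω ΓD,
      eLpNorm (fn u) 2 (volume.restrict Ω) ≤ C * eLpNorm (grad u) 2 (volume.restrict Ω) := by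
  obtain ⟨C, hC⟩ := isControlled_restrict hd hΩ
  refine ⟨NNReal.sqrt C, ?_⟩
  rintro u ⟨φ, hφ, h1, h2, h3⟩
  set μΓ := (Measure.hausdorffMeasure ((d : ℝ) - 1) : Measure (E d)).restrict ΓD
  have t1 := tendsto_eLpNorm_of_tendsto_sub one_le_two
    (fun k => (hφ k).1.continuous.aestronglyMeasurable) (memLp_fn u).1 h1
  have t2 := tendsto_eLpNorm_of_tendsto_sub one_le_two
    (fun k => (continuous_gradient (hφ k).1).aestronglyMeasurable) (memLp_grad u).1 h2
  have t3 := ENNReal.Tendsto.const_mul (a := (NNReal.sqrt C : ℝ≥0∞)) (h3.add t2)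
    (Or.inr ENNReal.coe_ne_top)
  rw [zero_add] at t3
  refine le_of_tendsto_of_tendsto' t1 t3 fun k => ?_
  rw [← ENNReal.pow_le_pow_left_iff (n := 2) (by norm_num), mul_pow, ← ENNReal.coe_pow,
    NNReal.sq_sqrt]
  have := hC (φ k) ((hφ k).1.of_le (by simp))
  rw [← eLpNorm_two_sq, ← eLpNorm_two_sq, ← eLpNorm_two_sq] at this
  refine this.trans ?_
  gcongr
  rw [add_sq]
  exact add_le_add (le_self_add) le_rfl

/-! ### Sobolev embeddings -/

/-- There is a basis of `ℝ^d` inside each ball. -/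
lemma exists_linearMap_mem_ball {d : ℕ} (e : E d) {c : ℝ} (hc : 0 < c) :
    ∃ B : (Fin d → ℝ) →ₗ[ℝ] (Fin d → ℝ), LinearMap.det B ≠ 0 ∧
      ∀ i, WithLp.toLp 2 (B (Pi.single i 1)) ∈ Metric.ball e c := by
  set ε := c / 2 with hε
  have hε0 : 0 < ε := by positivity
  -- The basis consists of the vectors `e + εσ_i e_i`, where `e_i` is the standard basis. A vector
  -- `y` of the kernel satisfies `(∑ y_i)(ε + ∑ σ_j e_j) = 0`, now with `e_j` the coordinates of
  -- `e`; the signs are chosen to make the second factor positive.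
  set σ : Fin d → ℝ := fun i => if 0 ≤ e i then 1 else -1 with hσ
  have hσ1 : ∀ i, σ i * σ i = 1 := by intro i; simp only [hσ]; split_ifs <;> norm_num
  have hσe : ∀ i, 0 ≤ σ i * e i := by
    intro i; simp only [hσ]; split_ifs with h
    · linarith
    · linarith
  set B : (Fin d → ℝ) →ₗ[ℝ] (Fin d → ℝ) :=
    { toFun := fun y j => (∑ i, y i) * e j + ε * (σ j * y j)
      map_add' := fun y z => by
        ext j; simp only [Pi.add_apply, Finset.sum_add_distrib]; ring
      map_smul' := fun a y => by
        ext j; simp only [Pi.smul_apply, smul_eq_mul, RingHom.id_apply, ← Finset.mul_sum]; ring }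
    with hB
  have hBa : ∀ y j, B y j = (∑ i, y i) * e j + ε * (σ j * y j) := fun y j => rfl
  refine ⟨B, ?_, ?_⟩
  · have hk : LinearMap.ker B = ⊥ := by
      rw [LinearMap.ker_eq_bot']
      intro y hy
      have h1 : ∀ j, ε * y j = - ((∑ i, y i) * (σ j * e j)) := by
        intro j
        have := congrFun hy j
        rw [hBa, Pi.zero_apply] at this
        have h2 : σ j * ((∑ i, y i) * e j + ε * (σ j * y j)) = 0 := by rw [this, mul_zero]
        linear_combination h2 - ε * y j * hσ1 j
      have h2 : (∑ i, y i) * (ε + ∑ j, σ j * e j) = 0 := by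
        have : ∑ j, ε * y j = ∑ j, - ((∑ i, y i) * (σ j * e j)) := Finset.sum_congr rfl fun j _ => h1 j
        rw [← Finset.mul_sum, Finset.sum_neg_distrib, ← Finset.mul_sum] at this
        linear_combination this
      have h3 : 0 < ε + ∑ j, σ j * e j :=
        add_pos_of_pos_of_nonneg hε0 (Finset.sum_nonneg fun j _ => hσe j)
      have h4 : ∑ i, y i = 0 := (mul_eq_zero.1 h2).resolve_right h3.ne'
      ext j
      have := h1 j
      rw [h4, zero_mul, neg_zero] at this
      exact (mul_eq_zero.1 this).resolve_left hε0.ne'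
    exact (LinearMap.isUnit_det B ((LinearMap.isUnit_iff_ker_eq_bot B).2 hk)).ne_zero
  · intro i
    have : WithLp.toLp 2 (B (Pi.single i 1)) - e = (ε * σ i) • EuclideanSpace.single i (1 : ℝ) := by
      ext j
      simp only [PiLp.sub_apply, hBa, Finset.sum_pi_single', Finset.mem_univ, if_true, one_mul,
        PiLp.smul_apply, smul_eq_mul]
      by_cases h : j = i
      · subst h; simp
      · simp [h]
    rw [Metric.mem_ball, dist_eq_norm, this, norm_smul, PiLp.norm_single, norm_one, mul_one,
      norm_mul, Real.norm_of_nonneg hε0.le]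
    have : ‖σ i‖ = 1 := by simp only [hσ]; split_ifs <;> simp
    rw [this]; linarith

lemma lintegral_comp_linearMap {d : ℕ} {B : (Fin d → ℝ) →ₗ[ℝ] (Fin d → ℝ)}
    (hB : LinearMap.det B ≠ 0) {F : E d → ℝ≥0∞} (hF : Measurable F) :
    ∫⁻ y, F (WithLp.toLp 2 (B y)) = ENNReal.ofReal |(LinearMap.det B)⁻¹| * ∫⁻ x, F x := by
  have h1 := Real.map_linearMap_volume_pi_eq_smul_volume_pi hB
  have hm : Measurable (fun y : Fin d → ℝ => F (WithLp.toLp 2 y)) :=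
    hF.comp (MeasurableEquiv.toLp 2 (Fin d → ℝ)).measurable
  have hBm : Measurable B := (LinearMap.continuous_of_finiteDimensional B).measurable
  rw [← lintegral_map (f := fun y => F (WithLp.toLp 2 y)) hm hBm, h1, lintegral_smul_measure,
    smul_eq_mul]
  congr 1
  exact (PiLp.volume_preserving_toLp (Fin d)).lintegral_comp hF

/-- The Gagliardo-Nirenberg-Loomis-Whitney inequality with respect to an arbitrary basis. -/
lemma exists_lintegral_prod_le {d : ℕ} (hd : 2 ≤ d) {B : (Fin d → ℝ) →ₗ[ℝ] (Fin d → ℝ)}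
    (hB : LinearMap.det B ≠ 0) : ∃ C : ℝ≥0, ∀ F : E d → ℝ≥0∞, Measurable F →
      ∫⁻ x, ∏ i, (∫⁻ r : ℝ, F (x + r • WithLp.toLp 2 (B (Pi.single i 1)))) ^ (1 / ((d : ℝ) - 1))
        ≤ C * (∫⁻ x, F x) ^ ((d : ℝ) / (d - 1)) := by
  have hd1 : (1 : ℝ) < d := by exact_mod_cast hd
  set a : ℝ≥0 := Real.toNNReal |(LinearMap.det B)⁻¹| with ha
  have ha0 : a ≠ 0 := by
    rw [ha, ne_eq, Real.toNNReal_eq_zero, not_le]; exact abs_pos.2 (inv_ne_zero hB)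
  have hp : Real.HolderConjugate (Fintype.card (Fin d)) ((d : ℝ) / (d - 1)) := by
    rw [Fintype.card_fin]
    exact (Real.holderConjugate_iff_eq_conjExponent hd1).2 rfl
  -- The inequality for the standard basis is applied to `F ∘ B`. The change of variables gives one
  -- Jacobian `a` on the left, and the power `d/(d-1)` of it on the right.
  refine ⟨a⁻¹ * a ^ ((d : ℝ) / (d - 1)), fun F hF => ?_⟩
  have hBc : Measurable fun y => F (WithLp.toLp 2 (B y)) :=
    hF.comp ((MeasurableEquiv.toLp 2 (Fin d → ℝ)).measurable.comp
      (LinearMap.continuous_of_finiteDimensional B).measurable)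
  have h1 := lintegral_prod_lintegral_pow_le (fun _ : Fin d => (volume : Measure ℝ)) hp hBc
  rw [← volume_pi, lintegral_comp_linearMap hB hF] at h1
  have hGm : Measurable fun x : E d =>
      ∏ i, (∫⁻ r : ℝ, F (x + r • WithLp.toLp 2 (B (Pi.single i 1)))) ^ (1 / ((d : ℝ) - 1)) := by
    refine Finset.measurable_prod _ fun i _ => Measurable.pow_const ?_ _
    exact Measurable.lintegral_prod_right' (f := fun z : E d × ℝ =>
      F (z.1 + z.2 • WithLp.toLp 2 (B (Pi.single i 1)))) (hF.comp (by fun_prop))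
  have h2 := lintegral_comp_linearMap hB hGm
  -- Replacing the `i`-th coordinate by `r` and adding `r` to it parametrise the same line; the two
  -- integrals agree by translation invariance.
  have h3 : ∀ y : Fin d → ℝ, ∀ i, ∫⁻ r : ℝ, F (WithLp.toLp 2 (B y) + r • WithLp.toLp 2 (B (Pi.single i 1)))
      = ∫⁻ r : ℝ, F (WithLp.toLp 2 (B (Function.update y i r))) := by
    intro y i
    rw [← lintegral_add_right_eq_self (μ := volume) (fun r : ℝ => F (WithLp.toLp 2 (B (Function.update y i r))))
      (y i)]
    refine lintegral_congr fun r => ?_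
    congr 1
    have : Function.update y i (r + y i) = y + r • Pi.single i 1 := by
      ext j
      by_cases h : j = i
      · subst h; simp; ring
      · simp [h]
    rw [this, map_add, map_smul, WithLp.toLp_add, WithLp.toLp_smul]
  simp only [h3] at h2
  rw [Fintype.card_fin, h2] at h1
  have h4 : ENNReal.ofReal |(LinearMap.det B)⁻¹| = (a : ℝ≥0∞) := rfl
  rw [h4, ENNReal.mul_rpow_of_nonneg _ _ (by have := sub_pos.2 hd1; positivity)] at h1
  rw [ENNReal.coe_mul, ENNReal.coe_rpow_of_ne_zero ha0, mul_assoc, ENNReal.coe_inv ha0,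
    ← ENNReal.mul_le_iff_le_inv (by simpa using ha0) ENNReal.coe_ne_top]
  exact h1

/-- Local representation of a smooth function near a point of the closure of a Lipschitz domain by
line integrals of its gradient within the domain. -/
lemma HasLipschitzBoundary.exists_enorm_le_lintegral {d : ℕ} {Ω : Set (E d)}
    (hL : HasLipschitzBoundary Ω) (hO : IsOpen Ω) {x₀ : E d} (hx₀ : x₀ ∈ closure Ω) :
    ∃ (B : (Fin d → ℝ) →ₗ[ℝ] (Fin d → ℝ)) (δ : ℝ) (C : ℝ≥0), LinearMap.det B ≠ 0 ∧ 0 < δ ∧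
      ∀ w : E d → ℝ, ContDiff ℝ 1 w → ∃ F : E d → ℝ≥0∞, Measurable F ∧
        ∫⁻ x, F x ≤ C * ∫⁻ x in Ω, (‖w x‖ₑ + ‖gradient w x‖ₑ) ∧
        ∀ x ∈ Ω, x ∈ Metric.ball x₀ δ → ∀ i,
          ‖w x‖ₑ ≤ ∫⁻ r : ℝ, F (x + r • WithLp.toLp 2 (B (Pi.single i 1))) := by
  obtain ⟨e, c, ρ, hc, hc1, hρ, he, hcone⟩ := hL.exists_cone hO hx₀
  obtain ⟨B, hB, hBm⟩ := exists_linearMap_mem_ball e hc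
  set v : Fin d → E d := fun i => WithLp.toLp 2 (B (Pi.single i 1)) with hv
  have hv0 : ∀ i, 0 < ‖v i‖ := by
    intro i
    rw [norm_pos_iff]
    intro h
    have h1 : B (Pi.single i 1) = 0 := congrArg WithLp.ofLp h
    have h2 : LinearMap.ker B = ⊥ :=
      (LinearMap.isUnit_iff_ker_eq_bot B).1 (LinearMap.isUnit_iff_isUnit_det B |>.2 hB.isUnit)
    have h3 := (LinearMap.ker_eq_bot'.1 h2) _ h1
    have := congrFun h3 i
    simp at this
  have hv2 : ∀ i, ‖v i‖ ≤ 2 := by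
    intro i
    have h1 := hBm i
    rw [Metric.mem_ball, dist_eq_norm] at h1
    calc ‖v i‖ = ‖(v i - e) + e‖ := by rw [sub_add_cancel]
      _ ≤ ‖v i - e‖ + ‖e‖ := norm_add_le _ _
      _ ≤ 2 := by linarith
  set h := ρ / 2 with hh
  have hh0 : 0 < h := by positivity
  -- Small enough that a step `h v_i` from any point of the ball of radius `δ` leaves it. There the
  -- cutoff `χ` vanishes, and `w(x)` is the integral of the derivative of `χw` along a segment in
  -- `Ω`.
  obtain ⟨δ, hδ, hδ0⟩ : ∃ δ : ℝ, (δ < ρ ∧ ∀ i, 2 * δ < h * ‖v i‖) ∧ 0 < δ := by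
    have h1 : ∀ᶠ δ : ℝ in 𝓝[>] 0, (δ < ρ ∧ ∀ i, 2 * δ < h * ‖v i‖) ∧ 0 < δ := by
      refine Eventually.and (Eventually.and ?_ (eventually_all.2 fun i => ?_)) self_mem_nhdsWithin
      · exact mem_nhdsWithin_of_mem_nhds (Iio_mem_nhds hρ)
      · have : Tendsto (fun δ : ℝ => 2 * δ) (𝓝[>] 0) (𝓝 0) := by
          have : Tendsto (fun δ : ℝ => 2 * δ) (𝓝 0) (𝓝 (2 * 0)) := (continuous_const_mul _).tendsto _
          rw [mul_zero] at this
          exact this.mono_left nhdsWithin_le_nhds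
        exact this.eventually (Iio_mem_nhds (mul_pos hh0 (hv0 i)))
    exact h1.exists
  set χ : ContDiffBump x₀ := ⟨δ / 2, δ, by positivity, by linarith⟩ with hχ
  have hχs : ContDiff ℝ ∞ (χ : E d → ℝ) := χ.contDiff
  obtain ⟨K, hK, hK'⟩ := exists_bound_smooth hχs χ.hasCompactSupport
  have hK0 : 0 ≤ K := (abs_nonneg _).trans (hK x₀)
  refine ⟨B, δ / 2, 2 * Real.toNNReal K, hB, by positivity, fun w hw => ?_⟩
  have hg : ContDiff ℝ 1 (fun x => χ x * w x) := (hχs.of_le (by simp)).mul hw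
  have hgg : ∀ x, gradient (fun x => χ x * w x) x = χ x • gradient w x + w x • gradient χ x := by
    intro x
    have h1 : DifferentiableAt ℝ χ x := hχs.differentiable (by simp) x
    have h2 : DifferentiableAt ℝ w x := hw.differentiable (by simp) x
    have : fderiv ℝ (fun x => χ x * w x) x = χ x • fderiv ℝ w x + w x • fderiv ℝ χ x := fderiv_mul h1 h2
    simp only [gradient, this, map_add, map_smulₛₗ]
    rfl
  -- The factor `2` bounds the lengths `‖v_i‖`. The same `F` serves all directions, as the
  -- Loomis-Whitney inequality requires.
  refine ⟨fun x => 2 * Ω.indicator (fun x => ‖gradient (fun x => χ x * w x) x‖ₑ) x, ?_, ?_, ?_⟩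
  · exact ((continuous_gradient_of_contDiff_one hg).enorm.measurable.indicator
      hO.measurableSet).const_mul 2
  · rw [lintegral_const_mul' _ _ (by simp), lintegral_indicator hO.measurableSet, ENNReal.coe_mul,
      mul_assoc, ENNReal.coe_ofNat, ← lintegral_const_mul' _ _ ENNReal.coe_ne_top]
    refine mul_le_mul_right (lintegral_mono fun x => ?_) _
    have hKe : ∀ {F : Type} [NormedAddCommGroup F] (y : F), ‖y‖ ≤ K → ‖y‖ₑ ≤ (K.toNNReal : ℝ≥0∞) := by
      intro F _ y hy
      rw [← ofReal_norm]; exact ENNReal.ofReal_le_ofReal hy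
    rw [hgg]
    refine (enorm_add_le _ _).trans ?_
    rw [enorm_smul, enorm_smul, mul_add, add_comm, mul_comm (‖w x‖ₑ)]
    gcongr
    · exact hKe _ (hK' x)
    · exact hKe _ (by rw [Real.norm_eq_abs]; exact hK x)
  · intro x hx hxb i
    have hxδ : x ∈ Metric.ball x₀ δ := Metric.ball_subset_ball (by linarith) hxb
    have h1 : χ x = 1 := χ.one_of_mem_closedBall (Metric.ball_subset_closedBall hxb)
    have h2 : χ (x + h • v i) = 0 := by
      refine χ.zero_of_le_dist ?_
      rw [Metric.mem_ball, dist_eq_norm] at hxδ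
      rw [dist_eq_norm]
      have h3 : ‖h • v i‖ ≤ ‖x + h • v i - x₀‖ + ‖x - x₀‖ := by
        have := norm_sub_le (x + h • v i - x₀) (x - x₀)
        rwa [sub_sub_sub_cancel_right, add_sub_cancel_left] at this
      rw [norm_smul, Real.norm_of_nonneg hh0.le] at h3
      have := hδ.2 i
      change δ ≤ _
      linarith
    have h3 := enorm_sub_le_lintegral hg x (v i) hh0.le le_rfl
    simp only [h1, h2, zero_mul, one_mul, zero_sub, enorm_neg] at h3
    have h4 : ‖v i‖ₑ ≤ 2 := by
      rw [← ofReal_norm]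
      exact (ENNReal.ofReal_le_ofReal (hv2 i)).trans (by simp)
    refine h3.trans ((mul_le_mul_left h4 _).trans ?_)
    rw [lintegral_const_mul' _ _ (by simp)]
    refine mul_le_mul_right ?_ _
    rw [← lintegral_indicator measurableSet_Ioo]
    refine lintegral_mono fun r => ?_
    by_cases hr : r ∈ Ioo 0 h
    · have hm : x + r • v i ∈ Ω := hcone x (subset_closure hx) (Metric.ball_subset_ball hδ.1.le hxδ) r hr.1
        (by have := hr.2; linarith) _ (hBm i)
      rw [indicator_of_mem hr, indicator_of_mem hm]
    · rw [indicator_of_notMem hr]; exact zero_le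

/-- The embedding of `W^{1,1}` into `L^{d/(d-1)}`. -/
lemma IsAdmissibleDomain.exists_lintegral_rpow_le {d : ℕ} (hd : 2 ≤ d) {Ω ΓD ΓN : Set (E d)}
    (hΩ : IsAdmissibleDomain Ω ΓD ΓN) : ∃ C : ℝ≥0, ∀ w : E d → ℝ, ContDiff ℝ 1 w →
      ∫⁻ x in Ω, ‖w x‖ₑ ^ ((d : ℝ) / (d - 1))
        ≤ C * (∫⁻ x in Ω, (‖w x‖ₑ + ‖gradient w x‖ₑ)) ^ ((d : ℝ) / (d - 1)) := by
  have hd1 : (1 : ℝ) < d := by exact_mod_cast hd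
  have hd2 : (0 : ℝ) < d - 1 := by linarith
  have hloc : ∀ x₀ ∈ closure Ω, ∃ V ∈ 𝓝 x₀, ∃ C : ℝ≥0, ∀ w : E d → ℝ, ContDiff ℝ 1 w →
      ∫⁻ x in Ω ∩ V, ‖w x‖ₑ ^ ((d : ℝ) / (d - 1))
        ≤ C * (∫⁻ x in Ω, (‖w x‖ₑ + ‖gradient w x‖ₑ)) ^ ((d : ℝ) / (d - 1)) := by
    intro x₀ hx₀
    obtain ⟨B, δ, C, hB, hδ, hw⟩ := hΩ.lipschitz.exists_enorm_le_lintegral hΩ.isOpen hx₀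
    obtain ⟨C', hC'⟩ := exists_lintegral_prod_le hd hB
    refine ⟨Metric.ball x₀ δ, Metric.ball_mem_nhds _ hδ, C' * C ^ ((d : ℝ) / (d - 1)),
      fun w hwc => ?_⟩
    obtain ⟨F, hF, hF1, hF2⟩ := hw w hwc
    calc ∫⁻ x in Ω ∩ Metric.ball x₀ δ, ‖w x‖ₑ ^ ((d : ℝ) / (d - 1))
        ≤ ∫⁻ x in Ω ∩ Metric.ball x₀ δ, ∏ i,
          (∫⁻ r : ℝ, F (x + r • WithLp.toLp 2 (B (Pi.single i 1)))) ^ (1 / ((d : ℝ) - 1)) := by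
          refine setLIntegral_mono_ae' (hΩ.isOpen.measurableSet.inter measurableSet_ball)
            (Eventually.of_forall fun x hx => ?_)
          calc ‖w x‖ₑ ^ ((d : ℝ) / (d - 1)) = ∏ _i : Fin d, ‖w x‖ₑ ^ (1 / ((d : ℝ) - 1)) := by
                rw [Finset.prod_const, Finset.card_univ, Fintype.card_fin, ← ENNReal.rpow_natCast,
                  ← ENNReal.rpow_mul]
                congr 1
                field_simp
            _ ≤ _ := Finset.prod_le_prod' fun i _ =>
                ENNReal.rpow_le_rpow (hF2 x hx.1 hx.2 i) (by positivity)
      _ ≤ _ := setLIntegral_le_lintegral _ _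
      _ ≤ C' * (∫⁻ x, F x) ^ ((d : ℝ) / (d - 1)) := hC' F hF
      _ ≤ C' * (C * ∫⁻ x in Ω, (‖w x‖ₑ + ‖gradient w x‖ₑ)) ^ ((d : ℝ) / (d - 1)) := by gcongr
      _ = _ := by
          rw [ENNReal.mul_rpow_of_nonneg _ _ (by positivity), ENNReal.coe_mul,
            ENNReal.coe_rpow_of_nonneg _ (by positivity), mul_assoc]
  choose! V hV C hC using hloc
  obtain ⟨t, ht, hcov⟩ := hΩ.bounded.isCompact_closure.elim_nhds_subcover V hV
  refine ⟨∑ x ∈ t, C x, fun w hw => ?_⟩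
  calc ∫⁻ x in Ω, ‖w x‖ₑ ^ ((d : ℝ) / (d - 1))
      ≤ ∫⁻ x in ⋃ y ∈ t, Ω ∩ V y, ‖w x‖ₑ ^ ((d : ℝ) / (d - 1)) := by
        refine lintegral_mono_set fun x hx => ?_
        obtain ⟨y, hy, hxy⟩ := mem_iUnion₂.1 (hcov (subset_closure hx))
        exact mem_iUnion₂.2 ⟨y, hy, hx, hxy⟩
    _ ≤ ∑ y ∈ t, ∫⁻ x in Ω ∩ V y, ‖w x‖ₑ ^ ((d : ℝ) / (d - 1)) := by
        have := lintegral_iUnion_le (μ := volume) (fun y : t => Ω ∩ V y)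
          fun x => ‖w x‖ₑ ^ ((d : ℝ) / (d - 1))
        rwa [tsum_fintype, Finset.sum_coe_sort t fun y => ∫⁻ x in Ω ∩ V y, ‖w x‖ₑ ^ ((d : ℝ) / (d - 1)),
          iUnion_subtype] at this
    _ ≤ ∑ y ∈ t, C y * (∫⁻ x in Ω, (‖w x‖ₑ + ‖gradient w x‖ₑ)) ^ ((d : ℝ) / (d - 1)) :=
        Finset.sum_le_sum fun y hy => hC y (ht y hy) w hw
    _ = _ := by rw [← Finset.sum_mul, ENNReal.ofNNReal_finsetSum]

/-- The `W^{1,1}` inequality is applied to `|u|^s`, whose gradient is at most `s|u|^{s-1}|∇u|`. By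
Cauchy-Schwarz the factor `|u|^{s-1}` enters through the norm of `u` in `L^{2(s-1)}`; the condition
on `s` says precisely that `2(s-1) ≤ sd/(d-1)`, so this is bounded by the norm `N` to be estimated,
to the power `s - 1`. Dividing `N^s` by `N^{s-1}` leaves the claim. -/
lemma IsAdmissibleDomain.exists_eLpNorm_smooth_le {d : ℕ} (hd : 2 ≤ d) {Ω ΓD ΓN : Set (E d)}
    (hΩ : IsAdmissibleDomain Ω ΓD ΓN) {s : ℝ} (hs : 1 < s) (hsd : s * ((d : ℝ) - 2) ≤ 2 * (d - 1)) :
    ∃ C : ℝ≥0, ∀ u : E d → ℝ, ContDiff ℝ 1 u →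
      eLpNorm u (ENNReal.ofReal (s * (d / (d - 1)))) (volume.restrict Ω)
        ≤ C * (eLpNorm u 2 (volume.restrict Ω) + eLpNorm (gradient u) 2 (volume.restrict Ω)) := by
  have hd1 : (1 : ℝ) < d := by exact_mod_cast hd
  have hd2 : (0 : ℝ) < d - 1 := by linarith
  have hs0 : 0 < s - 1 := by linarith
  have hfin := hΩ.isFiniteMeasure
  set μ := volume.restrict Ω
  set q : ℝ := (d : ℝ) / (d - 1) with hq
  have hq0 : 0 < q := by positivity
  obtain ⟨C, hC⟩ := hΩ.exists_lintegral_rpow_le hd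
  set M : ℝ≥0 := (μ univ ^ (1 / (ENNReal.ofReal (2 * (s - 1))).toReal
    - 1 / (ENNReal.ofReal (s * q)).toReal)).toNNReal with hM
  have hexp : 2 * (s - 1) ≤ s * q := by
    rw [hq, mul_div_assoc', le_div_iff₀ hd2]; nlinarith
  have hMe : μ univ ^ (1 / (ENNReal.ofReal (2 * (s - 1))).toReal
      - 1 / (ENNReal.ofReal (s * q)).toReal) = (M : ℝ≥0∞) := by
    refine (ENNReal.coe_toNNReal (ENNReal.rpow_ne_top_of_nonneg ?_ (measure_ne_top _ _))).symm
    rw [ENNReal.toReal_ofReal (by positivity), ENNReal.toReal_ofReal (by positivity), sub_nonneg]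
    exact one_div_le_one_div_of_le (by positivity) hexp
  set S : ℝ≥0 := ⟨s, by linarith⟩ with hS
  have hS1 : 1 ≤ (S : ℝ≥0∞) := by exact_mod_cast hs.le
  refine ⟨C ^ (1 / q) * (M ^ (s - 1) * S), fun u hu => ?_⟩
  set N := eLpNorm u (ENNReal.ofReal (s * q)) μ with hN
  set Y := eLpNorm u 2 μ + eLpNorm (gradient u) 2 μ with hY
  -- Finiteness of `N`, which holds because `u` is bounded on the compact closure of `Ω`, permits
  -- the cancellation of `N^{s-1}` at the end.
  have hNt : N ≠ ⊤ := by
    obtain ⟨K, hK⟩ := hΩ.bounded.isCompact_closure.exists_bound_of_continuousOn hu.continuous.continuousOn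
    refine (MemLp.of_bound hu.continuous.aestronglyMeasurable K ?_).2.ne
    exact (ae_restrict_iff' hΩ.isOpen.measurableSet).2
      (Eventually.of_forall fun x hx => hK x (subset_closure hx))
  rcases eq_or_ne N 0 with hN0 | hN0
  · rw [hN0]; exact zero_le
  have h1 := hC (fun x => ‖u x‖ ^ s) (hu.norm_rpow hs)
  have h2 : ∫⁻ x in Ω, ‖‖u x‖ ^ s‖ₑ ^ q = N ^ (s * q) := by
    have e1 := eLpNorm_norm_rpow (p := ENNReal.ofReal q) (μ := μ) u (show 0 < s by linarith)
    rw [← ENNReal.ofReal_mul hq0.le, mul_comm q s,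
      eLpNorm_eq_lintegral_rpow_enorm_toReal (by simpa using hq0) ENNReal.ofReal_ne_top,
      ENNReal.toReal_ofReal hq0.le] at e1
    rw [hN, ENNReal.rpow_mul, ← e1, ← ENNReal.rpow_mul, one_div_mul_cancel hq0.ne', ENNReal.rpow_one]
  have hU : eLpNorm (fun x => ‖u x‖ ^ (s - 1)) 2 μ ≤ (M * N) ^ (s - 1) := by
    rw [eLpNorm_norm_rpow u hs0]
    refine ENNReal.rpow_le_rpow ?_ hs0.le
    have e2 : (2 : ℝ≥0∞) * ENNReal.ofReal (s - 1) = ENNReal.ofReal (2 * (s - 1)) := by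
      rw [ENNReal.ofReal_mul (by norm_num), ENNReal.ofReal_ofNat]
    rw [e2, mul_comm (M : ℝ≥0∞) N, ← hMe]
    exact eLpNorm_le_eLpNorm_mul_rpow_measure_univ (ENNReal.ofReal_le_ofReal hexp)
      hu.continuous.aestronglyMeasurable
  have hcs : ∀ {F : Type} [NormedAddCommGroup F] {g : E d → F}, Continuous g →
      ∫⁻ x in Ω, ‖‖u x‖ ^ (s - 1)‖ₑ * ‖g x‖ₑ ≤ (M * N) ^ (s - 1) * eLpNorm g 2 μ := by
    intro F _ g hg
    have hcu : Continuous fun x => ‖u x‖ ^ (s - 1) :=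
      hu.continuous.norm.rpow_const fun x => Or.inr hs0.le
    have := ENNReal.lintegral_mul_le_Lp_mul_Lq μ Real.HolderConjugate.two_two
      hcu.enorm.aemeasurable hg.enorm.aemeasurable
    refine this.trans (mul_le_mul' (le_trans (le_of_eq ?_) hU) (le_of_eq ?_))
    · rw [eLpNorm_eq_lintegral_rpow_enorm_toReal (by simp) (by simp), ENNReal.toReal_ofNat]
    · rw [eLpNorm_eq_lintegral_rpow_enorm_toReal (by simp) (by simp), ENNReal.toReal_ofNat]
  have h3 : ∫⁻ x in Ω, (‖‖u x‖ ^ s‖ₑ + ‖gradient (fun x => ‖u x‖ ^ s) x‖ₑ)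
      ≤ (M * N) ^ (s - 1) * (S * Y) := by
    calc _ ≤ ∫⁻ x in Ω, (S * (‖‖u x‖ ^ (s - 1)‖ₑ * ‖u x‖ₑ)
            + S * (‖‖u x‖ ^ (s - 1)‖ₑ * ‖gradient u x‖ₑ)) := by
          refine lintegral_mono fun x => add_le_add ?_ ?_
          · have : ‖‖u x‖ ^ s‖ₑ = ‖‖u x‖ ^ (s - 1)‖ₑ * ‖u x‖ₑ := by
              rw [← enorm_norm (u x), ← enorm_mul,
                ← Real.rpow_add_one' (norm_nonneg _) (by linarith), sub_add_cancel]
            rw [this]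
            exact le_mul_of_one_le_left' hS1
          · have e3 := norm_fderiv_norm_rpow_le (hu.differentiable (by simp)) (x := x) hs
            rw [← norm_gradient, ← norm_gradient] at e3
            rw [← ofReal_norm (gradient (fun x => ‖u x‖ ^ s) x)]
            refine (ENNReal.ofReal_le_ofReal e3).trans (le_of_eq ?_)
            rw [mul_assoc, ENNReal.ofReal_mul (by linarith), ENNReal.ofReal_mul (by positivity),
              ofReal_norm, Real.enorm_of_nonneg (by positivity)]
            congr 1
            rw [ENNReal.ofReal]; congr 1
            exact Real.toNNReal_of_nonneg _
      _ = S * (∫⁻ x in Ω, (‖‖u x‖ ^ (s - 1)‖ₑ * ‖u x‖ₑ)) + S * ∫⁻ x in Ω, (‖‖u x‖ ^ (s - 1)‖ₑ * ‖gradient u x‖ₑ) := by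
          have hcu : Continuous fun x => ‖u x‖ ^ (s - 1) :=
            hu.continuous.norm.rpow_const fun x => Or.inr hs0.le
          have hcu' := hu.continuous
          have hm : Measurable fun x => (S : ℝ≥0∞) * (‖‖u x‖ ^ (s - 1)‖ₑ * ‖u x‖ₑ) :=
            (hcu.enorm.measurable.mul hcu'.enorm.measurable).const_mul _
          rw [lintegral_add_left hm, lintegral_const_mul' _ _ (by simp), lintegral_const_mul' _ _ (by simp)]
      _ ≤ S * ((M * N) ^ (s - 1) * eLpNorm u 2 μ) + S * ((M * N) ^ (s - 1) * eLpNorm (gradient u) 2 μ) := by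
          exact add_le_add (mul_le_mul_right (hcs hu.continuous) _)
            (mul_le_mul_right (hcs (continuous_gradient_of_contDiff_one hu)) _)
      _ = _ := by rw [hY]; ring
  rw [h2] at h1
  have h4 : N ^ s ≤ N ^ (s - 1) * (C ^ (1 / q) * (M ^ (s - 1) * S) * Y) := by
    have e4 := ENNReal.rpow_le_rpow (h1.trans (mul_le_mul_right (ENNReal.rpow_le_rpow h3 hq0.le) _))
      (z := 1 / q) (by positivity)
    rw [← ENNReal.rpow_mul, ENNReal.mul_rpow_of_nonneg _ _ (by positivity : (0:ℝ) ≤ 1 / q), ← ENNReal.rpow_mul,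
      mul_assoc, mul_one_div_cancel hq0.ne', mul_one, ENNReal.rpow_one,
      ENNReal.mul_rpow_of_nonneg _ _ hs0.le] at e4
    refine e4.trans (le_of_eq ?_)
    ring
  have h5 : N ^ s = N ^ (s - 1) * N := by
    conv_rhs => rw [← ENNReal.rpow_one N, ← ENNReal.rpow_mul, mul_comm 1, mul_one]
    rw [← ENNReal.rpow_add _ _ hN0 hNt, sub_add_cancel]
  rw [h5] at h4
  have h6 := (ENNReal.mul_le_mul_iff_right (ENNReal.rpow_pos hN0.bot_lt hNt).ne' (ENNReal.rpow_ne_top_of_nonneg hs0.le hNt)).1 h4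
  rw [ENNReal.coe_mul, ENNReal.coe_mul, ENNReal.coe_rpow_of_nonneg _ (by positivity),
    ENNReal.coe_rpow_of_nonneg _ (by positivity)]
  exact h6

/-- In one dimension the line through `x` is the whole space, so the representation by line
integrals is already a pointwise bound by the `W^{1,1}` norm. -/
lemma IsAdmissibleDomain.exists_eLpNorm_top_smooth_le {Ω ΓD ΓN : Set (E 1)}
    (hΩ : IsAdmissibleDomain Ω ΓD ΓN) : ∃ C : ℝ≥0, ∀ u : E 1 → ℝ, ContDiff ℝ 1 u →
      eLpNorm u ⊤ (volume.restrict Ω)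
        ≤ C * (eLpNorm u 2 (volume.restrict Ω) + eLpNorm (gradient u) 2 (volume.restrict Ω)) := by
  have hfin := hΩ.isFiniteMeasure
  set μ := volume.restrict Ω
  have hloc : ∀ x₀ ∈ closure Ω, ∃ V ∈ 𝓝 x₀, ∃ C : ℝ≥0, ∀ w : E 1 → ℝ, ContDiff ℝ 1 w →
      ∀ x ∈ Ω, x ∈ V → ‖w x‖ₑ ≤ C * ∫⁻ x in Ω, (‖w x‖ₑ + ‖gradient w x‖ₑ) := by
    intro x₀ hx₀
    obtain ⟨B, δ, C, hB, hδ, hw⟩ := hΩ.lipschitz.exists_enorm_le_lintegral hΩ.isOpen hx₀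
    refine ⟨Metric.ball x₀ δ, Metric.ball_mem_nhds _ hδ, Real.toNNReal |(LinearMap.det B)⁻¹| * C,
      fun w hwc x hx hxb => ?_⟩
    obtain ⟨F, hF, hF1, hF2⟩ := hw w hwc
    have h1 : ∫⁻ r : ℝ, F (x + r • WithLp.toLp 2 (B (Pi.single 0 1)))
        = ENNReal.ofReal |(LinearMap.det B)⁻¹| * ∫⁻ x, F x := by
      have e1 := lintegral_comp_linearMap hB (F := fun y => F (x + y)) (hF.comp (measurable_const_add x))
      rw [lintegral_add_left_eq_self F x] at e1
      rw [← e1]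
      refine (lintegral_congr fun r => ?_).trans
        ((volume_preserving_funUnique (Fin 1) ℝ).symm.lintegral_comp_emb
        (MeasurableEquiv.measurableEmbedding _) (fun y : Fin 1 → ℝ => F (x + WithLp.toLp 2 (B y))))
      have : (MeasurableEquiv.funUnique (Fin 1) ℝ).symm r = r • Pi.single 0 1 := by
        ext j; rw [Subsingleton.elim j 0]; simp [MeasurableEquiv.funUnique]
      rw [this, map_smul, WithLp.toLp_smul]
    refine (hF2 x hx hxb 0).trans ?_
    rw [h1, ENNReal.coe_mul, mul_assoc]
    exact mul_le_mul_right hF1 _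
  choose! V hV C hC using hloc
  obtain ⟨t, ht, hcov⟩ := hΩ.bounded.isCompact_closure.elim_nhds_subcover V hV
  set M : ℝ≥0 := (μ univ ^ (1 / (1 : ℝ≥0∞).toReal - 1 / (2 : ℝ≥0∞).toReal)).toNNReal
  have hMe : μ univ ^ (1 / (1 : ℝ≥0∞).toReal - 1 / (2 : ℝ≥0∞).toReal) = (M : ℝ≥0∞) :=
    (ENNReal.coe_toNNReal (ENNReal.rpow_ne_top_of_nonneg (by norm_num) (measure_ne_top _ _))).symm
  refine ⟨(∑ x ∈ t, C x) * M, fun w hw => ?_⟩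
  have h1 : ∀ x ∈ Ω, ‖w x‖ₑ ≤ ((∑ x ∈ t, C x : ℝ≥0) : ℝ≥0∞) * ∫⁻ x in Ω, (‖w x‖ₑ + ‖gradient w x‖ₑ) := by
    intro x hx
    obtain ⟨y, hy, hxy⟩ := mem_iUnion₂.1 (hcov (subset_closure hx))
    refine (hC y (ht y hy) w hw x hx hxy).trans ?_
    gcongr
    exact Finset.single_le_sum (f := C) (fun i _ => zero_le) hy
  have hg := continuous_gradient_of_contDiff_one hw
  have h2 : ∫⁻ x in Ω, (‖w x‖ₑ + ‖gradient w x‖ₑ) ≤ M * (eLpNorm w 2 μ + eLpNorm (gradient w) 2 μ) := by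
    rw [lintegral_add_left hw.continuous.enorm.measurable, ← eLpNorm_one_eq_lintegral_enorm,
      ← eLpNorm_one_eq_lintegral_enorm, mul_add, ← hMe, mul_comm, mul_comm _ (eLpNorm (gradient w) 2 μ)]
    exact add_le_add (eLpNorm_le_eLpNorm_mul_rpow_measure_univ one_le_two hw.continuous.aestronglyMeasurable)
      (eLpNorm_le_eLpNorm_mul_rpow_measure_univ one_le_two hg.aestronglyMeasurable)
  rw [eLpNorm_exponent_top]
  refine (eLpNormEssSup_le_of_ae_enorm_bound (C := _) ?_)
  refine (ae_restrict_iff' hΩ.isOpen.measurableSet).2 (Eventually.of_forall fun x hx => ?_)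
  refine (h1 x hx).trans ?_
  rw [ENNReal.coe_mul, mul_assoc]
  exact mul_le_mul_right h2 _

/-- The approximating functions converge in `L²`, not in `L^r`; Fatou's lemma along an almost
everywhere convergent subsequence makes the bound pass to the limit, including for `r = ∞`. -/
lemma eLpNorm_le_of_mem_H10 {d : ℕ} {Ω ΓD : Set (E d)} {r : ℝ≥0∞} {C : ℝ≥0}
    (hC : ∀ u : E d → ℝ, ContDiff ℝ 1 u → eLpNorm u r (volume.restrict Ω)
        ≤ C * (eLpNorm u 2 (volume.restrict Ω) + eLpNorm (gradient u) 2 (volume.restrict Ω)))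
    {u : H1 Ω} (hu : u ∈ H10 Ω ΓD) : eLpNorm (fn u) r (volume.restrict Ω)
        ≤ C * (eLpNorm (fn u) 2 (volume.restrict Ω) + eLpNorm (grad u) 2 (volume.restrict Ω)) := by
  obtain ⟨φ, hφ, h1, h2, -⟩ := hu
  have hm := fun k => (hφ k).1.continuous.aestronglyMeasurable (μ := volume.restrict Ω)
  have t1 := tendsto_eLpNorm_of_tendsto_sub one_le_two hm (memLp_fn u).1 h1
  have t2 := tendsto_eLpNorm_of_tendsto_sub one_le_two
    (fun k => (continuous_gradient (hφ k).1).aestronglyMeasurable) (memLp_grad u).1 h2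
  have t3 := ENNReal.Tendsto.const_mul (a := (C : ℝ≥0∞)) (t1.add t2) (Or.inr ENNReal.coe_ne_top)
  obtain ⟨ns, hns, hae⟩ := (tendstoInMeasure_of_tendsto_eLpNorm (by simp) hm (memLp_fn u).1
    h1).exists_seq_tendsto_ae
  refine (Lp.eLpNorm_lim_le_liminf_eLpNorm (fun k => hm (ns k)) _ hae).trans ?_
  have t4 := t3.comp hns.tendsto_atTop
  rw [← t4.liminf_eq]
  exact liminf_le_liminf (Eventually.of_forall fun k => hC _ ((hφ (ns k)).1.of_le (by simp)))

lemma eLpNorm_smul_le_of_exponents {d : ℕ} {Ω : Set (E d)} [IsFiniteMeasure (volume.restrict Ω)]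
    {r p₁ p : ℝ≥0∞} (hr : r⁻¹ + p₁⁻¹ = 2⁻¹) (hp : p₁ ≤ p) : ∃ C : ℝ≥0, ∀ (u : E d → ℝ) (g : E d → E d),
      AEStronglyMeasurable u (volume.restrict Ω) → AEStronglyMeasurable g (volume.restrict Ω) →
      eLpNorm (fun x => u x • g x) 2 (volume.restrict Ω)
        ≤ C * (eLpNorm u r (volume.restrict Ω) * eLpNorm g p (volume.restrict Ω)) := by
  have : ENNReal.HolderTriple r p₁ 2 := ⟨hr⟩
  set μ := volume.restrict Ω
  have h2 : (2 : ℝ≥0∞) ≤ p₁ := by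
    rw [← ENNReal.inv_le_inv, ← hr]; exact le_add_self
  set M : ℝ≥0 := (μ univ ^ (1 / p₁.toReal - 1 / p.toReal)).toNNReal
  have hMe : μ univ ^ (1 / p₁.toReal - 1 / p.toReal) = (M : ℝ≥0∞) := by
    refine (ENNReal.coe_toNNReal (ENNReal.rpow_ne_top_of_nonneg ?_ (measure_ne_top _ _))).symm
    rw [sub_nonneg]
    rcases eq_or_ne p ⊤ with h | h
    · rw [h, ENNReal.toReal_top, div_zero]; positivity
    · refine one_div_le_one_div_of_le (ENNReal.toReal_pos ?_ (ne_top_of_le_ne_top h hp))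
        (ENNReal.toReal_mono h hp)
      exact (lt_of_lt_of_le (by norm_num) h2).ne'
  refine ⟨M, fun u g hu hg => ?_⟩
  calc _ ≤ eLpNorm u r μ * eLpNorm g p₁ μ := eLpNorm_smul_le_mul_eLpNorm hg hu
    _ ≤ eLpNorm u r μ * (eLpNorm g p μ * M) := by
        gcongr
        rw [← hMe]
        exact eLpNorm_le_eLpNorm_mul_rpow_measure_univ hp hg
    _ = _ := by ring

/-- Multiplication with a field in `L^p` (`L²` if `d = 1`) maps `H₀¹(Ω ∪ Γ_N)` to `L²`. -/
theorem exists_eLpNorm_smul_le {d : ℕ} (hd : 1 ≤ d) {Ω ΓD ΓN : Set (E d)}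
    (hΩ : IsAdmissibleDomain Ω ΓD ΓN) {p : ℝ≥0∞} (hp2 : d = 2 → 2 < p)
    (hp3 : 3 ≤ d → (d : ℝ≥0∞) ≤ p) : ∃ C : ℝ≥0, ∀ u ∈ H10 Ω ΓD, ∀ g : E d → E d,
      AEStronglyMeasurable g (volume.restrict Ω) →
      eLpNorm (fun x => fn u x • g x) 2 (volume.restrict Ω)
        ≤ C * (eLpNorm (grad u) 2 (volume.restrict Ω) *
          eLpNorm g (if d = 1 then 2 else p) (volume.restrict Ω)) := by
  have hfin := hΩ.isFiniteMeasure
  obtain ⟨CP, hCP⟩ := exists_poincare hd hΩ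
  set μ := volume.restrict Ω
  obtain ⟨r, p₁, hr, hp₁, CS, hCS⟩ : ∃ r p₁ : ℝ≥0∞, r⁻¹ + p₁⁻¹ = 2⁻¹ ∧ p₁ ≤ (if d = 1 then 2 else p) ∧
      ∃ C : ℝ≥0, ∀ u : E d → ℝ, ContDiff ℝ 1 u →
        eLpNorm u r μ ≤ C * (eLpNorm u 2 μ + eLpNorm (gradient u) 2 μ) := by
    by_cases hd1 : d = 1
    · subst hd1
      exact ⟨⊤, 2, by simp, by simp, hΩ.exists_eLpNorm_top_smooth_le⟩
    · have hd2 : 2 ≤ d := by omega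
      have hdR : (2 : ℝ) ≤ d := by exact_mod_cast hd2
      -- A finite exponent `a > 2` with `d ≤ a ≤ p` is needed. For `d = 2` it must lie strictly
      -- above `2`, because `H¹` does not embed into `L^∞`; for `d ≥ 3` the critical value `a = d`
      -- is admissible.
      obtain ⟨a, ha2, had, hap⟩ : ∃ a : ℝ, 2 < a ∧ (d : ℝ) ≤ a ∧ ENNReal.ofReal a ≤ p := by
        by_cases hd3 : d = 2
        · obtain ⟨b, hb1, hb2⟩ := ENNReal.lt_iff_exists_nnreal_btwn.1 (hp2 hd3)
          have hb : (2 : ℝ) < b := by exact_mod_cast hb1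
          exact ⟨b, hb, by rw [hd3]; exact_mod_cast hb.le, by rw [ENNReal.ofReal_coe_nnreal]; exact hb2.le⟩
        · have hd4 : 3 ≤ d := by omega
          exact ⟨d, by exact_mod_cast hd4, le_rfl, by rw [ENNReal.ofReal_natCast]; exact hp3 hd4⟩
      have ha0 : 0 < a := by linarith
      have ha1 : 0 < a - 2 := by linarith
      have hd0 : (0 : ℝ) < d := by linarith
      have hd5 : (0 : ℝ) < d - 1 := by linarith
      -- Then `s d/(d-1) = 2a/(a-2)`, the exponent that is Hölder conjugate to `a` with respect to
      -- `L²`. The condition `s(d-2) ≤ 2(d-1)` reduces to `a ≥ d`.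
      set s : ℝ := 2 * a / (a - 2) * ((d - 1) / d) with hs
      have hs1 : 1 < s := by
        rw [hs, div_mul_div_comm, one_lt_div (by positivity)]
        nlinarith
      have hsd : s * ((d : ℝ) - 2) ≤ 2 * (d - 1) := by
        rw [hs, div_mul_div_comm, div_mul_eq_mul_div, div_le_iff₀ (by positivity)]
        nlinarith [mul_nonneg hd5.le (sub_nonneg.2 had)]
      have hse : s * ((d : ℝ) / (d - 1)) = 2 * a / (a - 2) := by
        rw [hs]; field_simp
      refine ⟨ENNReal.ofReal (s * ((d : ℝ) / (d - 1))), ENNReal.ofReal a, ?_, by rw [if_neg hd1]; exact hap,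
        hΩ.exists_eLpNorm_smooth_le hd2 hs1 hsd⟩
      rw [hse, ← ENNReal.ofReal_inv_of_pos (by positivity), ← ENNReal.ofReal_inv_of_pos ha0,
        ← ENNReal.ofReal_add (by positivity) (by positivity), ← ENNReal.ofReal_ofNat 2,
        ← ENNReal.ofReal_inv_of_pos (by norm_num)]
      congr 1
      field_simp
      ring
  obtain ⟨CH, hCH⟩ := eLpNorm_smul_le_of_exponents (Ω := Ω) hr hp₁
  refine ⟨CH * (CS * (CP + 1)), fun u hu g hg => ?_⟩
  calc _ ≤ CH * (eLpNorm (fn u) r μ * eLpNorm g (if d = 1 then 2 else p) μ) := hCH _ _ (memLp_fn u).1 hg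
    _ ≤ CH * (CS * (CP * eLpNorm (grad u) 2 μ + eLpNorm (grad u) 2 μ)
          * eLpNorm g (if d = 1 then 2 else p) μ) := by
        gcongr
        refine (eLpNorm_le_of_mem_H10 hCS hu).trans ?_
        gcongr
        exact hCP u hu
    _ = _ := by push_cast; ring

/-! ### Weak time derivatives and the convex energy inequality -/

lemma IsTestFun.eq_zero_of_notMem {X : Type*} [NormedAddCommGroup X] [NormedSpace ℝ X]
    {U : Set X} {ψ : X → ℝ} (hψ : IsTestFun U ψ) {t : X} (ht : t ∉ U) : ψ t = 0 :=
  image_eq_zero_of_notMem_tsupport fun h => ht (hψ.supp h)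

/-- Integration by parts against the primitive of an integrable function. -/
lemma IsTestFun.integral_deriv_mul_primitive {T : ℝ} {ψ g : ℝ → ℝ}
    (hψ : IsTestFun (Ioo 0 T) ψ) (hg : IntervalIntegrable g volume 0 T) :
    ∫ t in (0 : ℝ)..T, deriv ψ t * ∫ s in (0 : ℝ)..t, g s = - ∫ t in (0 : ℝ)..T, ψ t * g t := by
  have h1 := hg.absolutelyContinuousOnInterval_intervalIntegral (c := 0) (by simp)
  have h2 : AbsolutelyContinuousOnInterval ψ 0 T :=
    (hψ.smooth.of_le (by simp)).contDiffOn.absolutelyContinuousOnInterval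
  have h3 := h1.integral_mul_deriv_eq_deriv_mul h2
  rw [hψ.eq_zero_of_notMem (t := T) (by simp), hψ.eq_zero_of_notMem (t := 0) (by simp), mul_zero,
    mul_zero, sub_zero, zero_sub] at h3
  simp only [mul_comm (deriv ψ _), mul_comm (ψ _)]
  rw [h3]
  congr 1
  refine intervalIntegral.integral_congr_ae ?_
  filter_upwards [hg.ae_hasDerivAt_integral] with x hx hxm
  rw [(hx (uIoc_subset_uIcc hxm) 0 (by simp)).deriv]

/-- The primitive from `0` vanishes to the left of the support, and to the right of it because the
mean is zero. -/
lemma exists_isTestFun_primitive {T : ℝ} {ζ : ℝ → ℝ} (hζ : IsTestFun (Ioo 0 T) ζ)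
    (h0 : ∫ t in (0 : ℝ)..T, ζ t = 0) : ∃ ψ, IsTestFun (Ioo 0 T) ψ ∧ deriv ψ = ζ := by
  obtain ⟨a, b, ha, hb, hab⟩ : ∃ a b : ℝ, 0 < a ∧ b < T ∧ tsupport ζ ⊆ Icc a b := by
    rcases (tsupport ζ).eq_empty_or_nonempty with h | h
    · exact ⟨1, T - 1, one_pos, by linarith, by rw [h]; exact empty_subset _⟩
    · obtain ⟨a, ha⟩ := hζ.compact.isCompact.exists_isLeast h
      obtain ⟨b, hb⟩ := hζ.compact.isCompact.exists_isGreatest h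
      exact ⟨a, b, (hζ.supp ha.1).1, (hζ.supp hb.1).2, fun x hx => ⟨ha.2 hx, hb.2 hx⟩⟩
  have hz : ∀ t, t ∉ Icc a b → ζ t = 0 := fun t ht => image_eq_zero_of_notMem_tsupport fun h => ht (hab h)
  have hi : ∀ x y : ℝ, IntervalIntegrable ζ volume x y := fun x y =>
    hζ.smooth.continuous.intervalIntegrable _ _
  set ψ : ℝ → ℝ := fun t => ∫ s in (0 : ℝ)..t, ζ s with hψ
  have hd : ∀ t, HasDerivAt ψ (ζ t) t := fun t =>
    intervalIntegral.integral_hasDerivAt_right (hi _ _)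
      (hζ.smooth.continuous.stronglyMeasurableAtFilter _ _) hζ.smooth.continuous.continuousAt
  have hde : deriv ψ = ζ := funext fun t => (hd t).deriv
  have hs : ∀ t, t ∉ Icc a b → ψ t = 0 := by
    intro t ht
    rcases lt_or_ge t a with h | h
    · refine (intervalIntegral.integral_congr fun s hs => hz s ?_).trans intervalIntegral.integral_zero
      rintro ⟨h1, -⟩
      have := hs.2
      rcases le_max_iff.1 this with h2 | h2 <;> linarith
    · have htb : b < t := lt_of_not_ge fun h' => ht ⟨h, h'⟩
      have : ψ t = (∫ s in (0 : ℝ)..T, ζ s) - ∫ s in t..T, ζ s := by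
        rw [eq_sub_iff_add_eq]
        exact intervalIntegral.integral_add_adjacent_intervals (hi _ _) (hi _ _)
      rw [this, h0, zero_sub, neg_eq_zero]
      refine (intervalIntegral.integral_congr fun s hs => hz s ?_).trans intervalIntegral.integral_zero
      rintro ⟨-, h1⟩
      have := hs.1
      rcases min_le_iff.1 this with h2 | h2 <;> linarith
  refine ⟨ψ, ⟨?_, HasCompactSupport.intro isCompact_Icc hs, ?_⟩, hde⟩
  · rw [contDiff_infty_iff_deriv]
    exact ⟨fun t => (hd t).differentiableAt, by rw [hde]; exact hζ.smooth⟩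
  · refine (closure_minimal (fun t ht => ?_) isClosed_Icc).trans
      (fun t (ht : t ∈ Icc a b) => ⟨ha.trans_le ht.1, ht.2.trans_lt hb⟩)
    by_contra h
    exact ht (hs t h)

/-- A continuous function whose distributional derivative is integrable is its primitive. -/
theorem sub_eq_integral_of_weakDeriv {T : ℝ} (hT : 0 < T) {f g F : ℝ → ℝ}
    (hg : IntegrableOn g (Ioo 0 T)) (hF : ContinuousOn F (Icc 0 T)) (hfF : f =ᵐ[timeMeasure T] F)
    (h : ∀ ψ, IsTestFun (Ioo 0 T) ψ →
      ∫ t in Ioo 0 T, deriv ψ t * f t = - ∫ t in Ioo 0 T, ψ t * g t) {t : ℝ} (ht : t ∈ Icc 0 T) :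
    F t - F 0 = ∫ s in (0 : ℝ)..t, g s := by
  have hset : ∀ k : ℝ → ℝ, ∫ t in Ioo 0 T, k t = ∫ t in (0 : ℝ)..T, k t := fun k => by
    rw [intervalIntegral.integral_of_le hT.le, integral_Ioc_eq_integral_Ioo]
  have hgi : IntervalIntegrable g volume 0 T := by
    rw [intervalIntegrable_iff_integrableOn_Ioo_of_le hT.le]; exact hg
  -- `G` has zero weak derivative and has to be shown constant.
  set G : ℝ → ℝ := fun t => F t - ∫ s in (0 : ℝ)..t, g s with hG
  have hWc : ContinuousOn (fun t => ∫ s in (0 : ℝ)..t, g s) (Icc 0 T) := by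
    have := intervalIntegral.continuousOn_primitive_interval' hgi (a := 0) (by simp)
    rwa [uIcc_of_le hT.le] at this
  have hGc : ContinuousOn G (Icc 0 T) := hF.sub hWc
  have hci : ∀ {k : ℝ → ℝ}, ContinuousOn k (Icc 0 T) → IntervalIntegrable k volume 0 T := by
    intro k hk
    refine ContinuousOn.intervalIntegrable ?_
    rwa [uIcc_of_le hT.le]
  have hGt : ∀ ψ, IsTestFun (Ioo 0 T) ψ → ∫ t in (0 : ℝ)..T, deriv ψ t * G t = 0 := by
    intro ψ hψ
    have hdc : Continuous (deriv ψ) := hψ.smooth.continuous_deriv (by simp)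
    have h1 := h ψ hψ
    have h2 : ∫ t in Ioo 0 T, deriv ψ t * f t = ∫ t in Ioo 0 T, deriv ψ t * F t :=
      integral_congr_ae (by filter_upwards [hfF] with t ht; rw [ht])
    rw [h2, hset, hset] at h1
    simp only [hG, mul_sub]
    rw [intervalIntegral.integral_sub (hci (k := fun t => deriv ψ t * F t) (hdc.continuousOn.mul hF))
      (hci (k := fun t => deriv ψ t * ∫ s in (0 : ℝ)..t, g s) (hdc.continuousOn.mul hWc)), hψ.integral_deriv_mul_primitive hgi, h1, sub_self]
  -- Every test function differs from a multiple of a fixed test function of mean one by the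
  -- derivative of another test function. Hence `G` equals the number `c` almost everywhere, and
  -- everywhere by continuity.
  set η : ContDiffBump (T / 2) := ⟨T / 8, T / 4, by positivity, by linarith⟩ with hη
  have hηt : IsTestFun (Ioo 0 T) (η.normed volume) := by
    refine ⟨η.contDiff_normed, η.hasCompactSupport_normed, ?_⟩
    rw [η.tsupport_normed_eq, Real.closedBall_eq_Icc]
    intro x hx
    have h1 : η.rOut = T / 4 := rfl
    rw [h1] at hx
    exact ⟨by linarith [hx.1], by linarith [hx.2]⟩
  have hη1 : ∫ t in (0 : ℝ)..T, η.normed volume t = 1 := by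
    rw [← hset, setIntegral_eq_integral_of_forall_compl_eq_zero fun x hx => hηt.eq_zero_of_notMem hx,
      η.integral_normed]
  set c := ∫ t in (0 : ℝ)..T, η.normed volume t * G t with hc
  have hae : ∀ᵐ t, t ∈ Ioo 0 T → G t - c = 0 := by
    have hGL : IntegrableOn (fun t => G t - c) (Ioo 0 T) := by
      have := hci (hGc.sub (continuousOn_const (c := c)))
      rwa [intervalIntegrable_iff_integrableOn_Ioo_of_le hT.le] at this
    refine isOpen_Ioo.ae_eq_zero_of_integral_contDiff_smul_eq_zero
      hGL.locallyIntegrableOn fun χ hχ hχc hχs => ?_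
    have hχt : IsTestFun (Ioo 0 T) χ := ⟨hχ, hχc, hχs⟩
    set m := ∫ t in (0 : ℝ)..T, χ t with hm
    have hζ : IsTestFun (Ioo 0 T) (fun t => χ t - m * η.normed volume t) := by
      refine ⟨hχ.sub (contDiff_const.mul hηt.smooth), hχc.sub (hηt.compact.mul_left), ?_⟩
      refine (tsupport_sub _ _).trans (union_subset hχs ?_)
      exact (tsupport_mul_subset_right (f := fun _ => m)).trans hηt.supp
    have hζ0 : ∫ t in (0 : ℝ)..T, (χ t - m * η.normed volume t) = 0 := by
      rw [intervalIntegral.integral_sub (hχ.continuous.intervalIntegrable _ _)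
        ((hηt.smooth.continuous.const_mul m).intervalIntegrable _ _) , intervalIntegral.integral_const_mul,
        hη1, mul_one, sub_self]
    obtain ⟨ψ, hψ, hψd⟩ := exists_isTestFun_primitive hζ hζ0
    have h1 := hGt ψ hψ
    rw [hψd] at h1
    have hi1 := hci (k := fun t => χ t * G t) (hχ.continuous.continuousOn.mul hGc)
    have hi2 := hci (k := fun t => η.normed volume t * G t) (hηt.smooth.continuous.continuousOn.mul hGc)
    have hi3 : IntervalIntegrable χ volume 0 T := hχ.continuous.intervalIntegrable _ _
    simp only [sub_mul, mul_assoc] at h1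
    rw [intervalIntegral.integral_sub hi1 (hi2.const_mul m), intervalIntegral.integral_const_mul, ← hc] at h1
    rw [← setIntegral_eq_integral_of_forall_compl_eq_zero (s := Ioo 0 T)
      fun x hx => by rw [hχt.eq_zero_of_notMem hx, zero_smul], hset]
    simp only [smul_eq_mul, mul_sub]
    rw [intervalIntegral.integral_sub hi1 (hi3.mul_const c), intervalIntegral.integral_mul_const]
    exact h1
  have hae' : G =ᵐ[volume.restrict (Icc 0 T)] fun _ => c := by
    rw [← Measure.restrict_congr_set (Ioo_ae_eq_Icc (a := (0 : ℝ)) (b := T))]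
    refine (ae_restrict_iff' measurableSet_Ioo).2 ?_
    filter_upwards [hae] with x hx hxm
    exact sub_eq_zero.1 (hx hxm)
  have heq := Measure.eqOn_Icc_of_ae_eq volume hT.ne hae' hGc continuousOn_const
  have e1 := heq ht
  have e2 := heq (left_mem_Icc.2 hT.le)
  simp only [hG, intervalIntegral.integral_same, sub_zero] at e1 e2
  rw [e2]; linarith

/-- Backward averages of the increments bound the increment itself. -/
theorem ae_sub_le_integral_of_increments {X : Type*} [NormedAddCommGroup X] [NormedSpace ℝ X]
    {T : ℝ} {β : ℝ → ℝ} {β₀ : ℝ} {W : ℝ → StrongDual ℝ X} {z : ℝ → X}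
    (hβ : LocallyIntegrable β) (hβ0 : ∀ t ≤ 0, β t = β₀) (hWm : StronglyMeasurable W)
    (hW : MemLp W 2 volume) (hz : MemLp z 2 (timeMeasure T))
    (h : ∀ k > 0, ∀ᵐ t ∂timeMeasure T, β t - β (t - k) ≤ (∫ s in (t - k)..t, W s) (z t)) :
    ∀ᵐ t ∂timeMeasure T, β t - β₀ ≤ ∫ s in Ioo 0 t, W s (z s) := by
  set η : ℕ → ℝ := fun k => 1 / ((k : ℝ) + 1) with hη
  have hη0 : ∀ k, 0 < η k := fun k => by positivity
  have hηt : Tendsto η atTop (𝓝 0) := tendsto_one_div_add_atTop_nhds_zero_nat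
  -- The uniform measure on `(-η_k, 0)` gives the backward averages `A k t`, the means of `W` over
  -- `(t - η_k, t)`; they converge to `W` in `L²`.
  set ν : ℕ → Measure ℝ := fun k => ENNReal.ofReal (η k)⁻¹ • volume.restrict (Ioo (-η k) 0) with hν
  have hνp : ∀ k, IsProbabilityMeasure (ν k) := fun k => ⟨by
    rw [hν, Measure.smul_apply, Measure.restrict_apply_univ, Real.volume_Ioo, smul_eq_mul,
      zero_sub, neg_neg, ENNReal.ofReal_inv_of_pos (hη0 k)]
    exact ENNReal.inv_mul_cancel (by simpa using hη0 k) ENNReal.ofReal_ne_top⟩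
  have hνs : ∀ ε > 0, ∀ᶠ k in atTop, ∀ᵐ y ∂ν k, ‖y‖ < ε := by
    intro ε hε
    filter_upwards [hηt.eventually (Iio_mem_nhds hε)] with k hk
    refine Measure.ae_smul_measure ((ae_restrict_iff' measurableSet_Ioo).2
      (Eventually.of_forall fun y hy => ?_)) _
    rw [Real.norm_eq_abs, abs_lt]
    have hk' : η k < ε := hk
    constructor <;> linarith [hy.1, hy.2]
  have conv := tendsto_eLpNorm_average volume hWm hW ν hνs
  set A : ℕ → ℝ → StrongDual ℝ X := fun k x => ∫ y, W (x + y) ∂ν k with hA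
  have hWL : LocallyIntegrable W volume := hW.locallyIntegrable one_le_two
  have hAe : ∀ k x, A k x = (η k)⁻¹ • ∫ s in (x - η k)..x, W s := by
    intro k x
    simp only [hA, hν]
    rw [integral_smul_measure, ENNReal.toReal_ofReal (inv_nonneg.2 (hη0 k).le),
      ← integral_Ioc_eq_integral_Ioo, ← intervalIntegral.integral_of_le (by linarith [hη0 k]),
      intervalIntegral.integral_comp_add_left, add_zero, ← sub_eq_add_neg]
  have hAm : ∀ k, StronglyMeasurable (A k) := fun k =>
    StronglyMeasurable.integral_prod_right' (ν := ν k) (f := fun z : ℝ × ℝ => W (z.1 + z.2))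
      (hWm.comp_measurable (measurable_fst.add measurable_snd))
  have hm : volume.restrict (Ioo 0 T) ≤ volume := Measure.restrict_le_self
  have hmul : ∀ {V : ℝ → StrongDual ℝ X}, StronglyMeasurable V → ∀ t₁, t₁ ≤ T →
      ∫⁻ t in Ioo 0 t₁, ‖V t (z t)‖ₑ ≤ eLpNorm V 2 volume * eLpNorm z 2 (timeMeasure T) := by
    intro V hV t₁ ht₁
    have := ENNReal.lintegral_mul_le_Lp_mul_Lq (timeMeasure T) Real.HolderConjugate.two_two
      hV.aestronglyMeasurable.enorm hz.1.enorm
    calc ∫⁻ t in Ioo 0 t₁, ‖V t (z t)‖ₑ ≤ ∫⁻ t in Ioo 0 T, ‖V t‖ₑ * ‖z t‖ₑ :=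
          (lintegral_mono fun t => (V t).le_opENorm _).trans
            (lintegral_mono_set (Ioo_subset_Ioo_right ht₁))
      _ ≤ eLpNorm V 2 (timeMeasure T) * eLpNorm z 2 (timeMeasure T) := by
          refine this.trans (le_of_eq ?_)
          rw [eLpNorm_eq_lintegral_rpow_enorm_toReal (by simp) (by simp),
            eLpNorm_eq_lintegral_rpow_enorm_toReal (by simp) (by simp), ENNReal.toReal_ofNat]
      _ ≤ _ := mul_le_mul_left (eLpNorm_mono_measure _ hm) _
  have hVz : ∀ {V : ℝ → StrongDual ℝ X}, StronglyMeasurable V → eLpNorm V 2 volume < ⊤ →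
      ∀ t₁, t₁ ≤ T → IntegrableOn (fun t => V t (z t)) (Ioo 0 t₁) := by
    intro V hV hVt t₁ ht₁
    have hzm : AEStronglyMeasurable z (volume.restrict (Ioo 0 t₁)) :=
      hz.1.mono_measure (Measure.restrict_mono (Ioo_subset_Ioo_right ht₁) le_rfl)
    have hj : AEStronglyMeasurable (fun t => V t (z t)) (volume.restrict (Ioo 0 t₁)) :=
      isBoundedBilinearMap_apply.continuous.comp_aestronglyMeasurable
        (hV.aestronglyMeasurable.prodMk hzm)
    exact ⟨hj, (hmul hV t₁ ht₁).trans_lt (ENNReal.mul_lt_top hVt hz.2)⟩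
  have hβi : ∀ a b, IntervalIntegrable β volume a b := fun a b =>
    intervalIntegrable_iff.2 ((hβ.integrableOn_isCompact isCompact_uIcc).mono_set uIoc_subset_uIcc)
  refine (ae_restrict_iff' measurableSet_Ioo).2 ?_
  -- The argument works at those `t₁` where the primitive of `β` has derivative `β t₁`; no
  -- continuity of `β` in time is needed.
  filter_upwards [_root_.LocallyIntegrable.ae_hasDerivAt_integral hβ] with t₁ hd ht₁
  have hd := hd 0
  rw [hasDerivAt_iff_tendsto_slope_zero] at hd
  have hηn : Tendsto (fun k => -η k) atTop (𝓝[≠] 0) := by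
    refine tendsto_nhdsWithin_iff.2 ⟨by simpa using hηt.neg, Eventually.of_forall fun k => ?_⟩
    exact neg_ne_zero.2 (hη0 k).ne'
  have hL := (hd.comp hηn).sub_const β₀
  have hR : Tendsto (fun k => ∫ t in Ioo 0 t₁, A k t (z t)) atTop (𝓝 (∫ t in Ioo 0 t₁, W t (z t))) := by
    have hfin : ∀ᶠ k in atTop, eLpNorm (fun x => A k x - W x) 2 volume < ⊤ :=
      conv.eventually (Iio_mem_nhds ENNReal.zero_lt_top)
    refine tendsto_integral_of_L1 _ (hVz hWm hW.2 t₁ ht₁.2.le).1 ?_ ?_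
    · filter_upwards [hfin] with k hk
      have h1 := (hVz ((hAm k).sub hWm) hk t₁ ht₁.2.le).add (hVz hWm hW.2 t₁ ht₁.2.le)
      refine h1.congr (Eventually.of_forall fun t => ?_)
      simp
    · have h0 := ENNReal.Tendsto.mul_const (b := eLpNorm z 2 (timeMeasure T)) conv (Or.inr hz.2.ne)
      rw [zero_mul] at h0
      refine tendsto_of_tendsto_of_tendsto_of_le_of_le tendsto_const_nhds h0 (fun _ => zero_le)
        fun k => ?_
      exact hmul ((hAm k).sub hWm) t₁ ht₁.2.le
  refine le_of_tendsto_of_tendsto hL hR ?_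
  filter_upwards [conv.eventually (Iio_mem_nhds ENNReal.zero_lt_top),
    hηt.eventually (Iio_mem_nhds ht₁.1)] with k hk hkt
  have hAi : IntegrableOn (fun t => A k t (z t)) (Ioo 0 t₁) := by
    have h1 := (hVz ((hAm k).sub hWm) hk t₁ ht₁.2.le).add (hVz hWm hW.2 t₁ ht₁.2.le)
    refine h1.congr (Eventually.of_forall fun t => ?_)
    simp
  have hi1 : IntervalIntegrable (fun t => β t - β (t - η k)) volume 0 t₁ := by
    have h1 := (hβi (0 - η k) (t₁ - η k)).comp_sub_right (η k)
    rw [sub_add_cancel, sub_add_cancel] at h1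
    exact (hβi 0 t₁).sub h1
  have h2 : ∫ t in (0 : ℝ)..t₁, (β t - β (t - η k)) ≤ ∫ t in Ioo 0 t₁, η k * A k t (z t) := by
    rw [intervalIntegral.integral_of_le ht₁.1.le, integral_Ioc_eq_integral_Ioo]
    refine integral_mono_ae ((intervalIntegrable_iff_integrableOn_Ioo_of_le ht₁.1.le).1 hi1)
      (hAi.const_mul _) ?_
    have h3 := ae_restrict_of_ae_restrict_of_subset (Ioo_subset_Ioo_right ht₁.2.le) (h _ (hη0 k))
    filter_upwards [h3] with t ht
    refine ht.trans (le_of_eq ?_)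
    rw [hAe, smul_apply, smul_eq_mul, mul_inv_cancel_left₀ (hη0 k).ne']
  -- The integral of the increments telescopes to the integral of `β` over `(t₁ - η_k, t₁)` minus
  -- `η_k β₀`, because `β = β₀` for `t ≤ 0`. Divided by `η_k` it tends to `β t₁ - β₀`.
  have h4 : ∫ t in (0 : ℝ)..t₁, (β t - β (t - η k))
      = -((∫ t in (0 : ℝ)..(t₁ + -η k), β t) - ∫ t in (0 : ℝ)..t₁, β t) - η k * β₀ := by
    have h1 := (hβi (0 - η k) (t₁ - η k)).comp_sub_right (η k)
    rw [sub_add_cancel, sub_add_cancel] at h1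
    rw [intervalIntegral.integral_sub (hβi _ _) h1, intervalIntegral.integral_comp_sub_right,
      ← sub_eq_add_neg, ← intervalIntegral.integral_add_adjacent_intervals (hβi (0 - η k) 0) (hβi 0 (t₁ - η k))]
    have h5 : ∫ t in (0 - η k)..0, β t = η k * β₀ := by
      rw [intervalIntegral.integral_congr (g := fun _ => β₀), intervalIntegral.integral_const]
      · simp
      · intro t ht
        rw [uIcc_of_le (by linarith [hη0 k])] at ht
        exact hβ0 t ht.2
    rw [h5]; ring
  rw [h4, integral_const_mul] at h2
  simp only [Function.comp_apply, smul_eq_mul]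
  have h6 : (-η k)⁻¹ * ((∫ t in (0 : ℝ)..(t₁ + -η k), β t) - ∫ t in (0 : ℝ)..t₁, β t) - β₀
      = (η k)⁻¹ * (-((∫ t in (0 : ℝ)..(t₁ + -η k), β t) - ∫ t in (0 : ℝ)..t₁, β t) - η k * β₀) := by
    have := (hη0 k).ne'
    field_simp
  rw [h6, inv_mul_le_iff₀ (hη0 k)]
  exact h2

lemma exists_extension {F : Type*} [NormedAddCommGroup F] {T : ℝ} {p : ℝ≥0∞} {w : ℝ → F}
    (hw : MemLp w p (timeMeasure T)) : ∃ W : ℝ → F, StronglyMeasurable W ∧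
      W =ᵐ[timeMeasure T] w ∧ MemLp W p volume ∧ ∀ t, t ∉ Ioo 0 T → W t = 0 := by
  obtain ⟨w', hw', hww'⟩ := hw.1
  exact ⟨(Ioo 0 T).indicator w', hw'.indicator measurableSet_Ioo,
    (indicator_ae_eq_restrict measurableSet_Ioo).trans hww'.symm,
    (memLp_indicator_iff_restrict measurableSet_Ioo).2 (hw.ae_eq hww'),
    fun t ht => indicator_of_notMem ht _⟩

/-- The energy inequality: an integrated chain rule for convex functionals. -/
theorem ae_sub_le_integral_of_convex {X H : Type*} [NormedAddCommGroup X] [NormedSpace ℝ X]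
    [NormedAddCommGroup H] [InnerProductSpace ℝ H] {T : ℝ} (J : X → H) {u : ℝ → H} {u₀ : H}
    {w : ℝ → StrongDual ℝ X} {z : ℝ → X} {b : H → ℝ}
    (hw : MemLp w 2 (timeMeasure T)) (hz : MemLp z 2 (timeMeasure T))
    (hbi : Integrable (fun t => b (u t)) (timeMeasure T))
    (hu : ∀ᵐ t ∂timeMeasure T, ∀ φ, inner ℝ (J φ) (u t) - inner ℝ (J φ) u₀ = ∫ s in (0 : ℝ)..t, w s φ)
    (hb : ∀ᵐ t ∂timeMeasure T, ∀ v, b (u t) - b v ≤ inner ℝ (J (z t)) (u t - v)) :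
    ∀ᵐ t ∂timeMeasure T, b (u t) - b u₀ ≤ ∫ s in Ioo 0 t, w s (z s) := by
  classical
  obtain ⟨W, hWm, hWw, hWL, hW0⟩ := exists_extension hw
  have hWl : LocallyIntegrable W volume := hWL.locallyIntegrable one_le_two
  have hWi : ∀ a b, IntervalIntegrable W volume a b := fun a b =>
    intervalIntegrable_iff.2 ((hWl.integrableOn_isCompact isCompact_uIcc).mono_set uIoc_subset_uIcc)
  -- Extension by the initial value makes backward increments meaningful for `t < k` and compatible
  -- with the extension of `w` by zero. Values beyond `T` are never used.
  set ũ : ℝ → H := fun t => if t ∈ Ioo 0 T then u t else u₀ with hũ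
  have hkey : ∀ᵐ t, t < T → ∀ φ, inner ℝ (J φ) (ũ t) - inner ℝ (J φ) u₀ = (∫ s in (0 : ℝ)..t, W s) φ := by
    filter_upwards [(ae_restrict_iff' measurableSet_Ioo).1 hu] with t ht htT φ
    have happ : ∀ c, (∫ s in (0 : ℝ)..c, W s) φ = ∫ s in (0 : ℝ)..c, W s φ :=
      fun c => ContinuousLinearMap.intervalIntegral_apply (hWi 0 c) φ
    rw [happ]
    by_cases htm : t ∈ Ioo 0 T
    · rw [hũ]; simp only [if_pos htm]
      rw [ht htm φ, intervalIntegral.integral_of_le htm.1.le, intervalIntegral.integral_of_le htm.1.le,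
        integral_Ioc_eq_integral_Ioo, integral_Ioc_eq_integral_Ioo]
      refine integral_congr_ae ?_
      filter_upwards [ae_restrict_of_ae_restrict_of_subset (Ioo_subset_Ioo_right htT.le) hWw] with s hs
      rw [hs]
    · have ht0 : t ≤ 0 := le_of_not_gt fun h => htm ⟨h, htT⟩
      rw [hũ]; simp only [if_neg htm, sub_self]
      refine (intervalIntegral.integral_congr (g := fun _ => 0) fun s hs => ?_).trans intervalIntegral.integral_zero |>.symm
      rw [uIcc_of_ge ht0] at hs
      have : W s = 0 := hW0 s fun h => absurd h.1 (not_lt.2 hs.2)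
      simp [this]
  have hmain := ae_sub_le_integral_of_increments (T := T) (β := fun t => b (ũ t)) (β₀ := b u₀) (W := W)
    (z := z) ?_ ?_ hWm hWL hz ?_
  · refine (ae_restrict_iff' measurableSet_Ioo).2 ?_
    filter_upwards [(ae_restrict_iff' measurableSet_Ioo).1 hmain] with t ht htm
    have h1 := ht htm
    simp only [hũ, if_pos htm] at h1
    refine h1.trans (le_of_eq (integral_congr_ae ?_))
    filter_upwards [ae_restrict_of_ae_restrict_of_subset (Ioo_subset_Ioo_right htm.2.le) hWw] with s hs
    rw [hs]
  · have h1 : (fun t => b (ũ t)) = fun t => (Ioo 0 T).indicator (fun t => b (u t) - b u₀) t + b u₀ := by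
      ext t
      by_cases ht : t ∈ Ioo 0 T
      · rw [indicator_of_mem ht, sub_add_cancel]; simp only [hũ, if_pos ht]
      · rw [indicator_of_notMem ht, zero_add]; simp only [hũ, if_neg ht]
    rw [h1]
    have h2 : Integrable (fun t => b (u t) - b u₀) (timeMeasure T) := hbi.sub (integrable_const _)
    exact ((integrable_indicator_iff measurableSet_Ioo).2 h2).locallyIntegrable.add
      (locallyIntegrable_const _)
  · intro t ht
    have : t ∉ Ioo 0 T := fun h => absurd h.1 (not_lt.2 ht)
    simp only [hũ, if_neg this]
  · intro k hk
    have hshift : ∀ᵐ t, t - k < T → ∀ φ, inner ℝ (J φ) (ũ (t - k)) - inner ℝ (J φ) u₀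
        = (∫ s in (0 : ℝ)..(t - k), W s) φ :=
      (measurePreserving_sub_right volume k).quasiMeasurePreserving.ae hkey
    refine (ae_restrict_iff' measurableSet_Ioo).2 ?_
    -- Convexity bounds the increment by the pairing of the subgradient at time `t` with `u(t) -
    -- u(t-k)`. That difference, tested with elements of `X`, is the integral of the derivative;
    -- only `z`, and not `u`, has to take values in `X`.
    filter_upwards [hkey, hshift, (ae_restrict_iff' measurableSet_Ioo).1 hb] with t h1 h2 h3 ht
    have e1 := h1 ht.2 (z t)
    have e2 := h2 (by linarith [ht.2]) (z t)
    have e3 := h3 ht (ũ (t - k))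
    have e4 : ũ t = u t := by simp only [hũ, if_pos ht]
    rw [e4] at e1
    rw [inner_sub_right] at e3
    have e5 : (∫ s in (t - k)..t, W s) = (∫ s in (0 : ℝ)..t, W s) - ∫ s in (0 : ℝ)..(t - k), W s :=
      (intervalIntegral.integral_interval_sub_left (hWi _ _) (hWi _ _)).symm
    simp only [e4]
    rw [e5, sub_apply]
    linarith

section Abstract

variable {X H : Type*} [NormedAddCommGroup X] [NormedSpace ℝ X] [NormedAddCommGroup H]
  [InnerProductSpace ℝ H]

/-- The map `v ↦ ⟪v, J ·⟫` from a Hilbert space into the dual of a space that is mapped into it. -/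
def dualOf (J : X →L[ℝ] H) : H →L[ℝ] StrongDual ℝ X :=
  ((ContinuousLinearMap.compL ℝ X H ℝ).flip J).comp (innerSL ℝ)

lemma dualOf_apply (J : X →L[ℝ] H) (v : H) (φ : X) : dualOf J v φ = inner ℝ v (J φ) := rfl

/-- `w` is the distributional derivative of `F` on `(0,T)`. -/
def IsWeakDeriv (T : ℝ) (F w : ℝ → StrongDual ℝ X) : Prop :=
  ∀ ψ : ℝ → ℝ, IsTestFun (Ioo 0 T) ψ → ∀ φ : X,
    ∫ t in Ioo 0 T, deriv ψ t * F t φ = - ∫ t in Ioo 0 T, ψ t * w t φ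

lemma integrable_dual_apply {α : Type*} [MeasurableSpace α] {μ : Measure α} {w : α → StrongDual ℝ X}
    {z : α → X} (hw : MemLp w 2 μ) (hz : MemLp z 2 μ) : Integrable (fun t => w t (z t)) μ :=
  memLp_one_iff_integrable.1 ((ContinuousLinearMap.id ℝ (StrongDual ℝ X)).memLp_of_bilin 1 hw hz)

lemma integrable_dual_apply_const {T : ℝ} {w : ℝ → StrongDual ℝ X} (hw : MemLp w 2 (timeMeasure T))
    (φ : X) : Integrable (fun t => w t φ) (timeMeasure T) :=
  integrable_dual_apply hw (memLp_const φ)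

/-- The exceptional set of times comes only from the comparison of `F` with its continuous
representative, and so does not depend on `φ`; no separability of `X` is required. -/
lemma IsWeakDeriv.sub_eq_integral {T : ℝ} (hT : 0 < T) {F w : ℝ → StrongDual ℝ X} {U : ℝ → X → ℝ}
    (hw : MemLp w 2 (timeMeasure T)) (h : IsWeakDeriv T F w)
    (hU : ∀ φ, ContinuousOn (fun t => U t φ) (Icc 0 T))
    (hUF : ∀ᵐ t ∂timeMeasure T, ∀ φ, U t φ = F t φ) :
    ∀ᵐ t ∂timeMeasure T, ∀ φ, F t φ - U 0 φ = ∫ s in (0 : ℝ)..t, w s φ := by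
  filter_upwards [hUF, ae_restrict_mem measurableSet_Ioo] with t ht htm φ
  rw [← ht]
  refine sub_eq_integral_of_weakDeriv hT (integrable_dual_apply_const hw φ)
    (F := fun t => U t φ) (hU φ) ?_ (fun ψ hψ => h ψ hψ φ)
    (Ioo_subset_Icc_self htm)
  filter_upwards [hUF] with s hs
  exact (hs φ).symm

lemma memLp_exp_smul {T : ℝ} {p : ℝ≥0∞} {u : ℝ → X}
    (hu : MemLp u p (timeMeasure T)) (μ : ℝ) :
    MemLp (fun t => Real.exp (μ * t) • u t) p (timeMeasure T) := by
  have hc : Continuous fun t => Real.exp (μ * t) := by fun_prop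
  refine MemLp.of_le_mul (c := Real.exp (|μ| * |T|)) hu
    (hc.aestronglyMeasurable.smul hu.1) ?_
  filter_upwards [ae_restrict_mem measurableSet_Ioo] with t ht
  rw [norm_smul, Real.norm_of_nonneg (Real.exp_pos _).le]
  refine mul_le_mul_of_nonneg_right (Real.exp_le_exp.2 ?_) (norm_nonneg _)
  refine (le_abs_self _).trans ?_
  rw [abs_mul, abs_of_pos ht.1, abs_of_pos (ht.1.trans ht.2)]
  exact mul_le_mul_of_nonneg_left ht.2.le (abs_nonneg _)

/-- The product rule for the derivative of `e^{μt}F`. -/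
lemma IsWeakDeriv.exp_smul {T : ℝ} {F w : ℝ → StrongDual ℝ X} (hF : MemLp F 2 (timeMeasure T))
    (hw : MemLp w 2 (timeMeasure T)) (h : IsWeakDeriv T F w) (μ : ℝ) :
    IsWeakDeriv T (fun t => Real.exp (μ * t) • F t)
      (fun t => Real.exp (μ * t) • w t + (μ * Real.exp (μ * t)) • F t) := by
  intro ψ hψ φ
  have hc : ContDiff ℝ ∞ fun t => Real.exp (μ * t) := by fun_prop
  have hed : ∀ t, HasDerivAt (fun t => Real.exp (μ * t)) (μ * Real.exp (μ * t)) t := fun t => by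
    have := ((hasDerivAt_id t).const_mul μ).exp
    simpa [mul_comm] using this
  have hψ' : IsTestFun (Ioo 0 T) fun t => Real.exp (μ * t) * ψ t :=
    ⟨hc.mul hψ.smooth, hψ.compact.mul_left, (tsupport_mul_subset_right).trans hψ.supp⟩
  have hder : ∀ t, deriv (fun t => Real.exp (μ * t) * ψ t) t
      = μ * Real.exp (μ * t) * ψ t + Real.exp (μ * t) * deriv ψ t := fun t =>
    ((hed t).mul (hψ.smooth.differentiable (by simp) t).hasDerivAt).deriv
  have h1 := h _ hψ' φ
  have hI1 := integrable_dual_apply_const hF φ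
  have hI2 := integrable_dual_apply_const hw φ
  have hb : ∀ {k : ℝ → ℝ}, Continuous k → HasCompactSupport k → ∀ {g : ℝ → ℝ},
      Integrable g (timeMeasure T) → Integrable (fun t => k t * g t) (timeMeasure T) := by
    intro k hk hkc g hg
    obtain ⟨K, hK⟩ := hkc.exists_bound_of_continuous hk
    exact hg.bdd_mul hk.aestronglyMeasurable (Eventually.of_forall hK)
  have hdc : Continuous (deriv ψ) := hψ.smooth.continuous_deriv (by simp)
  have i1 := hb (k := fun t => μ * Real.exp (μ * t) * ψ t)
    ((continuous_const.mul hc.continuous).mul hψ.smooth.continuous) hψ.compact.mul_left hI1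
  have i2 := hb (k := fun t => Real.exp (μ * t) * deriv ψ t)
    (hc.continuous.mul hdc) hψ.compact.deriv.mul_left hI1
  have i3 := hb (k := fun t => Real.exp (μ * t) * ψ t)
    (hc.continuous.mul hψ.smooth.continuous) hψ.compact.mul_left hI2
  simp only [hder, add_mul] at h1
  rw [integral_add i1 i2] at h1
  have e1 : ∫ t in Ioo 0 T, ψ t * (Real.exp (μ * t) • w t + (μ * Real.exp (μ * t)) • F t) φ
      = (∫ t in Ioo 0 T, Real.exp (μ * t) * ψ t * w t φ) + ∫ t in Ioo 0 T, μ * Real.exp (μ * t) * ψ t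
        * F t φ := by
    rw [← integral_add i3 i1]
    refine integral_congr_ae (Eventually.of_forall fun t => ?_)
    simp only [add_apply, smul_apply, smul_eq_mul]
    ring
  have e2 : ∫ t in Ioo 0 T, deriv ψ t * (Real.exp (μ * t) • F t) φ
      = ∫ t in Ioo 0 T, Real.exp (μ * t) * deriv ψ t * F t φ := by
    refine integral_congr_ae (Eventually.of_forall fun t => ?_)
    simp only [smul_apply, smul_eq_mul]
    ring
  rw [e1, e2]
  linarith

/-- `S` carries the induced topology, so measurability in `X` passes to `S` once the values on a
null set are replaced by zero. -/
lemma exists_memLp_submodule {S : Submodule ℝ X} {T : ℝ} {u : ℝ → X}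
    (hu : MemLp u 2 (timeMeasure T)) (h : ∀ᵐ t ∂timeMeasure T, u t ∈ S) :
    ∃ z : ℝ → S, MemLp z 2 (timeMeasure T) ∧ ∀ᵐ t ∂timeMeasure T, (z t : X) = u t := by
  classical
  obtain ⟨z, hz⟩ : ∃ z : ℝ → S, ∀ t, u t ∈ S → (z t : X) = u t :=
    ⟨fun t => if ht : u t ∈ S then ⟨u t, ht⟩ else 0, fun t ht => by simp only [dif_pos ht]⟩
  have hzu : ∀ᵐ t ∂timeMeasure T, (z t : X) = u t := h.mono hz
  refine ⟨z, ?_, hzu⟩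
  have hm : AEStronglyMeasurable (fun t => (z t : X)) (timeMeasure T) :=
    hu.1.congr (hzu.mono fun t ht => ht.symm)
  have hzm : AEStronglyMeasurable z (timeMeasure T) :=
    (Topology.IsEmbedding.subtypeVal.aestronglyMeasurable_comp_iff).1 hm
  refine (memLp_congr_norm hu.1 hzm ?_).1 hu
  filter_upwards [hzu] with t ht
  rw [← ht]; rfl

/-- `v(0) = v₀` for the representative of `v` that is continuous with values in the dual of `X`. -/
def HasInitial (J : X →L[ℝ] H) (T : ℝ) (v : ℝ → H) (v₀ : H) : Prop :=
  ∃ U : ℝ → X → ℝ, (∀ φ, ContinuousOn (fun t => U t φ) (Icc 0 T)) ∧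
    (∀ᵐ t ∂timeMeasure T, ∀ φ, U t φ = inner ℝ (v t) (J φ)) ∧ ∀ φ, U 0 φ = inner ℝ v₀ (J φ)

theorem HasInitial.inner_sub_eq_integral {J : X →L[ℝ] H} {T : ℝ} (hT : 0 < T) {v : ℝ → H} {v₀ : H}
    (h₀ : HasInitial J T v v₀) {w : ℝ → StrongDual ℝ X} (hw : MemLp w 2 (timeMeasure T))
    (h : IsWeakDeriv T (fun t => dualOf J (v t)) w) :
    ∀ᵐ t ∂timeMeasure T, ∀ φ, inner ℝ (J φ) (v t) - inner ℝ (J φ) v₀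
      = ∫ s in (0 : ℝ)..t, w s φ := by
  obtain ⟨U, hU, hUv, hU0⟩ := h₀
  filter_upwards [h.sub_eq_integral hT hw hU hUv] with t ht φ
  rw [← ht φ, hU0, dualOf_apply, real_inner_comm, real_inner_comm v₀]

lemma HasInitial.exp_smul {J : X →L[ℝ] H} {T : ℝ} {v : ℝ → H} {v₀ : H}
    (h₀ : HasInitial J T v v₀) (μ : ℝ) :
    HasInitial J T (fun t => Real.exp (μ * t) • v t) v₀ := by
  obtain ⟨U, hU, hUv, hU0⟩ := h₀
  have hc : Continuous fun t => Real.exp (μ * t) := by fun_prop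
  refine ⟨fun t φ => Real.exp (μ * t) * U t φ, fun φ => hc.continuousOn.mul (hU φ), ?_,
    fun φ => ?_⟩
  · filter_upwards [hUv] with t ht φ
    rw [inner_smul_left, ← ht]
    rfl
  · simp only [mul_zero, Real.exp_zero, one_mul, hU0]

lemma memLp_dualOf (J : X →L[ℝ] H) {T : ℝ} {v : ℝ → H} (hv : MemLp v 2 (timeMeasure T)) :
    MemLp (fun t => dualOf J (v t)) 2 (timeMeasure T) :=
  (dualOf J).comp_memLp' hv

/-- The energy inequality for a convex functional of `e^{μt}v`. -/
theorem ae_exp_smul_sub_le_integral [CompleteSpace H] {J : X →L[ℝ] H} {T : ℝ} (hT : 0 < T)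
    {v : ℝ → H} {v₀ : H} (hv : MemLp v 2 (timeMeasure T)) (h₀ : HasInitial J T v v₀)
    {w : ℝ → StrongDual ℝ X} (hw : MemLp w 2 (timeMeasure T))
    (h : IsWeakDeriv T (fun t => dualOf J (v t)) w) (μ : ℝ) {z : ℝ → X}
    (hz : MemLp z 2 (timeMeasure T)) {b : H → ℝ}
    (hbi : Integrable (fun t => b (Real.exp (μ * t) • v t)) (timeMeasure T))
    (hb : ∀ᵐ t ∂timeMeasure T, ∀ y, b (Real.exp (μ * t) • v t) - b y
      ≤ inner ℝ (J (z t)) (Real.exp (μ * t) • v t - y)) :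
    ∀ᵐ t ∂timeMeasure T, b (Real.exp (μ * t) • v t) - b v₀
      ≤ ∫ s in Ioo 0 t, Real.exp (μ * s) * (w s (z s) + μ * inner ℝ (v s) (J (z s))) := by
  have hF := memLp_dualOf J hv
  have hw' : MemLp (fun t => Real.exp (μ * t) • w t + (μ * Real.exp (μ * t)) • dualOf J (v t)) 2
      (timeMeasure T) := by
    simp only [mul_smul]
    exact (memLp_exp_smul hw μ).add ((memLp_exp_smul hF μ).const_smul μ)
  have h' := h.exp_smul hF hw μ
  simp only [← map_smul] at h'
  have hu := (h₀.exp_smul μ).inner_sub_eq_integral hT (by simpa only [map_smul] using hw') h'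
  simp only [map_smul] at hu
  filter_upwards [ae_sub_le_integral_of_convex J hw' hz hbi hu hb] with t ht
  refine ht.trans (le_of_eq ?_)
  refine integral_congr_ae (Eventually.of_forall fun s => ?_)
  simp only [add_apply, smul_apply, smul_eq_mul, dualOf_apply]
  ring

/-- The energy inequality for the difference of two functions with the same initial value. -/
theorem ae_norm_sub_sq_le_integral [CompleteSpace H] {J : X →L[ℝ] H} {T : ℝ} (hT : 0 < T)
    {v v' : ℝ → H} {v₀ : H} (hv : MemLp v 2 (timeMeasure T)) (hv' : MemLp v' 2 (timeMeasure T))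
    (h₀ : HasInitial J T v v₀) (h₀' : HasInitial J T v' v₀)
    {w w' : ℝ → StrongDual ℝ X} (hw : MemLp w 2 (timeMeasure T)) (hw' : MemLp w' 2 (timeMeasure T))
    (h : IsWeakDeriv T (fun t => dualOf J (v t)) w)
    (h' : IsWeakDeriv T (fun t => dualOf J (v' t)) w') {z : ℝ → X}
    (hz : MemLp z 2 (timeMeasure T)) (hzv : ∀ᵐ t ∂timeMeasure T, J (z t) = v t - v' t) :
    ∀ᵐ t ∂timeMeasure T, ‖v t - v' t‖ ^ 2 / 2
      ≤ ∫ s in Ioo 0 t, (w s (z s) - w' s (z s)) := by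
  have hu : ∀ᵐ t ∂timeMeasure T, ∀ φ, inner ℝ (J φ) (v t - v' t) - inner ℝ (J φ) (0 : H)
      = ∫ s in (0 : ℝ)..t, (w s - w' s) φ := by
    filter_upwards [h₀.inner_sub_eq_integral hT hw h, h₀'.inner_sub_eq_integral hT hw' h',
      ae_restrict_mem measurableSet_Ioo] with t h1 h2 ht φ
    have hI : ∀ {k : ℝ → StrongDual ℝ X}, MemLp k 2 (timeMeasure T) →
        IntervalIntegrable (fun s => k s φ) volume 0 t := fun hk =>
      (intervalIntegrable_iff_integrableOn_Ioo_of_le ht.1.le).2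
        (IntegrableOn.mono_set (integrable_dual_apply_const hk φ) (Ioo_subset_Ioo_right ht.2.le))
    simp only [sub_apply]
    rw [intervalIntegral.integral_sub (hI hw) (hI hw'), ← h1, ← h2, inner_sub_right,
      inner_zero_right]
    ring
  have hbi : Integrable (fun t => ‖v t - v' t‖ ^ 2 / 2) (timeMeasure T) :=
    ((memLp_two_iff_integrable_sq_norm (hv.sub hv').1).1 (hv.sub hv')).div_const 2
  -- The convex functional is half the squared norm. Its subgradient at `v - v'` is `v - v'` itself,
  -- which comes from `X` by hypothesis.
  have key := ae_sub_le_integral_of_convex J (w := fun t => w t - w' t) (hw.sub hw') hz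
    (b := fun y => ‖y‖ ^ 2 / 2) (u := fun t => v t - v' t) (u₀ := 0) hbi hu ?_
  · filter_upwards [key] with t ht
    simpa using ht
  · filter_upwards [hzv] with t ht y
    rw [ht]
    have e := norm_sub_sq_real (v t - v' t) y
    have e0 : 0 ≤ ‖v t - v' t - y‖ ^ 2 := sq_nonneg _
    rw [inner_sub_right, real_inner_self_eq_norm_sq]
    linarith

end Abstract

/-! ### The energy inequality in `H₀¹(Ω ∪ Γ_N)` and Hölder estimates in `L²(Ω)` -/

instance {d : ℕ} (Ω ΓD : Set (E d)) : NormedAddCommGroup (H10 Ω ΓD) := Submodule.normedAddCommGroup _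

instance {d : ℕ} (Ω ΓD : Set (E d)) : NormedSpace ℝ (H10 Ω ΓD) := Submodule.normedSpace _

/-- The `L²`-component of an element of `H¹(Ω)`. -/
def fnL {d : ℕ} (Ω : Set (E d)) : H1 Ω →L[ℝ] Lp ℝ 2 (volume.restrict Ω) :=
  (WithLp.fstL 2 ℝ (Lp ℝ 2 (volume.restrict Ω)) (Lp (E d) 2 (volume.restrict Ω))).comp
    (H1 Ω).subtypeL

lemma coeFn_fnL {d : ℕ} {Ω : Set (E d)} (u : H1 Ω) : (fnL Ω u : E d → ℝ) = fn u := rfl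

/-- The embedding of `H₀¹(Ω ∪ Γ_N)` into `L²(Ω)`. -/
def toL2 {d : ℕ} (Ω ΓD : Set (E d)) : H10 Ω ΓD →L[ℝ] Lp ℝ 2 (volume.restrict Ω) :=
  (fnL Ω).comp (H10 Ω ΓD).subtypeL

lemma toL2_apply {d : ℕ} {Ω ΓD : Set (E d)} (φ : H10 Ω ΓD) :
    toL2 Ω ΓD φ = fnL Ω φ := rfl

lemma inner_fnL {d : ℕ} {Ω : Set (E d)} (u v : H1 Ω) :
    inner ℝ (fnL Ω u) (fnL Ω v) = ∫ x in Ω, fn u x * fn v x := by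
  rw [L2.inner_def]
  refine integral_congr_ae (Eventually.of_forall fun x => ?_)
  simp [coeFn_fnL, mul_comm]

lemma inner_toLp {d : ℕ} {Ω : Set (E d)} (v : H1 Ω) {f : E d → ℝ}
    (hf : MemLp f 2 (volume.restrict Ω)) :
    inner ℝ (hf.toLp f) (fnL Ω v) = ∫ x in Ω, f x * fn v x := by
  rw [L2.inner_def]
  refine integral_congr_ae ?_
  filter_upwards [hf.coeFn_toLp] with x hx
  rw [hx]; simp [coeFn_fnL, mul_comm]

lemma memLp_fnL {d : ℕ} {Ω : Set (E d)} {T : ℝ} {u : ℝ → H1 Ω}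
    (hu : MemLp u 2 (timeMeasure T)) : MemLp (fun t => fnL Ω (u t)) 2 (timeMeasure T) :=
  ContinuousLinearMap.comp_memLp' (𝕜 := ℝ) (𝕜' := ℝ) (E := H1 Ω) (fnL Ω) hu

lemma IsTimeDeriv.isWeakDeriv {d : ℕ} {Ω ΓD : Set (E d)} {T : ℝ} {u : ℝ → H1 Ω}
    {w : ℝ → HMinus1 Ω ΓD} (h : IsTimeDeriv T u w) :
    IsWeakDeriv (X := H10 Ω ΓD) T (fun t => dualOf (toL2 Ω ΓD) (fnL Ω (u t))) w := by
  intro ψ hψ φ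
  simp only [dualOf_apply, toL2_apply, inner_fnL]
  exact h ψ hψ φ

lemma HasInitialValue.hasInitial {d : ℕ} {Ω ΓD : Set (E d)} {T : ℝ} {u : ℝ → H1 Ω} {u₀ : E d → ℝ}
    (h : HasInitialValue ΓD T u u₀) (hu₀ : MemLp u₀ 2 (volume.restrict Ω)) :
    HasInitial (toL2 Ω ΓD) T (fun t => fnL Ω (u t)) (hu₀.toLp u₀) := by
  rcases h with ⟨U, h₁⟩
  refine ⟨fun t φ => U t φ, fun φ => h₁.1.eval_const φ, h₁.2.1.mono fun t ht φ => ?_, fun φ => ?_⟩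
  · rw [toL2_apply, inner_fnL]; exact ht φ
  · rw [toL2_apply, inner_toLp]; exact h₁.2.2 φ

/-- The energy inequality for the difference of two functions with the same initial value. -/
theorem IsTimeDeriv.ae_norm_sub_sq_le_integral {d : ℕ} {Ω ΓD : Set (E d)} {T : ℝ} (hT : 0 < T)
    {u u' : ℝ → H1 Ω} (hu : MemLp u 2 (timeMeasure T)) (hu' : MemLp u' 2 (timeMeasure T))
    {w w' : ℝ → HMinus1 Ω ΓD} (hw : MemLp w 2 (timeMeasure T)) (hw' : MemLp w' 2 (timeMeasure T))
    (h : IsTimeDeriv T u w) (h' : IsTimeDeriv T u' w')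
    {u₀ : E d → ℝ} (h₀ : HasInitialValue ΓD T u u₀) (h₀' : HasInitialValue ΓD T u' u₀)
    (hu₀ : MemLp u₀ 2 (volume.restrict Ω)) {z : ℝ → H10 Ω ΓD} (hz : MemLp z 2 (timeMeasure T)) (hzu : ∀ᵐ t ∂timeMeasure T,
      (z t : H1 Ω) = u t - u' t) :
    ∀ᵐ t ∂timeMeasure T, ‖fnL Ω (u t) - fnL Ω (u' t)‖ ^ 2 / 2
      ≤ ∫ s in Ioo 0 t, (w s (z s) - w' s (z s)) := by
  refine EnergyTransport.ae_norm_sub_sq_le_integral (J := toL2 Ω ΓD) hT (memLp_fnL hu) (memLp_fnL hu')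
    (h₀.hasInitial hu₀) (h₀'.hasInitial hu₀) hw hw' h.isWeakDeriv h'.isWeakDeriv hz ?_
  filter_upwards [hzu] with t ht
  rw [toL2_apply, ht, map_sub]

/-- The energy inequality for a convex functional of `e^{μt}u`. -/
theorem IsTimeDeriv.ae_exp_smul_sub_le_integral {d : ℕ} {Ω ΓD : Set (E d)} {T : ℝ} (hT : 0 < T)
    {u : ℝ → H1 Ω} (hu : MemLp u 2 (timeMeasure T))
    {w : ℝ → HMinus1 Ω ΓD} (hw : MemLp w 2 (timeMeasure T)) (h : IsTimeDeriv T u w)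
    {u₀ : E d → ℝ} (h₀ : HasInitialValue ΓD T u u₀) (hu₀ : MemLp u₀ 2 (volume.restrict Ω)) (μ : ℝ)
    {z : ℝ → H10 Ω ΓD} (hz : MemLp z 2 (timeMeasure T)) {b : Lp ℝ 2 (volume.restrict Ω) → ℝ}
    (hbi : Integrable (fun t => b (Real.exp (μ * t) • fnL Ω (u t))) (timeMeasure T))
    (hb : ∀ᵐ t ∂timeMeasure T, ∀ y, b (Real.exp (μ * t) • fnL Ω (u t)) - b y
      ≤ inner ℝ (fnL Ω (z t)) (Real.exp (μ * t) • fnL Ω (u t) - y)) :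
    ∀ᵐ t ∂timeMeasure T, b (Real.exp (μ * t) • fnL Ω (u t)) - b (hu₀.toLp u₀)
      ≤ ∫ s in Ioo 0 t, Real.exp (μ * s)
        * (w s (z s) + μ * inner ℝ (fnL Ω (u s)) (fnL Ω (z s))) :=
  EnergyTransport.ae_exp_smul_sub_le_integral (J := toL2 Ω ΓD) hT (memLp_fnL hu)
    (h₀.hasInitial hu₀) hw h.isWeakDeriv μ hz hbi hb

/-- The gradient of an element of `H¹(Ω)`. -/
def gradL {d : ℕ} (Ω : Set (E d)) : H1 Ω →L[ℝ] Lp (E d) 2 (volume.restrict Ω) :=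
  (WithLp.sndL 2 ℝ (Lp ℝ 2 (volume.restrict Ω)) (Lp (E d) 2 (volume.restrict Ω))).comp
    (H1 Ω).subtypeL

lemma coeFn_gradL {d : ℕ} {Ω : Set (E d)} (u : H1 Ω) : (gradL Ω u : E d → E d) = grad u := rfl

lemma inner_gradL {d : ℕ} {Ω : Set (E d)} (u v : H1 Ω) :
    inner ℝ (gradL Ω u) (gradL Ω v) = ∫ x in Ω, inner ℝ (grad u x) (grad v x) := by
  rw [L2.inner_def]
  rfl

lemma norm_fnL_sq {d : ℕ} {Ω : Set (E d)} (u : H1 Ω) : ‖fnL Ω u‖ ^ 2 = ∫ x in Ω, fn u x ^ 2 := by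
  rw [← real_inner_self_eq_norm_sq, inner_fnL]
  simp only [sq]

lemma norm_gradL_sq {d : ℕ} {Ω : Set (E d)} (u : H1 Ω) :
    ‖gradL Ω u‖ ^ 2 = ∫ x in Ω, ‖grad u x‖ ^ 2 := by
  rw [← real_inner_self_eq_norm_sq, inner_gradL]
  simp only [real_inner_self_eq_norm_sq]

lemma norm_sq_eq_fnL_add_gradL {d : ℕ} {Ω : Set (E d)} (u : H1 Ω) :
    ‖u‖ ^ 2 = ‖fnL Ω u‖ ^ 2 + ‖gradL Ω u‖ ^ 2 := norm_H1_sq u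

lemma exists_poincare_norm {d : ℕ} (hd : 1 ≤ d) {Ω ΓD ΓN : Set (E d)}
    (hΩ : IsAdmissibleDomain Ω ΓD ΓN) :
    ∃ C : ℝ, 0 ≤ C ∧ ∀ u ∈ H10 Ω ΓD, ‖fnL Ω u‖ ≤ C * ‖gradL Ω u‖ := by
  obtain ⟨C, hC⟩ := exists_poincare hd hΩ
  refine ⟨C, C.2, fun u hu => ?_⟩
  rw [Lp.norm_def, Lp.norm_def, ← ENNReal.coe_toReal C, ← ENNReal.toReal_mul]
  exact ENNReal.toReal_mono (ENNReal.mul_ne_top ENNReal.coe_ne_top (memLp_grad u).2.ne) (hC u hu)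

section Holder

variable {α A B : Type*} [MeasurableSpace α] {μ : Measure α} [NormedAddCommGroup A]
  [NormedAddCommGroup B]

lemma integrable_of_abs_le_mul (f : Lp A 2 μ) (g : Lp B 2 μ) {F : α → ℝ} {K : ℝ}
    (hF : AEStronglyMeasurable F μ) (h : ∀ᵐ x ∂μ, |F x| ≤ K * (‖f x‖ * ‖g x‖)) :
    Integrable F μ :=
  (((Lp.memLp f).norm.integrable_mul (Lp.memLp g).norm).const_mul K).mono' hF h

/-- Hölder's inequality for a function bounded by a multiple of `|f||g|`. -/
lemma abs_integral_le_mul (f : Lp A 2 μ) (g : Lp B 2 μ) {F : α → ℝ} {K : ℝ} (hK : 0 ≤ K)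
    (h : ∀ᵐ x ∂μ, |F x| ≤ K * (‖f x‖ * ‖g x‖)) : |∫ x, F x ∂μ| ≤ K * (‖f‖ * ‖g‖) := by
  have hf := (Lp.memLp f).norm
  have hg := (Lp.memLp g).norm
  have hi : Integrable (fun x => K * (‖f x‖ * ‖g x‖)) μ := (hf.integrable_mul hg).const_mul K
  refine (norm_integral_le_of_norm_le (f := F) hi h).trans ?_
  rw [integral_const_mul]
  refine mul_le_mul_of_nonneg_left ?_ hK
  have e := real_inner_le_norm (hf.toLp _) (hg.toLp _)
  rw [Lp.norm_toLp, Lp.norm_toLp, eLpNorm_norm, eLpNorm_norm, ← Lp.norm_def, ← Lp.norm_def,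
    L2.inner_def] at e
  refine le_trans (le_of_eq (integral_congr_ae ?_)) e
  filter_upwards [hf.coeFn_toLp, hg.coeFn_toLp] with x h1 h2
  rw [h1, h2, real_inner_eq_re_inner]
  simp [mul_comm]

lemma integrable_norm_mul_norm (f : Lp A 2 μ) (g : Lp B 2 μ) :
    Integrable (fun x => ‖f x‖ * ‖g x‖) μ :=
  (Lp.memLp f).norm.integrable_mul (Lp.memLp g).norm

lemma integral_norm_mul_norm_le (f : Lp A 2 μ) (g : Lp B 2 μ) :
    ∫ x, ‖f x‖ * ‖g x‖ ∂μ ≤ ‖f‖ * ‖g‖ := by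
  have := abs_integral_le_mul f g (F := fun x => ‖f x‖ * ‖g x‖) zero_le_one
    (Eventually.of_forall fun x => by rw [one_mul, abs_of_nonneg (by positivity)])
  rw [one_mul] at this
  exact (le_abs_self _).trans this

end Holder

/-! ### Lower bounds for the temperature and the density -/

/-- A smooth nondecreasing function `β` that is negative below `m` and vanishes above `m`, its
primitive `B`, and the primitive `s ↦ sβ(s) - B(s)` of `s ↦ sβ'(s)`. -/
structure IsCutoff (m : ℝ) (β B : ℝ → ℝ) (L L' : ℝ) : Prop where
  smoothLip : IsSmoothLip β L
  nonpos : ∀ s, β s ≤ 0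
  neg_one_le : ∀ s, -1 ≤ β s
  eq_zero : ∀ s, m ≤ s → β s = 0
  neg : ∀ s < m, β s < 0
  monotone : Monotone β
  hasDerivAt : ∀ s, HasDerivAt B (β s) s
  prim_eq_zero : ∀ s, m ≤ s → B s = 0
  prim_le : ∀ s, s ≤ m → B s ≤ (m - s) * -β s
  prim_pos : ∀ s < m, 0 < B s
  smoothLip' : IsSmoothLip (fun s => s * β s - B s) L'
  deriv_eq : ∀ s, deriv (fun s => s * β s - B s) s = s * deriv β s

lemma exists_abs_deriv_smoothTransition_le :
    ∃ L, ∀ s, |deriv Real.smoothTransition s| ≤ L := by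
  have hc : Continuous (deriv Real.smoothTransition) :=
    (Real.smoothTransition.contDiff (n := 1)).continuous_deriv le_rfl
  obtain ⟨L, hL⟩ := isCompact_Icc.exists_bound_of_continuousOn (s := Icc (0 : ℝ) 1) hc.continuousOn
  refine ⟨L, fun s => ?_⟩
  have hL0 : 0 ≤ L := (norm_nonneg _).trans (hL 0 ⟨le_rfl, zero_le_one⟩)
  rcases lt_or_ge s 0 with h | h
  · have : Real.smoothTransition =ᶠ[𝓝 s] fun _ => 0 := by
      filter_upwards [Iio_mem_nhds h] with r hr
      exact Real.smoothTransition.zero_of_nonpos (le_of_lt hr)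
    rw [this.deriv_eq]; simpa using hL0
  rcases lt_or_ge 1 s with h' | h'
  · have : Real.smoothTransition =ᶠ[𝓝 s] fun _ => 1 := by
      filter_upwards [Ioi_mem_nhds h'] with r hr
      exact Real.smoothTransition.one_of_one_le (le_of_lt hr)
    rw [this.deriv_eq]; simpa using hL0
  · exact hL s ⟨h, h'⟩

/-- A reflected smooth transition replaces the negative part of `s - m`, so that the chain rule for
smooth functions applies; it is bounded, and the sign properties used in the comparison arguments
are kept. -/
lemma exists_isCutoff {m : ℝ} (hm : 0 ≤ m) : ∃ β B L L', IsCutoff m β B L L' := by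
  obtain ⟨L, hL⟩ := exists_abs_deriv_smoothTransition_le
  have hsm : ContDiff ℝ ∞ Real.smoothTransition := Real.smoothTransition.contDiff
  have hST : Continuous Real.smoothTransition := hsm.continuous
  set β : ℝ → ℝ := fun s => -Real.smoothTransition (m - s) with hβ
  set B : ℝ → ℝ := fun s => ∫ r in (0 : ℝ)..(m - s), Real.smoothTransition r with hB
  have hβs : ContDiff ℝ ∞ β := (hsm.comp (contDiff_const.sub contDiff_id)).neg
  have hsub : ∀ s, HasDerivAt (fun s => m - s) (-1) s := fun s => (hasDerivAt_id s).const_sub m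
  have hβd : ∀ s, deriv β s = deriv Real.smoothTransition (m - s) := fun s => by
    have h1 := (((hsm.differentiable (by simp) (m - s)).hasDerivAt.comp s (hsub s)).neg).deriv
    rw [mul_neg_one, neg_neg] at h1
    exact h1
  have hBd : ∀ s, HasDerivAt B (β s) s := fun s => by
    have h1 := (intervalIntegral.integral_hasDerivAt_right (hST.intervalIntegrable 0 (m - s))
      (hST.stronglyMeasurableAtFilter _ _) hST.continuousAt).comp s (hsub s)
    rw [mul_neg_one] at h1
    exact h1
  have hBs : ContDiff ℝ ∞ B := by
    rw [contDiff_infty_iff_deriv]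
    exact ⟨fun s => (hBd s).differentiableAt, by rwa [funext fun s => (hBd s).deriv]⟩
  have hde : ∀ s, deriv (fun s => s * β s - B s) s = s * deriv β s := fun s => by
    have h1 := ((hasDerivAt_id s).mul (hβs.differentiable (by simp) s).hasDerivAt).sub (hBd s)
    have h2 := h1.deriv
    simp only [id] at h2
    refine h2.trans ?_
    ring
  have hmono : Monotone β := fun a b hab =>
    neg_le_neg (Real.smoothTransition.monotone (by linarith))
  have hz : ∀ s, m ≤ s → β s = 0 := fun s hs => by
    simp only [hβ, Real.smoothTransition.zero_of_nonpos (sub_nonpos.2 hs), neg_zero]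
  -- The derivative `sβ'(s)` of `sβ(s) - B(s)` vanishes unless `m - 1 ≤ s ≤ m`, where `|s| ≤ m + 1`.
  refine ⟨β, B, L, (m + 1) * L, ⟨hβs, fun s => hβd s ▸ hL _⟩,
    fun s => neg_nonpos.2 (Real.smoothTransition.nonneg _),
    fun s => neg_le_neg (Real.smoothTransition.le_one _), hz,
    fun s hs => neg_neg_of_pos (Real.smoothTransition.pos_of_pos (sub_pos.2 hs)), hmono, hBd,
    fun s hs => ?_, fun s hs => ?_, fun s hs => ?_, ⟨(contDiff_id.mul hβs).sub hBs, fun s => ?_⟩, hde⟩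
  · rw [hB]
    simp only
    rw [intervalIntegral.integral_congr (g := fun _ => 0), intervalIntegral.integral_zero]
    intro r hr
    rw [uIcc_of_ge (sub_nonpos.2 hs)] at hr
    exact Real.smoothTransition.zero_of_nonpos hr.2
  · have h1 := intervalIntegral.integral_mono_on (μ := volume) (a := 0) (b := m - s) (by linarith)
      (hST.intervalIntegrable 0 (m - s)) (intervalIntegrable_const (c := Real.smoothTransition (m - s)))
      (fun r hr => Real.smoothTransition.monotone hr.2)
    rw [intervalIntegral.integral_const, sub_zero, smul_eq_mul] at h1
    simpa [hβ] using h1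
  · exact intervalIntegral.intervalIntegral_pos_of_pos_on (hST.intervalIntegrable _ _)
      (fun r hr => Real.smoothTransition.pos_of_pos hr.1) (by linarith)
  · rw [hde, abs_mul]
    have hL0 : 0 ≤ L := (abs_nonneg _).trans (hL 0)
    rcases lt_or_ge m s with h | h
    · have : β =ᶠ[𝓝 s] fun _ => 0 := by
        filter_upwards [Ioi_mem_nhds h] with r hr using hz r (le_of_lt hr)
      rw [this.deriv_eq]; simp; positivity
    rcases lt_or_ge s (m - 1) with h' | h'
    · have : β =ᶠ[𝓝 s] fun _ => -1 := by
        filter_upwards [Iio_mem_nhds h'] with r hr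
        have : r < m - 1 := hr
        simp only [hβ, Real.smoothTransition.one_of_one_le (show 1 ≤ m - r by linarith)]
      rw [this.deriv_eq]; simp; positivity
    · refine mul_le_mul (abs_le.2 ⟨by linarith, by linarith⟩) (hβd s ▸ hL _) (abs_nonneg _)
        (by linarith)

namespace IsCutoff

variable {m L L' : ℝ} {β B : ℝ → ℝ}

lemma deriv_nonneg (h : IsCutoff m β B L L') (s : ℝ) : 0 ≤ deriv β s :=
  h.monotone.deriv_nonneg

lemma deriv_eq_zero (h : IsCutoff m β B L L') {s : ℝ} (hs : m ≤ s) : deriv β s = 0 := by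
  have : IsLocalMax β s := Eventually.of_forall fun r => (h.nonpos r).trans_eq (h.eq_zero s hs).symm
  exact this.deriv_eq_zero

/-- By the mean value theorem, since `β = B'` is nondecreasing: this is the subgradient inequality
of the convex function `B`. -/
lemma sub_le (h : IsCutoff m β B L L') (a c : ℝ) : B a - B c ≤ β a * (a - c) := by
  have hc : Continuous B := continuous_iff_continuousAt.2 fun s => (h.hasDerivAt s).continuousAt
  rcases lt_trichotomy a c with hac | rfl | hac
  · obtain ⟨r, hr, he⟩ := exists_hasDerivAt_eq_slope B β hac hc.continuousOn
      fun s _ => h.hasDerivAt s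
    rw [eq_div_iff (sub_pos.2 hac).ne'] at he
    have := h.monotone hr.1.le
    nlinarith
  · simp
  · obtain ⟨r, hr, he⟩ := exists_hasDerivAt_eq_slope B β hac hc.continuousOn
      fun s _ => h.hasDerivAt s
    rw [eq_div_iff (sub_pos.2 hac).ne'] at he
    have := h.monotone hr.2.le
    nlinarith

lemma abs_sub_le (h : IsCutoff m β B L L') (a c : ℝ) : |B a - B c| ≤ |a - c| := by
  have key : ∀ a c, B a - B c ≤ |a - c| := fun a c => by
    refine (h.sub_le a c).trans ((le_abs_self _).trans ?_)
    rw [abs_mul]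
    refine mul_le_of_le_one_left (abs_nonneg _) (abs_le.2 ⟨h.neg_one_le a, ?_⟩)
    exact (h.nonpos a).trans zero_le_one
  refine abs_sub_le_iff.2 ⟨key a c, ?_⟩
  rw [abs_sub_comm]
  exact key c a

lemma prim_nonneg (h : IsCutoff m β B L L') (s : ℝ) : 0 ≤ B s := by
  rcases lt_or_ge s m with hs | hs
  · exact (h.prim_pos s hs).le
  · exact (h.prim_eq_zero s hs).ge

lemma prim_le_of_nonneg (h : IsCutoff m β B L L') (hm : 0 ≤ m) {s : ℝ} (hs : 0 ≤ s) : B s ≤ m := by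
  rcases le_total s m with hs' | hs'
  · have h1 := h.prim_le s hs'
    have h2 := h.neg_one_le s
    nlinarith
  · rwa [h.prim_eq_zero s hs']

lemma mul_sub_prim_nonpos (h : IsCutoff m β B L L') {s : ℝ} (hs : 0 ≤ s) : s * β s - B s ≤ 0 := by
  have := mul_nonpos_of_nonneg_of_nonpos hs (h.nonpos s)
  linarith [h.prim_nonneg s]

/-- Since `B(s) ≤ -(m - s)β(s)` for `s ≤ m`. Together with the upper bound zero for `s ≥ 0`, this
controls the function whose gradient arises from the drift term. -/
lemma le_mul_sub_prim (h : IsCutoff m β B L L') (s : ℝ) : m * β s ≤ s * β s - B s := by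
  rcases le_total s m with hs' | hs'
  · have h1 := h.prim_le s hs'
    linarith
  · rw [h.prim_eq_zero s hs', h.eq_zero s hs']; simp

end IsCutoff

/-- Nothing is known about `κ` on the negative axis. Truncation gives a continuous function on the
line that agrees with `κ` on nonnegative densities, from which measurability follows. -/
lemma IsConductivity.continuous_comp_max {κ : ℝ → ℝ} (hκ : IsConductivity κ) :
    Continuous fun s => κ (max s 0) :=
  hκ.contDiffOn.continuousOn.comp_continuous (by fun_prop) fun s => le_max_right s 0

lemma IsConductivity.nonneg {κ : ℝ → ℝ} (hκ : IsConductivity κ) {z : ℝ} (hz : 0 ≤ z) : 0 ≤ κ z := by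
  rcases hz.eq_or_lt with rfl | hz
  · rcases hκ.lower with ⟨κ₀, h0, h⟩ | ⟨n₁, h1, h⟩
    · exact h0.le.trans (h 0 le_rfl)
    · exact (h 0 le_rfl h1.le).ge
  · exact (hκ.pos z hz).le

lemma IsConductivity.exists_bound {κ : ℝ → ℝ} (hκ : IsConductivity κ) (K : ℝ) :
    ∃ M, 0 ≤ M ∧ ∀ z, 0 ≤ z → z ≤ K → |κ z| ≤ M := by
  obtain ⟨M, hM⟩ := isCompact_Icc.exists_bound_of_continuousOn
    (hκ.contDiffOn.continuousOn.mono (Icc_subset_Ici_self (a := K) (b := 0)))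
  exact ⟨max M 0, le_max_right _ _, fun z h0 hK => (hM z ⟨h0, hK⟩).trans (le_max_left _ _)⟩

lemma IsConductivity.aestronglyMeasurable_comp {α : Type*} [MeasurableSpace α] {μ : Measure α}
    {κ : ℝ → ℝ} (hκ : IsConductivity κ) {f : α → ℝ} (hf : AEStronglyMeasurable f μ)
    (h0 : ∀ᵐ x ∂μ, 0 ≤ f x) : AEStronglyMeasurable (fun x => κ (f x)) μ := by
  refine (hκ.continuous_comp_max.comp_aestronglyMeasurable hf).congr ?_
  filter_upwards [h0] with x hx
  simp only [max_eq_left hx]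

lemma integrable_of_abs_le {α : Type*} [MeasurableSpace α] {μ : Measure α} [IsFiniteMeasure μ]
    {f : α → ℝ} (hf : AEStronglyMeasurable f μ) {K : ℝ} (h : ∀ᵐ x ∂μ, |f x| ≤ K) :
    Integrable f μ := Integrable.of_bound hf K h

variable {d : ℕ} {Ω ΓD ΓN : Set (E d)}

/-- The lower bound for the temperature at a fixed time. -/
theorem ae_le_temperature (hd : 1 ≤ d) (hΩ : IsAdmissibleDomain Ω ΓD ΓN) {κ : ℝ → ℝ}
    (hκ : IsConductivity κ) {τ m K : ℝ} (hτ : 0 < τ) (hm : 0 ≤ m) {n θ θD : H1 Ω} {θL : E d → ℝ}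
    (hbc : θ - θD ∈ H10 Ω ΓD) (hθD : ∀ᵐ x ∂volume.restrict Ω, m ≤ fn θD x)
    (hθLm : AEStronglyMeasurable θL (volume.restrict Ω))
    (hθL : ∀ᵐ x ∂volume.restrict Ω, m ≤ θL x ∧ θL x ≤ K)
    (hθ : ∀ᵐ x ∂volume.restrict Ω, |fn θ x| ≤ K)
    (hn : ∀ᵐ x ∂volume.restrict Ω, 0 ≤ fn n x ∧ fn n x ≤ K)
    (heq : ∀ φ ∈ H10 Ω ΓD,
      - ∫ x in Ω, κ (fn n x) * (inner ℝ (grad θ x) (grad φ x) : ℝ)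
        = ∫ x in Ω, fn n x / τ * (fn θ x - θL x) * fn φ x) :
    (∀ᵐ x ∂volume.restrict Ω, fn n x ≠ 0 → m ≤ fn θ x) ∧
      ∀ κ₀ > 0, (∀ z ≥ 0, κ₀ ≤ κ z) → ∀ᵐ x ∂volume.restrict Ω, m ≤ fn θ x := by
  have hfin := hΩ.isFiniteMeasure
  obtain ⟨β, B, L, L', hβ⟩ := exists_isCutoff hm
  obtain ⟨F, -, hF⟩ := hβ.smoothLip.exists_comp hΩ
  obtain ⟨M, hM0, hM⟩ := hκ.exists_bound K
  have hv1 := (hF θ).1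
  have hv2 := (hF θ).2
  have hv : F θ ∈ H10 Ω ΓD := hβ.smoothLip.comp_mem_H10 hΩ hbc hθD hβ.eq_zero hv1 hv2
  -- With test function `β(θ)` the left side is `-∫κ(n)β'(θ)|∇θ|² ≤ 0`, and the right side is
  -- nonnegative because `θ < m ≤ θ_L` wherever `β(θ) < 0`. Both therefore vanish: the right side
  -- gives the bound where `n ≠ 0`, the left side gives `∇β(θ) = 0` when `κ` is bounded below.
  have e := heq (F θ) hv
  have hκm := hκ.aestronglyMeasurable_comp (memLp_fn n).1 (hn.mono fun x hx => hx.1)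
  have hL0 := hβ.smoothLip.nonneg
  -- the left-hand side
  have hl : ∀ᵐ x ∂volume.restrict Ω, κ (fn n x) * inner ℝ (grad θ x) (grad (F θ) x)
      = κ (fn n x) * (deriv β (fn θ x) * ‖grad θ x‖ ^ 2) := by
    filter_upwards [hv2] with x h2
    rw [h2, inner_smul_right, real_inner_self_eq_norm_sq]
  have hl0 : ∀ᵐ x ∂volume.restrict Ω, 0 ≤ κ (fn n x) * (deriv β (fn θ x) * ‖grad θ x‖ ^ 2) := by
    filter_upwards [hn] with x hx
    exact mul_nonneg (hκ.nonneg hx.1) (mul_nonneg (hβ.deriv_nonneg _) (sq_nonneg _))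
  have hli : Integrable (fun x => κ (fn n x) * (deriv β (fn θ x) * ‖grad θ x‖ ^ 2))
      (volume.restrict Ω) := by
    refine integrable_of_abs_le_mul (K := M * L) (gradL Ω θ) (gradL Ω θ)
      (hκm.mul ((hβ.smoothLip.continuous_deriv.comp_aestronglyMeasurable (memLp_fn θ).1).mul
        ((memLp_grad θ).1.norm.pow 2))) ?_
    filter_upwards [hn] with x hx
    rw [abs_mul, abs_mul, coeFn_gradL, abs_of_nonneg (sq_nonneg ‖grad θ x‖), sq, mul_assoc]
    exact mul_le_mul (hM _ hx.1 hx.2) (mul_le_mul_of_nonneg_right (hβ.smoothLip.bound _)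
      (by positivity)) (by positivity) hM0
  -- the right-hand side
  have hr : ∀ᵐ x ∂volume.restrict Ω, fn n x / τ * (fn θ x - θL x) * fn (F θ) x
      = fn n x / τ * (fn θ x - θL x) * β (fn θ x) := by
    filter_upwards [hv1] with x h1
    rw [h1]
  have hr0 : ∀ᵐ x ∂volume.restrict Ω, 0 ≤ fn n x / τ * (fn θ x - θL x) * β (fn θ x) := by
    filter_upwards [hn, hθL] with x hx hx'
    have h0 : 0 ≤ fn n x / τ := div_nonneg hx.1 hτ.le
    rcases lt_or_ge (fn θ x) m with h | h
    · rw [mul_assoc]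
      exact mul_nonneg h0 (mul_nonneg_of_nonpos_of_nonpos (by linarith) (hβ.nonpos _))
    · rw [hβ.eq_zero _ h, mul_zero]
  have hri : Integrable (fun x => fn n x / τ * (fn θ x - θL x) * β (fn θ x))
      (volume.restrict Ω) := by
    refine integrable_of_abs_le (K := K / τ * (K + K) * 1) ((((memLp_fn n).1.mul_const τ⁻¹).mul
      ((memLp_fn θ).1.sub hθLm)).mul
        (hβ.smoothLip.smooth.continuous.comp_aestronglyMeasurable (memLp_fn θ).1)) ?_
    filter_upwards [hn, hθL, hθ] with x h1 h2 h3
    have hK : 0 ≤ K := (abs_nonneg _).trans h3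
    have h4 : |θL x| ≤ K := abs_le.2 ⟨by linarith, h2.2⟩
    have h5 : |β (fn θ x)| ≤ 1 := abs_le.2 ⟨hβ.neg_one_le _, (hβ.nonpos _).trans zero_le_one⟩
    have h6 : |fn n x / τ| ≤ K / τ := by
      rw [abs_of_nonneg (div_nonneg h1.1 hτ.le)]
      gcongr
      exact h1.2
    have h7 : |fn θ x - θL x| ≤ K + K := (abs_sub _ _).trans (add_le_add h3 h4)
    rw [abs_mul, abs_mul]
    gcongr
  rw [integral_congr_ae hl, integral_congr_ae hr] at e
  have i1 := integral_nonneg_of_ae hl0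
  have i2 := integral_nonneg_of_ae hr0
  constructor
  · have := (integral_eq_zero_iff_of_nonneg_ae hr0 hri).1 (by linarith)
    filter_upwards [this, hθL] with x hx hx' hne
    by_contra! hlt
    rcases mul_eq_zero.1 hx with h | h
    · rcases mul_eq_zero.1 h with h | h
      · exact hne (by simpa [hτ.ne'] using h)
      · linarith
    · exact (hβ.neg _ hlt).ne h
  · intro κ₀ hκ₀ hκl
    have h0 := (integral_eq_zero_iff_of_nonneg_ae hl0 hli).1 (by linarith)
    obtain ⟨CP, -, hCP⟩ := exists_poincare_norm hd hΩ
    have hg : gradL Ω (F θ) = 0 := by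
      refine Lp.ext ?_
      filter_upwards [h0, hv2, hn, Lp.coeFn_zero (E d) 2 (volume.restrict Ω)] with x h1 h2 h3 h4
      rw [h4, coeFn_gradL, h2]
      have h5 : 0 < κ (fn n x) := hκ₀.trans_le (hκl _ h3.1)
      have h6 : deriv β (fn θ x) * ‖grad θ x‖ ^ 2 = 0 := by
        simpa [h5.ne'] using h1
      rcases mul_eq_zero.1 h6 with h | h
      · simp [h]
      · simp [norm_eq_zero.1 (pow_eq_zero_iff two_ne_zero |>.1 h)]
    have hz := hCP _ hv
    rw [hg, norm_zero, mul_zero, norm_le_zero_iff] at hz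
    have hz' := Lp.coeFn_zero ℝ 2 (volume.restrict Ω)
    rw [← hz, coeFn_fnL] at hz'
    filter_upwards [hz', hv1] with x h1 h2
    by_contra! hlt
    exact (hβ.neg _ hlt).ne (h2 ▸ h1)

set_option maxHeartbeats 1000000 in
/-- The density equation at a fixed time, tested with a cutoff of a multiple of the density. -/
theorem density_add_mul_nonpos (hΩ : IsAdmissibleDomain Ω ΓD ΓN) {κ : ℝ → ℝ}
    {τ lam m K a : ℝ} (hτ : 0 < τ) (hlam : 0 < lam) (hm : 0 ≤ m) (ha : 1 ≤ a) {β B : ℝ → ℝ}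
    {L L' : ℝ} (hβ : IsCutoff m β B L L') (hκ : ∀ z, 0 ≤ z → z ≤ m → κ z = z)
    {n nD θ V v : H1 Ω} {θL C : E d → ℝ} (hbc : n - nD ∈ H10 Ω ΓD)
    (hnD : ∀ᵐ x ∂volume.restrict Ω, m ≤ fn nD x)
    (hθLm : AEStronglyMeasurable θL (volume.restrict Ω))
    (hθL : ∀ᵐ x ∂volume.restrict Ω, |θL x| ≤ K)
    (hCm : AEStronglyMeasurable C (volume.restrict Ω))
    (hC : ∀ᵐ x ∂volume.restrict Ω, 0 ≤ C x ∧ C x ≤ K)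
    (hθ : ∀ᵐ x ∂volume.restrict Ω, |fn θ x| ≤ K)
    (hθ0 : ∀ᵐ x ∂volume.restrict Ω, fn n x ≠ 0 → 0 ≤ fn θ x)
    (hn : ∀ᵐ x ∂volume.restrict Ω, 0 ≤ fn n x ∧ fn n x ≤ K)
    (htemp : ∀ φ ∈ H10 Ω ΓD,
      - ∫ x in Ω, κ (fn n x) * (inner ℝ (grad θ x) (grad φ x) : ℝ)
        = ∫ x in Ω, fn n x / τ * (fn θ x - θL x) * fn φ x)
    (hpois : ∀ φ ∈ H10 Ω ΓD,
      lam ^ 2 * ∫ x in Ω, (inner ℝ (grad V x) (grad φ x) : ℝ)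
        = ∫ x in Ω, (fn n x - C x) * fn φ x)
    (hv : v ∈ H10 Ω ΓD) (hv1 : fn v =ᵐ[volume.restrict Ω] fun x => β (fn (a • n) x))
    (hv2 : grad v =ᵐ[volume.restrict Ω] fun x => deriv β (fn (a • n) x) • grad (a • n) x) {W : ℝ}
    (hW : W + ∫ x in Ω, (inner ℝ (fn θ x • grad n x + fn n x • grad θ x + fn n x • grad V x)
      (grad v x) : ℝ) = 0) :
    W + (K / τ + m / lam ^ 2) * ∫ x in Ω, fn n x * fn v x ≤ 0 := by
  have hfin := hΩ.isFiniteMeasure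
  have ha0 : 0 < a := zero_lt_one.trans_le ha
  have hfa := fn_smul a n
  have hga := grad_smul a n
  -- With `s = an`, the drift term contains `sβ'(s)∇s`, which is the gradient of `sβ(s) - B(s)`.
  -- This function `g` vanishes on `Γ_D` and is admissible in the Poisson equation.
  obtain ⟨F, -, hF⟩ := hβ.smoothLip'.exists_comp hΩ
  obtain ⟨g, hg1, hg2⟩ : ∃ g : H1 Ω,
      fn g =ᵐ[volume.restrict Ω] (fun x => fn (a • n) x * β (fn (a • n) x) - B (fn (a • n) x)) ∧
      grad g =ᵐ[volume.restrict Ω]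
        fun x => deriv (fun s => s * β s - B s) (fn (a • n) x) • grad (a • n) x :=
    ⟨F (a • n), hF _⟩
  have hbc' : a • n - a • nD ∈ H10 Ω ΓD := by
    rw [← smul_sub]; exact (H10 Ω ΓD).smul_mem a hbc
  have hnD' : ∀ᵐ x ∂volume.restrict Ω, m ≤ fn (a • nD) x := by
    filter_upwards [hnD, fn_smul a nD] with x h1 h2
    rw [h2, Pi.smul_apply, smul_eq_mul]
    nlinarith
  have hg : g ∈ H10 Ω ΓD := hβ.smoothLip'.comp_mem_H10 hΩ hbc' hnD'
    (fun s hs => by simp [hβ.eq_zero s hs, hβ.prim_eq_zero s hs]) hg1 hg2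
  -- integrability
  have j1 : Integrable (fun x => fn θ x * inner ℝ (grad n x) (grad v x)) (volume.restrict Ω) := by
    refine integrable_of_abs_le_mul (K := K) (gradL Ω n) (gradL Ω v)
      ((memLp_fn θ).1.mul ((memLp_grad n).1.inner (memLp_grad v).1)) ?_
    filter_upwards [hθ] with x hx
    rw [abs_mul]
    exact mul_le_mul hx (abs_real_inner_le_norm _ _) (abs_nonneg _) ((abs_nonneg _).trans hx)
  have j2 : ∀ u : H1 Ω, Integrable (fun x => fn n x * inner ℝ (grad u x) (grad v x))
      (volume.restrict Ω) := fun u => by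
    refine integrable_of_abs_le_mul (K := K) (gradL Ω u) (gradL Ω v)
      ((memLp_fn n).1.mul ((memLp_grad u).1.inner (memLp_grad v).1)) ?_
    filter_upwards [hn] with x hx
    rw [abs_mul, abs_of_nonneg hx.1]
    exact mul_le_mul hx.2 (abs_real_inner_le_norm _ _) (abs_nonneg _) (hx.1.trans hx.2)
  have hsplit : ∫ x in Ω, (inner ℝ (fn θ x • grad n x + fn n x • grad θ x + fn n x • grad V x)
      (grad v x) : ℝ) = (∫ x in Ω, fn θ x * inner ℝ (grad n x) (grad v x))
        + (∫ x in Ω, fn n x * inner ℝ (grad θ x) (grad v x))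
        + ∫ x in Ω, fn n x * inner ℝ (grad V x) (grad v x) := by
    rw [← integral_add j1 (j2 θ)]
    refine Eq.trans ?_ (integral_add (j1.add (j2 θ)) (j2 V))
    simp only [inner_add_left, real_inner_smul_left]
  -- The sign of `θ` is known only where `n ≠ 0`; on `{n = 0}` the gradient of `n` vanishes almost
  -- everywhere.
  have hI1 : 0 ≤ ∫ x in Ω, fn θ x * inner ℝ (grad n x) (grad v x) := by
    refine integral_nonneg_of_ae ?_
    filter_upwards [hv2, hga, hθ0, grad_eq_zero_of_fn_eq_zero hΩ n] with x h1 h2 h3 h4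
    rw [h1, h2, Pi.smul_apply, inner_smul_right, inner_smul_right, real_inner_self_eq_norm_sq]
    by_cases h : fn n x = 0
    · simp [h4 h]
    · exact mul_nonneg (h3 h) (mul_nonneg (hβ.deriv_nonneg _) (mul_nonneg ha0.le (sq_nonneg _)))
  -- Where `β'(an) ≠ 0` one has `n ≤ an < m`, hence `κ(n) = n`, and the heat flux is the one in the
  -- temperature equation. This is the use of the linear behaviour of `κ` near zero and of `a ≥ 1`.
  have hI2 : ∫ x in Ω, fn n x * inner ℝ (grad θ x) (grad v x)
      = - ∫ x in Ω, fn n x / τ * (fn θ x - θL x) * fn v x := by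
    rw [← htemp v hv, neg_neg]
    refine integral_congr_ae ?_
    filter_upwards [hv2, hfa, hn] with x h1 h2 h3
    rw [h1, h2, Pi.smul_apply, smul_eq_mul]
    rcases le_total m (a * fn n x) with h | h
    · simp [hβ.deriv_eq_zero h]
    · rw [hκ (fn n x) h3.1 (by nlinarith)]
  have hI3 : lam ^ 2 * (a * ∫ x in Ω, fn n x * inner ℝ (grad V x) (grad v x))
      = ∫ x in Ω, (fn n x - C x) * fn g x := by
    have e : lam ^ 2 * ∫ x in Ω, (inner ℝ (grad V x) (grad g x) : ℝ)
        = ∫ x in Ω, (fn n x - C x) * fn g x := hpois g hg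
    rw [← e, ← integral_const_mul a]
    congr 1
    refine integral_congr_ae ?_
    filter_upwards [hv2, hg2, hfa] with x h1 h2 h3
    have h3' : fn (a • n) x = a * fn n x := h3
    rw [h1, h2, hβ.deriv_eq, h3']
    generalize grad (a • n) x = q
    rw [real_inner_smul_right, real_inner_smul_right]
    ring
  have bβ : ∀ s, |β s| ≤ 1 := fun s => abs_le.2 ⟨hβ.neg_one_le _, (hβ.nonpos _).trans zero_le_one⟩
  have k1 : Integrable (fun x => fn n x * fn v x) (volume.restrict Ω) :=
    (memLp_fn n).integrable_mul (memLp_fn v)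
  have k2 : Integrable (fun x => fn n x / τ * (fn θ x - θL x) * fn v x) (volume.restrict Ω) := by
    refine integrable_of_abs_le (K := K / τ * (K + K) * 1) ((((memLp_fn n).1.mul_const τ⁻¹).mul
      ((memLp_fn θ).1.sub hθLm)).mul (memLp_fn v).1) ?_
    filter_upwards [hn, hθL, hθ, hv1] with x h1 h2 h3 h4
    have hK : 0 ≤ K := (abs_nonneg _).trans h3
    have h6 : |fn n x / τ| ≤ K / τ := by
      rw [abs_of_nonneg (div_nonneg h1.1 hτ.le)]
      gcongr
      exact h1.2
    have h7 : |fn θ x - θL x| ≤ K + K := (abs_sub _ _).trans (add_le_add h3 h2)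
    rw [abs_mul, abs_mul, h4]
    gcongr
    exact bβ _
  have k3 : Integrable (fun x => (fn n x - C x) * fn g x) (volume.restrict Ω) := by
    refine ((memLp_fn n).sub (?_ : MemLp C 2 (volume.restrict Ω))).integrable_mul (memLp_fn g)
    refine MemLp.of_bound hCm K ?_
    filter_upwards [hC] with x hx
    rw [Real.norm_of_nonneg hx.1]; exact hx.2
  -- Since `v ≤ 0` and `θ - θ_L ≥ -K` wherever `n ≠ 0`.
  have m1 : ∫ x in Ω, fn n x / τ * (fn θ x - θL x) * fn v x
      ≤ -(K / τ) * ∫ x in Ω, fn n x * fn v x := by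
    rw [← integral_const_mul]
    refine integral_mono_ae k2 (k1.const_mul _) ?_
    filter_upwards [hn, hθL, hθ0, hv1] with x h1 h2 h3 h4
    rw [h4]
    have h5 := hβ.nonpos (fn (a • n) x)
    by_cases h : fn n x = 0
    · simp [h]
    · have h6 := h3 h
      have h7 := (abs_le.1 h2).2
      have h8 : 0 ≤ fn n x * -β (fn (a • n) x) := mul_nonneg h1.1 (by linarith)
      have h9 : 0 ≤ (K + fn θ x - θL x) * (fn n x * -β (fn (a • n) x)) :=
        mul_nonneg (by linarith) h8
      rw [div_mul_eq_mul_div, div_mul_eq_mul_div, neg_mul, div_mul_eq_mul_div, ← neg_div]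
      gcongr
      linarith
  -- Since `mβ ≤ g ≤ 0` and `C ≥ 0`, the doping contributes with a favourable sign.
  have m2 : m * ∫ x in Ω, fn n x * fn v x ≤ ∫ x in Ω, (fn n x - C x) * fn g x := by
    rw [← integral_const_mul]
    refine integral_mono_ae (k1.const_mul _) k3 ?_
    filter_upwards [hn, hC, hv1, hg1, hfa] with x h1 h2 h3 h4 h5
    rw [h3, h4]
    have h6 : 0 ≤ fn (a • n) x := by
      rw [h5]; exact mul_nonneg ha0.le h1.1
    have h7 := hβ.le_mul_sub_prim (fn (a • n) x)
    have h8 := hβ.mul_sub_prim_nonpos h6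
    nlinarith [mul_nonneg h2.1 (neg_nonneg.2 h8), mul_le_mul_of_nonneg_left h7 h1.1]
  have hneg : ∫ x in Ω, fn n x * fn v x ≤ 0 := by
    refine integral_nonpos_of_ae ?_
    filter_upwards [hn, hv1] with x h1 h2
    rw [h2]
    exact mul_nonpos_of_nonneg_of_nonpos h1.1 (hβ.nonpos _)
  rw [← hI3] at m2
  rw [hsplit, hI2] at hW
  set I3 := ∫ x in Ω, fn n x * inner ℝ (grad V x) (grad v x)
  set N := ∫ x in Ω, fn n x * fn v x
  -- The factor `a ≥ 1` is removed by cases: `N ≤ 0` settles `I3 ≥ 0`, and otherwise `a I3 ≤ I3`.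
  have m3 : m / lam ^ 2 * N ≤ I3 := by
    have hl2 : 0 < lam ^ 2 := by positivity
    have : m * N ≤ lam ^ 2 * I3 := by
      rcases le_total 0 I3 with h | h
      · exact (mul_nonpos_of_nonneg_of_nonpos hm hneg).trans (mul_nonneg hl2.le h)
      · refine m2.trans (mul_le_mul_of_nonneg_left ?_ hl2.le)
        nlinarith
    rw [div_mul_eq_mul_div, div_le_iff₀ hl2]
    linarith
  linarith

lemma exists_ae_abs_le {α : Type*} [MeasurableSpace α] {μ : Measure α} {f : α → ℝ}
    (hf : MemLp f ⊤ μ) : ∃ K : ℝ, ∀ᵐ x ∂μ, |f x| ≤ K := by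
  have h := hf.2
  rw [eLpNorm_exponent_top] at h
  refine ⟨(eLpNormEssSup f μ).toReal, ?_⟩
  filter_upwards [ae_le_eLpNormEssSup (f := f) (μ := μ)] with x hx
  have := ENNReal.toReal_mono h.ne hx
  simpa using this

namespace IsCutoff

variable {m L L' : ℝ} {β B : ℝ → ℝ} {α : Type*} [MeasurableSpace α] {μ : Measure α}
  [IsFiniteMeasure μ]

lemma integrable_prim (h : IsCutoff m β B L L') (v : Lp ℝ 2 μ) :
    Integrable (fun x => B (v x)) μ := by
  have hc : Continuous B := continuous_iff_continuousAt.2 fun s => (h.hasDerivAt s).continuousAt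
  have hi : Integrable (fun x => v x - m) μ :=
    ((Lp.memLp v).integrable (by norm_num)).sub (integrable_const m)
  refine hi.mono (hc.comp_aestronglyMeasurable (Lp.aestronglyMeasurable v))
    (Eventually.of_forall fun x => ?_)
  have := h.abs_sub_le (v x) m
  rwa [h.prim_eq_zero m le_rfl, sub_zero] at this

/-- Integrating the scalar inequality shows that `β(v)` is a subgradient of the convex functional `v
↦ ∫B(v)` on `L²`. This functional is the one to which the energy inequality for the density is
applied. -/
lemma integral_sub_le_inner (h : IsCutoff m β B L L') (v y : Lp ℝ 2 μ) {g : Lp ℝ 2 μ}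
    (hg : g =ᵐ[μ] fun x => β (v x)) :
    (∫ x, B (v x) ∂μ) - ∫ x, B (y x) ∂μ ≤ inner ℝ g (v - y) := by
  rw [← integral_sub (h.integrable_prim v) (h.integrable_prim y), L2.inner_def]
  refine integral_mono_ae ((h.integrable_prim v).sub (h.integrable_prim y))
    (L2.integrable_inner g (v - y)) ?_
  filter_upwards [hg, Lp.coeFn_sub v y] with x h1 h2
  rw [h1, h2, Pi.sub_apply, real_inner_eq_re_inner]
  simpa [mul_comm] using h.sub_le (v x) (y x)

lemma continuous_integral_prim (h : IsCutoff m β B L L') :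
    Continuous fun v : Lp ℝ 2 μ => ∫ x, B (v x) ∂μ := by
  have h1 : MemLp (fun _ : α => (1 : ℝ)) 2 μ := memLp_const 1
  refine LipschitzWith.continuous (K := ‖h1.toLp _‖₊) (LipschitzWith.of_dist_le_mul fun v y => ?_)
  rw [Real.dist_eq, dist_eq_norm, ← integral_sub (h.integrable_prim v) (h.integrable_prim y)]
  have := abs_integral_le_mul (v - y) (h1.toLp _) (F := fun x => B (v x) - B (y x)) zero_le_one ?_
  · rw [one_mul, mul_comm] at this
    exact this
  · filter_upwards [Lp.coeFn_sub v y, h1.coeFn_toLp] with x h2 h3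
    rw [h2, h3]
    simpa using h.abs_sub_le (v x) (y x)

end IsCutoff

lemma norm_gradL_le (u : H1 Ω) : ‖gradL Ω u‖ ≤ ‖u‖ :=
  abs_le_of_sq_le_sq' (by rw [norm_sq_eq_fnL_add_gradL]; nlinarith [sq_nonneg ‖fnL Ω u‖])
    (norm_nonneg _) |>.2

lemma norm_le_fnL_add_gradL (u : H1 Ω) : ‖u‖ ≤ ‖fnL Ω u‖ + ‖gradL Ω u‖ :=
  abs_le_of_sq_le_sq' (by
    rw [norm_sq_eq_fnL_add_gradL]
    nlinarith [norm_nonneg (fnL Ω u), norm_nonneg (gradL Ω u)]) (by positivity) |>.2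

lemma IsSmoothLip.memLp_comp_time [IsFiniteMeasure (volume.restrict Ω)] {f : ℝ → ℝ} {L M : ℝ}
    (hf : IsSmoothLip f L) (hM : ∀ s, |f s| ≤ M) {F : H1 Ω → H1 Ω} (hFc : Continuous F)
    (hF : ∀ u, fn (F u) =ᵐ[volume.restrict Ω] (fun x => f (fn u x)) ∧
      grad (F u) =ᵐ[volume.restrict Ω] fun x => deriv f (fn u x) • grad u x) {T : ℝ}
    {u : ℝ → H1 Ω} (hu : MemLp u 2 (timeMeasure T)) :
    MemLp (fun t => F (u t)) 2 (timeMeasure T) := by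
  have hM0 : 0 ≤ M := (abs_nonneg _).trans (hM 0)
  obtain ⟨A, hA⟩ : ∃ A : ℝ, ∀ u, ‖fnL Ω (F u)‖ ≤ A := by
    refine ⟨_, fun u => Lp.norm_le_of_ae_bound (C := M) hM0 ?_⟩
    filter_upwards [(hF u).1] with x hx
    rw [coeFn_fnL, hx]
    exact hM _
  have hG : ∀ u, ‖gradL Ω (F u)‖ ≤ L * ‖u‖ := fun u => by
    refine (Lp.norm_le_mul_norm_of_ae_le_mul (g := gradL Ω u) ?_).trans
      (mul_le_mul_of_nonneg_left (norm_gradL_le u) hf.nonneg)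
    filter_upwards [(hF u).2] with x hx
    rw [coeFn_gradL, hx, norm_smul]
    exact mul_le_mul_of_nonneg_right (hf.bound _) (norm_nonneg _)
  have hg : MemLp (fun t => A + L * ‖u t‖) 2 (timeMeasure T) :=
    (memLp_const A).add (hu.norm.const_mul L)
  refine hg.mono (hFc.comp_aestronglyMeasurable hu.1) (Eventually.of_forall fun t => ?_)
  refine le_trans ?_ (le_abs_self _)
  exact (norm_le_fnL_add_gradL _).trans (add_le_add (hA _) (hG _))

namespace IsBoundedWeakSolution

variable {T τ lam q : ℝ} {κ : ℝ → ℝ} {nD θD VD n θ V : ℝ → H1 Ω}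
  {nI θL C : E d → ℝ}

lemma exists_bound (hI : IsInitialData Ω nI θL C)
    (h : IsBoundedWeakSolution Ω ΓD T τ lam κ nD θD VD nI θL C n θ V) :
    ∃ K, 0 ≤ K ∧ (∀ᵐ t ∂timeMeasure T, ∀ᵐ x ∂volume.restrict Ω, 0 ≤ fn (n t) x ∧ fn (n t) x ≤ K) ∧
      (∀ᵐ t ∂timeMeasure T, ∀ᵐ x ∂volume.restrict Ω, |fn (θ t) x| ≤ K) ∧
      (∀ᵐ x ∂volume.restrict Ω, |θL x| ≤ K) ∧ ∀ᵐ x ∂volume.restrict Ω, 0 ≤ C x ∧ C x ≤ K := by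
  obtain ⟨K₁, h1⟩ := h.bdd_n
  obtain ⟨K₂, h2⟩ := h.bdd_θ
  obtain ⟨K₃, h3⟩ := exists_ae_abs_le hI.bdd_θL
  obtain ⟨K₄, h4⟩ := exists_ae_abs_le hI.bdd_C
  refine ⟨max 0 (max (max K₁ K₂) (max K₃ K₄)), le_max_left _ _, ?_, ?_, ?_, ?_⟩
  · filter_upwards [h1, h.nonneg_n] with t ht ht'
    filter_upwards [ht, ht'] with x hx hx'
    exact ⟨hx', (le_abs_self _).trans (hx.trans (by simp))⟩
  · filter_upwards [h2] with t ht
    filter_upwards [ht] with x hx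
    exact hx.trans (by simp)
  · filter_upwards [h3] with x hx
    exact hx.trans (by simp)
  · filter_upwards [h4, hI.nonneg_C] with x hx hx'
    exact ⟨hx', (le_abs_self _).trans (hx.trans (by simp))⟩

lemma temperature_mem (h : IsBoundedWeakSolution Ω ΓD T τ lam κ nD θD VD nI θL C n θ V) :
    ∀ᵐ t ∂timeMeasure T, ∀ φ ∈ H10 Ω ΓD,
      - ∫ x in Ω, κ (fn (n t) x) * (inner ℝ (grad (θ t) x) (grad φ x) : ℝ)
        = ∫ x in Ω, fn (n t) x / τ * (fn (θ t) x - θL x) * fn φ x := by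
  filter_upwards [h.temperature] with t ht φ hφ
  exact ht ⟨φ, hφ⟩

lemma poisson_mem (h : IsBoundedWeakSolution Ω ΓD T τ lam κ nD θD VD nI θL C n θ V) :
    ∀ᵐ t ∂timeMeasure T, ∀ φ ∈ H10 Ω ΓD,
      lam ^ 2 * ∫ x in Ω, (inner ℝ (grad (V t) x) (grad φ x) : ℝ)
        = ∫ x in Ω, (fn (n t) x - C x) * fn φ x := by
  filter_upwards [h.poisson] with t ht φ hφ
  exact ht ⟨φ, hφ⟩

/-- The temperature is bounded from below where the density does not vanish, and everywhere if the
conductivity is. -/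
theorem exists_temperature_lower_bound (hd : 1 ≤ d) (hΩ : IsAdmissibleDomain Ω ΓD ΓN) (hτ : 0 < τ)
    (hκ : IsConductivity κ) (hD : IsBoundaryData T q nD θD VD) (hI : IsInitialData Ω nI θL C)
    (h : IsBoundedWeakSolution Ω ΓD T τ lam κ nD θD VD nI θL C n θ V) :
    ∃ m > 0, (∀ᵐ t ∂timeMeasure T, ∀ᵐ x ∂volume.restrict Ω, fn (n t) x ≠ 0 → m ≤ fn (θ t) x) ∧
      ∀ κ₀ > 0, (∀ z ≥ 0, κ₀ ≤ κ z) →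
        ∀ᵐ t ∂timeMeasure T, ∀ᵐ x ∂volume.restrict Ω, m ≤ fn (θ t) x := by
  obtain ⟨K, hK0, hn, hθ, hL, -⟩ := h.exists_bound hI
  obtain ⟨c₁, hc₁, h1⟩ := hD.inf_θ
  obtain ⟨c₂, hc₂, h2⟩ := hI.inf_θL
  have hm : 0 < min c₁ c₂ := lt_min hc₁ hc₂
  have hθL : ∀ᵐ x ∂volume.restrict Ω, min c₁ c₂ ≤ θL x ∧ θL x ≤ K := by
    filter_upwards [h2, hL] with x hx hx'
    exact ⟨(min_le_right _ _).trans hx, (le_abs_self _).trans hx'⟩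
  have key : ∀ᵐ t ∂timeMeasure T,
      (∀ᵐ x ∂volume.restrict Ω, fn (n t) x ≠ 0 → min c₁ c₂ ≤ fn (θ t) x) ∧
        ∀ κ₀ > 0, (∀ z ≥ 0, κ₀ ≤ κ z) → ∀ᵐ x ∂volume.restrict Ω, min c₁ c₂ ≤ fn (θ t) x := by
    filter_upwards [hn, hθ, h1, h.bc_θ, h.temperature_mem] with t a1 a2 a3 a4 a5
    exact ae_le_temperature hd hΩ hκ hτ hm.le a4 (a3.mono fun x hx => (min_le_left _ _).trans hx)
      hI.bdd_θL.1 hθL a2 a1 a5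
  refine ⟨_, hm, key.mono fun t ht => ht.1, fun κ₀ hκ₀ hκl => key.mono fun t ht => ht.2 κ₀ hκ₀ hκl⟩

/-- The density is bounded from below if the conductivity is linear near zero. -/
theorem exists_density_lower_bound (hd : 1 ≤ d) (hΩ : IsAdmissibleDomain Ω ΓD ΓN) (hT : 0 < T)
    (hτ : 0 < τ) (hlam : 0 < lam) (hκ : IsConductivity κ) {n₁ : ℝ} (hn₁ : 0 < n₁)
    (hκ₁ : ∀ z, 0 ≤ z → z ≤ n₁ → κ z = z) (hD : IsBoundaryData T q nD θD VD)
    (hI : IsInitialData Ω nI θL C)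
    (h : IsBoundedWeakSolution Ω ΓD T τ lam κ nD θD VD nI θL C n θ V) :
    ∃ c > 0, ∀ᵐ t ∂timeMeasure T, ∀ᵐ x ∂volume.restrict Ω, c ≤ fn (n t) x := by
  have hfin := hΩ.isFiniteMeasure
  obtain ⟨K, hK0, hn, hθ, hL, hC⟩ := h.exists_bound hI
  obtain ⟨mθ, hmθ, hθ0, -⟩ := h.exists_temperature_lower_bound hd hΩ hτ hκ hD hI
  obtain ⟨c₁, hc₁, h1⟩ := hD.inf_n
  obtain ⟨c₂, hc₂, h2⟩ := hI.inf_nI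
  -- The threshold lies in the range where `κ` is linear, and below the boundary and initial
  -- densities, so that `β` vanishes on both.
  obtain ⟨m, hm, hmn, hm1, hm2⟩ : ∃ m > 0, m ≤ n₁ ∧ m ≤ c₁ ∧ m ≤ c₂ :=
    ⟨min n₁ (min c₁ c₂), lt_min hn₁ (lt_min hc₁ hc₂), min_le_left _ _, by simp, by simp⟩
  obtain ⟨β, B, L, L', hβ⟩ := exists_isCutoff hm.le
  obtain ⟨F, hFc, hF⟩ := hβ.smoothLip.exists_comp hΩ
  have bβ : ∀ s, |β s| ≤ 1 := fun s => abs_le.2 ⟨hβ.neg_one_le _, (hβ.nonpos _).trans zero_le_one⟩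
  -- The rate at which the exponential weight compensates for the relaxation and drift terms in
  -- `density_add_mul_nonpos`. As `μ ≥ 0`, the weight is at least one and keeps the boundary values
  -- above `m`.
  obtain ⟨μ, hμ⟩ : ∃ μ, μ = K / τ + m / lam ^ 2 := ⟨_, rfl⟩
  have hμ0 : 0 ≤ μ := by rw [hμ]; positivity
  have hnI : MemLp nI 2 (volume.restrict Ω) := hI.bdd_nI.mono_exponent le_top
  have hu := memLp_exp_smul h.memLp_n μ
  have hmem : ∀ᵐ t ∂timeMeasure T, F (Real.exp (μ * t) • n t) ∈ H10 Ω ΓD := by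
    filter_upwards [h.bc_n, h1, ae_restrict_mem measurableSet_Ioo] with t a1 a2 a3
    refine hβ.smoothLip.comp_mem_H10 (uD := Real.exp (μ * t) • nD t) hΩ ?_ ?_ hβ.eq_zero (hF _).1
      (hF _).2
    · rw [← smul_sub]
      exact (H10 Ω ΓD).smul_mem _ a1
    · have he : 1 ≤ Real.exp (μ * t) := Real.one_le_exp (mul_nonneg hμ0 a3.1.le)
      filter_upwards [a2, fn_smul (Real.exp (μ * t)) (nD t)] with x b1 b2
      rw [b2, Pi.smul_apply, smul_eq_mul]
      nlinarith
  obtain ⟨z, hz, hzF⟩ := exists_memLp_submodule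
    (hβ.smoothLip.memLp_comp_time bβ hFc hF hu) hmem
  obtain ⟨w, hw, hwn, hweq⟩ := h.density
  have hnt : ∀ᵐ t ∂timeMeasure T, ∀ᵐ x ∂volume.restrict Ω,
      (Real.exp (μ * t) • fnL Ω (n t) : Lp ℝ 2 (volume.restrict Ω)) x
        = Real.exp (μ * t) * fn (n t) x :=
    Eventually.of_forall fun t => Lp.coeFn_smul (Real.exp (μ * t)) (fnL Ω (n t))
  obtain ⟨b, hb⟩ : ∃ b : Lp ℝ 2 (volume.restrict Ω) → ℝ, b = fun v => ∫ x in Ω, B (v x) :=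
    ⟨_, rfl⟩
  have hbc : Continuous b := hb ▸ hβ.continuous_integral_prim
  have hbi : Integrable (fun t => b (Real.exp (μ * t) • fnL Ω (n t))) (timeMeasure T) := by
    refine Integrable.of_bound (hbc.comp_aestronglyMeasurable (memLp_exp_smul (memLp_fnL h.memLp_n)
      μ).1) (m * (volume.restrict Ω).real univ) ?_
    filter_upwards [hn, hnt] with t a1 a2
    rw [hb]
    refine norm_integral_le_of_norm_le_const ?_
    filter_upwards [a1, a2] with x b1 b2
    rw [b2, Real.norm_of_nonneg (hβ.prim_nonneg _)]
    exact hβ.prim_le_of_nonneg hm.le (mul_nonneg (Real.exp_pos _).le b1.1)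
  -- The functional is zero initially and its production is nonpositive, so it stays zero; since `B
  -- > 0` below `m`, this means `e^{μt}n ≥ m`.
  have key := hwn.ae_exp_smul_sub_le_integral hT h.memLp_n hw h.initial hnI μ hz hbi (by
    filter_upwards [hzF] with t ht y
    rw [hb]
    refine hβ.integral_sub_le_inner _ _ ?_
    rw [ht, coeFn_fnL]
    filter_upwards [(hF (Real.exp (μ * t) • n t)).1, fn_smul (Real.exp (μ * t)) (n t),
      Lp.coeFn_smul (Real.exp (μ * t)) (fnL Ω (n t))] with x b1 b2 b3
    rw [b1, b2, b3, coeFn_fnL])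
  have hb0 : b (hnI.toLp nI) = 0 := by
    rw [hb]
    refine integral_eq_zero_of_ae ?_
    filter_upwards [hnI.coeFn_toLp, h2] with x b1 b2
    rw [b1]
    exact hβ.prim_eq_zero _ (hm2.trans b2)
  have hle : ∀ᵐ s ∂timeMeasure T,
      Real.exp (μ * s) * (w s (z s) + μ * inner ℝ (fnL Ω (n s)) (fnL Ω (z s))) ≤ 0 := by
    filter_upwards [hn, hθ, h1, h.bc_n, h.temperature_mem, h.poisson_mem, hθ0, hzF, hweq,
      ae_restrict_mem measurableSet_Ioo] with s a1 a2 a3 a4 a5 a6 a7 a8 a9 a10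
    refine mul_nonpos_of_nonneg_of_nonpos (Real.exp_pos _).le ?_
    rw [inner_fnL, hμ]
    refine density_add_mul_nonpos (a := Real.exp (μ * s)) hΩ hτ hlam hm.le
      (Real.one_le_exp (mul_nonneg hμ0 a10.1.le)) hβ (fun y y0 ym => hκ₁ y y0 (ym.trans hmn)) a4
      (a3.mono fun x hx => hm1.trans hx) hI.bdd_θL.1 hL hI.bdd_C.1 hC a2
      (a7.mono fun x hx hx' => hmθ.le.trans (hx hx')) a1 a5 a6 (z s).2 ?_ ?_ (a9 (z s))
    · rw [a8]; exact (hF _).1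
    · rw [a8]; exact (hF _).2
  refine ⟨Real.exp (-(μ * T)) * m, by positivity, ?_⟩
  filter_upwards [key, hn, ae_restrict_mem measurableSet_Ioo] with t a1 a2 a3
  have hI0 : ∫ s in Ioo 0 t, Real.exp (μ * s)
      * (w s (z s) + μ * inner ℝ (fnL Ω (n s)) (fnL Ω (z s))) ≤ 0 :=
    integral_nonpos_of_ae (ae_restrict_of_ae_restrict_of_subset (Ioo_subset_Ioo_right a3.2.le) hle)
  have hbt : b (Real.exp (μ * t) • fnL Ω (n t)) ≤ 0 := by linarith
  rw [hb] at hbt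
  have h0 := (integral_eq_zero_iff_of_nonneg (fun x => hβ.prim_nonneg _)
    (hβ.integrable_prim _)).1 (le_antisymm hbt (integral_nonneg fun x => hβ.prim_nonneg _))
  filter_upwards [h0, Lp.coeFn_smul (Real.exp (μ * t)) (fnL Ω (n t)), a2] with x b1 b2 b3
  have hge : m ≤ Real.exp (μ * t) * fn (n t) x := by
    by_contra! hlt
    have := hβ.prim_pos _ hlt
    rw [b2] at b1
    exact this.ne' b1
  have he : Real.exp (-(μ * T)) * Real.exp (μ * t) ≤ 1 := by
    rw [← Real.exp_add]
    refine Real.exp_le_one_iff.2 ?_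
    nlinarith [a3.2]
  calc Real.exp (-(μ * T)) * m ≤ Real.exp (-(μ * T)) * (Real.exp (μ * t) * fn (n t) x) := by gcongr
    _ = Real.exp (-(μ * T)) * Real.exp (μ * t) * fn (n t) x := by ring
    _ ≤ fn (n t) x := mul_le_of_le_one_left b3.1 he

/-- The temperature equation is uniformly elliptic and the temperature is bounded from below. -/
theorem exists_lower_bound (hd : 1 ≤ d) (hΩ : IsAdmissibleDomain Ω ΓD ΓN) (hT : 0 < T)
    (hτ : 0 < τ) (hlam : 0 < lam) (hκ : IsConductivity κ) (hD : IsBoundaryData T q nD θD VD)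
    (hI : IsInitialData Ω nI θL C)
    (h : IsBoundedWeakSolution Ω ΓD T τ lam κ nD θD VD nI θL C n θ V) :
    ∃ c > 0, ∀ᵐ t ∂timeMeasure T, ∀ᵐ x ∂volume.restrict Ω,
      c ≤ κ (fn (n t) x) ∧ c ≤ fn (θ t) x := by
  obtain ⟨m, hm, hθ1, hθ2⟩ := h.exists_temperature_lower_bound hd hΩ hτ hκ hD hI
  obtain ⟨K, hK0, hn, -⟩ := h.exists_bound hI
  rcases hκ.lower with ⟨κ₀, hκ₀, hl⟩ | ⟨n₁, hn₁, hl⟩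
  · refine ⟨min κ₀ m, lt_min hκ₀ hm, ?_⟩
    filter_upwards [hn, hθ2 κ₀ hκ₀ hl] with t a1 a2
    filter_upwards [a1, a2] with x b1 b2
    exact ⟨(min_le_left _ _).trans (hl _ b1.1), (min_le_right _ _).trans b2⟩
  · obtain ⟨c, hc, hcn⟩ := h.exists_density_lower_bound hd hΩ hT hτ hlam hκ hn₁ hl hD hI
    -- The density stays in a compact interval of positive numbers, where the continuous positive
    -- function `κ` has a positive minimum. The density being nonzero, the temperature bound holds
    -- almost everywhere too.
    obtain ⟨y, hy, hmin⟩ := isCompact_Icc.exists_isMinOn (nonempty_Icc.2 (le_max_right K c))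
      (hκ.contDiffOn.continuousOn.mono (fun s hs => hc.le.trans hs.1))
    refine ⟨min (κ y) m, lt_min (hκ.pos y (hc.trans_le hy.1)) hm, ?_⟩
    filter_upwards [hn, hcn, hθ1] with t a1 a2 a3
    filter_upwards [a1, a2, a3] with x b1 b2 b3
    exact ⟨(min_le_left _ _).trans (hmin ⟨b2, b1.2.trans (le_max_left _ _)⟩),
      (min_le_right _ _).trans (b3 (hc.trans_le b2).ne')⟩

end IsBoundedWeakSolution

/-! ### Stability of the potential, the temperature and the density -/

/-- A smooth Lipschitz function that agrees with `s²/2` on a bounded interval. -/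
lemma exists_isSmoothLip_sq (K : ℝ) (hK : 0 ≤ K) : ∃ f L, IsSmoothLip f L ∧
    ∀ s, |s| ≤ K → f s = s ^ 2 / 2 ∧ deriv f s = s := by
  let χ : ContDiffBump (0 : ℝ) := ⟨K + 1, K + 2, by linarith, by linarith⟩
  set f : ℝ → ℝ := fun s => χ s * (s ^ 2 / 2) with hf
  have hsm : ContDiff ℝ ∞ f := χ.contDiff.mul ((contDiff_id.pow 2).div_const 2)
  have hcs : HasCompactSupport f := χ.hasCompactSupport.mul_right
  obtain ⟨L, hL⟩ := hcs.deriv.exists_bound_of_continuous (hsm.continuous_deriv (by simp))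
  refine ⟨f, L, ⟨hsm, hL⟩, fun s hs => ?_⟩
  have h1 : ∀ r ∈ Metric.ball (0 : ℝ) (K + 1), f r = r ^ 2 / 2 := fun r hr => by
    simp only [hf]
    rw [χ.one_of_mem_closedBall (Metric.ball_subset_closedBall hr), one_mul]
  have hsb : s ∈ Metric.ball (0 : ℝ) (K + 1) := by
    rw [mem_ball_zero_iff, Real.norm_eq_abs]; linarith
  refine ⟨h1 s hsb, ?_⟩
  have h2 : f =ᶠ[𝓝 s] fun r => r ^ 2 / 2 :=
    eventually_of_mem (Metric.isOpen_ball.mem_nhds hsb) h1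
  rw [h2.deriv_eq]
  simp

lemma fn_sub (u v : H1 Ω) : fn (u - v) =ᵐ[volume.restrict Ω] fun x => fn u x - fn v x :=
  Lp.coeFn_sub (u : L2Pair Ω).fst (v : L2Pair Ω).fst

lemma grad_sub (u v : H1 Ω) : grad (u - v) =ᵐ[volume.restrict Ω] fun x => grad u x - grad v x :=
  Lp.coeFn_sub (u : L2Pair Ω).snd (v : L2Pair Ω).snd

lemma integrable_mul_inner_grad {f : E d → ℝ} {K : ℝ}
    (hf : AEStronglyMeasurable f (volume.restrict Ω)) (hK : ∀ᵐ x ∂volume.restrict Ω, |f x| ≤ K)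
    (u v : H1 Ω) : Integrable (fun x => f x * inner ℝ (grad u x) (grad v x))
      (volume.restrict Ω) := by
  refine integrable_of_abs_le_mul (K := K) (gradL Ω u) (gradL Ω v)
    (hf.mul ((memLp_grad u).1.inner (memLp_grad v).1)) ?_
  filter_upwards [hK] with x hx
  rw [abs_mul]
  exact mul_le_mul hx (abs_real_inner_le_norm _ _) (abs_nonneg _) ((abs_nonneg _).trans hx)

/-- The Lipschitz dependence of the electric field on the density. -/
theorem norm_gradL_potential_sub_le {lam CP : ℝ} (hlam : 0 < lam) (hCP0 : 0 ≤ CP)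
    (hCP : ∀ u ∈ H10 Ω ΓD, ‖fnL Ω u‖ ≤ CP * ‖gradL Ω u‖) {n₁ n₂ V₁ V₂ : H1 Ω} {C : E d → ℝ}
    (hC : MemLp C 2 (volume.restrict Ω)) (hV : V₁ - V₂ ∈ H10 Ω ΓD)
    (h₁ : ∀ φ ∈ H10 Ω ΓD, lam ^ 2 * ∫ x in Ω, (inner ℝ (grad V₁ x) (grad φ x) : ℝ)
      = ∫ x in Ω, (fn n₁ x - C x) * fn φ x)
    (h₂ : ∀ φ ∈ H10 Ω ΓD, lam ^ 2 * ∫ x in Ω, (inner ℝ (grad V₂ x) (grad φ x) : ℝ)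
      = ∫ x in Ω, (fn n₂ x - C x) * fn φ x) :
    ‖gradL Ω (V₁ - V₂)‖ ≤ CP / lam ^ 2 * ‖fnL Ω (n₁ - n₂)‖ := by
  have e1 := h₁ _ hV
  have e2 := h₂ _ hV
  rw [← inner_gradL] at e1 e2
  have hi : ∀ n : H1 Ω, Integrable (fun x => (fn n x - C x) * fn (V₁ - V₂) x)
      (volume.restrict Ω) := fun n => ((memLp_fn n).sub hC).integrable_mul (memLp_fn (V₁ - V₂))
  have e3 : inner ℝ (fnL Ω (n₁ - n₂)) (fnL Ω (V₁ - V₂))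
      = (∫ x in Ω, (fn n₁ x - C x) * fn (V₁ - V₂) x)
        - ∫ x in Ω, (fn n₂ x - C x) * fn (V₁ - V₂) x := by
    rw [inner_fnL, ← integral_sub (hi n₁) (hi n₂)]
    refine integral_congr_ae ?_
    filter_upwards [fn_sub n₁ n₂] with x hx
    rw [hx]; ring
  have e4 : lam ^ 2 * ‖gradL Ω (V₁ - V₂)‖ ^ 2
      = inner ℝ (fnL Ω (n₁ - n₂)) (fnL Ω (V₁ - V₂)) := by
    rw [e3, ← e1, ← e2, ← mul_sub, ← inner_sub_left, ← map_sub, real_inner_self_eq_norm_sq]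
  have e5 := real_inner_le_norm (fnL Ω (n₁ - n₂)) (fnL Ω (V₁ - V₂))
  have e6 := mul_le_mul_of_nonneg_left (hCP _ hV) (norm_nonneg (fnL Ω (n₁ - n₂)))
  have hl : 0 < lam ^ 2 := by positivity
  rcases (norm_nonneg (gradL Ω (V₁ - V₂))).eq_or_lt with h0 | h0
  · rw [← h0]; positivity
  · rw [div_mul_eq_mul_div, le_div_iff₀ hl]
    refine le_of_mul_le_mul_right ?_ h0
    linarith

/-- The pointwise monotonicity estimate behind the stability of the temperature. -/
lemma temperature_flux_sub_ge {G : Type*} [NormedAddCommGroup G] [InnerProductSpace ℝ G]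
    {c K Λ τ k₁ k₂ n₁ n₂ t₁ t₂ tL : ℝ} {g₁ g₂ : G} (hτ : 0 < τ) (hΛ0 : 0 ≤ Λ)
    (hk : |k₁ - k₂| ≤ Λ * |n₁ - n₂|) (hn : 0 ≤ n₂) (ht : |t₁| ≤ K) (htL : |tL| ≤ K)
    (hg : ‖g₁‖ ≤ K) (hc : c ≤ k₂) :
    c * ‖g₁ - g₂‖ ^ 2 ≤ k₁ * inner ℝ g₁ (g₁ - g₂) - k₂ * inner ℝ g₂ (g₁ - g₂)
      + (n₁ / τ * (t₁ - tL) * (t₁ - t₂) - n₂ / τ * (t₂ - tL) * (t₁ - t₂))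
      + (Λ * K * (‖n₁ - n₂‖ * ‖g₁ - g₂‖) + 2 * K / τ * (‖n₁ - n₂‖ * ‖t₁ - t₂‖)) := by
  have e : inner ℝ g₂ (g₁ - g₂) = inner ℝ g₁ (g₁ - g₂) - ‖g₁ - g₂‖ ^ 2 := by
    rw [← real_inner_self_eq_norm_sq, ← inner_sub_left]; simp
  have c2 := abs_real_inner_le_norm g₁ (g₁ - g₂)
  have c3 : -(Λ * K * (‖n₁ - n₂‖ * ‖g₁ - g₂‖)) ≤ (k₁ - k₂) * inner ℝ g₁ (g₁ - g₂) := by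
    refine (neg_le_neg ?_).trans (neg_abs_le _)
    rw [abs_mul, Real.norm_eq_abs]
    calc _ ≤ Λ * |n₁ - n₂| * (‖g₁‖ * ‖g₁ - g₂‖) := by gcongr
      _ ≤ Λ * |n₁ - n₂| * (K * ‖g₁ - g₂‖) := by gcongr
      _ = _ := by ring
  have c4 : -(2 * K / τ * (‖n₁ - n₂‖ * ‖t₁ - t₂‖))
      ≤ (n₁ - n₂) / τ * (t₁ - tL) * (t₁ - t₂) := by
    refine (neg_le_neg ?_).trans (neg_abs_le _)
    have c5 : |t₁ - tL| ≤ K + K := (abs_sub _ _).trans (add_le_add ht htL)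
    rw [abs_mul, abs_mul, abs_div, abs_of_pos hτ, Real.norm_eq_abs, Real.norm_eq_abs]
    calc _ ≤ |n₁ - n₂| / τ * (K + K) * |t₁ - t₂| := by gcongr
      _ = _ := by ring
  have c6 : c * ‖g₁ - g₂‖ ^ 2 ≤ k₂ * ‖g₁ - g₂‖ ^ 2 := by gcongr
  -- The relaxation term is monotone in the temperature because `n₂ ≥ 0`; this part is discarded,
  -- and only the change of its coefficient has to be estimated.
  have c7 : 0 ≤ n₂ / τ * (t₁ - t₂) ^ 2 := mul_nonneg (div_nonneg hn hτ.le) (sq_nonneg _)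
  rw [sub_div] at c4
  rw [e]
  linarith

set_option maxHeartbeats 1000000 in
/-- The Lipschitz dependence of the temperature on the density. -/
theorem norm_gradL_temperature_sub_le {κ : ℝ → ℝ} (hκ : IsConductivity κ) {τ c K Λ CP : ℝ}
    (hτ : 0 < τ) (hc : 0 < c) (hK : 0 ≤ K) (hΛ0 : 0 ≤ Λ)
    (hΛ : ∀ a b, 0 ≤ a → a ≤ K → 0 ≤ b → b ≤ K → |κ a - κ b| ≤ Λ * |a - b|) (hCP0 : 0 ≤ CP)
    (hCP : ∀ u ∈ H10 Ω ΓD, ‖fnL Ω u‖ ≤ CP * ‖gradL Ω u‖) {n₁ n₂ θ₁ θ₂ : H1 Ω} {θL : E d → ℝ}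
    (hθLm : AEStronglyMeasurable θL (volume.restrict Ω))
    (hθL : ∀ᵐ x ∂volume.restrict Ω, |θL x| ≤ K) (hΘ : θ₁ - θ₂ ∈ H10 Ω ΓD)
    (hn₁ : ∀ᵐ x ∂volume.restrict Ω, 0 ≤ fn n₁ x ∧ fn n₁ x ≤ K)
    (hn₂ : ∀ᵐ x ∂volume.restrict Ω, 0 ≤ fn n₂ x ∧ fn n₂ x ≤ K)
    (hθ₁ : ∀ᵐ x ∂volume.restrict Ω, |fn θ₁ x| ≤ K)
    (hθ₂ : ∀ᵐ x ∂volume.restrict Ω, |fn θ₂ x| ≤ K)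
    (hgθ : ∀ᵐ x ∂volume.restrict Ω, ‖grad θ₁ x‖ ≤ K)
    (hκc : ∀ᵐ x ∂volume.restrict Ω, c ≤ κ (fn n₂ x))
    (h₁ : ∀ φ ∈ H10 Ω ΓD, - ∫ x in Ω, κ (fn n₁ x) * (inner ℝ (grad θ₁ x) (grad φ x) : ℝ)
        = ∫ x in Ω, fn n₁ x / τ * (fn θ₁ x - θL x) * fn φ x)
    (h₂ : ∀ φ ∈ H10 Ω ΓD, - ∫ x in Ω, κ (fn n₂ x) * (inner ℝ (grad θ₂ x) (grad φ x) : ℝ)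
        = ∫ x in Ω, fn n₂ x / τ * (fn θ₂ x - θL x) * fn φ x) :
    ‖gradL Ω (θ₁ - θ₂)‖ ≤ (Λ * K + 2 * K / τ * CP) / c * ‖fnL Ω (n₁ - n₂)‖ := by
  have e1 := h₁ _ hΘ
  have e2 := h₂ _ hΘ
  obtain ⟨M, hM0, hM⟩ := hκ.exists_bound K
  have hi : ∀ n θ : H1 Ω, (∀ᵐ x ∂volume.restrict Ω, 0 ≤ fn n x ∧ fn n x ≤ K) →
      Integrable (fun x => κ (fn n x) * (inner ℝ (grad θ x) (grad (θ₁ - θ₂) x) : ℝ))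
        (volume.restrict Ω) := fun n θ hn =>
    integrable_mul_inner_grad (K := M)
      (hκ.aestronglyMeasurable_comp (memLp_fn n).1 (hn.mono fun x hx => hx.1))
      (hn.mono fun x hx => hM _ hx.1 hx.2) θ (θ₁ - θ₂)
  have hj : ∀ n θ : H1 Ω, (∀ᵐ x ∂volume.restrict Ω, 0 ≤ fn n x ∧ fn n x ≤ K) →
      (∀ᵐ x ∂volume.restrict Ω, |fn θ x| ≤ K) →
      Integrable (fun x => fn n x / τ * (fn θ x - θL x) * fn (θ₁ - θ₂) x)
        (volume.restrict Ω) := fun n θ hn hθ => by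
    refine integrable_of_abs_le_mul (K := 2 * K / τ) (fnL Ω n) (fnL Ω (θ₁ - θ₂))
      ((((memLp_fn n).1.mul_const τ⁻¹).mul ((memLp_fn θ).1.sub hθLm)).mul
        (memLp_fn (θ₁ - θ₂)).1) ?_
    filter_upwards [hn, hθ, hθL] with x a1 a2 a3
    have a4 : |fn θ x - θL x| ≤ K + K := (abs_sub _ _).trans (add_le_add a2 a3)
    rw [abs_mul, abs_mul, abs_div, abs_of_pos hτ, coeFn_fnL, coeFn_fnL, Real.norm_eq_abs,
      Real.norm_eq_abs]
    calc |fn n x| / τ * |fn θ x - θL x| * |fn (θ₁ - θ₂) x|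
        ≤ |fn n x| / τ * (K + K) * |fn (θ₁ - θ₂) x| := by gcongr
      _ = 2 * K / τ * (|fn n x| * |fn (θ₁ - θ₂) x|) := by ring
  have s1 := integral_sub (hi n₁ θ₁ hn₁) (hi n₂ θ₂ hn₂)
  have s2 := integral_sub (hj n₁ θ₁ hn₁ hθ₁) (hj n₂ θ₂ hn₂ hθ₂)
  have p1 := integral_norm_mul_norm_le (fnL Ω (n₁ - n₂)) (gradL Ω (θ₁ - θ₂))
  have p2 := integral_norm_mul_norm_le (fnL Ω (n₁ - n₂)) (fnL Ω (θ₁ - θ₂))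
  have i0 : Integrable (fun x => c * ‖grad (θ₁ - θ₂) x‖ ^ 2) (volume.restrict Ω) :=
    ((memLp_two_iff_integrable_sq_norm (memLp_grad _).1).1 (memLp_grad (θ₁ - θ₂))).const_mul c
  have i1 := (integrable_norm_mul_norm (fnL Ω (n₁ - n₂)) (gradL Ω (θ₁ - θ₂))).const_mul (Λ * K)
  have i2 := (integrable_norm_mul_norm (fnL Ω (n₁ - n₂)) (fnL Ω (θ₁ - θ₂))).const_mul (2 * K / τ)
  have i3 := (hi n₁ θ₁ hn₁).sub (hi n₂ θ₂ hn₂)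
  have i4 := (hj n₁ θ₁ hn₁ hθ₁).sub (hj n₂ θ₂ hn₂ hθ₂)
  have key : c * ‖gradL Ω (θ₁ - θ₂)‖ ^ 2 ≤ Λ * K * ‖fnL Ω (n₁ - n₂)‖ * ‖gradL Ω (θ₁ - θ₂)‖
      + 2 * K / τ * ‖fnL Ω (n₁ - n₂)‖ * ‖fnL Ω (θ₁ - θ₂)‖ := by
    have hmono : ∫ x in Ω, c * ‖grad (θ₁ - θ₂) x‖ ^ 2 ≤ _ :=
      integral_mono_ae i0 ((i3.add i4).add (i1.add i2)) ?_
    · rw [integral_const_mul, ← norm_gradL_sq] at hmono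
      refine hmono.trans ?_
      rw [integral_add' (i3.add i4) (i1.add i2), integral_add' i3 i4, integral_add' i1 i2,
        integral_const_mul, integral_const_mul]
      have s1' : ∫ x in Ω, ((fun x => κ (fn n₁ x) * (inner ℝ (grad θ₁ x) (grad (θ₁ - θ₂) x) : ℝ))
        - fun x => κ (fn n₂ x) * (inner ℝ (grad θ₂ x) (grad (θ₁ - θ₂) x) : ℝ)) x = _ := s1
      have s2' : ∫ x in Ω, ((fun x => fn n₁ x / τ * (fn θ₁ x - θL x) * fn (θ₁ - θ₂) x)
        - fun x => fn n₂ x / τ * (fn θ₂ x - θL x) * fn (θ₁ - θ₂) x) x = _ := s2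
      rw [s1', s2']
      have q1 := mul_le_mul_of_nonneg_left p1 (mul_nonneg hΛ0 hK)
      have q2 := mul_le_mul_of_nonneg_left p2 (show 0 ≤ 2 * K / τ by positivity)
      linarith
    · filter_upwards [hn₁, hn₂, hθ₁, hθL, hgθ, hκc, fn_sub n₁ n₂, fn_sub θ₁ θ₂, grad_sub θ₁ θ₂]
        with x a1 a2 a3 a4 a5 a6 a7 a8 a9
      simp only [Pi.add_apply, Pi.sub_apply, coeFn_fnL, coeFn_gradL]
      rw [a7, a8, a9]
      exact temperature_flux_sub_ge hτ hΛ0 (hΛ _ _ a1.1 a1.2 a2.1 a2.2) a2.1 a3 a4 a5 a6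
  have hp := mul_le_mul_of_nonneg_left (hCP _ hΘ)
    (show 0 ≤ 2 * K / τ * ‖fnL Ω (n₁ - n₂)‖ by positivity)
  rcases (norm_nonneg (gradL Ω (θ₁ - θ₂))).eq_or_lt with h0 | h0
  · rw [← h0]; positivity
  · rw [div_mul_eq_mul_div, le_div_iff₀ hc]
    refine le_of_mul_le_mul_right ?_ h0
    linarith

/-- The pointwise estimate of the difference of two fluxes of the density. -/
lemma density_flux_sub_ge {G : Type*} [NormedAddCommGroup G] [InnerProductSpace ℝ G]
    {c K n₁ n₂ t₁ t₂ : ℝ} {g₁ g₂ q₁ q₂ e₁ e₂ : G} (hn : 0 ≤ n₂ ∧ n₂ ≤ K) (ht : c ≤ t₁)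
    (hq : ‖q₁‖ ≤ K) :
    c * ‖g₁ - g₂‖ ^ 2 + (n₁ - n₂) * inner ℝ e₁ (g₁ - g₂)
      - (‖(t₁ - t₂) • g₂‖ * ‖g₁ - g₂‖ + K * (‖n₁ - n₂‖ * ‖g₁ - g₂‖)
        + K * (‖q₁ - q₂‖ * ‖g₁ - g₂‖) + K * (‖e₁ - e₂‖ * ‖g₁ - g₂‖))
      ≤ inner ℝ (t₁ • g₁ + n₁ • q₁ + n₁ • e₁) (g₁ - g₂)
        - inner ℝ (t₂ • g₂ + n₂ • q₂ + n₂ • e₂) (g₁ - g₂) := by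
  -- The splitting puts `q₁ = ∇θ₁`, which is bounded, and `e₁ = ∇V₁` next to `n₁ - n₂`. No pointwise
  -- bound on `e₁` is available, so its term is kept exactly and treated after integration.
  have hdec : inner ℝ (t₁ • g₁ + n₁ • q₁ + n₁ • e₁) (g₁ - g₂)
      - inner ℝ (t₂ • g₂ + n₂ • q₂ + n₂ • e₂) (g₁ - g₂)
      = t₁ * ‖g₁ - g₂‖ ^ 2 + inner ℝ ((t₁ - t₂) • g₂) (g₁ - g₂)
        + (n₁ - n₂) * inner ℝ q₁ (g₁ - g₂) + n₂ * inner ℝ (q₁ - q₂) (g₁ - g₂)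
        + (n₁ - n₂) * inner ℝ e₁ (g₁ - g₂) + n₂ * inner ℝ (e₁ - e₂) (g₁ - g₂) := by
    rw [← real_inner_self_eq_norm_sq, ← real_inner_smul_left, ← real_inner_smul_left,
      ← real_inner_smul_left, ← real_inner_smul_left, ← real_inner_smul_left, ← inner_sub_left,
      ← inner_add_left, ← inner_add_left, ← inner_add_left, ← inner_add_left, ← inner_add_left]
    congr 1
    module
  rw [hdec]
  have a1 := neg_le_of_abs_le (abs_real_inner_le_norm ((t₁ - t₂) • g₂) (g₁ - g₂))
  have a2 : -(K * (‖n₁ - n₂‖ * ‖g₁ - g₂‖)) ≤ (n₁ - n₂) * inner ℝ q₁ (g₁ - g₂) := by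
    refine (neg_le_neg ?_).trans (neg_abs_le _)
    rw [abs_mul, Real.norm_eq_abs]
    calc _ ≤ |n₁ - n₂| * (‖q₁‖ * ‖g₁ - g₂‖) := by gcongr; exact abs_real_inner_le_norm _ _
      _ ≤ |n₁ - n₂| * (K * ‖g₁ - g₂‖) := by gcongr
      _ = _ := by ring
  have a3 : ∀ v : G, -(K * (‖v‖ * ‖g₁ - g₂‖)) ≤ n₂ * inner ℝ v (g₁ - g₂) := fun v => by
    refine (neg_le_neg ?_).trans (neg_abs_le _)
    rw [abs_mul, abs_of_nonneg hn.1]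
    exact mul_le_mul hn.2 (abs_real_inner_le_norm _ _) (abs_nonneg _) (hn.1.trans hn.2)
  have a4 : c * ‖g₁ - g₂‖ ^ 2 ≤ t₁ * ‖g₁ - g₂‖ ^ 2 := by gcongr
  linarith [a3 (q₁ - q₂), a3 (e₁ - e₂)]

lemma integrable_inner_flux {K : ℝ} {n θ V : H1 Ω}
    (hn : ∀ᵐ x ∂volume.restrict Ω, 0 ≤ fn n x ∧ fn n x ≤ K)
    (hθ : ∀ᵐ x ∂volume.restrict Ω, |fn θ x| ≤ K) (v : H1 Ω) :
    Integrable (fun x => (inner ℝ (fn θ x • grad n x + fn n x • grad θ x + fn n x • grad V x)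
      (grad v x) : ℝ)) (volume.restrict Ω) := by
  have hn' : ∀ᵐ x ∂volume.restrict Ω, |fn n x| ≤ K := hn.mono fun x hx =>
    (abs_of_nonneg hx.1).trans_le hx.2
  refine (((integrable_mul_inner_grad (memLp_fn θ).1 hθ n v).add
    (integrable_mul_inner_grad (memLp_fn n).1 hn' θ v)).add
    (integrable_mul_inner_grad (memLp_fn n).1 hn' V v)).congr (Eventually.of_forall fun x => ?_)
  simp only [Pi.add_apply, inner_add_left, real_inner_smul_left]

/-- The drift term of the density equation, tested with the difference of two densities. -/
lemma integral_mul_inner_grad_potential_ge (hΩ : IsAdmissibleDomain Ω ΓD ΓN) {lam K : ℝ}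
    (hlam : 0 < lam) (hK : 0 ≤ K) {n₁ n V : H1 Ω} {C : E d → ℝ} (hn : n ∈ H10 Ω ΓD)
    (hCm : AEStronglyMeasurable C (volume.restrict Ω))
    (hC : ∀ᵐ x ∂volume.restrict Ω, 0 ≤ C x ∧ C x ≤ K)
    (hn₁ : ∀ᵐ x ∂volume.restrict Ω, 0 ≤ fn n₁ x ∧ fn n₁ x ≤ K)
    (hnK : ∀ᵐ x ∂volume.restrict Ω, |fn n x| ≤ K)
    (h : ∀ φ ∈ H10 Ω ΓD, lam ^ 2 * ∫ x in Ω, (inner ℝ (grad V x) (grad φ x) : ℝ)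
      = ∫ x in Ω, (fn n₁ x - C x) * fn φ x) :
    -(K / (2 * lam ^ 2) * ‖fnL Ω n‖ ^ 2) ≤ ∫ x in Ω, fn n x * inner ℝ (grad V x) (grad n x) := by
  have hfin := hΩ.isFiniteMeasure
  -- The test function is `n²/2`, admissible because `n` is bounded and vanishes on `Γ_D`; its
  -- gradient `n∇n` reproduces the drift term. The lower bound then comes from `n₁ - C ≥ -K`.
  obtain ⟨f, L, hf, hfs⟩ := exists_isSmoothLip_sq K hK
  obtain ⟨F, -, hF⟩ := hf.exists_comp hΩ
  obtain ⟨v, hv1, hv2⟩ : ∃ v : H1 Ω, fn v =ᵐ[volume.restrict Ω] (fun x => f (fn n x)) ∧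
    grad v =ᵐ[volume.restrict Ω] fun x => deriv f (fn n x) • grad n x := ⟨F n, hF n⟩
  have hv : v ∈ H10 Ω ΓD := hf.comp_mem_H10_of_zero hΩ hn
    (by rw [(hfs 0 (by simpa using hK)).1]; simp) hv1 hv2
  have e := h v hv
  have e1 : ∫ x in Ω, (inner ℝ (grad V x) (grad v x) : ℝ)
      = ∫ x in Ω, fn n x * inner ℝ (grad V x) (grad n x) := by
    refine integral_congr_ae ?_
    filter_upwards [hv2, hnK] with x h1 h2
    rw [h1, (hfs _ h2).2]
    exact real_inner_smul_right _ _ _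
  rw [e1] at e
  have hC2 : MemLp C 2 (volume.restrict Ω) := by
    refine MemLp.of_bound hCm K ?_
    filter_upwards [hC] with x hx
    rw [Real.norm_of_nonneg hx.1]; exact hx.2
  have hi : Integrable (fun x => (fn n₁ x - C x) * fn v x) (volume.restrict Ω) :=
    ((memLp_fn n₁).sub hC2).integrable_mul (memLp_fn v)
  have hi2 : Integrable (fun x => -(K / 2) * fn n x ^ 2) (volume.restrict Ω) :=
    ((memLp_two_iff_integrable_sq (memLp_fn n).1).1 (memLp_fn n)).const_mul _
  have hle : ∫ x in Ω, -(K / 2) * fn n x ^ 2 ≤ ∫ x in Ω, (fn n₁ x - C x) * fn v x := by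
    refine integral_mono_ae hi2 hi ?_
    filter_upwards [hn₁, hC, hv1, hnK] with x h1 h2 h3 h4
    rw [h3, (hfs _ h4).1]
    nlinarith [sq_nonneg (fn n x), h1.1, h2.2]
  rw [integral_const_mul, ← norm_fnL_sq, ← e] at hle
  have hl : 0 < lam ^ 2 := by positivity
  have e2 : K / (2 * lam ^ 2) * ‖fnL Ω n‖ ^ 2 = K / 2 * ‖fnL Ω n‖ ^ 2 / lam ^ 2 := by
    field_simp
  rw [e2, neg_le, ← sub_nonneg]
  have e3 := div_nonneg (sub_nonneg.2 hle) hl.le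
  rw [sub_div, mul_div_cancel_left₀ _ hl.ne', neg_mul, neg_div] at e3
  linarith

set_option maxHeartbeats 1000000 in
/-- The difference of the density equations, tested with the difference of the densities. -/
theorem density_sub_le (hΩ : IsAdmissibleDomain Ω ΓD ΓN) {lam c K R : ℝ}
    (hlam : 0 < lam) (hK : 0 ≤ K) {n₁ n₂ θ₁ θ₂ V₁ V₂ : H1 Ω} {C : E d → ℝ}
    (hn : n₁ - n₂ ∈ H10 Ω ΓD)
    (hCm : AEStronglyMeasurable C (volume.restrict Ω))
    (hC : ∀ᵐ x ∂volume.restrict Ω, 0 ≤ C x ∧ C x ≤ K)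
    (hn₁ : ∀ᵐ x ∂volume.restrict Ω, 0 ≤ fn n₁ x ∧ fn n₁ x ≤ K)
    (hn₂ : ∀ᵐ x ∂volume.restrict Ω, 0 ≤ fn n₂ x ∧ fn n₂ x ≤ K)
    (hθ₁ : ∀ᵐ x ∂volume.restrict Ω, |fn θ₁ x| ≤ K)
    (hθ₂ : ∀ᵐ x ∂volume.restrict Ω, |fn θ₂ x| ≤ K)
    (hgθ : ∀ᵐ x ∂volume.restrict Ω, ‖grad θ₁ x‖ ≤ K)
    (hθc : ∀ᵐ x ∂volume.restrict Ω, c ≤ fn θ₁ x)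
    (hP : MemLp (fun x => fn (θ₁ - θ₂) x • grad n₂ x) 2 (volume.restrict Ω))
    (hPR : ‖hP.toLp _‖ ≤ R)
    (h₁ : ∀ φ ∈ H10 Ω ΓD, lam ^ 2 * ∫ x in Ω, (inner ℝ (grad V₁ x) (grad φ x) : ℝ)
      = ∫ x in Ω, (fn n₁ x - C x) * fn φ x) {W₁ W₂ : ℝ}
    (hW₁ : W₁ + ∫ x in Ω, (inner ℝ (fn θ₁ x • grad n₁ x + fn n₁ x • grad θ₁ x
      + fn n₁ x • grad V₁ x) (grad (n₁ - n₂) x) : ℝ) = 0)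
    (hW₂ : W₂ + ∫ x in Ω, (inner ℝ (fn θ₂ x • grad n₂ x + fn n₂ x • grad θ₂ x
      + fn n₂ x • grad V₂ x) (grad (n₁ - n₂) x) : ℝ) = 0) :
    W₁ - W₂ ≤ -(c * ‖gradL Ω (n₁ - n₂)‖ ^ 2) + (R + K * (‖fnL Ω (n₁ - n₂)‖
      + ‖gradL Ω (θ₁ - θ₂)‖ + ‖gradL Ω (V₁ - V₂)‖)) * ‖gradL Ω (n₁ - n₂)‖
      + K / (2 * lam ^ 2) * ‖fnL Ω (n₁ - n₂)‖ ^ 2 := by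
  have hnK : ∀ᵐ x ∂volume.restrict Ω, |fn (n₁ - n₂) x| ≤ K := by
    filter_upwards [hn₁, hn₂, fn_sub n₁ n₂] with x a1 a2 a3
    rw [a3]
    exact abs_le.2 ⟨by linarith [a1.1, a2.2], by linarith [a1.2, a2.1]⟩
  have hdrift := integral_mul_inner_grad_potential_ge hΩ hlam hK hn hCm hC hn₁ hnK h₁
  have i0 : Integrable (fun x => c * ‖grad (n₁ - n₂) x‖ ^ 2) (volume.restrict Ω) :=
    ((memLp_two_iff_integrable_sq_norm (memLp_grad _).1).1 (memLp_grad (n₁ - n₂))).const_mul c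
  have i1 := integrable_mul_inner_grad (memLp_fn (n₁ - n₂)).1 hnK V₁ (n₁ - n₂)
  have i2 := integrable_norm_mul_norm (hP.toLp _) (gradL Ω (n₁ - n₂))
  have i3 := (integrable_norm_mul_norm (fnL Ω (n₁ - n₂)) (gradL Ω (n₁ - n₂))).const_mul K
  have i4 := (integrable_norm_mul_norm (gradL Ω (θ₁ - θ₂)) (gradL Ω (n₁ - n₂))).const_mul K
  have i5 := (integrable_norm_mul_norm (gradL Ω (V₁ - V₂)) (gradL Ω (n₁ - n₂))).const_mul K
  have f1 := integrable_inner_flux (V := V₁) hn₁ hθ₁ (n₁ - n₂)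
  have f2 := integrable_inner_flux (V := V₂) hn₂ hθ₂ (n₁ - n₂)
  have hmono := integral_mono_ae ((i0.add i1).sub (((i2.add i3).add i4).add i5)) (f1.sub f2) (by
    filter_upwards [hn₂, hgθ, hθc, fn_sub n₁ n₂, grad_sub n₁ n₂, fn_sub θ₁ θ₂, grad_sub θ₁ θ₂,
      grad_sub V₁ V₂, hP.coeFn_toLp] with x a1 a2 a3 a4 a5 a6 a7 a8 a9
    simp only [Pi.add_apply, Pi.sub_apply, coeFn_fnL, coeFn_gradL]
    rw [a9, a4, a5, a6, a7, a8]
    exact density_flux_sub_ge a1 a3 a2)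
  rw [integral_sub' (i0.add i1) (((i2.add i3).add i4).add i5), integral_add' i0 i1,
    integral_add' ((i2.add i3).add i4) i5, integral_add' (i2.add i3) i4, integral_add' i2 i3,
    integral_sub' f1 f2, integral_const_mul, ← norm_gradL_sq, integral_const_mul,
    integral_const_mul, integral_const_mul] at hmono
  have q2 := (integral_norm_mul_norm_le (hP.toLp _) (gradL Ω (n₁ - n₂))).trans
    (mul_le_mul_of_nonneg_right hPR (norm_nonneg _))
  have q3 := mul_le_mul_of_nonneg_left
    (integral_norm_mul_norm_le (fnL Ω (n₁ - n₂)) (gradL Ω (n₁ - n₂))) hK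
  have q4 := mul_le_mul_of_nonneg_left
    (integral_norm_mul_norm_le (gradL Ω (θ₁ - θ₂)) (gradL Ω (n₁ - n₂))) hK
  have q5 := mul_le_mul_of_nonneg_left
    (integral_norm_mul_norm_le (gradL Ω (V₁ - V₂)) (gradL Ω (n₁ - n₂))) hK
  linarith

/-! ### Gronwall's lemma with an integrable coefficient -/

/-- A nonnegative function dominated by the product of an integrable function with its own
primitive has vanishing integral. -/
lemma integral_eq_zero_of_le_mul_primitive {T : ℝ} (hT : 0 ≤ T) {G k : ℝ → ℝ} (hG : Integrable G)
    (hk : Integrable k) (hG0 : ∀ᵐ t, 0 ≤ G t) (hk0 : ∀ᵐ t, 0 ≤ k t)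
    (h : ∀ᵐ t, t ∈ Ioo 0 T → k t ≤ G t * ∫ s in (0 : ℝ)..t, k s) :
    ∫ s in (0 : ℝ)..T, k s = 0 := by
  have hki : ∀ a b, IntervalIntegrable k volume a b := fun a b => hk.intervalIntegrable
  have hGi : ∀ a b, IntervalIntegrable G volume a b := fun a b => hG.intervalIntegrable
  set Φ : ℝ → ℝ := fun t => ∫ s in (0 : ℝ)..t, k s with hΦ
  have hΦc : Continuous Φ := intervalIntegral.continuous_primitive hki 0
  have hsub : ∀ a b, Φ b - Φ a = ∫ s in a..b, k s := fun a b =>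
    intervalIntegral.integral_interval_sub_left (hki 0 b) (hki 0 a)
  have hmono : Monotone Φ := fun a b hab => by
    have := intervalIntegral.integral_nonneg_of_ae hab hk0
    rw [← hsub] at this
    linarith
  have hΦ0 : Φ 0 = 0 := by simp [hΦ]
  have hZ : IsCompact (Icc 0 T ∩ Φ ⁻¹' {0}) :=
    isCompact_Icc.inter_right (isClosed_singleton.preimage hΦc)
  -- Let `s` be the last zero of the nondecreasing primitive `Φ`. Shortly after `s` the integral of
  -- `G` is below `1/2`, and monotonicity gives `Φ(r) ≤ Φ(r)/2`, hence a later zero unless `s = T`.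
  obtain ⟨s, ⟨hsT, hs0⟩, hmax⟩ := hZ.exists_isGreatest ⟨0, ⟨le_rfl, hT⟩, hΦ0⟩
  have hs0' : Φ s = 0 := hs0
  rcases hsT.2.eq_or_lt with rfl | hlt
  · exact hs0
  exfalso
  have hΨ : Continuous fun r => ∫ t in s..r, G t := intervalIntegral.continuous_primitive hGi s
  have h1 : ∀ᶠ r in 𝓝[>] s, ∫ t in s..r, G t < 1 / 2 := by
    refine (hΨ.continuousAt.eventually (gt_mem_nhds ?_)).filter_mono nhdsWithin_le_nhds
    simp
  obtain ⟨r, hr, hsr, hrT⟩ := (h1.and (Ioo_mem_nhdsGT hlt)).exists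
  have hle : ∫ t in s..r, k t ≤ ∫ t in s..r, G t * Φ r := by
    rw [intervalIntegral.integral_of_le hsr.le, intervalIntegral.integral_of_le hsr.le]
    refine setIntegral_mono_ae_restrict hk.integrableOn (hG.mul_const _).integrableOn ?_
    filter_upwards [ae_restrict_mem measurableSet_Ioc, ae_restrict_of_ae h,
      ae_restrict_of_ae hG0] with t ht h2 h3
    exact (h2 ⟨hsT.1.trans_lt ht.1, ht.2.trans_lt hrT⟩).trans
      (mul_le_mul_of_nonneg_left (hmono ht.2) h3)
  rw [← hsub, hs0', sub_zero, intervalIntegral.integral_mul_const] at hle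
  have hr0 : 0 ≤ Φ r := hs0'.symm.le.trans (hmono hsr.le)
  have hrz : Φ r = 0 := by nlinarith
  exact absurd (hmax ⟨⟨hsT.1.trans hsr.le, hrT.le⟩, hrz⟩) (not_le.2 hsr)

/-- Gronwall's lemma with an integrable coefficient. -/
theorem ae_eq_zero_of_le_integral {T : ℝ} (hT : 0 ≤ T) {G Y : ℝ → ℝ}
    (hG : Integrable G (timeMeasure T)) (hGY : Integrable (fun t => G t * Y t) (timeMeasure T))
    (hG0 : ∀ᵐ t ∂timeMeasure T, 0 ≤ G t) (hY0 : ∀ᵐ t ∂timeMeasure T, 0 ≤ Y t)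
    (h : ∀ᵐ t ∂timeMeasure T, Y t ≤ ∫ s in Ioo 0 t, G s * Y s) :
    ∀ᵐ t ∂timeMeasure T, Y t = 0 := by
  have hm : MeasurableSet (Ioo 0 T) := measurableSet_Ioo
  have hGi : Integrable ((Ioo 0 T).indicator G) := (integrable_indicator_iff hm).2 hG
  have hki : Integrable ((Ioo 0 T).indicator fun t => G t * Y t) :=
    (integrable_indicator_iff hm).2 hGY
  have hprim : ∀ t ∈ Ioo 0 T, ∫ s in (0 : ℝ)..t, (Ioo 0 T).indicator (fun t => G t * Y t) s
      = ∫ s in Ioo 0 t, G s * Y s := fun t ht => by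
    rw [intervalIntegral.integral_of_le ht.1.le, integral_Ioc_eq_integral_Ioo,
      setIntegral_indicator hm, inter_eq_left.2 (Ioo_subset_Ioo_right ht.2.le)]
  have hG0' := (ae_restrict_iff' hm).1 hG0
  have hY0' := (ae_restrict_iff' hm).1 hY0
  have h' := (ae_restrict_iff' hm).1 h
  have hk0 : ∀ᵐ t, 0 ≤ (Ioo 0 T).indicator (fun t => G t * Y t) t := by
    filter_upwards [hG0', hY0'] with t h1 h2
    exact indicator_apply_nonneg (fun ht => mul_nonneg (h1 ht) (h2 ht))
  have hz := integral_eq_zero_of_le_mul_primitive hT hGi hki (by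
    filter_upwards [hG0'] with t h1
    exact indicator_apply_nonneg h1) hk0 (by
    filter_upwards [hG0', h'] with t h1 h2 ht
    rw [hprim t ht, indicator_of_mem ht, indicator_of_mem ht]
    exact mul_le_mul_of_nonneg_left (h2 ht) (h1 ht))
  filter_upwards [h, hY0, ae_restrict_mem hm] with t h1 h2 ht
  refine le_antisymm (h1.trans ?_) h2
  have e := intervalIntegral.integral_mono_interval le_rfl ht.1.le ht.2.le
    (ae_restrict_of_ae hk0) hki.intervalIntegrable
  rwa [hz, hprim t ht] at e

/-- For `d = 1` the exponent `p` may be as small as one, so `2` takes its place and the `L²` norm of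
the gradient is used. -/
lemma exists_norm_toLp_smul_le (hd : 1 ≤ d) (hΩ : IsAdmissibleDomain Ω ΓD ΓN) {p : ℝ≥0∞}
    (hp2 : d = 2 → 2 < p) (hp3 : 3 ≤ d → (d : ℝ≥0∞) ≤ p) :
    ∃ S : ℝ, 0 ≤ S ∧ ∀ u ∈ H10 Ω ΓD, ∀ v : H1 Ω, ∀ k : ℝ, 0 ≤ k →
      eLpNorm (grad v) (if d = 1 then 2 else p) (volume.restrict Ω) ≤ ENNReal.ofReal k →
      ∃ h : MemLp (fun x => fn u x • grad v x) 2 (volume.restrict Ω),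
        ‖h.toLp _‖ ≤ S * ‖gradL Ω u‖ * k := by
  obtain ⟨S, hS⟩ := exists_eLpNorm_smul_le hd hΩ hp2 hp3
  refine ⟨S, S.coe_nonneg, fun u hu v k hk hv => ?_⟩
  have h1 : eLpNorm (fun x => fn u x • grad v x) 2 (volume.restrict Ω)
      ≤ ENNReal.ofReal (S * ‖gradL Ω u‖ * k) := by
    refine (hS u hu _ (memLp_grad v).1).trans ?_
    rw [ENNReal.ofReal_mul (by positivity), ENNReal.ofReal_mul S.coe_nonneg, ENNReal.ofReal_coe_nnreal,
      mul_assoc, Lp.norm_def, coeFn_gradL, ENNReal.ofReal_toReal (memLp_grad u).2.ne]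
    gcongr
  have hm : MemLp (fun x => fn u x • grad v x) 2 (volume.restrict Ω) :=
    ⟨(memLp_fn u).1.smul (memLp_grad v).1, h1.trans_lt ENNReal.ofReal_lt_top⟩
  refine ⟨hm, ?_⟩
  rw [Lp.norm_toLp]
  exact ENNReal.toReal_le_of_le_ofReal (by positivity) h1

/-- By Poincaré's inequality the gradient determines an element of `H₀¹(Ω ∪ Γ_N)`. -/
lemma eq_of_norm_gradL_sub_le_zero {CP : ℝ}
    (hCP : ∀ u ∈ H10 Ω ΓD, ‖fnL Ω u‖ ≤ CP * ‖gradL Ω u‖) {u v : H1 Ω} (h : u - v ∈ H10 Ω ΓD)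
    (h0 : ‖gradL Ω (u - v)‖ ≤ 0) : u = v := by
  have h1 := le_antisymm h0 (norm_nonneg _)
  have h2 := hCP _ h
  rw [h1, mul_zero] at h2
  have h3 := norm_le_fnL_add_gradL (u - v)
  rw [h1, add_zero] at h3
  exact sub_eq_zero.1 (norm_le_zero_iff.1 (h3.trans h2))

/-! ### Comparison of two regular solutions -/

variable {T τ lam q : ℝ} {κ : ℝ → ℝ}
  {nD θD VD n₁ θ₁ V₁ n₂ θ₂ V₂ : ℝ → H1 Ω} {nI θL C : E d → ℝ} {p : ℝ≥0∞}

lemma ae_sub_mem_H10 {u v uD : ℝ → H1 Ω} (hu : ∀ᵐ t ∂timeMeasure T, u t - uD t ∈ H10 Ω ΓD)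
    (hv : ∀ᵐ t ∂timeMeasure T, v t - uD t ∈ H10 Ω ΓD) :
    ∀ᵐ t ∂timeMeasure T, u t - v t ∈ H10 Ω ΓD := by
  filter_upwards [hu, hv] with t h1 h2
  have := (H10 Ω ΓD).sub_mem h1 h2
  rwa [sub_sub_sub_cancel_right] at this

/-- The bounds on two regular solutions that enter the stability estimates. -/
structure AreBounded (Ω : Set (E d)) (T : ℝ) (p : ℝ≥0∞) (n₁ θ₁ n₂ θ₂ : ℝ → H1 Ω)
    (θL C : E d → ℝ) (K : ℝ) : Prop where
  nonneg : 0 ≤ K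
  density₁ : ∀ᵐ t ∂timeMeasure T, ∀ᵐ x ∂volume.restrict Ω, 0 ≤ fn (n₁ t) x ∧ fn (n₁ t) x ≤ K
  density₂ : ∀ᵐ t ∂timeMeasure T, ∀ᵐ x ∂volume.restrict Ω, 0 ≤ fn (n₂ t) x ∧ fn (n₂ t) x ≤ K
  temperature₁ : ∀ᵐ t ∂timeMeasure T, ∀ᵐ x ∂volume.restrict Ω, |fn (θ₁ t) x| ≤ K
  temperature₂ : ∀ᵐ t ∂timeMeasure T, ∀ᵐ x ∂volume.restrict Ω, |fn (θ₂ t) x| ≤ K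
  lattice : ∀ᵐ x ∂volume.restrict Ω, |θL x| ≤ K
  doping : ∀ᵐ x ∂volume.restrict Ω, 0 ≤ C x ∧ C x ≤ K
  grad_temperature : ∀ᵐ t ∂timeMeasure T, ∀ᵐ x ∂volume.restrict Ω, ‖grad (θ₁ t) x‖ ≤ K
  grad_density : ∀ᵐ t ∂timeMeasure T,
    eLpNorm (grad (n₂ t)) (if d = 1 then 2 else p) (volume.restrict Ω)
      ≤ ENNReal.ofReal (K + ‖n₂ t‖)

/-- The gradient of `n₂` is bounded uniformly in time by the `W^{1,p}` regularity if `d ≥ 2`; if `d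
= 1` only the norm of `n₂(t)` in `H¹(Ω)` is available. The sum `K + ‖n₂ t‖` covers both cases. -/
lemma exists_areBounded (hI : IsInitialData Ω nI θL C)
    (h₁ : IsRegularSolution Ω ΓD T τ lam κ nD θD VD nI θL C p n₁ θ₁ V₁)
    (h₂ : IsRegularSolution Ω ΓD T τ lam κ nD θD VD nI θL C p n₂ θ₂ V₂) :
    ∃ K, AreBounded Ω T p n₁ θ₁ n₂ θ₂ θL C K := by
  obtain ⟨K₁, hK₁, a1, a2, a3, a4⟩ := h₁.sol.exists_bound hI
  obtain ⟨K₂, hK₂, b1, b2, -, -⟩ := h₂.sol.exists_bound hI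
  obtain ⟨K₃, hg⟩ := h₁.reg_θ
  obtain ⟨K₄, hn⟩ := h₂.reg_n
  obtain ⟨K, e1, e2, e3, e4⟩ : ∃ K : ℝ, K₁ ≤ K ∧ K₂ ≤ K ∧ (K₃ : ℝ) ≤ K ∧ (K₄ : ℝ) ≤ K :=
    ⟨max (max K₁ K₂) (max K₃ K₄), by simp, by simp, by simp, by simp⟩
  have hK : 0 ≤ K := hK₁.trans e1
  refine ⟨K, hK, ?_, ?_, ?_, ?_, ?_, ?_, ?_, ?_⟩
  · filter_upwards [a1] with t h
    filter_upwards [h] with x hx using ⟨hx.1, hx.2.trans e1⟩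
  · filter_upwards [b1] with t h
    filter_upwards [h] with x hx using ⟨hx.1, hx.2.trans e2⟩
  · filter_upwards [a2] with t h
    filter_upwards [h] with x hx using hx.trans e1
  · filter_upwards [b2] with t h
    filter_upwards [h] with x hx using hx.trans e2
  · filter_upwards [a3] with x hx using hx.trans e1
  · filter_upwards [a4] with x hx using ⟨hx.1, hx.2.trans e1⟩
  · filter_upwards [hg] with t h
    have h' := h.2
    rw [eLpNorm_exponent_top] at h'
    filter_upwards [ae_le_eLpNormEssSup (f := grad (θ₁ t)) (μ := volume.restrict Ω)] with x hx
    have h3 := hx.trans h'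
    rw [enorm_le_coe] at h3
    exact (NNReal.coe_le_coe.2 h3).trans e3
  · filter_upwards [hn] with t h
    split_ifs with hd1
    · refine le_trans (le_of_eq ?_)
        (ENNReal.ofReal_le_ofReal ((norm_gradL_le (n₂ t)).trans (le_add_of_nonneg_left hK)))
      rw [Lp.norm_def, coeFn_gradL, ENNReal.ofReal_toReal (memLp_grad (n₂ t)).2.ne]
    · refine h.2.trans ?_
      rw [← ENNReal.ofReal_coe_nnreal]
      exact ENNReal.ofReal_le_ofReal (e4.trans (le_add_of_nonneg_right (norm_nonneg _)))

lemma exists_lipschitz_bound (hκ : LocallyLipschitzOn (Ici (0 : ℝ)) κ) (K : ℝ) :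
    ∃ Λ, 0 ≤ Λ ∧ ∀ a b, 0 ≤ a → a ≤ K → 0 ≤ b → b ≤ K → |κ a - κ b| ≤ Λ * |a - b| := by
  obtain ⟨Λ, hΛ⟩ := (hκ.mono (Icc_subset_Ici_self (a := K) (b := 0))
    ).exists_lipschitzOnWith_of_compact isCompact_Icc
  exact ⟨Λ, Λ.coe_nonneg, fun a b a0 aK b0 bK => hΛ.dist_le_mul a ⟨a0, aK⟩ b ⟨b0, bK⟩⟩

/-- The temperatures and potentials depend on the densities in a Lipschitz continuous way. -/
theorem exists_elliptic_stability (hd : 1 ≤ d) (hΩ : IsAdmissibleDomain Ω ΓD ΓN) (hT : 0 < T)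
    (hτ : 0 < τ) (hlam : 0 < lam) (hκ : IsConductivity κ)
    (hκ_lip : LocallyLipschitzOn (Ici (0 : ℝ)) κ) (hD : IsBoundaryData T q nD θD VD)
    (hI : IsInitialData Ω nI θL C) {K : ℝ} (hK : AreBounded Ω T p n₁ θ₁ n₂ θ₂ θL C K)
    (h₁ : IsRegularSolution Ω ΓD T τ lam κ nD θD VD nI θL C p n₁ θ₁ V₁)
    (h₂ : IsRegularSolution Ω ΓD T τ lam κ nD θD VD nI θL C p n₂ θ₂ V₂) :
    ∃ A, 0 ≤ A ∧ ∀ᵐ t ∂timeMeasure T,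
      ‖gradL Ω (θ₁ t - θ₂ t)‖ ≤ A * ‖fnL Ω (n₁ t - n₂ t)‖ ∧
      ‖gradL Ω (V₁ t - V₂ t)‖ ≤ A * ‖fnL Ω (n₁ t - n₂ t)‖ := by
  have hfin := hΩ.isFiniteMeasure
  -- Ellipticity is taken from the second solution and boundedness of the temperature gradient from
  -- the first, according to `κ(n₁)∇θ₁ - κ(n₂)∇θ₂ = (κ(n₁) - κ(n₂))∇θ₁ + κ(n₂)∇(θ₁ - θ₂)`.
  obtain ⟨c, hc, hlow⟩ := h₂.sol.exists_lower_bound hd hΩ hT hτ hlam hκ hD hI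
  obtain ⟨CP, hCP0, hCP⟩ := exists_poincare_norm hd hΩ
  obtain ⟨Λ, hΛ0, hΛ⟩ := exists_lipschitz_bound hκ_lip K
  have hC2 : MemLp C 2 (volume.restrict Ω) := hI.bdd_C.mono_exponent le_top
  have hK0 := hK.nonneg
  refine ⟨max ((Λ * K + 2 * K / τ * CP) / c) (CP / lam ^ 2),
    le_max_of_le_right (by positivity), ?_⟩
  filter_upwards [hlow, hK.density₁, hK.density₂, hK.temperature₁, hK.temperature₂,
    hK.grad_temperature, ae_sub_mem_H10 h₁.sol.bc_θ h₂.sol.bc_θ,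
    ae_sub_mem_H10 h₁.sol.bc_V h₂.sol.bc_V, h₁.sol.temperature_mem, h₂.sol.temperature_mem,
    h₁.sol.poisson_mem, h₂.sol.poisson_mem] with t a0 a1 a2 a3 a4 a5 a6 a7 a8 a9 a10 a11
  have hθ := norm_gradL_temperature_sub_le hκ hτ hc hK0 hΛ0 hΛ hCP0 hCP hI.bdd_θL.1 hK.lattice a6
    a1 a2 a3 a4 a5 (a0.mono fun x hx => hx.1) a8 a9
  have hV := norm_gradL_potential_sub_le hlam hCP0 hCP hC2 a7 a10 a11
  exact ⟨hθ.trans (mul_le_mul_of_nonneg_right (le_max_left _ _) (norm_nonneg _)),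
    hV.trans (mul_le_mul_of_nonneg_right (le_max_right _ _) (norm_nonneg _))⟩

/-- The difference of the time derivatives of two densities, applied to the difference of the
densities, is bounded by an integrable multiple of the square of its `L²`-norm. -/
theorem exists_density_stability (hd : 1 ≤ d) (hΩ : IsAdmissibleDomain Ω ΓD ΓN) (hT : 0 < T)
    (hτ : 0 < τ) (hlam : 0 < lam) (hκ : IsConductivity κ) (hD : IsBoundaryData T q nD θD VD)
    (hI : IsInitialData Ω nI θL C) (hp2 : d = 2 → 2 < p) (hp3 : 3 ≤ d → (d : ℝ≥0∞) ≤ p)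
    {K A : ℝ} (hK : AreBounded Ω T p n₁ θ₁ n₂ θ₂ θL C K) (hA0 : 0 ≤ A)
    (hA : ∀ᵐ t ∂timeMeasure T, ‖gradL Ω (θ₁ t - θ₂ t)‖ ≤ A * ‖fnL Ω (n₁ t - n₂ t)‖ ∧
      ‖gradL Ω (V₁ t - V₂ t)‖ ≤ A * ‖fnL Ω (n₁ t - n₂ t)‖)
    (h₁ : IsRegularSolution Ω ΓD T τ lam κ nD θD VD nI θL C p n₁ θ₁ V₁)
    (h₂ : IsRegularSolution Ω ΓD T τ lam κ nD θD VD nI θL C p n₂ θ₂ V₂) :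
    ∃ G : ℝ → ℝ, Integrable G (timeMeasure T) ∧ (∀ t, 0 ≤ G t) ∧
      ∀ᵐ t ∂timeMeasure T, ∀ W₁ W₂ : ℝ,
        W₁ + ∫ x in Ω, (inner ℝ (fn (θ₁ t) x • grad (n₁ t) x + fn (n₁ t) x • grad (θ₁ t) x
          + fn (n₁ t) x • grad (V₁ t) x) (grad (n₁ t - n₂ t) x) : ℝ) = 0 →
        W₂ + ∫ x in Ω, (inner ℝ (fn (θ₂ t) x • grad (n₂ t) x + fn (n₂ t) x • grad (θ₂ t) x
          + fn (n₂ t) x • grad (V₂ t) x) (grad (n₁ t - n₂ t) x) : ℝ) = 0 →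
        W₁ - W₂ ≤ G t * ‖fnL Ω (n₁ t - n₂ t)‖ ^ 2 := by
  have hfin := hΩ.isFiniteMeasure
  obtain ⟨c, hc, hlow⟩ := h₁.sol.exists_lower_bound hd hΩ hT hτ hlam hκ hD hI
  obtain ⟨S, hS0, hS⟩ := exists_norm_toLp_smul_le hd hΩ hp2 hp3
  have hK0 := hK.nonneg
  -- `D(1 + K + ‖n₂‖)‖n‖`, with `n = n₁ - n₂`, bounds everything that multiplies `‖∇n‖`, once the
  -- elliptic estimates have replaced the differences of temperatures and potentials. Young's
  -- inequality with weight `c` then gives the coefficient `D²/(4c)`.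
  obtain ⟨D, hD0⟩ : ∃ D, D = S * A + K * (1 + 2 * A) := ⟨_, rfl⟩
  have hDn : 0 ≤ D := by rw [hD0]; positivity
  have hmem : MemLp (fun t => 1 + K + ‖n₂ t‖) 2 (timeMeasure T) :=
    (memLp_const (1 + K)).add h₂.sol.memLp_n.norm
  refine ⟨fun t => D ^ 2 / (4 * c) * (1 + K + ‖n₂ t‖) ^ 2 + K / (2 * lam ^ 2),
    (((memLp_two_iff_integrable_sq hmem.1).1 hmem).const_mul _).add (integrable_const _),
    fun t => by positivity, ?_⟩
  filter_upwards [hlow, hK.density₁, hK.density₂, hK.temperature₁, hK.temperature₂,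
    hK.grad_temperature, hK.grad_density, hA, ae_sub_mem_H10 h₁.sol.bc_n h₂.sol.bc_n,
    ae_sub_mem_H10 h₁.sol.bc_θ h₂.sol.bc_θ, h₁.sol.poisson_mem]
    with t a0 a1 a2 a3 a4 a5 a6 a7 a8 a9 a10 W₁ W₂ hW₁ hW₂
  obtain ⟨hP, hPR⟩ := hS _ a9 (n₂ t) (K + ‖n₂ t‖) (by positivity) a6
  have key := density_sub_le hΩ hlam hK0 a8 hI.bdd_C.1 hK.doping a1 a2 a3 a4 a5
    (a0.mono fun x hx => hx.2) hP hPR a10 hW₁ hW₂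
  -- The letters stand for `‖∇(n₁ - n₂)‖`, `‖n₁ - n₂‖`, `‖n₂‖` in `H¹(Ω)`, and the norms of the
  -- gradients of the differences of temperatures and potentials.
  have alg : ∀ g y k Θ Ψ : ℝ, 0 ≤ g → 0 ≤ y → 0 ≤ k → Θ ≤ A * y → Ψ ≤ A * y →
      -(c * g ^ 2) + (S * Θ * (K + k) + K * (y + Θ + Ψ)) * g + K / (2 * lam ^ 2) * y ^ 2
        ≤ (D ^ 2 / (4 * c) * (1 + K + k) ^ 2 + K / (2 * lam ^ 2)) * y ^ 2 := by
    intro g y k Θ Ψ hg hy hk hΘ hΨ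
    have e1 : S * Θ * (K + k) + K * (y + Θ + Ψ) ≤ D * (1 + K + k) * y := by
      calc S * Θ * (K + k) + K * (y + Θ + Ψ)
          ≤ S * (A * y) * (1 + K + k) + K * (y + A * y + A * y) * (1 + K + k) := by
            refine add_le_add ?_ ?_
            · gcongr
              linarith
            · refine (mul_le_mul_of_nonneg_left (add_le_add (add_le_add le_rfl hΘ) hΨ) hK0).trans
                (le_mul_of_one_le_right (by positivity) (by linarith))
        _ = D * (1 + K + k) * y := by rw [hD0]; ring
    have e2 := mul_le_mul_of_nonneg_right e1 hg
    have e3 : D * (1 + K + k) * y * g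
        ≤ c * g ^ 2 + D ^ 2 / (4 * c) * (1 + K + k) ^ 2 * y ^ 2 := by
      have e4 : c * g ^ 2 + D ^ 2 / (4 * c) * (1 + K + k) ^ 2 * y ^ 2 - D * (1 + K + k) * y * g
          = (2 * c * g - D * (1 + K + k) * y) ^ 2 / (4 * c) := by
        field_simp
        ring
      have e5 : 0 ≤ (2 * c * g - D * (1 + K + k) * y) ^ 2 / (4 * c) := by positivity
      linarith
    linarith
  exact key.trans (alg _ _ _ _ _ (norm_nonneg _) (norm_nonneg _) (norm_nonneg _) a7.1 a7.2)

/-- The energy inequality for `n₁ - n₂` and the stability of the density give `‖n(t)‖² ≤ ∫ 2G‖n‖²`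
over `(0,t)`, so the densities agree by Gronwall; the elliptic estimates then make the temperatures
and potentials agree. -/
theorem ae_eq_of_isRegularSolution (hd : 1 ≤ d) (hΩ : IsAdmissibleDomain Ω ΓD ΓN) (hT : 0 < T)
    (hτ : 0 < τ) (hlam : 0 < lam) (hκ : IsConductivity κ)
    (hκ_lip : LocallyLipschitzOn (Ici (0 : ℝ)) κ) (hD : IsBoundaryData T q nD θD VD)
    (hI : IsInitialData Ω nI θL C) (hp2 : d = 2 → 2 < p) (hp3 : 3 ≤ d → (d : ℝ≥0∞) ≤ p)
    (h₁ : IsRegularSolution Ω ΓD T τ lam κ nD θD VD nI θL C p n₁ θ₁ V₁)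
    (h₂ : IsRegularSolution Ω ΓD T τ lam κ nD θD VD nI θL C p n₂ θ₂ V₂) :
    ∀ᵐ t ∂timeMeasure T, n₁ t = n₂ t ∧ θ₁ t = θ₂ t ∧ V₁ t = V₂ t := by
  have hfin := hΩ.isFiniteMeasure
  obtain ⟨K, hK⟩ := exists_areBounded hI h₁ h₂
  obtain ⟨A, hA0, hA⟩ := exists_elliptic_stability hd hΩ hT hτ hlam hκ hκ_lip hD hI hK h₁ h₂
  obtain ⟨G, hGi, hG0, hG⟩ := exists_density_stability hd hΩ hT hτ hlam hκ hD hI hp2 hp3 hK hA0 hA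
    h₁ h₂
  obtain ⟨CP, -, hCP⟩ := exists_poincare_norm hd hΩ
  have hn := ae_sub_mem_H10 h₁.sol.bc_n h₂.sol.bc_n
  obtain ⟨z, hz, hzn⟩ := exists_memLp_submodule (h₁.sol.memLp_n.sub h₂.sol.memLp_n) hn
  obtain ⟨w₁, hw₁, hwn₁, hweq₁⟩ := h₁.sol.density
  obtain ⟨w₂, hw₂, hwn₂, hweq₂⟩ := h₂.sol.density
  have hnI : MemLp nI 2 (volume.restrict Ω) := hI.bdd_nI.mono_exponent le_top
  have henergy := hwn₁.ae_norm_sub_sq_le_integral hT h₁.sol.memLp_n h₂.sol.memLp_n hw₁ hw₂ hwn₂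
    h₁.sol.initial h₂.sol.initial hnI hz hzn
  have hwi : Integrable (fun s => w₁ s (z s) - w₂ s (z s)) (timeMeasure T) :=
    (integrable_dual_apply (X := H10 Ω ΓD) hw₁ hz).sub
      (integrable_dual_apply (X := H10 Ω ΓD) hw₂ hz)
  have hle : ∀ᵐ s ∂timeMeasure T,
      w₁ s (z s) - w₂ s (z s) ≤ G s * ‖fnL Ω (n₁ s - n₂ s)‖ ^ 2 := by
    filter_upwards [hG, hzn, hweq₁, hweq₂] with s g1 g2 g3 g4
    have e3 := g3 (z s)
    have e4 := g4 (z s)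
    rw [g2] at e3 e4
    exact g1 _ _ e3 e4
  -- As `G` is merely integrable, a uniform bound on `‖n₁ - n₂‖` is needed for the integrability of
  -- `G‖n₁ - n₂‖²`; it comes from the boundedness of the densities.
  obtain ⟨M, hM⟩ : ∃ M : ℝ, ∀ᵐ t ∂timeMeasure T, ‖fnL Ω (n₁ t - n₂ t)‖ ≤ M := by
    refine ⟨measureUnivNNReal (volume.restrict Ω) ^ (2 : ℝ≥0∞).toReal⁻¹ * K, ?_⟩
    filter_upwards [hK.density₁, hK.density₂] with t a1 a2
    refine Lp.norm_le_of_ae_bound hK.nonneg ?_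
    filter_upwards [a1, a2, fn_sub (n₁ t) (n₂ t)] with x b1 b2 b3
    rw [coeFn_fnL, b3, Real.norm_eq_abs]
    exact abs_le.2 ⟨by linarith [b1.1, b2.2], by linarith [b1.2, b2.1]⟩
  have hYm : AEStronglyMeasurable (fun t => ‖fnL Ω (n₁ t - n₂ t)‖ ^ 2) (timeMeasure T) :=
    (memLp_fnL (h₁.sol.memLp_n.sub h₂.sol.memLp_n)).1.norm.pow 2
  have hGY : Integrable (fun t => G t * ‖fnL Ω (n₁ t - n₂ t)‖ ^ 2) (timeMeasure T) := by
    refine hGi.mul_bdd hYm (c := M ^ 2) ?_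
    filter_upwards [hM] with t ht
    rw [Real.norm_of_nonneg (sq_nonneg _)]
    exact pow_le_pow_left₀ (norm_nonneg _) ht 2
  have hY := ae_eq_zero_of_le_integral hT.le (G := fun t => 2 * G t)
    (Y := fun t => ‖fnL Ω (n₁ t - n₂ t)‖ ^ 2) (hGi.const_mul 2)
    ((hGY.const_mul 2).congr (Eventually.of_forall fun t => (mul_assoc _ _ _).symm))
    (Eventually.of_forall fun t => mul_nonneg zero_le_two (hG0 t))
    (Eventually.of_forall fun t => sq_nonneg _) (by
    filter_upwards [henergy, ae_restrict_mem measurableSet_Ioo] with t ht htm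
    have hsub : Ioo 0 t ⊆ Ioo 0 T := Ioo_subset_Ioo_right htm.2.le
    have e1 := setIntegral_mono_ae_restrict (IntegrableOn.mono_set hwi hsub)
      (IntegrableOn.mono_set hGY hsub) (ae_restrict_of_ae_restrict_of_subset hsub hle)
    simp only [mul_assoc]
    rw [integral_const_mul, map_sub]
    linarith)
  filter_upwards [hY, hA, hn, ae_sub_mem_H10 h₁.sol.bc_θ h₂.sol.bc_θ,
    ae_sub_mem_H10 h₁.sol.bc_V h₂.sol.bc_V] with t a1 a2 a3 a4 a5
  have h0 : ‖fnL Ω (n₁ t - n₂ t)‖ = 0 := pow_eq_zero_iff two_ne_zero |>.1 a1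
  rw [h0, mul_zero] at a2
  refine ⟨H1.ext_fn hΩ.isOpen ?_, eq_of_norm_gradL_sub_le_zero hCP a4 a2.1,
    eq_of_norm_gradL_sub_le_zero hCP a5 a2.2⟩
  rw [norm_eq_zero, map_sub, sub_eq_zero] at h0
  rw [← coeFn_fnL, ← coeFn_fnL, h0]

end EnergyTransport

end

theorem theorem2 {d : ℕ} (hd : 1 ≤ d)
    (Ω ΓD ΓN : Set (EnergyTransport.E d)) (hΩ : EnergyTransport.IsAdmissibleDomain Ω ΓD ΓN)
    (T τ lam : ℝ) (hT : 0 < T) (hτ : 0 < τ) (hlam : 0 < lam)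
    (κ : ℝ → ℝ) (hκ : EnergyTransport.IsConductivity κ)
    (hκ_lip : LocallyLipschitzOn (Set.Ici (0 : ℝ)) κ)
    (q : ℝ) (hq : 2 < q) (nD θD VD : ℝ → EnergyTransport.H1 Ω)
    (hD : EnergyTransport.IsBoundaryData T q nD θD VD)
    (nI θL C : EnergyTransport.E d → ℝ) (hI : EnergyTransport.IsInitialData Ω nI θL C)
    (p : ℝ≥0∞) (hp1 : 1 ≤ p) (hp2 : d = 2 → 2 < p) (hp3 : 3 ≤ d → (d : ℝ≥0∞) ≤ p)
    (n₁ θ₁ V₁ n₂ θ₂ V₂ : ℝ → EnergyTransport.H1 Ω)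
    (h₁ : EnergyTransport.IsRegularSolution Ω ΓD T τ lam κ nD θD VD nI θL C p n₁ θ₁ V₁)
    (h₂ : EnergyTransport.IsRegularSolution Ω ΓD T τ lam κ nD θD VD nI θL C p n₂ θ₂ V₂) :
    ∀ᵐ t ∂(MeasureTheory.volume.restrict (Set.Ioo 0 T)),
      n₁ t = n₂ t ∧ θ₁ t = θ₂ t ∧ V₁ t = V₂ t := by
  exact EnergyTransport.ae_eq_of_isRegularSolution hd hΩ hT hτ hlam hκ hκ_lip hD hI hp2 hp3 h₁ h₂
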